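/- **Setting.** Let $n,m\ge 1$ be integers, $T>0$, $\beta=1/T$, $q=e^{-1/T}\in(0,1)$. Let $\varphi_k(x)=(\sqrt{2\pi}\,k!)^{-1/2}H_k(x)e^{-x^2/4}$, $k\ge 0$, where $H_k$ is the monic Hermite polynomial orthogonal with respect to $e^{-x^2/2}$. Put $$G(y,t\mid x,0)=\sum_{k\ge 0}\varphi_k(x)\varphi_k(y)e^{-kt},\qquad Z_n(q)=\sum_{0\le k_1<\dots<k_n}q^{k_1+\dots+k_n+n/2},$$ $$E(x,y;\tau,\sigma)=\begin{cases}0,&\tau\ge\sigma,\\ \sum_{k\ge 0}\varphi_k(x)\varphi_k(y)e^{k(\tau-\sigma)},&\tau<\sigma,\end{cases}$$ $$K(x,y;\tau,\sigma;z;q)=\sum_{k\ge 0}\frac{q^kz}{1+q^kz}\varphi_k(x)\varphi_k(y)e^{k(\tau-\sigma)}-E(x,y;\tau,\sigma),\qquad F(z)=q^{-n(n-1)/2}(q;q)_n\frac{(-z;q)_\infty}{z^n},$$ where $(a;q)_N=\prod_{k=0}^{N-1}(1-aq^k)$. *Free fermions.* For $n$ free fermions with Hamiltonian $-d^2/dx^2+x^2/4$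 at temperature $T$, the joint probability density on $(\mathbb R^n)^p$ of the positions $\mathbf x^{(1)},\dots,\mathbf x^{(p)}$ at imaginary times $s_1<\dots<s_p$ in $[0,\beta)$, the particles at each time being labelled in uniformly random order, is $$\frac{1}{(n!)^p}\frac{q^{n/2}}{Z_n(q)}\prod_{l=1}^{p-1}\det\bigl(G(x^{(l+1)}_j,s_{l+1}-s_l\mid x^{(l)}_k,0)\bigr)_{j,k=1}^n\cdot\det\bigl(G(x^{(1)}_j,\beta-(s_p-s_1)\mid x^{(p)}_k,0)\bigr)_{j,k=1}^n .$$ For $p=1$ this is the density $P_n(x_1,\dots,x_n)=Z_n(q)^{-1}\sum_{0\le k_1<\dots<k_n}\frac{1}{n!}\det(\varphi_{k_i}(x_j))_{i,j=1}^n{}^2\,q^{k_1+\dots+k_n+n/2}$. *Ornstein–Uhlenbeck processes.* The stationary nonintersecting OU processes with period $\beta$ are obtained as follows: choose $(y_1,\dots,y_n)$ with density $P_n$; given $y$, take $n$ independent OU processes $dx_k=-x_k\,dt+\sqrt2\,dW_k$ on $[0,\beta]$ with $x_k(0)=x_k(\beta)=y_k$ (OU bridges with continuous paths), conditioned not to intersect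 during $[0,\beta]$. Let $\tau_1,\dots,\tau_m\in[0,1/T)$. The multi-time correlation function $R_n^{(m)}(x_1,\dots,x_m;\tau_1,\dots,\tau_m)$ is the sum, over all choices of one particle at each time $\tau_i$ (different particles when times coincide), of the joint density at $(x_1,\dots,x_m)$ of the positions of the chosen particles. For the OU processes it is the density, with respect to Lebesgue measure on $\mathbb R^m$, of the measure assigning to a Borel set $B$ the expected number of such choices whose positions form a point of $B$. Contour integrals are over a circle $|z|=r$, $r>0$, positively oriented and avoiding the points $-q^{-k}$, $k\ge 0$. **Theorem.** The series and integrals above and below converge, and the following hold for either model. (a) The multi-time correlation function is $$R_n^{(m)}(x_1,\dots,x_m;\tau_1,\dots,\tau_m)=\frac1{2\pi i}\oint_0F(z)\det\bigl(K(x_i,x_j;\tau_i,\tau_j;z;q)\bigr)_{i,j=1}^m\,\frac{dz}{z},$$ for free fermions at all $x\in\mathbb R^m$, for OU processes as a density. It also equals $$\frac{q^{n/2}}{Z_n(q)}\sum_{0\le k_1<\dots<k_n}q^{k_1+\dots+k_n}\det\Bigl(\sum_{l=1}^n\varphi_{k_l}(x_i)\varphi_{k_l}(x_j)e^{k_l(\tau_i-\tau_j)}-E(x_i,x_j;\tau_i,\tau_j)\Bigr)_{i,j=1}^m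 .$$ (b) If $\tau_1,\dots,\tau_m$ are distinct and $A_1,\dots,A_m\subseteq\mathbb R$ are measurable, then the probability that at time $\tau_k$ all particles are in $A_k$, for every $k=1,\dots,m$, is $$\mathbb P_n(A_1,\dots,A_m;\tau_1,\dots,\tau_m)=\frac1{2\pi i}\oint_0F(z)\det\bigl(I-\mathbf K(\tau_1,\dots,\tau_m;z;q)\chi_{A_1^c,\dots,A_m^c}\bigr)\frac{dz}{z}.$$ Here $\mathbf K(\tau_1,\dots,\tau_m;z;q)$ is the integral operator on $L^2(\mathbb R\times\{1,\dots,m\})$ with kernel $((x,k),(y,j))\mapsto K(x,y;\tau_k,\tau_j;z;q)$, $\chi_{A_1^c,\dots,A_m^c}$ is multiplication by the indicator of $\{(x,k):x\notin A_k\}$, and $\det(I-\mathbf L)=\sum_{l\ge 0}\frac{(-1)^l}{l!}\int\det(L(a_i,a_j))_{i,j=1}^l\,da_1\cdots da_l$ is the Fredholm determinant of the operator with kernel $L$. -/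

import Mathlib

open MeasureTheory ProbabilityTheory
open scoped ENNReal

noncomputable section

namespace MNS

/-! ### Harmonic oscillator, propagator and kernels -/

/-- The normalized eigenfunctions `φ_k` of `-d²/dx² + x²/4`; `Polynomial.hermite k` is the monic
Hermite polynomial orthogonal with respect to `exp (-x² / 2)`. -/
def phi (k : ℕ) (x : ℝ) : ℝ :=
  Real.sqrt (1 / (Real.sqrt (2 * Real.pi) * (k.factorial : ℝ))) *
    Polynomial.aeval x (Polynomial.hermite k) * Real.exp (-x ^ 2 / 4)

/-- The Boltzmann factor `q = exp (-1/T)` at temperature `T`. -/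
def boltz (T : ℝ) : ℝ := Real.exp (-(1 / T))

/-- The imaginary time propagator `G(y, t | x, 0) = ∑ φ_k(x) φ_k(y) exp (-k t)`. -/
def propagator (y t x : ℝ) : ℝ := ∑' k : ℕ, phi k x * phi k y * Real.exp (-((k : ℝ) * t))

/-- The term `E(x, y; τ, σ)`. -/
def termE (x y τ σ : ℝ) : ℝ :=
  if τ < σ then ∑' k : ℕ, phi k x * phi k y * Real.exp ((k : ℝ) * (τ - σ)) else 0

/-- The kernel `K(x, y; τ, σ; z; q)`. -/
def kernelK (q : ℝ) (x y τ σ : ℝ) (z : ℂ) : ℂ :=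
  (∑' k : ℕ, ((q : ℂ) ^ k * z / (1 + (q : ℂ) ^ k * z)) *
      ((phi k x * phi k y * Real.exp ((k : ℝ) * (τ - σ)) : ℝ) : ℂ)) -
    ((termE x y τ σ : ℝ) : ℂ)

/-- The kernel `K_{k_1, …, k_n}(x, y; τ, σ)` of the eigenstate `(k_1, …, k_n)`. -/
def eigenKernel {n : ℕ} (k : Fin n → ℕ) (x y τ σ : ℝ) : ℝ :=
  (∑ i, phi (k i) x * phi (k i) y * Real.exp ((k i : ℝ) * (τ - σ))) - termE x y τ σ

/-- The function `F(z) = q^{-n(n-1)/2} (q; q)_n (-z; q)_∞ / z^n`. -/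
def fugF (q : ℝ) (n : ℕ) (z : ℂ) : ℂ :=
  ((q : ℂ) ^ (n * (n - 1) / 2))⁻¹ * (∏ k ∈ Finset.range n, (1 - (q : ℂ) * (q : ℂ) ^ k)) *
    (∏' k : ℕ, (1 - (-z) * (q : ℂ) ^ k)) / z ^ n

/-! ### Fredholm determinants -/

/-- The `l`-th integrand `det (K(a_i, a_j))_{i, j ≤ l}` of the Fredholm expansion. -/
def fredholmIntegrand {α : Type*} (K : α → α → ℂ) (l : ℕ) (a : Fin l → α) : ℂ :=
  Matrix.det (Matrix.of fun i j => K (a i) (a j))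

/-- The `l`-th term `(-1)^l / l! ∫ det (K(a_i, a_j)) dμ(a_1) … dμ(a_l)`. -/
def fredholmTerm {α : Type*} [MeasurableSpace α] (μ : Measure α) (K : α → α → ℂ) (l : ℕ) : ℂ :=
  (-1) ^ l / (l.factorial : ℂ) * ∫ a, fredholmIntegrand K l a ∂(Measure.pi fun _ : Fin l => μ)

/-- The Fredholm determinant `det (I - K)` of the integral operator with kernel `K` on `L²(μ)`. -/
def fredholmDet {α : Type*} [MeasurableSpace α] (μ : Measure α) (K : α → α → ℂ) : ℂ :=
  ∑' l : ℕ, fredholmTerm μ K l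

/-- The reference measure on `ℝ × {1, …, m}`: Lebesgue measure on every copy of `ℝ`. -/
def copies (m : ℕ) : Measure (ℝ × Fin m) := (volume : Measure ℝ).prod Measure.count

/-- The kernel on `ℝ × {1, …, m}` of the operator `K(τ_1, …, τ_m; z; q) χ_{A_1ᶜ, …, A_mᶜ}`. -/
def gapKernel (q : ℝ) {m : ℕ} (τ : Fin m → ℝ) (A : Fin m → Set ℝ) (z : ℂ)
    (a b : ℝ × Fin m) : ℂ :=
  kernelK q a.1 b.1 (τ a.2) (τ b.2) z * (A b.2)ᶜ.indicator (fun _ => (1 : ℂ)) b.1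

/-! ### The canonical ensemble -/

/-- The labels `k_1 < ⋯ < k_n` of the eigenstates of `n` fermions. -/
abbrev Eigenstate (n : ℕ) : Type := {k : Fin n → ℕ // StrictMono k}

/-- The partition function `Z_n(q)`. -/
def partitionFn (q : ℝ) (n : ℕ) : ℝ :=
  ∑' k : Eigenstate n, q ^ ((∑ i, (k.1 i : ℝ)) + (n : ℝ) / 2)

/-- The Slater determinant `Φ_{k_1, …, k_n}`. -/
def slater {n : ℕ} (k : Fin n → ℕ) (x : Fin n → ℝ) : ℝ :=
  1 / Real.sqrt (n.factorial : ℝ) * Matrix.det (Matrix.of fun i j => phi (k i) (x j))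

/-- The one-time density `P_n(x_1, …, x_n)` on `ℝⁿ`. -/
def density (q : ℝ) {n : ℕ} (x : Fin n → ℝ) : ℝ :=
  1 / partitionFn q n *
    ∑' k : Eigenstate n, (slater k.1 x) ^ 2 * q ^ ((∑ i, (k.1 i : ℝ)) + (n : ℝ) / 2)

/-- Cyclic time increments, with period `β`, of increasing times `s_1 < ⋯ < s_p`: these are
`s_{l+1} - s_l` for `l < p`, and `β - (s_p - s_1)` for `l = p`. -/
def increment (β : ℝ) {p : ℕ} (s : Fin p → ℝ) (l : Fin p) : ℝ :=
  if s l < s (finRotate p l) then s (finRotate p l) - s l else β - (s l - s (finRotate p l))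

/-- The joint density, on `(ℝⁿ)^p`, of the positions `x l` of `n` free fermions at imaginary times
`s_1 < ⋯ < s_p` (`p ≥ 1`) and temperature `T`. The particles at each time are labelled
in random order, whence the factor `(n!)^{-p}`; for `p = 1` this is `density`. -/
def multiDensity (T : ℝ) {n p : ℕ} (s : Fin p → ℝ) (x : Fin p → Fin n → ℝ) : ℝ :=
  1 / (n.factorial : ℝ) ^ p * ((boltz T) ^ ((n : ℝ) / 2) / partitionFn (boltz T) n) *
    ∏ l : Fin p, Matrix.det (Matrix.of fun j k : Fin n =>
      propagator (x (finRotate p l) j) (increment (1 / T) s l) (x l k))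

/-! ### Free fermions: gap probabilities and correlation functions -/

/-- The set of values of `τ_1, …, τ_m`. -/
def timeSet {m : ℕ} (τ : Fin m → ℝ) : Finset ℝ := Finset.univ.image τ

/-- The distinct values of `τ_1, …, τ_m` in increasing order. -/
def times {m : ℕ} (τ : Fin m → ℝ) : Fin (timeSet τ).card → ℝ := (timeSet τ).orderEmbOfFin rfl

/-- The position of `τ_i` in the list `times τ`, so that `times τ (timeIndex τ i) = τ i`. -/
def timeIndex {m : ℕ} (τ : Fin m → ℝ) (i : Fin m) : Fin (timeSet τ).card :=
  ((timeSet τ).orderIsoOfFin rfl).symm ⟨τ i, Finset.mem_image_of_mem τ (Finset.mem_univ i)⟩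

/-- The probability that, for every `i`, all `n` fermions are in `A_i` at imaginary time `τ_i`. -/
def fermionGap (T : ℝ) (n : ℕ) {m : ℕ} (τ : Fin m → ℝ) (A : Fin m → Set ℝ) : ℝ :=
  ∫ x in {x : Fin (timeSet τ).card → Fin n → ℝ | ∀ i j, x (timeIndex τ i) j ∈ A i},
    multiDensity T (times τ) x

/-- `(l, k)` is one of the `m` space-time slots: particle `j i` at time `τ_i`. -/
def IsSlot {m n : ℕ} (τ : Fin m → ℝ) (j : Fin m → Fin n)
    (a : Fin (timeSet τ).card × Fin n) : Prop :=
  ∃ i, (timeIndex τ i, j i) = a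

open Classical in
/-- The configuration in which particle `j i` sits at `x i` at time `τ_i`, and the
remaining coordinates are given by `w`. -/
def fill {m n : ℕ} (τ : Fin m → ℝ) (j : Fin m → Fin n) (x : Fin m → ℝ)
    (w : {a // ¬ IsSlot τ j a} → ℝ) (l : Fin (timeSet τ).card) (k : Fin n) : ℝ :=
  if h : IsSlot τ j (l, k) then x h.choose else w ⟨(l, k), h⟩

open Classical in
/-- The multi-time correlation function `R(x_1, …, x_m; τ_1, …, τ_m)` of `n` free fermions: the sum,
over the choices of a particle `j i` at time `τ_i` for each `i`, distinct at coinciding times, of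
the marginal densities at `x` of the multi-time joint density. If `m_l` of the times are equal to
the `l`-th distinct time, there are `∏ n! / (n - m_l)!` choices, with equal contributions. -/
def fermionCorr (T : ℝ) (n : ℕ) {m : ℕ} (τ x : Fin m → ℝ) : ℝ :=
  ∑ j : Fin m → Fin n with Function.Injective (fun i => (τ i, j i)),
    ∫ w : {a // ¬ IsSlot τ j a} → ℝ, multiDensity T (times τ) (fill τ j x w)

/-! ### Nonintersecting Ornstein–Uhlenbeck processes -/

/-- The transition density from `x` to `y` in time `t` of `dX = -X dt + √2 dW`: the solution started
at `x` is normal at time `t`, with mean `e^{-t} x` and variance `1 - e^{-2t}`. -/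
def ouDensity (t x y : ℝ) : ℝ :=
  gaussianPDFReal (Real.exp (-t) * x) (Real.toNNReal (1 - Real.exp (-(2 * t)))) y

/-- The joint density at times `0 < t_1 < ⋯ < t_r < β` of the Ornstein–Uhlenbeck bridge which is
at `y` at times `0` and `β`. -/
def bridgeDensity (β y : ℝ) {r : ℕ} (t x : Fin r → ℝ) : ℝ :=
  let s : Fin (r + 2) → ℝ := Fin.cons (0 : ℝ) (Fin.snoc t β : Fin (r + 1) → ℝ)
  let u : Fin (r + 2) → ℝ := Fin.cons y (Fin.snoc x y : Fin (r + 1) → ℝ)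
  (∏ i : Fin (r + 1), ouDensity (s i.succ - s i.castSucc) (u i.castSucc) (u i.succ)) /
    ouDensity β y y

/-- Under `Q y`, the processes `X 1, …, X n` are independent Ornstein–Uhlenbeck bridges with
continuous paths on `[0, β]`, and `X k` goes from `y k` to `y k`. -/
structure IsOUBridgeFamily (β : ℝ) {n : ℕ} {Ω : Type*} [MeasurableSpace Ω]
    (X : Fin n → ℝ → Ω → ℝ) (Q : Kernel (Fin n → ℝ) Ω) : Prop where
  measurable_eval : ∀ k t, Measurable (X k t)
  continuous_path : ∀ k ω, ContinuousOn (fun t => X k t ω) (Set.Icc 0 β)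
  endpoints : ∀ y, ∀ᵐ ω ∂(Q y), ∀ k, X k 0 ω = y k ∧ X k β ω = y k
  law : ∀ (y : Fin n → ℝ) (r : ℕ) (t : Fin r → ℝ), StrictMono t → (∀ i, t i ∈ Set.Ioo 0 β) →
    (Q y).map (fun ω (k : Fin n) (i : Fin r) => X k (t i) ω) =
      Measure.pi fun k : Fin n =>
        (volume : Measure (Fin r → ℝ)).withDensity
          fun x => ENNReal.ofReal (bridgeDensity β (y k) t x)

/-- The event that the `n` paths do not intersect during `[0, β]`. -/
def nonintersecting (β : ℝ) {n : ℕ} {Ω : Type*} (X : Fin n → ℝ → Ω → ℝ) : Set Ω :=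
  {ω | ∀ k l, k ≠ l → ∀ t ∈ Set.Icc 0 β, X k t ω ≠ X l t ω}

/-- The law of the stationary nonintersecting Ornstein–Uhlenbeck processes with period `1/T`: choose
`y` with density `P_n`, and condition the bridges from `y` to `y` not to intersect. -/
def periodicOU (T : ℝ) {n : ℕ} {Ω : Type*} [MeasurableSpace Ω]
    (X : Fin n → ℝ → Ω → ℝ) (Q : Kernel (Fin n → ℝ) Ω) : Measure Ω :=
  ((volume : Measure (Fin n → ℝ)).withDensity
      fun y => ENNReal.ofReal (density (boltz T) y)).bind
    fun y => ProbabilityTheory.cond (Q y) (nonintersecting (1 / T) X)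

/-- `R` is the multi-time correlation function at times `τ_1, …, τ_m` of the random paths
`X 1, …, X n`: for every measurable `B`, the integral of `R` over `B` is the expected number of
choices of a particle `j i` at time `τ_i` for each `i`, distinct at coinciding times, whose
positions form a point of `B`. -/
def IsCorrelationFn {n : ℕ} {Ω : Type*} [MeasurableSpace Ω] (P : Measure Ω)
    (X : Fin n → ℝ → Ω → ℝ) {m : ℕ} (τ : Fin m → ℝ) (R : (Fin m → ℝ) → ℝ) : Prop :=
  ∀ B : Set (Fin m → ℝ), MeasurableSet B →
    open Classical in
    ∑ j : Fin m → Fin n with Function.Injective (fun i => (τ i, j i)),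
        P {ω | (fun i => X (j i) (τ i) ω) ∈ B} =
      ∫⁻ x in B, ENNReal.ofReal (R x)

/-! ### Right-hand sides -/

/-- The integrand `F(z) det (K(x_i, x_j; τ_i, τ_j; z; q))`. -/
def corrIntegrand (q : ℝ) (n : ℕ) {m : ℕ} (τ x : Fin m → ℝ) (z : ℂ) : ℂ :=
  fugF q n z * Matrix.det (Matrix.of fun i j => kernelK q (x i) (x j) (τ i) (τ j) z)

/-- The integrand `F(z) det (I - K(τ_1, …, τ_m; z; q) χ_{A_1ᶜ, …, A_mᶜ})`. -/
def gapIntegrand (q : ℝ) (n : ℕ) {m : ℕ} (τ : Fin m → ℝ) (A : Fin m → Set ℝ) (z : ℂ) : ℂ :=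
  fugF q n z * fredholmDet (copies m) (gapKernel q τ A z)

/-- `(1 / 2πi) ∮ f(z) dz / z` over the positively oriented circle of radius `r` around `0`. -/
def contour (r : ℝ) (f : ℂ → ℂ) : ℂ :=
  (2 * (Real.pi : ℂ) * Complex.I)⁻¹ * ∮ z in C(0, r), f z / z

end MNS

end

open MeasureTheory ProbabilityTheory
open scoped ENNReal

noncomputable section

namespace MNS

/-! Everything reduces to one function, `corrSum`: the canonical average, over the sets S of n
occupied levels, of `levelDet`, the determinant of the kernel of the eigenstate S. It is computed in
three ways.

From the canonical to the grand canonical ensemble. Replace the occupation probabilities q^k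
z/(1+q^k z) in the kernel by arbitrary numbers c_k, so that its coefficients become (c_k - 1_{τ<σ})
e^{k(τ-σ)}. Changing a single c_k perturbs the kernel by a rank-one term, hence its determinants and
Fredholm determinants are affine in each c_k separately (`multiAffine_det`,
`multiAffine_fredholmDet`). An affine function h of one variable satisfies (1+a) h(a/(1+a)) = h(0) +
a h(1). Multiplying out over all levels with a = q^k z gives ∏(1+q^k z) h(c(z)) = ∑_S z^{|S|} q^{∑S}
h(1_S), and dz/z^{n+1} extracts the terms with |S| = n. The prefactor of F is the inverse of the
elementary symmetric function e_n(1,q,q²,…) (`esum_eq`), so the contour integral is the canonical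
average (`MultiAffine.contour`). Convergence rests on Hadamard's inequality and on
`MultiAffine.norm_le`, which bounds h(1_S) by a multiple of ρ^{-∑S} for some ρ > q.

Free fermions. A block factorization of the kernel matrix of all particles at all times
(`levelDet_slots`), followed by Cauchy–Binet, identifies the joint density with `corrSum` over all
slots divided by (n!)^p (`multiDensity_eq`). Marginals follow by integrating out one particle at a
time: the kernels reproduce themselves under composition up to a sign or zero factor
(`integral_levelKernel_mul`), and the resulting factor n - #{i : t_i = s} is exactly the number of
particles still free at time s (`placements_sum_unit`). This gives the correlation functions, and
inclusion–exclusion turns them into gap probabilities, that is, into a Fredholm series which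
terminates for each eigenstate.

Ornstein–Uhlenbeck processes. By Mehler's formula the determinant of propagators over one time step
is the product of its diagonal entries times `stepRatio`. For configurations in the same order this
ratio lies in [0,1], because the exponential kernel is totally positive (`det_exp_mul_bounds`).
Multiplied around the period, the diagonal entries form the density of independent bridges. Thus the
fermion density on a grid of times is an expectation over bridges of a weight which vanishes unless
the order is the same at all grid times. The density is consistent under refinement of the grid,
while the weight tends to 1 on paths which stay apart (`tendsto_pathWeight_one`) and to 0 on paths
which cross (`tendsto_pathWeight_zero`). Bridges which touch without crossing form a null event
(`ae_crossing`), since its probability is bounded by jumps of a monotone function of the difference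
of the starting points. Hence the fermion density is the law of the bridges restricted to the
nonintersecting event (`lintegral_multiDensity_eq`). Taken at time 0 alone, this says that P_n
contains the probability of not intersecting as a factor, and this factor cancels the normalization
of the conditioning (`periodicOU_eq`). -/

/-! ### Hermite polynomials -/

/-- The monic Hermite polynomial as a real function. -/
def He (k : ℕ) (x : ℝ) : ℝ := Polynomial.aeval x (Polynomial.hermite k)

lemma derivative_hermite_succ (k : ℕ) :
    Polynomial.derivative (Polynomial.hermite (k + 1)) = ((k : Polynomial ℤ) + 1) * Polynomial.hermite k := by
  induction k with
  | zero => simp [Polynomial.hermite_zero]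
  | succ k ih =>
    rw [Polynomial.hermite_succ (k + 1)]
    simp only [Polynomial.derivative_sub, Polynomial.derivative_mul, Polynomial.derivative_X, ih]
    simp only [Polynomial.derivative_add, Polynomial.derivative_natCast, Polynomial.derivative_one]
    rw [Polynomial.hermite_succ k]
    push_cast
    ring

lemma He_zero (x : ℝ) : He 0 x = 1 := by simp [He]

lemma He_one (x : ℝ) : He 1 x = x := by simp [He]

lemma He_succ_succ (k : ℕ) (x : ℝ) : He (k + 2) x = x * He (k + 1) x - (k + 1) * He k x := by
  unfold He
  rw [Polynomial.hermite_succ (k + 1), derivative_hermite_succ]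
  simp

lemma hasDerivAt_He_succ (k : ℕ) (x : ℝ) : HasDerivAt (He (k + 1)) ((k + 1) * He k x) x := by
  have h := (Polynomial.hermite (k + 1)).hasDerivAt_aeval x
  rw [derivative_hermite_succ] at h
  simp only [map_mul, map_add, map_natCast, map_one] at h
  exact h

lemma hasDerivAt_He_zero (x : ℝ) : HasDerivAt (He 0) 0 x := by
  have : He 0 = fun _ => (1 : ℝ) := funext He_zero
  rw [this]; exact hasDerivAt_const x 1

lemma continuous_He (k : ℕ) : Continuous (He k) := by
  unfold He; exact Polynomial.continuous_aeval _

/-- The growth majorant `∏_{i ≤ k} (1 + M / √i)` of the normalized Hermite polynomials. -/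
def heBound (M : ℝ) (k : ℕ) : ℝ := ∏ i ∈ Finset.range k, (1 + M / Real.sqrt (i + 1))

lemma heBound_succ (M : ℝ) (k : ℕ) :
    heBound M (k + 1) = heBound M k * (1 + M / Real.sqrt (k + 1)) := by
  simp [heBound, Finset.prod_range_succ]

lemma one_le_heBound {M : ℝ} (hM : 0 ≤ M) (k : ℕ) : 1 ≤ heBound M k := by
  induction k with
  | zero => simp [heBound]
  | succ k ih =>
    rw [heBound_succ]
    have : 0 ≤ M / Real.sqrt (k + 1) := by positivity
    nlinarith

lemma heBound_le_succ {M : ℝ} (hM : 0 ≤ M) (k : ℕ) : heBound M k ≤ heBound M (k + 1) := by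
  rw [heBound_succ]
  have : 0 ≤ M / Real.sqrt (k + 1) := by positivity
  nlinarith [one_le_heBound hM k]

/-- For He_k/√(k!) the three-term recurrence has coefficients x/√(k+2) and √((k+1)/(k+2)) ≤ 1, so
one step multiplies the running maximum by at most 1 + M/√(k+2). These factors tend to 1, so the
majorant grows more slowly than any geometric sequence. -/
lemma abs_He_le {M : ℝ} (hM : 0 ≤ M) {x : ℝ} (hx : |x| ≤ M) (k : ℕ) :
    |He k x| ≤ Real.sqrt (k.factorial) * heBound M k := by
  suffices h : |He k x| ≤ Real.sqrt (k.factorial) * heBound M k ∧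
      |He (k + 1) x| ≤ Real.sqrt ((k + 1).factorial) * heBound M (k + 1) from h.1
  induction k with
  | zero =>
    simp only [zero_add, He_zero, He_one, heBound]
    simp
    linarith
  | succ k ih =>
    refine ⟨ih.2, ?_⟩
    rw [He_succ_succ, heBound_succ]
    have h1 : Real.sqrt ((k + 1 + 1).factorial) =
        Real.sqrt (k + 2) * Real.sqrt ((k + 1).factorial) := by
      rw [← Real.sqrt_mul (by positivity), Nat.factorial_succ]; push_cast; ring_nf
    have h2 : Real.sqrt ((k + 1).factorial) = Real.sqrt (k + 1) * Real.sqrt (k.factorial) := by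
      rw [← Real.sqrt_mul (by positivity), Nat.factorial_succ]; push_cast; ring_nf
    have hs : (0 : ℝ) < Real.sqrt (k + 2) := by positivity
    have e1 : ((k + 1 : ℕ) : ℝ) + 1 = k + 2 := by push_cast; ring
    rw [e1]
    have h3 : Real.sqrt (k + 1) ≤ Real.sqrt (k + 2) := Real.sqrt_le_sqrt (by linarith)
    have h4 : Real.sqrt ((k : ℝ) + 1) * Real.sqrt (k + 1) = k + 1 :=
      Real.mul_self_sqrt (by positivity)
    have hb := heBound_le_succ hM k
    have hb1 := one_le_heBound hM (k + 1)
    calc |x * He (k + 1) x - (k + 1) * He k x|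
        ≤ |x| * |He (k + 1) x| + (k + 1) * |He k x| := by
          refine (abs_sub _ _).trans ?_
          rw [abs_mul, abs_mul, abs_of_nonneg (by positivity : (0:ℝ) ≤ (k:ℝ) + 1)]
      _ ≤ M * (Real.sqrt ((k + 1).factorial) * heBound M (k + 1)) +
          (k + 1) * (Real.sqrt (k.factorial) * heBound M (k + 1)) := by
          gcongr
          · exact ih.2
          · exact ih.1.trans (by gcongr)
      _ = Real.sqrt ((k + 1).factorial) * heBound M (k + 1) * (M + Real.sqrt (k + 1)) := by
          rw [h2]; linear_combination (-(Real.sqrt k.factorial * heBound M (k + 1))) * h4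
      _ ≤ Real.sqrt ((k + 1).factorial) * heBound M (k + 1) * (M + Real.sqrt (k + 2)) := by
          gcongr
      _ = _ := by
          rw [h1]; field_simp; ring

/-- Ratio test with limit r. The square is there for the two Hermite factors of a bilinear series,
the factor k + 1 for its derivative, so one majorant serves both. -/
lemma summable_heBound {M : ℝ} (hM : 0 ≤ M) {r : ℝ} (hr : 0 < r) (hr1 : r < 1) :
    Summable fun k : ℕ => ((k : ℝ) + 1) * (heBound M k * heBound M k) * r ^ k := by
  apply summable_of_ratio_test_tendsto_lt_one hr1
  · filter_upwards with k
    have := one_le_heBound hM k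
    positivity
  · have hlim : Filter.Tendsto (fun k : ℕ => (1 + 1 / ((k : ℝ) + 1)) *
        (1 + M / Real.sqrt (k + 1)) ^ 2 * r) Filter.atTop (nhds ((1 + 0) * (1 + 0) ^ 2 * r)) := by
      refine (Filter.Tendsto.mul (Filter.Tendsto.mul ?_ ?_) tendsto_const_nhds)
      · exact tendsto_const_nhds.add tendsto_one_div_add_atTop_nhds_zero_nat
      · refine (tendsto_const_nhds.add ?_).pow 2
        refine Filter.Tendsto.div_atTop tendsto_const_nhds ?_
        exact Real.tendsto_sqrt_atTop.comp
          (Filter.tendsto_atTop_add_const_right _ _ tendsto_natCast_atTop_atTop)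
    simp only [add_zero, one_pow, one_mul] at hlim
    refine hlim.congr fun k => ?_
    have := one_le_heBound hM k
    have h0 : (0:ℝ) < heBound M k := by linarith
    have h3 : 0 ≤ M / Real.sqrt (k + 1) := by positivity
    rw [heBound_succ, Real.norm_of_nonneg (by positivity), Real.norm_of_nonneg (by positivity),
      pow_succ]
    push_cast
    field_simp
    ring

lemma summable_He_mul {M : ℝ} (hM : 0 ≤ M) {r : ℝ} (hr : 0 < r) (hr1 : r < 1) {x y : ℝ}
    (hx : |x| ≤ M) (hy : |y| ≤ M) :
    Summable fun k : ℕ => r ^ k / k.factorial * (He k x * He k y) := by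
  refine Summable.of_norm_bounded (summable_heBound hM hr hr1) fun k => ?_
  have h1 := abs_He_le hM hx k
  have h2 := abs_He_le hM hy k
  have hb := one_le_heBound hM k
  have h4 : Real.sqrt (k.factorial : ℝ) * Real.sqrt (k.factorial) = k.factorial :=
      Real.mul_self_sqrt (by positivity)
  rw [Real.norm_eq_abs, abs_mul, abs_mul, abs_of_nonneg (by positivity)]
  calc r ^ k / k.factorial * (|He k x| * |He k y|)
      ≤ r ^ k / k.factorial * ((Real.sqrt (k.factorial) * heBound M k) *
        (Real.sqrt (k.factorial) * heBound M k)) := by gcongr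
    _ = 1 * (heBound M k * heBound M k) * r ^ k := by
      rw [show (Real.sqrt (k.factorial : ℝ) * heBound M k) *
        (Real.sqrt (k.factorial) * heBound M k) = (Real.sqrt (k.factorial : ℝ) *
        Real.sqrt (k.factorial)) * (heBound M k * heBound M k) by ring, h4]
      field_simp
    _ ≤ _ := by
      gcongr
      linarith [(Nat.cast_nonneg k : (0:ℝ) ≤ k)]

lemma abs_He_succ_mul_le {M : ℝ} (hM : 0 ≤ M) {r : ℝ} (hr : 0 < r) {x y : ℝ}
    (hx : |x| ≤ M) (hy : |y| ≤ M) (k : ℕ) :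
    |r ^ (k + 1) / (k + 1).factorial * (He (k + 1) x * ((k + 1) * He k y))| ≤
      (((k + 1 : ℕ) : ℝ) + 1) * (heBound M (k + 1) * heBound M (k + 1)) * r ^ (k + 1) := by
  have h1 := abs_He_le hM hx (k + 1)
  have h2 := abs_He_le hM hy k
  have hb := one_le_heBound hM (k + 1)
  have hb' := heBound_le_succ hM k
  have h4 : Real.sqrt (k.factorial : ℝ) * Real.sqrt (k.factorial) = k.factorial :=
      Real.mul_self_sqrt (by positivity)
  have h5 : Real.sqrt ((k + 1).factorial) = Real.sqrt (k + 1) * Real.sqrt (k.factorial) := by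
      rw [← Real.sqrt_mul (by positivity), Nat.factorial_succ]; push_cast; ring_nf
  have h6 : Real.sqrt ((k : ℝ) + 1) ≤ k + 1 := by
    rw [Real.sqrt_le_left (by positivity)]; nlinarith [(Nat.cast_nonneg k : (0:ℝ) ≤ k)]
  rw [abs_mul, abs_mul, abs_mul, abs_of_nonneg (by positivity : 0 ≤ r ^ (k + 1) / ((k + 1).factorial : ℝ)),
    abs_of_nonneg (by positivity : (0:ℝ) ≤ (k:ℝ) + 1)]
  have hb0 : 0 ≤ heBound M k := by linarith [one_le_heBound hM k]
  calc r ^ (k + 1) / ((k + 1).factorial : ℝ) * (|He (k + 1) x| * ((k + 1) * |He k y|))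
      ≤ r ^ (k + 1) / ((k + 1).factorial : ℝ) * ((Real.sqrt ((k + 1).factorial) * heBound M (k + 1)) *
        ((k + 1) * (Real.sqrt (k.factorial) * heBound M (k + 1)))) := by
        gcongr
        exact h2.trans (by gcongr)
    _ = Real.sqrt (k + 1) * (heBound M (k + 1) * heBound M (k + 1)) * r ^ (k + 1) := by
      rw [h5, show (Real.sqrt ((k : ℝ) + 1) * Real.sqrt (k.factorial) * heBound M (k + 1)) *
        ((k + 1) * (Real.sqrt (k.factorial) * heBound M (k + 1))) =
          (Real.sqrt (k.factorial : ℝ) * Real.sqrt (k.factorial)) *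
          (Real.sqrt ((k : ℝ) + 1) * (k + 1) * (heBound M (k + 1) * heBound M (k + 1))) by ring, h4]
      rw [Nat.factorial_succ]
      push_cast
      field_simp
    _ ≤ _ := by
      push_cast
      gcongr
      linarith

/-- The bilinear Hermite series. -/
def heSeries (r x y : ℝ) : ℝ := ∑' k : ℕ, r ^ k / k.factorial * (He k x * He k y)

lemma heSeries_comm (r x y : ℝ) : heSeries r x y = heSeries r y x := by
  unfold heSeries; congr 1; ext k; ring

/-- The shifted series `∑ r^{k+1} / k! He_{k+1}(x) He_k(y)`. -/
def heSeriesShift (r x y : ℝ) : ℝ :=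
  ∑' k : ℕ, r ^ (k + 1) / (k + 1).factorial * (He (k + 1) x * ((k + 1) * He k y))

lemma summable_heSeriesShift {r : ℝ} (hr : 0 < r) (hr1 : r < 1) (x y : ℝ) :
    Summable fun k : ℕ =>
      r ^ (k + 1) / (k + 1).factorial * (He (k + 1) x * ((k + 1) * He k y)) := by
  have hM : 0 ≤ max |x| |y| := by positivity
  refine Summable.of_norm_bounded ((summable_nat_add_iff 1).2 (summable_heBound hM hr hr1))
    fun k => ?_
  exact abs_He_succ_mul_le hM hr (le_max_left _ _) (le_max_right _ _) k

/-- Termwise differentiation, since He_{k+1}' = (k+1) He_k turns the bilinear series into the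
shifted one. -/
lemma hasDerivAt_heSeries {r : ℝ} (hr : 0 < r) (hr1 : r < 1) (x y : ℝ) :
    HasDerivAt (heSeries r x) (heSeriesShift r x y) y := by
  -- This M dominates |x| and every |z| with |z - y| < 1, so a single majorant works on the whole
  -- ball.
  set M := max |x| (|y| + 1)
  have hM : 0 ≤ M := by positivity
  have hsum := summable_heBound hM hr hr1
  have key := hasDerivAt_tsum_of_isPreconnected (𝕜 := ℝ) (F := ℝ) (t := Metric.ball y 1)
    (g := fun (k : ℕ) z => r ^ k / k.factorial * (He k x * He k z))
    -- The truncated `k - 1` is harmless at k = 0, where the factor k vanishes.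
    (g' := fun (k : ℕ) z => r ^ k / k.factorial * (He k x * (k * He (k - 1) z))) (y₀ := y) (y := y)
    hsum Metric.isOpen_ball (convex_ball y 1).isPreconnected ?_ ?_ (by simp) ?_ (by simp)
  · have e : ∑' k : ℕ, r ^ k / k.factorial * (He k x * (k * He (k - 1) y)) =
        heSeriesShift r x y := by
      rw [Summable.tsum_eq_zero_add]
      · simp [heSeriesShift]
      · rw [← summable_nat_add_iff 1]
        simpa using summable_heSeriesShift hr hr1 x y
    rw [← e]; exact key
  · intro k z _
    apply HasDerivAt.const_mul
    apply HasDerivAt.const_mul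
    cases k with
    | zero => simpa using hasDerivAt_He_zero z
    | succ k => simpa using hasDerivAt_He_succ k z
  · intro k z hz
    have hz : |z| ≤ M := by
      have : |z - y| < 1 := by simpa [Real.dist_eq] using hz
      have := abs_sub_abs_le_abs_sub z y
      exact le_max_of_le_right (by linarith)
    cases k with
    | zero => simp [heBound]
    | succ k =>
      rw [Real.norm_eq_abs]
      simpa using abs_He_succ_mul_le hM hr (le_max_left _ _) hz k
  · exact summable_He_mul hM hr hr1 (le_max_left _ _) (le_max_of_le_right (by linarith))

/-- This is the recurrence He_{k+1}(x) = x He_k(x) - k He_{k-1}(x), summed. Together with its mirror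
image under x ↔ y it is a linear system with determinant 1 - r² for the two shifted series. -/
lemma heSeriesShift_eq {r : ℝ} (hr : 0 < r) (hr1 : r < 1) (x y : ℝ) :
    heSeriesShift r x y = r * x * heSeries r x y - r * heSeriesShift r y x := by
  have hM : 0 ≤ max |x| |y| := by positivity
  have hs := summable_He_mul hM hr hr1 (le_max_left |x| |y|) (le_max_right |x| |y|)
  have hs' : Summable fun k : ℕ => r ^ k / k.factorial * (He k y * (k * He (k - 1) x)) := by
    rw [← summable_nat_add_iff 1]
    simpa using summable_heSeriesShift hr hr1 y x
  have e2 : heSeriesShift r y x = ∑' k : ℕ, r ^ k / k.factorial * (He k y * (k * He (k - 1) x)) := by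
    rw [hs'.tsum_eq_zero_add]; simp [heSeriesShift]
  rw [e2, heSeries, ← tsum_mul_left, ← tsum_mul_left,
    ← (hs.mul_left (r * x)).tsum_sub (hs'.mul_left r)]
  unfold heSeriesShift
  congr 1; ext k
  rw [pow_succ, Nat.factorial_succ]
  cases k with
  | zero => simp [He_one, He_zero]
  | succ k =>
    rw [He_succ_succ]
    push_cast
    field_simp

lemma hasDerivAt_heSeries' {r : ℝ} (hr : 0 < r) (hr1 : r < 1) (x y : ℝ) :
    HasDerivAt (heSeries r x) ((r * x - r ^ 2 * y) / (1 - r ^ 2) * heSeries r x y) y := by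
  have h1 := heSeriesShift_eq hr hr1 x y
  have h2 := heSeriesShift_eq hr hr1 y x
  rw [heSeries_comm r y x] at h2
  have h3 : 1 - r ^ 2 ≠ 0 := by nlinarith
  -- Solving the two-by-two system makes the derivative proportional to the series itself: a
  -- first-order linear differential equation in y.
  have : heSeriesShift r x y = (r * x - r ^ 2 * y) / (1 - r ^ 2) * heSeries r x y := by
    rw [h2] at h1
    field_simp
    linear_combination h1
  rw [← this]; exact hasDerivAt_heSeries hr hr1 x y

lemma heSeries_eq_right {r : ℝ} (hr : 0 < r) (hr1 : r < 1) (x y : ℝ) :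
    heSeries r x y = heSeries r x 0 * Real.exp ((r * x * y - r ^ 2 * y ^ 2 / 2) / (1 - r ^ 2)) := by
  set f : ℝ → ℝ := fun y => heSeries r x y * Real.exp (-((r * x * y - r ^ 2 * y ^ 2 / 2) / (1 - r ^ 2)))
  have hf : ∀ y, HasDerivAt f 0 y := by
    intro y
    have h1 := hasDerivAt_heSeries' hr hr1 x y
    have h2 : HasDerivAt (fun y : ℝ => -((r * x * y - r ^ 2 * y ^ 2 / 2) / (1 - r ^ 2)))
        (-((r * x - r ^ 2 * y) / (1 - r ^ 2))) y := by
      have := (((hasDerivAt_id y).const_mul (r * x)).sub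
        (((hasDerivAt_pow 2 y).const_mul (r ^ 2)).div_const 2)).div_const (1 - r ^ 2)
      refine this.neg.congr_deriv ?_
      push_cast
      ring
    exact (h1.mul h2.exp).congr_deriv (by ring)
  have h0 : f y = f 0 := is_const_of_deriv_eq_zero (fun y => (hf y).differentiableAt)
    (fun y => (hf y).deriv) y 0
  have h1 : f 0 = heSeries r x 0 := by simp [f]
  rw [← h1, ← h0]
  simp only [f]
  rw [mul_assoc, ← Real.exp_add]
  simp

lemma heSeries_eq {r : ℝ} (hr : 0 < r) (hr1 : r < 1) (x y : ℝ) :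
    heSeries r x y = heSeries r 0 0 *
      Real.exp ((r * x * y - r ^ 2 * (x ^ 2 + y ^ 2) / 2) / (1 - r ^ 2)) := by
  rw [heSeries_eq_right hr hr1 x y, heSeries_comm, heSeries_eq_right hr hr1 0 x, mul_assoc,
    ← Real.exp_add]
  congr 2
  ring

/-! ### Orthonormality and Mehler's formula -/

lemma integrable_aeval_mul_gaussian (p : Polynomial ℤ) :
    Integrable fun x : ℝ => Polynomial.aeval x p * Real.exp (-x ^ 2 / 2) := by
  induction p using Polynomial.induction_on' with
  | add p q hp hq =>
    simp only [map_add, add_mul]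
    exact hp.add hq
  | monomial n a =>
    have h := integrable_rpow_mul_exp_neg_mul_sq (b := 1 / 2) (by norm_num) (s := n)
      (by linarith [(Nat.cast_nonneg n : (0 : ℝ) ≤ n)])
    refine (h.const_mul (a : ℝ)).congr (Filter.Eventually.of_forall fun x => ?_)
    simp only [Polynomial.aeval_monomial, Real.rpow_natCast]
    simp only [algebraMap_int_eq, eq_intCast]
    rw [show -(1 / 2) * x ^ 2 = -x ^ 2 / 2 by ring]
    ring

lemma hasDerivAt_He_mul_gaussian (k : ℕ) (x : ℝ) :
    HasDerivAt (fun x => He k x * Real.exp (-x ^ 2 / 2))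
      (-(He (k + 1) x * Real.exp (-x ^ 2 / 2))) x := by
  have h1 : HasDerivAt (He k) (Polynomial.aeval x (Polynomial.derivative (Polynomial.hermite k))) x :=
    (Polynomial.hermite k).hasDerivAt_aeval x
  have h2 : HasDerivAt (fun x : ℝ => Real.exp (-x ^ 2 / 2)) (Real.exp (-x ^ 2 / 2) * (-x)) x := by
    have : HasDerivAt (fun x : ℝ => -x ^ 2 / 2) (-x) x := by
      refine ((hasDerivAt_pow 2 x).neg.div_const 2).congr_deriv ?_
      push_cast; ring
    exact this.exp
  refine (h1.mul h2).congr_deriv ?_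
  unfold He
  rw [Polynomial.hermite_succ]
  simp
  ring

/-- Integration by parts, as He_{k+1} e^{-x²/2} is minus the derivative of He_k e^{-x²/2}. -/
lemma integral_He_succ_mul (k : ℕ) (p : Polynomial ℤ) :
    ∫ x : ℝ, Polynomial.aeval x p * (He (k + 1) x * Real.exp (-x ^ 2 / 2)) =
      ∫ x : ℝ, Polynomial.aeval x (Polynomial.derivative p) * (He k x * Real.exp (-x ^ 2 / 2)) := by
  have hi : ∀ (p : Polynomial ℤ) (k : ℕ),
      Integrable fun x : ℝ => Polynomial.aeval x p * (He k x * Real.exp (-x ^ 2 / 2)) := by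
    intro p k
    refine (integrable_aeval_mul_gaussian (p * Polynomial.hermite k)).congr
      (Filter.Eventually.of_forall fun x => ?_)
    simp [He, mul_assoc]
  have h := integral_mul_deriv_eq_deriv_mul_of_integrable
    (u := fun x : ℝ => Polynomial.aeval x p) (v := fun x => He k x * Real.exp (-x ^ 2 / 2))
    (u' := fun x => Polynomial.aeval x (Polynomial.derivative p))
    (v' := fun x => -(He (k + 1) x * Real.exp (-x ^ 2 / 2)))
    (fun x _ => p.hasDerivAt_aeval x) (fun x _ => hasDerivAt_He_mul_gaussian k x)
    (by simpa [Pi.mul_def] using (hi p (k + 1)).neg) (by simpa [Pi.mul_def] using hi _ k)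
    (by simpa [Pi.mul_def] using hi _ k)
  simp only [mul_neg, integral_neg, neg_inj] at h
  exact h

/-- One integration by parts lowers both degrees at the price of the factor j + 1, until one of them
is 0. There either the Gaussian integral remains, or the integral of an exact derivative. -/
lemma integral_He_mul_He (j k : ℕ) :
    ∫ x : ℝ, He j x * (He k x * Real.exp (-x ^ 2 / 2)) =
      if j = k then (k.factorial : ℝ) * Real.sqrt (2 * Real.pi) else 0 := by
  have hz : ∀ k, ∫ x : ℝ, He 0 x * (He (k + 1) x * Real.exp (-x ^ 2 / 2)) = 0 := by
    intro k
    have := integral_He_succ_mul k (Polynomial.hermite 0)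
    simp only [Polynomial.hermite_zero, Polynomial.derivative_C, map_zero, zero_mul,
      integral_zero] at this
    simpa [He] using this
  induction k generalizing j with
  | zero =>
    cases j with
    | zero =>
      rw [if_pos rfl]
      simp only [He_zero, one_mul]
      have := integral_gaussian (1 / 2)
      simp only [Nat.factorial_zero, Nat.cast_one, one_mul]
      rw [show 2 * Real.pi = Real.pi / (1 / 2) by ring, ← this]
      congr 1; ext x; congr 1; ring
    | succ j =>
      rw [if_neg (by simp)]
      rw [← hz j]
      congr 1; ext x; ring
  | succ k ih =>
    cases j with
    | zero => rw [if_neg (by simp)]; exact hz k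
    | succ j =>
      have h := integral_He_succ_mul k (Polynomial.hermite (j + 1))
      rw [derivative_hermite_succ] at h
      change ∫ x : ℝ, He (j + 1) x * _ = _ at h
      rw [h]
      have h2 : ∀ x : ℝ, Polynomial.aeval x (((j : Polynomial ℤ) + 1) * Polynomial.hermite j) *
          (He k x * Real.exp (-x ^ 2 / 2)) = ((j : ℝ) + 1) * (He j x *
          (He k x * Real.exp (-x ^ 2 / 2))) := by
        intro x; simp [He]; ring
      simp only [h2]
      rw [integral_const_mul, ih]
      by_cases hjk : j = k
      · subst hjk; simp [Nat.factorial_succ]; ring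
      · simp [hjk]

lemma phi_eq (k : ℕ) (x : ℝ) : phi k x =
    Real.sqrt (1 / (Real.sqrt (2 * Real.pi) * (k.factorial : ℝ))) * He k x *
      Real.exp (-x ^ 2 / 4) := rfl

lemma continuous_phi (k : ℕ) : Continuous (phi k) := by
  have := continuous_He k
  have h : phi k = fun x => Real.sqrt (1 / (Real.sqrt (2 * Real.pi) * (k.factorial : ℝ))) * He k x *
      Real.exp (-x ^ 2 / 4) := rfl
  rw [h]
  fun_prop

lemma phi_mul_phi (j k : ℕ) (x : ℝ) : phi j x * phi k x =
    Real.sqrt (1 / (Real.sqrt (2 * Real.pi) * (j.factorial : ℝ))) *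
    Real.sqrt (1 / (Real.sqrt (2 * Real.pi) * (k.factorial : ℝ))) *
      (He j x * (He k x * Real.exp (-x ^ 2 / 2))) := by
  rw [phi_eq, phi_eq, show -x ^ 2 / 2 = -x ^ 2 / 4 + -x ^ 2 / 4 by ring, Real.exp_add]
  ring

lemma integrable_phi_mul_phi (j k : ℕ) : Integrable fun x => phi j x * phi k x := by
  simp only [phi_mul_phi]
  refine Integrable.const_mul ?_ _
  refine (integrable_aeval_mul_gaussian (Polynomial.hermite j * Polynomial.hermite k)).congr
      (Filter.Eventually.of_forall fun x => ?_)
  simp [He, mul_assoc]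

lemma integral_phi_mul_phi (j k : ℕ) : ∫ x, phi j x * phi k x = if j = k then 1 else 0 := by
  simp only [phi_mul_phi]
  rw [integral_const_mul, integral_He_mul_He]
  split_ifs with h
  · subst h
    rw [Real.mul_self_sqrt (by positivity)]
    have : (0:ℝ) < Real.sqrt (2 * Real.pi) := by positivity
    have : (j.factorial : ℝ) ≠ 0 := by positivity
    field_simp
  · simp

lemma abs_phi_le {M : ℝ} (hM : 0 ≤ M) {x : ℝ} (hx : |x| ≤ M) (k : ℕ) :
    |phi k x| ≤ Real.sqrt (1 / Real.sqrt (2 * Real.pi)) * heBound M k := by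
  rw [phi_eq, abs_mul, abs_mul, abs_of_nonneg (Real.sqrt_nonneg _), abs_of_pos (Real.exp_pos _)]
  have h1 : Real.sqrt (1 / (Real.sqrt (2 * Real.pi) * (k.factorial : ℝ))) *
      Real.sqrt k.factorial = Real.sqrt (1 / Real.sqrt (2 * Real.pi)) := by
    rw [← Real.sqrt_mul (by positivity)]
    congr 1
    have : (k.factorial : ℝ) ≠ 0 := by positivity
    field_simp
  have h2 : Real.exp (-x ^ 2 / 4) ≤ 1 := by
    rw [Real.exp_le_one_iff]; nlinarith [sq_nonneg x]
  have hb := one_le_heBound hM k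
  calc _ ≤ Real.sqrt (1 / (Real.sqrt (2 * Real.pi) * (k.factorial : ℝ))) *
        (Real.sqrt (k.factorial) * heBound M k) * 1 := by
        gcongr
        exact abs_He_le hM hx k
    _ = _ := by rw [← h1]; ring

lemma summable_abs_phi_mul_pow (x : ℝ) {r : ℝ} (hr : 0 < r) (hr1 : r < 1) :
    Summable fun k => |phi k x| * r ^ k := by
  have hM : 0 ≤ |x| := abs_nonneg x
  refine Summable.of_nonneg_of_le (fun k => by positivity) (fun k => ?_)
    ((summable_heBound hM hr hr1).mul_left (Real.sqrt (1 / Real.sqrt (2 * Real.pi))))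
  have h := abs_phi_le hM le_rfl k (x := x)
  have hb := one_le_heBound hM k
  have hk : (0:ℝ) ≤ k := Nat.cast_nonneg k
  calc _ ≤ Real.sqrt (1 / Real.sqrt (2 * Real.pi)) * heBound |x| k * r ^ k := by gcongr
    _ = Real.sqrt (1 / Real.sqrt (2 * Real.pi)) * (1 * (heBound |x| k * 1) * r ^ k) := by ring
    _ ≤ _ := by
      gcongr
      · linarith

lemma summable_abs_phi_mul_phi (x y : ℝ) {r : ℝ} (hr : 0 < r) (hr1 : r < 1) :
    Summable fun k => |phi k x| * |phi k y| * r ^ k := by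
  have hM : 0 ≤ max |x| |y| := by positivity
  refine Summable.of_nonneg_of_le (fun k => by positivity) (fun k => ?_)
    ((summable_heBound hM hr hr1).mul_left (Real.sqrt (1 / Real.sqrt (2 * Real.pi)) *
      Real.sqrt (1 / Real.sqrt (2 * Real.pi))))
  have h := abs_phi_le hM (le_max_left |x| |y|) k
  have h' := abs_phi_le hM (le_max_right |x| |y|) k
  have hb := one_le_heBound hM k
  have hk : (0:ℝ) ≤ k := Nat.cast_nonneg k
  set b := heBound (max |x| |y|) k
  calc _ ≤ (Real.sqrt (1 / Real.sqrt (2 * Real.pi)) * b) *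
        (Real.sqrt (1 / Real.sqrt (2 * Real.pi)) * b) * r ^ k := by gcongr
    _ = Real.sqrt (1 / Real.sqrt (2 * Real.pi)) * Real.sqrt (1 / Real.sqrt (2 * Real.pi)) *
        (1 * (b * b) * r ^ k) := by ring
    _ ≤ _ := by
      gcongr
      linarith

lemma summable_phi_mul_phi (x y : ℝ) {r : ℝ} (hr : 0 < r) (hr1 : r < 1) :
    Summable fun k => phi k x * phi k y * r ^ k := by
  refine Summable.of_norm ((summable_abs_phi_mul_phi x y hr hr1).congr fun k => ?_)
  rw [Real.norm_eq_abs, abs_mul, abs_mul, abs_of_nonneg (pow_nonneg hr.le k)]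

/-- The Mehler kernel `∑ φ_k(x) φ_k(y) r^k`. -/
def mehler (r x y : ℝ) : ℝ := ∑' k : ℕ, phi k x * phi k y * r ^ k

lemma mehler_eq_heSeries {r : ℝ} (x y : ℝ) :
    mehler r x y = 1 / Real.sqrt (2 * Real.pi) * Real.exp (-(x ^ 2 + y ^ 2) / 4) *
      heSeries r x y := by
  rw [heSeries, ← tsum_mul_left]
  unfold mehler
  congr 1; ext k
  rw [phi_eq, phi_eq, show -(x ^ 2 + y ^ 2) / 4 = -x ^ 2 / 4 + -y ^ 2 / 4 by ring, Real.exp_add]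
  have h : Real.sqrt (1 / (Real.sqrt (2 * Real.pi) * (k.factorial : ℝ))) *
    Real.sqrt (1 / (Real.sqrt (2 * Real.pi) * (k.factorial : ℝ))) =
      1 / Real.sqrt (2 * Real.pi) * (1 / k.factorial) := by
    rw [Real.mul_self_sqrt (by positivity), one_div_mul_one_div]
  calc _ = (Real.sqrt (1 / (Real.sqrt (2 * Real.pi) * (k.factorial : ℝ))) *
    Real.sqrt (1 / (Real.sqrt (2 * Real.pi) * (k.factorial : ℝ)))) * (He k x * He k y *
      (Real.exp (-x ^ 2 / 4) * Real.exp (-y ^ 2 / 4)) * r ^ k) := by ring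
    _ = _ := by rw [h]; ring

/-- From |ab| ≤ (a² + b²)/2 and the normalization. Being uniform in j and k, the bound justifies
exchanging sums and integrals below. -/
lemma integral_norm_phi_mul_phi_le_one (j k : ℕ) : ∫ x, ‖phi j x * phi k x‖ ≤ 1 := by
  have h1 := integral_phi_mul_phi j j
  have h2 := integral_phi_mul_phi k k
  rw [if_pos rfl] at h1 h2
  calc ∫ x, ‖phi j x * phi k x‖ ≤ ∫ x, (phi j x * phi j x + phi k x * phi k x) / 2 := by
        apply integral_mono (integrable_phi_mul_phi j k).norm
        · exact ((integrable_phi_mul_phi j j).add (integrable_phi_mul_phi k k)).div_const 2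
        · intro x
          simp only [Real.norm_eq_abs, abs_mul]
          nlinarith [sq_nonneg (|phi j x| - |phi k x|), abs_mul_abs_self (phi j x),
            abs_mul_abs_self (phi k x)]
    _ = 1 := by
        rw [integral_div, integral_add (integrable_phi_mul_phi j j) (integrable_phi_mul_phi k k),
          h1, h2]
        norm_num

lemma integral_mehler_diag {r : ℝ} (hr : 0 < r) (hr1 : r < 1) :
    ∫ x, mehler r x x = 1 / (1 - r) := by
  have h := hasSum_integral_of_summable_integral_norm (μ := (volume : Measure ℝ))
    (F := fun (k : ℕ) x => phi k x * phi k x * r ^ k)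
    (fun k => (integrable_phi_mul_phi k k).mul_const _) ?_
  · have h2 : ∀ k : ℕ, ∫ x, phi k x * phi k x * r ^ k = r ^ k := by
      intro k; rw [integral_mul_const, integral_phi_mul_phi]; simp
    simp only [h2] at h
    unfold mehler
    rw [← h.tsum_eq, tsum_geometric_of_lt_one hr.le hr1, one_div]
  · refine Summable.of_nonneg_of_le (fun k => integral_nonneg fun x => norm_nonneg _) (fun k => ?_)
      (summable_geometric_of_lt_one hr.le hr1)
    simp only [norm_mul _ (r ^ k), Real.norm_of_nonneg (pow_nonneg hr.le k)]
    rw [integral_mul_const]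
    have := integral_norm_phi_mul_phi_le_one k k
    have h0 : 0 ≤ r ^ k := pow_nonneg hr.le k
    nlinarith

/-- The differential equation leaves a multiplicative constant open. It is fixed by the trace: the
diagonal of the Mehler kernel is a Gaussian times this constant, and its integral is the geometric
series ∑ r^k. -/
lemma heSeries_zero_zero {r : ℝ} (hr : 0 < r) (hr1 : r < 1) :
    heSeries r 0 0 = 1 / Real.sqrt (1 - r ^ 2) := by
  have h := integral_mehler_diag hr hr1
  have h1 : ∀ x, mehler r x x = heSeries r 0 0 * (1 / Real.sqrt (2 * Real.pi)) *
      Real.exp (-((1 - r) / (2 * (1 + r))) * x ^ 2) := by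
    intro x
    rw [mehler_eq_heSeries, heSeries_eq hr hr1]
    have : Real.exp (-((1 - r) / (2 * (1 + r))) * x ^ 2) = Real.exp (-(x ^ 2 + x ^ 2) / 4) *
        Real.exp ((r * x * x - r ^ 2 * (x ^ 2 + x ^ 2) / 2) / (1 - r ^ 2)) := by
      rw [← Real.exp_add]
      congr 1
      have e1 : 1 - r ^ 2 = (1 - r) * (1 + r) := by ring
      have e2 : (1 - r) ≠ 0 := by linarith
      have e3 : (1 + r) ≠ 0 := by linarith
      rw [e1]
      field_simp
      ring
    rw [this]; ring
  simp only [h1] at h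
  rw [integral_const_mul, integral_gaussian] at h
  have e2 : 0 < (1 - r) := by linarith
  have e3 : 0 < (1 + r) := by linarith
  have e4 : Real.sqrt (Real.pi / ((1 - r) / (2 * (1 + r)))) =
      Real.sqrt (2 * Real.pi) * (Real.sqrt (1 - r ^ 2) / (1 - r)) := by
    rw [show Real.pi / ((1 - r) / (2 * (1 + r))) = 2 * Real.pi * ((1 - r ^ 2) / (1 - r) ^ 2) by
      rw [show 1 - r ^ 2 = (1 - r) * (1 + r) by ring]; field_simp]
    rw [Real.sqrt_mul (by positivity), Real.sqrt_div (by nlinarith), Real.sqrt_sq e2.le]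
  rw [e4] at h
  have e5 : 0 < Real.sqrt (1 - r ^ 2) := Real.sqrt_pos.2 (by nlinarith)
  have e6 : 0 < Real.sqrt (2 * Real.pi) := by positivity
  field_simp at h
  field_simp
  exact h

/-- **Mehler's formula**. -/
lemma mehler_eq {r : ℝ} (hr : 0 < r) (hr1 : r < 1) (x y : ℝ) :
    mehler r x y = 1 / (Real.sqrt (2 * Real.pi) * Real.sqrt (1 - r ^ 2)) *
      Real.exp (-((1 + r ^ 2) / (4 * (1 - r ^ 2))) * (x ^ 2 + y ^ 2)) *
      Real.exp (r / (1 - r ^ 2) * (x * y)) := by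
  rw [mehler_eq_heSeries, heSeries_eq hr hr1, heSeries_zero_zero hr hr1]
  have e2 : (1 - r ^ 2) ≠ 0 := by nlinarith
  have : Real.exp (-((1 + r ^ 2) / (4 * (1 - r ^ 2))) * (x ^ 2 + y ^ 2)) *
      Real.exp (r / (1 - r ^ 2) * (x * y)) = Real.exp (-(x ^ 2 + y ^ 2) / 4) *
        Real.exp ((r * x * y - r ^ 2 * (x ^ 2 + y ^ 2) / 2) / (1 - r ^ 2)) := by
    rw [← Real.exp_add, ← Real.exp_add]
    congr 1
    field_simp
    ring
  rw [← one_div_mul_one_div]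
  linear_combination (-(1 / Real.sqrt (2 * Real.pi) * (1 / Real.sqrt (1 - r ^ 2)))) * this

lemma mehler_pos {r : ℝ} (hr : 0 < r) (hr1 : r < 1) (x y : ℝ) : 0 < mehler r x y := by
  rw [mehler_eq hr hr1]
  have : 0 < 1 - r ^ 2 := by nlinarith
  have := Real.sqrt_pos.2 this
  positivity

lemma integrable_mehler_diag {r : ℝ} (hr : 0 < r) (hr1 : r < 1) :
    Integrable fun x => mehler r x x := by
  -- The Bochner integral of a function which is not integrable is 0, whereas the trace is positive.
  by_contra h
  have h1 := integral_mehler_diag hr hr1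
  rw [integral_undef h] at h1
  have : 0 < 1 / (1 - r) := by rw [one_div]; exact inv_pos.2 (by linarith)
  linarith

/-- Parseval's identity for the functions `φ_k`. -/
lemma integral_tsum_mul_tsum {a b : ℕ → ℝ} (ha : Summable fun k => |a k|)
    (hb : Summable fun k => |b k|) (ha' : ∀ x, Summable fun k => |a k * phi k x|)
    (hb' : ∀ x, Summable fun k => |b k * phi k x|) :
    ∫ x, (∑' k, a k * phi k x) * (∑' k, b k * phi k x) = ∑' k, a k * b k := by
  have h := hasSum_integral_of_summable_integral_norm (μ := (volume : Measure ℝ))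
    (F := fun (p : ℕ × ℕ) x => (a p.1 * phi p.1 x) * (b p.2 * phi p.2 x)) ?_ ?_
  · have h2 : ∀ p : ℕ × ℕ, ∫ x, (a p.1 * phi p.1 x) * (b p.2 * phi p.2 x) =
        if p.1 = p.2 then a p.1 * b p.2 else 0 := by
      intro p
      have : ∀ x, (a p.1 * phi p.1 x) * (b p.2 * phi p.2 x) =
        (a p.1 * b p.2) * (phi p.1 x * phi p.2 x) := fun x => mul_mul_mul_comm _ _ _ _
      simp only [this]
      rw [integral_const_mul, integral_phi_mul_phi, mul_ite, mul_one, mul_zero]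
    simp only [h2] at h
    have h3 : ∀ x, ∑' p : ℕ × ℕ, (a p.1 * phi p.1 x) * (b p.2 * phi p.2 x) =
        (∑' k, a k * phi k x) * (∑' k, b k * phi k x) := by
      intro x
      have ea : Summable fun k => ‖a k * phi k x‖ := by simpa only [Real.norm_eq_abs] using ha' x
      have eb : Summable fun k => ‖b k * phi k x‖ := by simpa only [Real.norm_eq_abs] using hb' x
      exact (tsum_mul_tsum_of_summable_norm ea eb).symm
    simp only [h3] at h
    rw [← h.tsum_eq]
    -- Orthonormality leaves only the diagonal of the double series.
    have hinj : Function.Injective fun k : ℕ => (k, k) := fun i j hij => congrArg Prod.fst hij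
    rw [← hinj.tsum_eq (f := fun p : ℕ × ℕ => if p.1 = p.2 then a p.1 * b p.2 else 0)]
    · simp only [if_true]
    · intro p hp
      by_cases hpp : p.1 = p.2
      · exact ⟨p.1, Prod.ext rfl hpp⟩
      · exact absurd (if_neg hpp) hp
  · intro p
    refine ((integrable_phi_mul_phi p.1 p.2).const_mul (a p.1 * b p.2)).congr
      (Filter.Eventually.of_forall fun x => ?_)
    simp only; ring
  · refine Summable.of_nonneg_of_le (fun k => integral_nonneg fun x => norm_nonneg _) (fun p => ?_)
      (ha.mul_of_nonneg hb (fun k => abs_nonneg _) (fun k => abs_nonneg _))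
    have : ∀ x, ‖(a p.1 * phi p.1 x) * (b p.2 * phi p.2 x)‖ =
      (|a p.1| * |b p.2|) * ‖phi p.1 x * phi p.2 x‖ := fun x => by
        simp only [Real.norm_eq_abs, abs_mul]; ring
    simp only [this]
    rw [integral_const_mul]
    have h1 := integral_norm_phi_mul_phi_le_one p.1 p.2
    exact mul_le_of_le_one_right (by positivity) h1

/-! ### Eigenstates as finite sets of levels -/

/-- The set of occupied levels of an eigenstate. -/
def levels {n : ℕ} (k : Eigenstate n) : Finset ℕ := Finset.univ.map ⟨k.1, k.2.injective⟩

lemma card_levels {n : ℕ} (k : Eigenstate n) : (levels k).card = n := by simp [levels]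

lemma sum_levels {n : ℕ} (k : Eigenstate n) : ∑ j ∈ levels k, j = ∑ i, k.1 i := by
  simp [levels]

lemma prod_levels {n : ℕ} (k : Eigenstate n) {M : Type*} [CommMonoid M] (f : ℕ → M) :
    ∏ j ∈ levels k, f j = ∏ i, f (k.1 i) := by
  simp [levels]

lemma levels_injective (n : ℕ) : Function.Injective (levels (n := n)) := by
  intro k l h
  apply Subtype.ext
  have hk := Finset.orderEmbOfFin_unique (card_levels k) (f := k.1)
    (fun x => by simp [levels]) k.2
  have hl := Finset.orderEmbOfFin_unique (card_levels k) (f := l.1)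
    (fun x => by rw [h]; simp [levels]) l.2
  rw [hk, hl]

lemma exists_levels_eq {n : ℕ} {S : Finset ℕ} (hS : S.card = n) : ∃ k : Eigenstate n, levels k = S := by
  refine ⟨⟨S.orderEmbOfFin hS, (S.orderEmbOfFin hS).strictMono⟩, ?_⟩
  ext j
  have := Finset.range_orderEmbOfFin S hS
  rw [Set.ext_iff] at this
  simp only [levels, Finset.mem_map, Finset.mem_univ, true_and, Function.Embedding.coeFn_mk]
  exact this j

/-- Eigenstates correspond to n-element sets of levels. In the form of a sum over all finite sets,
the series can be exhausted by the subsets of {0, …, N-1}, on which the finite algebra of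
determinants and products takes place. -/
lemma hasSum_levels_iff {E : Type*} [AddCommMonoid E] [TopologicalSpace E] {n : ℕ}
    {g : Finset ℕ → E} {a : E} :
    HasSum (fun k : Eigenstate n => g (levels k)) a ↔
      HasSum (fun S : Finset ℕ => if S.card = n then g S else 0) a := by
  rw [← (levels_injective n).hasSum_iff]
  · simp [Function.comp_def, card_levels]
  · intro S hS
    by_cases h : S.card = n
    · exact absurd (exists_levels_eq h) hS
    · simp [h]

lemma tendsto_powerset_range :
    Filter.Tendsto (fun N => (Finset.range N).powerset) Filter.atTop Filter.atTop := by
  apply Filter.tendsto_atTop_finset_of_monotone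
  · intro M N h
    exact Finset.powerset_mono.2 (Finset.range_mono h)
  · intro S
    refine ⟨S.sup id + 1, ?_⟩
    rw [Finset.mem_powerset]
    intro j hj
    rw [Finset.mem_range]
    exact Nat.lt_succ_of_le (Finset.le_sup (f := id) hj)

lemma tendsto_sum_powersetCard {E : Type*} [AddCommMonoid E] [TopologicalSpace E] {n : ℕ}
    {g : Finset ℕ → E} {a : E} (h : HasSum (fun k : Eigenstate n => g (levels k)) a) :
    Filter.Tendsto (fun N => ∑ S ∈ Finset.powersetCard n (Finset.range N), g S)
      Filter.atTop (nhds a) := by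
  rw [hasSum_levels_iff] at h
  refine (h.comp tendsto_powerset_range).congr fun N => ?_
  rw [Function.comp_apply, ← Finset.sum_filter, ← Finset.powersetCard_eq_filter]

lemma summable_pow_sum {n : ℕ} {x : ℝ} (hx : 0 ≤ x) (hx1 : x < 1) :
    Summable fun k : Eigenstate n => x ^ (∑ i, k.1 i) := by
  have h := summable_finsetProd_of_summable_nonneg (f := fun k : ℕ => x ^ k)
    (fun k => pow_nonneg hx k) (summable_geometric_of_lt_one hx hx1)
  refine (h.comp_injective (levels_injective n)).congr fun k => ?_
  simp only [Function.comp_apply]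
  rw [prod_levels, Finset.prod_pow_eq_pow_sum]

/-- The elementary symmetric function `∑_{k_1 < ⋯ < k_n} x^{k_1 + ⋯ + k_n}`. -/
def esum (x : ℝ) (n : ℕ) : ℝ := ∑' k : Eigenstate n, x ^ (∑ i, k.1 i)

lemma tendsto_esum {n : ℕ} {x : ℝ} (hx : 0 ≤ x) (hx1 : x < 1) :
    Filter.Tendsto (fun N => ∑ S ∈ Finset.powersetCard n (Finset.range N), x ^ (∑ j ∈ S, j))
      Filter.atTop (nhds (esum x n)) := by
  apply tendsto_sum_powersetCard (g := fun S => x ^ (∑ j ∈ S, j))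
  simp only [sum_levels]
  exact (summable_pow_sum hx hx1).hasSum

lemma sum_powersetCard_map_succ (x : ℝ) (n N : ℕ) :
    ∑ S ∈ Finset.powersetCard n ((Finset.range N).map (addRightEmbedding 1)), x ^ (∑ j ∈ S, j) =
      x ^ n * ∑ S ∈ Finset.powersetCard n (Finset.range N), x ^ (∑ j ∈ S, j) := by
  rw [Finset.powersetCard_map, Finset.sum_map, Finset.mul_sum]
  refine Finset.sum_congr rfl fun S hS => ?_
  rw [Finset.mem_powersetCard] at hS
  simp only [RelEmbedding.coe_toEmbedding, Finset.mapEmbedding_apply, Finset.sum_map,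
    addRightEmbedding_apply, Finset.sum_add_distrib, Finset.sum_const, smul_eq_mul, mul_one]
  rw [hS.2, pow_add, mul_comm]

/-- Split the subsets of {0, …, N} according to whether they contain 0. The remaining elements are
shifted down by one, which costs x for each of them. -/
lemma sum_powersetCard_succ (x : ℝ) (n N : ℕ) :
    ∑ S ∈ Finset.powersetCard (n + 1) (Finset.range (N + 1)), x ^ (∑ j ∈ S, j) =
      x ^ (n + 1) * ∑ S ∈ Finset.powersetCard (n + 1) (Finset.range N), x ^ (∑ j ∈ S, j) +
      x ^ n * ∑ S ∈ Finset.powersetCard n (Finset.range N), x ^ (∑ j ∈ S, j) := by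
  have h0 : Finset.range (N + 1) = insert 0 ((Finset.range N).map (addRightEmbedding 1)) := by
    ext j
    cases j <;> simp
  have hn : (0 : ℕ) ∉ (Finset.range N).map (addRightEmbedding 1) := by simp
  rw [h0, Finset.powersetCard_succ_insert hn, Finset.sum_union, Finset.sum_image,
    sum_powersetCard_map_succ, ← sum_powersetCard_map_succ x n N]
  · congr 1
    refine Finset.sum_congr rfl fun S hS => ?_
    rw [Finset.mem_powersetCard] at hS
    rw [Finset.sum_insert (fun h => hn (hS.1 h)), zero_add]
  · intro S hS S' hS' h
    simp only [Finset.mem_coe, Finset.mem_powersetCard] at hS hS'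
    rw [← Finset.erase_insert (fun h => hn (hS.1 h)), h,
      Finset.erase_insert (fun h => hn (hS'.1 h))]
  · rw [Finset.disjoint_left]
    intro S hS hS'
    rw [Finset.mem_powersetCard] at hS
    rw [Finset.mem_image] at hS'
    obtain ⟨U, -, rfl⟩ := hS'
    exact hn (hS.1 (Finset.mem_insert_self _ _))

lemma esum_succ {x : ℝ} (hx : 0 ≤ x) (hx1 : x < 1) (n : ℕ) :
    esum x (n + 1) * (1 - x ^ (n + 1)) = x ^ n * esum x n := by
  have h1 := (tendsto_esum (n := n + 1) hx hx1).comp (Filter.tendsto_add_atTop_nat 1)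
  have h2 := ((tendsto_esum (n := n + 1) hx hx1).const_mul (x ^ (n + 1))).add
    ((tendsto_esum (n := n) hx hx1).const_mul (x ^ n))
  have h3 := tendsto_nhds_unique h1 (h2.congr fun N => (sum_powersetCard_succ x n N).symm)
  linarith

/-- Iterating the recursion e_{n+1}(1 - x^{n+1}) = x^n e_n. It is this closed form that makes the
constant in F the reciprocal of the canonical partition function, up to the ground state energy
q^{n/2}. -/
lemma esum_eq {x : ℝ} (hx : 0 ≤ x) (hx1 : x < 1) (n : ℕ) :
    esum x n * ∏ k ∈ Finset.range n, (1 - x * x ^ k) = x ^ (n * (n - 1) / 2) := by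
  induction n with
  | zero =>
    have : esum x 0 = 1 := by
      refine tendsto_nhds_unique (tendsto_esum (n := 0) hx hx1) ?_
      simp
    simp [this]
  | succ n ih =>
    rw [Finset.prod_range_succ, mul_comm (∏ k ∈ _, _), ← mul_assoc, ← pow_succ',
      esum_succ hx hx1, mul_assoc, ih, ← pow_add]
    congr 1
    rw [← Finset.sum_range_id, ← Finset.sum_range_id, Finset.sum_range_succ, add_comm]

lemma esum_pos {x : ℝ} (hx : 0 < x) (hx1 : x < 1) (n : ℕ) : 0 < esum x n := by
  have h := esum_eq hx.le hx1 n
  have h1 : 0 < ∏ k ∈ Finset.range n, (1 - x * x ^ k) := by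
    refine Finset.prod_pos fun k _ => ?_
    have : x * x ^ k < 1 := by
      rw [← pow_succ']; exact pow_lt_one₀ hx.le hx1 (by simp)
    linarith
  have h2 : 0 < x ^ (n * (n - 1) / 2) := by positivity
  rw [← h] at h2
  exact (pos_iff_pos_of_mul_pos h2).2 h1

lemma partitionFn_eq {q : ℝ} (hq : 0 < q) (n : ℕ) :
    partitionFn q n = q ^ ((n : ℝ) / 2) * esum q n := by
  unfold partitionFn esum
  rw [← tsum_mul_left]
  congr 1; ext k
  rw [Real.rpow_add hq, mul_comm]
  congr 1
  rw [← Nat.cast_sum, Real.rpow_natCast]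

lemma rpow_div_partitionFn {q : ℝ} (hq : 0 < q) (n : ℕ) :
    q ^ ((n : ℝ) / 2) / partitionFn q n = (esum q n)⁻¹ := by
  rw [partitionFn_eq hq]
  have : 0 < q ^ ((n : ℝ) / 2) := Real.rpow_pos_of_pos hq _
  field_simp

/-! ### Contour integrals of multi-affine functionals -/

/-- Sequences of occupation numbers with `c_k = O(ρ^k)`. -/
def Admissible (ρ : ℝ) (c : ℕ → ℂ) : Prop := ∃ R : ℝ, 0 ≤ R ∧ ∀ k, ‖c k‖ ≤ R * ρ ^ k

lemma Admissible.piecewise {ρ : ℝ} (hρ : 0 < ρ) {c : ℕ → ℂ} (hc : Admissible ρ c) (s : Finset ℕ)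
    (a : ℕ → ℂ) : Admissible ρ fun k => if k ∈ s then a k else c k := by
  obtain ⟨R, hR0, hR⟩ := hc
  have h0 : 0 ≤ ∑ j ∈ s, ‖a j‖ / ρ ^ j := Finset.sum_nonneg fun j _ => by positivity
  refine ⟨R + ∑ j ∈ s, ‖a j‖ / ρ ^ j, by positivity, fun k => ?_⟩
  have hk : 0 < ρ ^ k := pow_pos hρ k
  dsimp only
  split_ifs with h
  · have := Finset.single_le_sum (f := fun j => ‖a j‖ / ρ ^ j) (fun j _ => by positivity) h
    rw [← div_le_iff₀ hk]
    linarith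
  · refine (hR k).trans ?_
    gcongr
    linarith

lemma Admissible.update {ρ : ℝ} (hρ : 0 < ρ) {c : ℕ → ℂ} (hc : Admissible ρ c) (k : ℕ) (t : ℂ) :
    Admissible ρ (Function.update c k t) := by
  convert hc.piecewise hρ {k} (fun _ => t) using 2 with j
  by_cases h : j = k
  · subst h; simp
  · simp [h]

lemma admissible_zero (ρ : ℝ) : Admissible ρ 0 := ⟨0, le_rfl, by simp⟩

/-- Functionals of a sequence of occupation numbers which are affine in every entry, bounded on the
polydiscs `|c_k| ≤ R ρ^k`, and compatible there with truncation. -/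
structure MultiAffine (ρ : ℝ) (h : (ℕ → ℂ) → ℂ) : Prop where
  affine : ∀ c, Admissible ρ c → ∀ k t, h (Function.update c k t) =
    (1 - t) * h (Function.update c k 0) + t * h (Function.update c k 1)
  bdd : ∀ R : ℝ, ∃ B : ℝ, ∀ c : ℕ → ℂ, (∀ k, ‖c k‖ ≤ R * ρ ^ k) → ‖h c‖ ≤ B
  lim : ∀ (R : ℝ) (c : ℕ → ℂ), (∀ k, ‖c k‖ ≤ R * ρ ^ k) →
    Filter.Tendsto (fun N => h fun k => if k < N then c k else 0) Filter.atTop (nhds (h c))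

/-- The occupation numbers of the eigenstate with occupied levels `S`. -/
def occ (S : Finset ℕ) (k : ℕ) : ℂ := if k ∈ S then 1 else 0

lemma admissible_occ {ρ : ℝ} (hρ : 0 < ρ) (S : Finset ℕ) : Admissible ρ (occ S) :=
  (admissible_zero ρ).piecewise hρ S 1

/-- An affine function of one variable is recovered from its values at ±t by 2t h(1) = (1+t) h(t) -
(1-t) h(-t). With t = ρ^a both points lie in the polydisc where h is bounded and the two weights add
up to 2, so raising the entry c_a to 1 costs exactly a factor ρ^{-a}. Doing this for the levels in S
one after another gives the power ρ^{-∑S}, which q^{∑S} beats because q < ρ. -/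
lemma MultiAffine.norm_le {ρ : ℝ} {h : (ℕ → ℂ) → ℂ} (hh : MultiAffine ρ h) (hρ : 0 < ρ)
    (hρ1 : ρ < 1) {B : ℝ} (hB : ∀ c : ℕ → ℂ, (∀ k, ‖c k‖ ≤ ρ ^ k) → ‖h c‖ ≤ B)
    (S : Finset ℕ) (c : ℕ → ℂ) (h1 : ∀ k ∈ S, c k = 1) (h2 : ∀ k ∉ S, ‖c k‖ ≤ ρ ^ k) :
    ‖h c‖ ≤ B * (ρ ^ (∑ j ∈ S, j))⁻¹ := by
  induction S using Finset.induction_on generalizing c with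
  | empty => simpa using hB c fun k => h2 k (by simp)
  | insert a S ha ih =>
    set t : ℂ := ((ρ ^ a : ℝ) : ℂ) with ht
    have ht0 : 0 < ρ ^ a := pow_pos hρ a
    have ht1 : ρ ^ a ≤ 1 := pow_le_one₀ hρ.le hρ1.le
    have hb : ∀ s : ℂ, ‖s‖ = ρ ^ a → ‖h (Function.update c a s)‖ ≤ B * (ρ ^ (∑ j ∈ S, j))⁻¹ := by
      intro s hs
      apply ih
      · intro k hk
        rw [Function.update_of_ne (ne_of_mem_of_not_mem hk ha)]
        exact h1 k (Finset.mem_insert_of_mem hk)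
      · intro k hk
        by_cases hka : k = a
        · subst hka; simp [hs]
        · rw [Function.update_of_ne hka]
          exact h2 k (by simp [hka, hk])
    have hc : Function.update c a 1 = c := by
      rw [← h1 a (Finset.mem_insert_self _ _), Function.update_eq_self]
    have hadm : Admissible ρ c := by
      have h3 : Admissible ρ fun k => if k ∈ insert a S then (0 : ℂ) else c k := by
        refine ⟨1, zero_le_one, fun k => ?_⟩
        dsimp only
        split_ifs with h
        · rw [norm_zero]; positivity
        · simpa using h2 k h
      convert h3.piecewise hρ (insert a S) 1 using 2 with k
      split_ifs with h
      · exact h1 k h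
      · rfl
    have e1 := hh.affine c hadm a t
    have e2 := hh.affine c hadm a (-t)
    rw [hc] at e1 e2
    have e3 : 2 * t * h c = (1 + t) * h (Function.update c a t) -
        (1 - t) * h (Function.update c a (-t)) := by
      rw [e1, e2]; ring
    have hnt : ‖t‖ = ρ ^ a := by rw [ht, Complex.norm_real, Real.norm_of_nonneg ht0.le]
    have f1 := hb t hnt
    have f2 := hb (-t) (by rw [norm_neg, hnt])
    have g1 : ‖1 + t‖ = 1 + ρ ^ a := by
      rw [ht, ← Complex.ofReal_one, ← Complex.ofReal_add, Complex.norm_real,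
        Real.norm_of_nonneg (by positivity)]
    have g2 : ‖1 - t‖ = 1 - ρ ^ a := by
      rw [ht, ← Complex.ofReal_one, ← Complex.ofReal_sub, Complex.norm_real,
        Real.norm_of_nonneg (by linarith)]
    have e4 : 2 * ρ ^ a * ‖h c‖ ≤ 2 * (B * (ρ ^ (∑ j ∈ S, j))⁻¹) := by
      calc 2 * ρ ^ a * ‖h c‖ = ‖2 * t * h c‖ := by
            rw [norm_mul, norm_mul, hnt]; simp
        _ ≤ (1 + ρ ^ a) * ‖h (Function.update c a t)‖ +
          (1 - ρ ^ a) * ‖h (Function.update c a (-t))‖ := by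
            rw [e3, ← g1, ← g2, ← norm_mul, ← norm_mul]
            exact norm_sub_le _ _
        _ ≤ (1 + ρ ^ a) * (B * (ρ ^ (∑ j ∈ S, j))⁻¹) + (1 - ρ ^ a) * (B * (ρ ^ (∑ j ∈ S, j))⁻¹) := by
            gcongr
        _ = _ := by ring
    rw [Finset.sum_insert ha, pow_add, mul_inv, mul_comm (ρ ^ a)⁻¹, ← mul_assoc,
      ← div_eq_mul_inv, le_div_iff₀ ht0]
    linarith

lemma MultiAffine.exists_norm_occ_le {ρ : ℝ} {h : (ℕ → ℂ) → ℂ} (hh : MultiAffine ρ h) (hρ : 0 < ρ)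
    (hρ1 : ρ < 1) : ∃ B, ∀ S : Finset ℕ, ‖h (occ S)‖ ≤ B * (ρ ^ (∑ j ∈ S, j))⁻¹ := by
  obtain ⟨B, hB⟩ := hh.bdd 1
  refine ⟨B, fun S => hh.norm_le hρ hρ1 (fun c hc => hB c (by simpa using hc)) S _ ?_ ?_⟩
  · intro k hk; simp [occ, hk]
  · intro k hk; simp [occ, hk]; positivity

/-- For one affine variable, (1+a) h(a/(1+a)) = h(0) + a h(1): the weight 1 + a clears the
denominator of the occupation probability. Induction on the levels yields a generating polynomial
over sets of occupied levels. The entries outside s are kept arbitrary, so that the induction can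
fix the entry of the new level at 0 or at 1. -/
lemma MultiAffine.prod_mul_eq {ρ : ℝ} {h : (ℕ → ℂ) → ℂ} (hh : MultiAffine ρ h) (hρ : 0 < ρ)
    (a : ℕ → ℂ) (s : Finset ℕ) (ha : ∀ k ∈ s, 1 + a k ≠ 0) (c : ℕ → ℂ) (hc : Admissible ρ c) :
    (∏ k ∈ s, (1 + a k)) * h (fun k => if k ∈ s then a k / (1 + a k) else c k) =
      ∑ S ∈ s.powerset, (∏ k ∈ S, a k) *
        h (fun k => if k ∈ S then 1 else if k ∈ s then 0 else c k) := by
  induction s using Finset.induction_on generalizing c with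
  | empty => simp
  | insert x s hx ih =>
    have ih := ih (fun k hk => ha k (Finset.mem_insert_of_mem hk))
    rw [Finset.sum_powerset_insert hx, Finset.prod_insert hx]
    have e1 : (fun k => if k ∈ insert x s then a k / (1 + a k) else c k) =
        Function.update (fun k => if k ∈ s then a k / (1 + a k) else c k) x (a x / (1 + a x)) := by
      ext k
      by_cases hk : k = x
      · subst hk; simp
      · simp [hk]
    have e2 : ∀ t : ℂ, Function.update (fun k => if k ∈ s then a k / (1 + a k) else c k) x t =
        fun k => if k ∈ s then a k / (1 + a k) else Function.update c x t k := by
      intro t; ext k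
      by_cases hk : k = x
      · subst hk; simp [hx]
      · simp [hk]
    have hax := ha x (Finset.mem_insert_self _ _)
    rw [e1, hh.affine _ (hc.piecewise hρ s _), e2, e2]
    have e3 : (1 + a x) * (∏ k ∈ s, (1 + a k)) * ((1 - a x / (1 + a x)) *
        h (fun k => if k ∈ s then a k / (1 + a k) else Function.update c x 0 k) +
        a x / (1 + a x) * h (fun k => if k ∈ s then a k / (1 + a k) else Function.update c x 1 k)) =
        (∏ k ∈ s, (1 + a k)) * h (fun k => if k ∈ s then a k / (1 + a k) else Function.update c x 0 k)
        + a x * ((∏ k ∈ s, (1 + a k)) *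
          h (fun k => if k ∈ s then a k / (1 + a k) else Function.update c x 1 k)) := by
      field_simp
      ring
    rw [e3, ih _ (hc.update hρ x 0), ih _ (hc.update hρ x 1), Finset.mul_sum]
    congr 1
    · refine Finset.sum_congr rfl fun S hS => ?_
      rw [Finset.mem_powerset] at hS
      congr 2; ext k
      by_cases hk : k = x
      · subst hk; simp [hx]
      · simp [hk]
    · refine Finset.sum_congr rfl fun S hS => ?_
      rw [Finset.mem_powerset] at hS
      rw [Finset.prod_insert (fun e => hx (hS e)), mul_assoc]
      congr 3; ext k
      by_cases hk : k = x
      · subst hk; simp [hx]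
      · simp [hk]

lemma contour_const_mul (r : ℝ) (a : ℂ) (f : ℂ → ℂ) :
    contour r (fun z => a * f z) = a * contour r f := by
  unfold contour
  simp only [mul_div_assoc]
  rw [circleIntegral.integral_const_mul]
  ring

lemma contour_congr {r : ℝ} (hr : 0 < r) {f g : ℂ → ℂ}
    (h : ∀ z ∈ Metric.sphere (0 : ℂ) r, f z = g z) : contour r f = contour r g := by
  unfold contour
  congr 1
  exact circleIntegral.integral_congr hr.le fun z hz => by simp only [h z hz]

lemma contour_pow_div_pow {r : ℝ} (hr : 0 < r) (j n : ℕ) :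
    contour r (fun z => z ^ j / z ^ n) = if j = n then 1 else 0 := by
  unfold contour
  have h : ∮ z in C(0, r), z ^ j / z ^ n / z =
      ∮ z in C(0, r), (z - 0) ^ ((j : ℤ) - n - 1) := by
    apply circleIntegral.integral_congr hr.le
    intro z hz
    have hz0 : z ≠ 0 := by
      rintro rfl
      simp at hz; exact hr.ne hz
    simp only [sub_zero]
    rw [zpow_sub₀ hz0, zpow_sub₀ hz0]
    simp
  rw [h]
  split_ifs with hjn
  · subst hjn
    simp only [sub_self, zero_sub, zpow_neg, zpow_one]
    rw [circleIntegral.integral_sub_center_inv _ hr.ne']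
    have : (2 * (Real.pi : ℂ) * Complex.I) ≠ 0 := by simp [Real.pi_ne_zero]
    field_simp
  · rw [circleIntegral.integral_sub_zpow_of_ne (by omega), mul_zero]

lemma contour_sum {r : ℝ} (hr : 0 < r) {ι : Type*} (s : Finset ι) (f : ι → ℂ → ℂ)
    (hf : ∀ i ∈ s, ContinuousOn (f i) (Metric.sphere (0 : ℂ) r)) :
    contour r (fun z => ∑ i ∈ s, f i z) = ∑ i ∈ s, contour r (f i) := by
  unfold contour
  simp only [Finset.sum_div]
  rw [circleIntegral.integral_fun_sum, Finset.mul_sum]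
  intro i hi
  apply ContinuousOn.circleIntegrable hr.le
  apply (hf i hi).div continuousOn_id
  intro z hz e
  simp only [id] at e
  subst e
  simp at hz; exact hr.ne hz

/-- Dominated convergence on the circle. Measurability and integrability of the limit are inherited
from the approximants, so continuity of the determinants in z never has to be shown. -/
lemma tendsto_contour {r : ℝ} (hr : 0 < r) {f : ℕ → ℂ → ℂ} {g : ℂ → ℂ}
    (hc : ∀ N, ContinuousOn (f N) (Metric.sphere (0 : ℂ) r)) {B : ℝ}
    (hb : ∀ N, ∀ z ∈ Metric.sphere (0 : ℂ) r, ‖f N z‖ ≤ B)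
    (hl : ∀ z ∈ Metric.sphere (0 : ℂ) r, Filter.Tendsto (f · z) Filter.atTop (nhds (g z))) :
    CircleIntegrable (fun z => g z / z) 0 r ∧
      Filter.Tendsto (fun N => contour r (f N)) Filter.atTop (nhds (contour r g)) := by
  have hm : ∀ θ, circleMap 0 r θ ∈ Metric.sphere (0 : ℂ) r := circleMap_mem_sphere 0 hr.le
  have hcont : ∀ N, Continuous fun θ => f N (circleMap 0 r θ) / circleMap 0 r θ := by
    intro N
    refine Continuous.div ?_ (continuous_circleMap 0 r) fun θ => by simp [circleMap, hr.ne']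
    exact (hc N).comp_continuous (continuous_circleMap 0 r) hm
  have hlim : ∀ θ, Filter.Tendsto (fun N => f N (circleMap 0 r θ) / circleMap 0 r θ) Filter.atTop
      (nhds (g (circleMap 0 r θ) / circleMap 0 r θ)) := fun θ => (hl _ (hm θ)).div_const _
  have hmeas : AEStronglyMeasurable (fun θ => g (circleMap 0 r θ) / circleMap 0 r θ) volume :=
    aestronglyMeasurable_of_tendsto_ae Filter.atTop (fun N => (hcont N).aestronglyMeasurable)
      (Filter.Eventually.of_forall hlim)
  have hbd : ∀ N θ, ‖f N (circleMap 0 r θ) / circleMap 0 r θ‖ ≤ B / r := by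
    intro N θ
    rw [norm_div, norm_circleMap_zero, abs_of_pos hr]
    gcongr
    exact hb N _ (hm θ)
  constructor
  · have hbg : ∀ θ, ‖g (circleMap 0 r θ) / circleMap 0 r θ‖ ≤ B / r := fun θ =>
      le_of_tendsto (hlim θ).norm (Filter.Eventually.of_forall fun N => hbd N θ)
    unfold CircleIntegrable
    rw [intervalIntegrable_iff]
    refine Integrable.mono' (g := fun _ => B / r) ?_ hmeas.restrict
      (Filter.Eventually.of_forall hbg)
    exact integrableOn_const (by simp [ENNReal.mul_eq_top])
  · unfold contour circleIntegral
    refine Filter.Tendsto.const_mul _ ?_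
    refine intervalIntegral.tendsto_integral_filter_of_dominated_convergence (fun _ => r * (B / r))
      ?_ ?_ ?_ ?_
    · refine Filter.Eventually.of_forall fun N => Continuous.aestronglyMeasurable ?_
      simp only [deriv_circleMap]
      exact ((continuous_circleMap 0 r).mul continuous_const).smul (hcont N)
    · refine Filter.Eventually.of_forall fun N => Filter.Eventually.of_forall fun θ _ => ?_
      rw [norm_smul, deriv_circleMap, norm_mul, norm_circleMap_zero, abs_of_pos hr]
      simp only [Complex.norm_I, mul_one]
      gcongr
      exact hbd N θ
    · exact intervalIntegrable_const
    · exact Filter.Eventually.of_forall fun θ _ => (hlim θ).const_smul _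

/-- The occupation probabilities `q^k z / (1 + q^k z)` of the grand canonical ensemble. -/
def occProb (q : ℝ) (z : ℂ) (k : ℕ) : ℂ := (q : ℂ) ^ k * z / (1 + (q : ℂ) ^ k * z)

lemma one_add_pow_mul_ne_zero {q r : ℝ} (hq : 0 < q)
    (hpole : ∀ k : ℕ, q ^ k * r ≠ 1) {z : ℂ} (hz : z ∈ Metric.sphere (0 : ℂ) r) (k : ℕ) :
    1 + (q : ℂ) ^ k * z ≠ 0 := by
  intro h
  have hz' : ‖z‖ = r := by simpa using hz
  have h1 : (q : ℂ) ^ k * z = -1 := by linear_combination h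
  have h2 := congrArg norm h1
  rw [norm_mul, norm_pow, Complex.norm_real, Real.norm_of_nonneg hq.le, hz'] at h2
  exact hpole k (by simpa using h2)

/-- On the circle |1 + q^k z| ≥ |1 - q^k r|. None of these lower bounds vanishes and they tend to 1,
so their inverses are bounded uniformly in k. -/
lemma exists_norm_occProb_le {q r : ℝ} (hq : 0 < q) (hq1 : q < 1) (hr : 0 < r)
    (hpole : ∀ k : ℕ, q ^ k * r ≠ 1) : ∃ R, 0 < R ∧
      ∀ z ∈ Metric.sphere (0 : ℂ) r, ∀ k, ‖occProb q z k‖ ≤ R * q ^ k := by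
  have hlim : Filter.Tendsto (fun k : ℕ => |1 - q ^ k * r|⁻¹) Filter.atTop (nhds |1 - 0 * r|⁻¹) := by
    refine Filter.Tendsto.inv₀ ?_ (by simp)
    exact ((tendsto_const_nhds.sub ((tendsto_pow_atTop_nhds_zero_of_lt_one hq.le hq1).mul_const r))).abs
  obtain ⟨C, hC⟩ := hlim.bddAbove_range
  have hC' : ∀ k, |1 - q ^ k * r|⁻¹ ≤ C := fun k => hC ⟨k, rfl⟩
  have hC0 : 0 < C := by
    refine lt_of_lt_of_le (inv_pos.2 (abs_pos.2 ?_)) (hC' 0)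
    exact sub_ne_zero.2 (hpole 0).symm
  refine ⟨r * C, by positivity, fun z hz k => ?_⟩
  have hz' : ‖z‖ = r := by simpa using hz
  have hn : ‖(q : ℂ) ^ k * z‖ = q ^ k * r := by
    rw [norm_mul, norm_pow, Complex.norm_real, Real.norm_of_nonneg hq.le, hz']
  have h1 : |1 - q ^ k * r| ≤ ‖1 + (q : ℂ) ^ k * z‖ := by
    rw [← hn]
    have := abs_norm_sub_norm_le (1 : ℂ) (-((q : ℂ) ^ k * z))
    rw [norm_neg, norm_one, sub_neg_eq_add] at this
    exact this
  have h0 : 0 < |1 - q ^ k * r| := abs_pos.2 (sub_ne_zero.2 (hpole k).symm)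
  unfold occProb
  rw [norm_div, hn, div_eq_mul_inv]
  calc q ^ k * r * ‖1 + (q : ℂ) ^ k * z‖⁻¹ ≤ q ^ k * r * C := by
        gcongr
        exact (inv_anti₀ h0 h1).trans (hC' k)
    _ = _ := by ring

lemma MultiAffine.norm_pow_mul_le {ρ : ℝ} {q : ℝ} (hq : 0 < q) {B : ℝ}
    {h : (ℕ → ℂ) → ℂ} (hB : ∀ S : Finset ℕ, ‖h (occ S)‖ ≤ B * (ρ ^ (∑ j ∈ S, j))⁻¹) (S : Finset ℕ) :
    ‖(q : ℂ) ^ (∑ j ∈ S, j) * h (occ S)‖ ≤ B * (q / ρ) ^ (∑ j ∈ S, j) := by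
  rw [norm_mul, norm_pow, Complex.norm_real, Real.norm_of_nonneg hq.le, div_pow]
  calc _ ≤ q ^ (∑ j ∈ S, j) * (B * (ρ ^ (∑ j ∈ S, j))⁻¹) := by gcongr; exact hB S
    _ = _ := by rw [div_eq_mul_inv]; ring

lemma MultiAffine.summable {ρ : ℝ} {h : (ℕ → ℂ) → ℂ} (hh : MultiAffine ρ h) {q : ℝ} (hq : 0 < q)
    (hqρ : q < ρ) (hρ1 : ρ < 1) (n : ℕ) :
    Summable fun k : Eigenstate n => (q : ℂ) ^ (∑ i, k.1 i) * h (occ (levels k)) := by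
  have hρ : 0 < ρ := hq.trans hqρ
  obtain ⟨B, hB⟩ := hh.exists_norm_occ_le hρ hρ1
  refine Summable.of_norm_bounded ((summable_pow_sum (n := n) (x := q / ρ) (by positivity)
    ((div_lt_one hρ).2 hqρ)).mul_left B) fun k => ?_
  rw [← sum_levels]
  exact MultiAffine.norm_pow_mul_le hq hB _

/-- The contour integral of a multi-affine functional of the grand canonical occupation
probabilities is the canonical average of the functional. -/
theorem MultiAffine.contour {ρ : ℝ} {h : (ℕ → ℂ) → ℂ} (hh : MultiAffine ρ h) {q r : ℝ} (hq : 0 < q)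
    (hqρ : q < ρ) (hρ1 : ρ < 1) (hr : 0 < r) (hpole : ∀ k : ℕ, q ^ k * r ≠ 1) (n : ℕ) :
    CircleIntegrable (fun z => fugF q n z * h (occProb q z) / z) 0 r ∧
      HasSum (fun k : Eigenstate n => ((q ^ ((n : ℝ) / 2) / partitionFn q n : ℝ) : ℂ) *
        ((q : ℂ) ^ (∑ i, k.1 i) * h (occ (levels k))))
        (contour r fun z => fugF q n z * h (occProb q z)) := by
  have hρ : 0 < ρ := hq.trans hqρ
  have hq1 : q < 1 := hqρ.trans hρ1
  obtain ⟨R, hR0, hR⟩ := exists_norm_occProb_le hq hq1 hr hpole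
  set κ : ℂ := ((q ^ ((n : ℝ) / 2) / partitionFn q n : ℝ) : ℂ) with hκ
  -- The constant in F is the canonical weight q^{n/2}/Z_n(q).
  have hκ' : κ = ((q : ℂ) ^ (n * (n - 1) / 2))⁻¹ *
      (∏ k ∈ Finset.range n, (1 - (q : ℂ) * (q : ℂ) ^ k)) := by
    rw [hκ, rpow_div_partitionFn hq]
    have h1 := esum_eq hq.le hq1 n
    have h2 := (esum_pos hq hq1 n).ne'
    have h3 : (esum q n)⁻¹ = (q ^ (n * (n - 1) / 2))⁻¹ * ∏ k ∈ Finset.range n, (1 - q * q ^ k) := by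
      rw [← h1]
      have h4 : ∏ k ∈ Finset.range n, (1 - q * q ^ k) ≠ 0 := by
        intro h0
        rw [h0, mul_zero] at h1
        exact (pow_pos hq _).ne h1
      field_simp
    rw [h3]
    push_cast
    rfl
  -- Only the first N levels may be occupied, so the integrand becomes a Laurent polynomial in z,
  -- graded by the number of occupied levels.
  set f : ℕ → ℂ → ℂ := fun N z => ∑ S ∈ (Finset.range N).powerset,
    κ * ((q : ℂ) ^ (∑ j ∈ S, j) * h (occ S)) * (z ^ S.card / z ^ n) with hf
  have hz0 : ∀ z ∈ Metric.sphere (0 : ℂ) r, z ≠ 0 := by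
    rintro z hz rfl
    simp at hz; exact hr.ne hz
  have hcont : ∀ j : ℕ, ContinuousOn (fun z : ℂ => z ^ j / z ^ n) (Metric.sphere (0 : ℂ) r) :=
    fun j => (continuousOn_pow j).div (continuousOn_pow n) fun z hz => pow_ne_zero _ (hz0 z hz)
  have hfN : ∀ N, ∀ z ∈ Metric.sphere (0 : ℂ) r, f N z =
      κ * (∏ k ∈ Finset.range N, (1 - (-z) * (q : ℂ) ^ k)) / z ^ n *
        h (fun k => if k < N then occProb q z k else 0) := by
    intro N z hz
    have e := hh.prod_mul_eq hρ (fun k => (q : ℂ) ^ k * z) (Finset.range N)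
      (fun k _ => one_add_pow_mul_ne_zero hq hpole hz k) 0 (admissible_zero ρ)
    simp only [Finset.mem_range, Pi.zero_apply] at e
    have e1 : (fun k => if k < N then occProb q z k else 0) = fun k => if k < N then
      (q : ℂ) ^ k * z / (1 + (q : ℂ) ^ k * z) else 0 := rfl
    have e2 : ∀ k, (1 - (-z) * (q : ℂ) ^ k) = 1 + (q : ℂ) ^ k * z := fun k => by ring
    simp only [e2]
    rw [e1, mul_div_right_comm, mul_assoc, e, hf, Finset.mul_sum]
    refine Finset.sum_congr rfl fun S hS => ?_
    rw [Finset.prod_mul_distrib, Finset.prod_const, Finset.prod_pow_eq_pow_sum]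
    have e3 : (fun k => if k ∈ S then (1 : ℂ) else if k < N then 0 else 0) = occ S := by
      ext k; simp [occ]
    rw [e3]
    ring
  have hmult : ∀ z ∈ Metric.sphere (0 : ℂ) r, Filter.Tendsto
      (fun N => ∏ k ∈ Finset.range N, (1 - (-z) * (q : ℂ) ^ k)) Filter.atTop
      (nhds (∏' k : ℕ, (1 - (-z) * (q : ℂ) ^ k))) := by
    intro z hz
    have hm : Multipliable fun k : ℕ => (1 + z * (q : ℂ) ^ k) := by
      apply multipliable_one_add_of_summable
      simp only [norm_mul, norm_pow, Complex.norm_real, Real.norm_of_nonneg hq.le]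
      exact (summable_geometric_of_lt_one hq.le hq1).mul_left _
    have e : (fun k : ℕ => (1 + z * (q : ℂ) ^ k)) = fun k => (1 - (-z) * (q : ℂ) ^ k) := by
      ext k; ring
    rw [e] at hm
    exact hm.hasProd.tendsto_prod_nat
  have hocc : ∀ z ∈ Metric.sphere (0 : ℂ) r, ∀ k, ‖occProb q z k‖ ≤ R * ρ ^ k := by
    intro z hz k
    refine (hR z hz k).trans ?_
    gcongr
  obtain ⟨B, hB⟩ := hh.bdd R
  have hprod : ∀ N, ∀ z ∈ Metric.sphere (0 : ℂ) r,
      ‖∏ k ∈ Finset.range N, (1 - (-z) * (q : ℂ) ^ k)‖ ≤ Real.exp (r / (1 - q)) := by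
    intro N z hz
    have hz' : ‖z‖ = r := by simpa using hz
    rw [norm_prod]
    calc ∏ k ∈ Finset.range N, ‖1 - (-z) * (q : ℂ) ^ k‖
        ≤ ∏ k ∈ Finset.range N, Real.exp (r * q ^ k) := by
          refine Finset.prod_le_prod (fun k _ => norm_nonneg _) fun k _ => ?_
          refine (norm_sub_le _ _).trans ?_
          rw [norm_one, norm_mul, norm_neg, hz', norm_pow, Complex.norm_real,
            Real.norm_of_nonneg hq.le]
          linarith [Real.add_one_le_exp (r * q ^ k)]
      _ = Real.exp (∑ k ∈ Finset.range N, r * q ^ k) := (Real.exp_sum _ _).symm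
      _ ≤ _ := by
          apply Real.exp_le_exp.2
          rw [← Finset.mul_sum, div_eq_mul_inv, ← tsum_geometric_of_lt_one hq.le hq1]
          gcongr
          exact (summable_geometric_of_lt_one hq.le hq1).sum_le_tsum _ fun k _ => by positivity
  have htr : ∀ N, ∀ z ∈ Metric.sphere (0 : ℂ) r,
      ‖h (fun k => if k < N then occProb q z k else 0)‖ ≤ B := by
    intro N z hz
    apply hB
    intro k
    split_ifs
    · exact hocc z hz k
    · rw [norm_zero]; positivity
  have key := tendsto_contour hr (f := f) (g := fun z => fugF q n z * h (occProb q z))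
    (B := ‖κ‖ * Real.exp (r / (1 - q)) / r ^ n * B) ?_ ?_ ?_
  · refine ⟨key.1, ?_⟩
    have hs : Summable fun k : Eigenstate n => κ * ((q : ℂ) ^ (∑ i, k.1 i) * h (occ (levels k))) :=
      (hh.summable hq hqρ hρ1 n).mul_left κ
    have hsum := hs.hasSum
    have ht := tendsto_sum_powersetCard (n := n)
      (g := fun S => κ * ((q : ℂ) ^ (∑ j ∈ S, j) * h (occ S))) (by
        simp only [sum_levels]; exact hsum)
    -- The contour integral of z^{|S|}/z^n selects the sets with exactly n levels: this is the
    -- passage to the canonical ensemble.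
    have e : ∀ N, MNS.contour r (f N) = ∑ S ∈ Finset.powersetCard n (Finset.range N),
        κ * ((q : ℂ) ^ (∑ j ∈ S, j) * h (occ S)) := by
      intro N
      have hc := contour_sum hr (Finset.range N).powerset
        (fun S z => κ * ((q : ℂ) ^ (∑ j ∈ S, j) * h (occ S)) * (z ^ S.card / z ^ n))
        fun S _ => continuousOn_const.mul (hcont S.card)
      rw [hf, hc, Finset.powersetCard_eq_filter, Finset.sum_filter]
      refine Finset.sum_congr rfl fun S _ => ?_
      rw [contour_const_mul, contour_pow_div_pow hr]
      split_ifs <;> simp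
    rw [tendsto_nhds_unique key.2 (ht.congr fun N => (e N).symm)]
    exact hsum
  · intro N
    rw [hf]
    exact continuousOn_finsetSum _ fun S _ => continuousOn_const.mul (hcont S.card)
  · intro N z hz
    have hz' : ‖z‖ = r := by simpa using hz
    rw [hfN N z hz, norm_mul, norm_div, norm_mul, norm_pow, hz']
    gcongr
    · exact hprod N z hz
    · exact htr N z hz
  · intro z hz
    have := (((hmult z hz).const_mul κ).div_const (z ^ n)).mul (hh.lim R _ (hocc z hz))
    refine (this.congr fun N => (hfN N z hz).symm).trans (le_of_eq ?_)
    rw [fugF, hκ']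

/-! ### Determinant bounds and Fredholm determinants -/

open scoped ComplexOrder in
/-- A form of **Hadamard's inequality**. -/
lemma norm_det_sq_le {ι : Type*} [Fintype ι] [DecidableEq ι] (A : Matrix ι ι ℂ)
    (hA : ∀ i j, ‖A i j‖ ≤ 1) :
    ‖A.det‖ ^ 2 ≤ (Fintype.card ι : ℝ) ^ Fintype.card ι := by
  rcases isEmpty_or_nonempty ι with h | h
  · simp
  set l := Fintype.card ι
  have hl : 0 < (l : ℝ) := by exact_mod_cast Fintype.card_pos
  have hpsd : (A.conjTranspose * A).PosSemidef := Matrix.posSemidef_conjTranspose_mul_self A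
  set ev := hpsd.1.eigenvalues
  have hev : ∀ i, 0 ≤ ev i := hpsd.eigenvalues_nonneg
  have h1 : ((‖A.det‖ ^ 2 : ℝ) : ℂ) = ((∏ i, ev i : ℝ) : ℂ) := by
    have := hpsd.1.det_eq_prod_eigenvalues
    rw [Matrix.det_mul, Matrix.det_conjTranspose] at this
    push_cast
    rw [← Complex.conj_mul']
    simpa using this
  have h1' : ‖A.det‖ ^ 2 = ∏ i, ev i := by exact_mod_cast h1
  have h2 : ∑ i, ev i ≤ (l : ℝ) * l := by
    have h3 := hpsd.1.trace_eq_sum_eigenvalues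
    have h4 : (A.conjTranspose * A).trace = ((∑ j, ∑ i, ‖A i j‖ ^ 2 : ℝ) : ℂ) := by
      rw [Matrix.trace]
      push_cast
      refine Finset.sum_congr rfl fun j _ => ?_
      rw [Matrix.diag_apply, Matrix.mul_apply]
      refine Finset.sum_congr rfl fun i _ => ?_
      rw [Matrix.conjTranspose_apply, ← Complex.conj_mul']
      rfl
    rw [h4] at h3
    have h5 : ∑ j, ∑ i, ‖A i j‖ ^ 2 = ∑ i, ev i := by
      have : (((∑ j, ∑ i, ‖A i j‖ ^ 2 : ℝ)) : ℂ) = ((∑ i, ev i : ℝ) : ℂ) := by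
        rw [h3]; push_cast; rfl
      exact_mod_cast this
    rw [← h5]
    calc ∑ j, ∑ i, ‖A i j‖ ^ 2 ≤ ∑ j : ι, ∑ i : ι, (1 : ℝ) := by
          gcongr with j _ i _
          exact pow_le_one₀ (norm_nonneg _) (hA i j)
      _ = _ := by simp [l]
  -- The squared modulus of the determinant is the product of the eigenvalues of A*A, whose sum is
  -- the squared Frobenius norm, at most l². The inequality of the means bounds the product by l^l.
  have h6 := Real.geom_mean_le_arith_mean_weighted Finset.univ (fun _ : ι => (l : ℝ)⁻¹) ev
    (fun _ _ => by positivity) (by simp [l]) (fun i _ => hev i)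
  rw [Real.finsetProd_rpow _ _ (fun i _ => hev i), ← h1', ← Finset.mul_sum] at h6
  have h7 : (‖A.det‖ ^ 2) ^ (l : ℝ)⁻¹ ≤ l := by
    refine h6.trans ?_
    calc (l : ℝ)⁻¹ * ∑ i, ev i ≤ (l : ℝ)⁻¹ * (l * l) := by gcongr
      _ = l := by field_simp
  calc ‖A.det‖ ^ 2 = ((‖A.det‖ ^ 2) ^ (l : ℝ)⁻¹) ^ l := by
        rw [← Real.rpow_mul_natCast (by positivity), inv_mul_cancel₀ hl.ne', Real.rpow_one]
    _ ≤ _ := by gcongr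

/-- The constant in Hadamard's inequality. -/
def hadamardConst (l : ℕ) : ℝ := Real.sqrt ((l : ℝ) ^ l)

/-- Dividing row i by C w_i and column j by w_j reduces to entries of modulus at most 1. The weights
come out squared, and therefore integrable when w is the square root of the Mehler diagonal. -/
lemma norm_det_le {ι : Type*} [Fintype ι] [DecidableEq ι] (A : Matrix ι ι ℂ) {C : ℝ} (hC : 0 ≤ C)
    {w : ι → ℝ} (hw : ∀ i, 0 < w i) (hA : ∀ i j, ‖A i j‖ ≤ C * w i * w j) :
    ‖A.det‖ ≤ hadamardConst (Fintype.card ι) * C ^ Fintype.card ι * ∏ i, w i ^ 2 := by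
  rcases hC.eq_or_lt with rfl | hC
  · rcases isEmpty_or_nonempty ι with h | h
    · simp [hadamardConst]
    · have : A = 0 := by
        ext i j
        have := hA i j
        simpa using this
      rw [this, Matrix.det_zero]
      simp only [norm_zero]
      unfold hadamardConst
      positivity
  set B : Matrix ι ι ℂ := Matrix.of fun i j => A i j / ((C * w i * w j : ℝ) : ℂ) with hB
  have hB1 : ∀ i j, ‖B i j‖ ≤ 1 := by
    intro i j
    have := hw i
    have := hw j
    simp only [hB, Matrix.of_apply, norm_div, Complex.norm_real]
    rw [Real.norm_of_nonneg (by positivity)]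
    exact (div_le_one (by positivity)).2 (hA i j)
  have hAB : A = Matrix.of fun i j => (w j : ℂ) * (Matrix.of fun i j => ((C * w i : ℝ) : ℂ) * B i j) i j := by
    ext i j
    have h1 := (hw i).ne'
    have h2 := (hw j).ne'
    have h3 := hC.ne'
    simp only [hB, Matrix.of_apply]
    push_cast
    have h1 : (w i : ℂ) ≠ 0 := by exact_mod_cast h1
    have h2 : (w j : ℂ) ≠ 0 := by exact_mod_cast h2
    have h3 : (C : ℂ) ≠ 0 := by exact_mod_cast h3
    field_simp
  have hdet : A.det = (∏ i, (w i : ℂ)) * ((∏ i, ((C * w i : ℝ) : ℂ)) * B.det) := by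
    rw [← Matrix.det_mul_column, ← Matrix.det_mul_row, ← hAB]
  have h2 : ‖B.det‖ ≤ hadamardConst (Fintype.card ι) := by
    apply Real.le_sqrt_of_sq_le
    exact norm_det_sq_le B hB1
  have hpw : 0 ≤ ∏ i, w i := Finset.prod_nonneg fun i _ => (hw i).le
  rw [hdet, norm_mul, norm_mul, norm_prod, norm_prod]
  simp only [Complex.norm_real, Real.norm_eq_abs, abs_mul, abs_of_pos (hw _), abs_of_pos hC]
  rw [Finset.prod_mul_distrib, Finset.prod_pow, Finset.prod_const, Finset.card_univ]
  calc _ ≤ (∏ i, w i) * (C ^ Fintype.card ι * (∏ i, w i) * hadamardConst (Fintype.card ι)) := by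
        gcongr
    _ = _ := by ring

/-- From l^l ≤ e^l l!, the square of the term is at most (4eC²)^l/l! · 4^{-l}, a product of terms of
two summable series. A geometric mean is at most the sum. -/
lemma summable_hadamardConst {C : ℝ} (hC : 0 ≤ C) :
    Summable fun l : ℕ => (l.factorial : ℝ)⁻¹ * (hadamardConst l * C ^ l) := by
  have h1 := (Real.summable_pow_div_factorial (4 * Real.exp 1 * C ^ 2)).add
    (summable_geometric_of_lt_one (r := (1 / 4 : ℝ)) (by norm_num) (by norm_num))
  refine Summable.of_nonneg_of_le (fun l => ?_) (fun l => ?_) h1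
  · unfold hadamardConst; positivity
  · have hf : (0 : ℝ) < l.factorial := by positivity
    have h2 : (l : ℝ) ^ l ≤ Real.exp 1 ^ l * l.factorial := by
      have := Real.pow_div_factorial_le_exp (l : ℝ) (by positivity) l
      rw [div_le_iff₀ hf] at this
      rwa [← Real.exp_nat_mul, mul_one]
    have h3 : ((l.factorial : ℝ)⁻¹ * (hadamardConst l * C ^ l)) ^ 2 ≤
        (4 * Real.exp 1 * C ^ 2) ^ l / l.factorial * (1 / 4) ^ l := by
      rw [mul_pow, mul_pow, hadamardConst, Real.sq_sqrt (by positivity)]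
      calc ((l.factorial : ℝ)⁻¹) ^ 2 * ((l : ℝ) ^ l * (C ^ l) ^ 2)
          ≤ ((l.factorial : ℝ)⁻¹) ^ 2 * ((Real.exp 1 ^ l * l.factorial) * (C ^ l) ^ 2) := by gcongr
        _ = _ := by
          rw [mul_pow, mul_pow, one_div, inv_pow, ← pow_mul, ← pow_mul, mul_comm l 2, inv_pow]
          field_simp
    have h4 : 0 ≤ (4 * Real.exp 1 * C ^ 2) ^ l / l.factorial := by positivity
    have h5 : (0 : ℝ) ≤ (1 / 4) ^ l := by positivity
    refine le_of_sq_le_sq ?_ (by positivity)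
    nlinarith

lemma norm_fredholmIntegrand_le {α : Type*} {K : α → α → ℂ} {C : ℝ} (hC : 0 ≤ C) {w : α → ℝ} (hw : ∀ a, 0 < w a)
    (hK : ∀ a b, ‖K a b‖ ≤ C * w a * w b) (l : ℕ) (a : Fin l → α) :
    ‖fredholmIntegrand K l a‖ ≤ hadamardConst l * C ^ l * ∏ i, w (a i) ^ 2 := by
  have := norm_det_le (Matrix.of fun i j => K (a i) (a j)) hC (w := fun i => w (a i))
    (fun i => hw _) (fun i j => hK _ _)
  rwa [Fintype.card_fin] at this

section Fredholm

variable {α : Type*} [MeasurableSpace α] {μ : Measure α} [SigmaFinite μ]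

lemma measurable_fredholmIntegrand {K : α → α → ℂ} (hK : Measurable (Function.uncurry K)) (l : ℕ) :
    Measurable (fredholmIntegrand K l) := by
  unfold fredholmIntegrand
  simp only [Matrix.det_apply]
  refine Finset.measurable_sum _ fun σ _ => ?_
  refine Measurable.const_smul ?_ _
  refine Finset.measurable_prod _ fun i _ => ?_
  simp only [Matrix.of_apply]
  exact hK.comp (f := fun a : Fin l → α => (a (σ i), a i))
    ((measurable_pi_apply (σ i)).prodMk (measurable_pi_apply i))

lemma integrable_fredholmIntegrand {K : α → α → ℂ} (hKm : Measurable (Function.uncurry K)) {C : ℝ}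
    (hC : 0 ≤ C) {w : α → ℝ} (hw : ∀ a, 0 < w a) (hwi : Integrable (fun a => w a ^ 2) μ)
    (hK : ∀ a b, ‖K a b‖ ≤ C * w a * w b) (l : ℕ) :
    Integrable (fredholmIntegrand K l) (Measure.pi fun _ : Fin l => μ) := by
  refine Integrable.mono' (g := fun a => hadamardConst l * C ^ l * ∏ i, w (a i) ^ 2) ?_
    (measurable_fredholmIntegrand hKm l).aestronglyMeasurable
    (Filter.Eventually.of_forall (norm_fredholmIntegrand_le hC hw hK l))
  exact (Integrable.fintype_prod (f := fun _ a => w a ^ 2) fun _ => hwi).const_mul _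

lemma norm_fredholmTerm_le {K : α → α → ℂ} {C : ℝ}
    (hC : 0 ≤ C) {w : α → ℝ} (hw : ∀ a, 0 < w a) (hwi : Integrable (fun a => w a ^ 2) μ)
    (hK : ∀ a b, ‖K a b‖ ≤ C * w a * w b) (l : ℕ) :
    ‖fredholmTerm μ K l‖ ≤ (l.factorial : ℝ)⁻¹ *
      (hadamardConst l * (C * ∫ a, w a ^ 2 ∂μ) ^ l) := by
  unfold fredholmTerm
  have h1 : ‖∫ a, fredholmIntegrand K l a ∂(Measure.pi fun _ : Fin l => μ)‖ ≤
      hadamardConst l * C ^ l * (∫ a, w a ^ 2 ∂μ) ^ l := by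
    refine (norm_integral_le_of_norm_le (g := fun a => hadamardConst l * C ^ l *
      ∏ i, w (a i) ^ 2) ?_ (Filter.Eventually.of_forall
        (norm_fredholmIntegrand_le hC hw hK l))).trans (le_of_eq ?_)
    · exact (Integrable.fintype_prod (f := fun _ a => w a ^ 2) fun _ => hwi).const_mul _
    · rw [integral_const_mul, integral_fintype_prod_eq_prod (f := fun _ a => w a ^ 2)]
      simp
  rw [norm_mul, norm_div, norm_pow, norm_neg, norm_one, one_pow, one_div, Complex.norm_natCast,
    mul_pow, ← mul_assoc (hadamardConst l)]
  gcongr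

lemma summable_fredholmTerm {K : α → α → ℂ} {C : ℝ}
    (hC : 0 ≤ C) {w : α → ℝ} (hw : ∀ a, 0 < w a) (hwi : Integrable (fun a => w a ^ 2) μ)
    (hK : ∀ a b, ‖K a b‖ ≤ C * w a * w b) : Summable (fredholmTerm μ K) :=
  Summable.of_norm_bounded
    (summable_hadamardConst (mul_nonneg hC (integral_nonneg fun _ => sq_nonneg _)))
    (norm_fredholmTerm_le hC hw hwi hK)

lemma norm_fredholmDet_le {K : α → α → ℂ} {C : ℝ}
    (hC : 0 ≤ C) {w : α → ℝ} (hw : ∀ a, 0 < w a) (hwi : Integrable (fun a => w a ^ 2) μ)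
    (hK : ∀ a b, ‖K a b‖ ≤ C * w a * w b) :
    ‖fredholmDet μ K‖ ≤ ∑' l : ℕ, (l.factorial : ℝ)⁻¹ *
      (hadamardConst l * (C * ∫ a, w a ^ 2 ∂μ) ^ l) :=
  tsum_of_norm_bounded
    (summable_hadamardConst (mul_nonneg hC (integral_nonneg fun _ => sq_nonneg _))).hasSum
    (norm_fredholmTerm_le hC hw hwi hK)

/-- Dominated convergence twice, in each integral and in the series, with the Hadamard bound as
common majorant. -/
lemma tendsto_fredholmDet {K : ℕ → α → α → ℂ} {L : α → α → ℂ}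
    (hKm : ∀ N, Measurable (Function.uncurry (K N))) {C : ℝ}
    (hC : 0 ≤ C) {w : α → ℝ} (hw : ∀ a, 0 < w a) (hwi : Integrable (fun a => w a ^ 2) μ)
    (hK : ∀ N a b, ‖K N a b‖ ≤ C * w a * w b)
    (hlim : ∀ a b, Filter.Tendsto (fun N => K N a b) Filter.atTop (nhds (L a b))) :
    Filter.Tendsto (fun N => fredholmDet μ (K N)) Filter.atTop (nhds (fredholmDet μ L)) := by
  unfold fredholmDet
  refine tendsto_tsum_of_dominated_convergence
    (summable_hadamardConst (mul_nonneg hC (integral_nonneg fun _ => sq_nonneg _)))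
    (fun l => ?_) (Filter.Eventually.of_forall fun N l => norm_fredholmTerm_le hC hw hwi (hK N) l)
  unfold fredholmTerm
  refine Filter.Tendsto.const_mul _ ?_
  refine tendsto_integral_of_dominated_convergence
    (fun a => hadamardConst l * C ^ l * ∏ i, w (a i) ^ 2)
    (fun N => (measurable_fredholmIntegrand (hKm N) l).aestronglyMeasurable) ?_
    (fun N => Filter.Eventually.of_forall (norm_fredholmIntegrand_le hC hw (hK N) l))
    (Filter.Eventually.of_forall fun a => ?_)
  · exact (Integrable.fintype_prod (f := fun _ a => w a ^ 2) fun _ => hwi).const_mul _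
  · unfold fredholmIntegrand
    simp only [Matrix.det_apply]
    refine tendsto_finsetSum _ fun σ _ => Filter.Tendsto.const_smul ?_ _
    exact tendsto_finsetProd _ fun i _ => hlim _ _

end Fredholm

/-- The determinant is affine along rank-one perturbations. -/
lemma det_add_smul_vecMulVec {R : Type*} [CommRing R] {ι : Type*} [Fintype ι] [DecidableEq ι]
    (M : Matrix ι ι R) (u v : ι → R) (t : R) :
    (M + t • Matrix.vecMulVec u v).det =
      (1 - t) * M.det + t * (M + Matrix.vecMulVec u v).det := by
  -- A Schur complement moves the perturbation into the single row (s v, 1) of a bordered matrix.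
  -- This row is an affine combination of its values at s = 0 and s = 1, and the determinant is
  -- linear in it.
  have key : ∀ s : R, (M + s • Matrix.vecMulVec u v).det =
      ((Matrix.fromBlocks M (-Matrix.replicateCol Unit u) 0 (1 : Matrix Unit Unit R)).updateRow
        (Sum.inr ()) (Sum.elim (s • v) 1)).det := by
    intro s
    have : (Matrix.fromBlocks M (-Matrix.replicateCol Unit u) 0 (1 : Matrix Unit Unit R)).updateRow
        (Sum.inr ()) (Sum.elim (s • v) 1) = Matrix.fromBlocks M (-Matrix.replicateCol Unit u)
          (Matrix.replicateRow Unit (s • v)) 1 := by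
      ext i j
      rcases i with i | i <;> rcases j with j | j <;> simp [Matrix.updateRow_apply]
    rw [this, Matrix.det_fromBlocks_one₂₂]
    congr 1
    ext i j
    simp [Matrix.vecMulVec_apply, Matrix.mul_apply]
  have h0 := key 0
  have h1 := key 1
  rw [zero_smul, add_zero] at h0
  rw [one_smul] at h1
  rw [h0, h1, key t, ← Matrix.det_updateRow_smul, ← Matrix.det_updateRow_smul,
    ← Matrix.det_updateRow_add]
  congr 2
  ext j
  rcases j with j | j <;> simp

/-! ### The kernel with general occupation numbers -/

/-- The decay parameters `ρ`, `r` control all the kernels at the times `t_i`. -/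
def TimeBound {ι : Type*} (ρ r : ℝ) (t : ι → ℝ) : Prop :=
  ∀ i j, ρ * Real.exp (t i - t j) ≤ r ∧ (t i < t j → Real.exp (t i - t j) ≤ r)

lemma TimeBound.comp {ι κ : Type*} {ρ r : ℝ} {t : ι → ℝ} (h : TimeBound ρ r t) (f : κ → ι) :
    TimeBound ρ r (t ∘ f) := fun i j => h (f i) (f j)

/-- Times in [0, β) differ by less than β, so q e^{t_i - t_j} < 1. These are finitely many strict
inequalities, which survive when q is enlarged to some ρ and the bound 1 is lowered to some r. The
room between q and ρ pays for the thermal sum, that between r and 1 for the Mehler series. -/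
lemma exists_timeBound {ι : Type*} [Finite ι] {T : ℝ} (hT : 0 < T) {t : ι → ℝ}
    (ht : ∀ i, t i ∈ Set.Ico 0 (1 / T)) :
    ∃ ρ r, boltz T < ρ ∧ ρ < 1 ∧ 0 < r ∧ r < 1 ∧ TimeBound ρ r t := by
  have hq1 : boltz T < 1 := by
    unfold boltz
    rw [Real.exp_lt_one_iff]
    have : 0 < 1 / T := by positivity
    linarith
  have h1 : ∀ i j, boltz T * Real.exp (t i - t j) < 1 := by
    intro i j
    unfold boltz
    rw [← Real.exp_add, Real.exp_lt_one_iff]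
    have := (ht i).2
    have := (ht j).1
    linarith
  have h2 : ∀ᶠ ρ in nhdsWithin (boltz T) (Set.Ioi (boltz T)),
      (∀ p : ι × ι, ρ * Real.exp (t p.1 - t p.2) < 1) ∧ ρ < 1 ∧ boltz T < ρ := by
    refine Filter.Eventually.and ?_ (Filter.Eventually.and ?_ ?_)
    · rw [Filter.eventually_all]
      intro p
      have : Filter.Tendsto (fun ρ => ρ * Real.exp (t p.1 - t p.2)) (nhds (boltz T))
        (nhds (boltz T * Real.exp (t p.1 - t p.2))) := by
        apply Continuous.tendsto; fun_prop
      exact nhdsWithin_le_nhds (this.eventually (gt_mem_nhds (h1 p.1 p.2)))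
    · exact nhdsWithin_le_nhds (gt_mem_nhds hq1)
    · exact self_mem_nhdsWithin
  obtain ⟨ρ, hρ, hρ1, hqρ⟩ := h2.exists
  have h3 : ∀ᶠ r in nhdsWithin (1 : ℝ) (Set.Iio 1),
      ((∀ p : ι × ι, ρ * Real.exp (t p.1 - t p.2) < r) ∧
        (∀ p : ι × ι, t p.1 < t p.2 → Real.exp (t p.1 - t p.2) < r)) ∧ 0 < r ∧ r < 1 := by
    refine Filter.Eventually.and (Filter.Eventually.and ?_ ?_) (Filter.Eventually.and ?_ ?_)
    · rw [Filter.eventually_all]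
      exact fun p => nhdsWithin_le_nhds (lt_mem_nhds (hρ p))
    · rw [Filter.eventually_all]
      intro p
      by_cases hp : t p.1 < t p.2
      · have : Real.exp (t p.1 - t p.2) < 1 := by rw [Real.exp_lt_one_iff]; linarith
        filter_upwards [nhdsWithin_le_nhds (lt_mem_nhds this)] with r hr _ using hr
      · exact Filter.Eventually.of_forall fun r h => absurd h hp
    · exact nhdsWithin_le_nhds (lt_mem_nhds one_pos)
    · exact self_mem_nhdsWithin
  obtain ⟨r, ⟨hr1, hr2⟩, hr0, hr'⟩ := h3.exists
  exact ⟨ρ, r, hqρ, hρ1, hr0, hr', fun i j => ⟨(hr1 (i, j)).le, fun h => (hr2 (i, j) h).le⟩⟩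

lemma boltz_pos (T : ℝ) : 0 < boltz T := Real.exp_pos _

/-- The coefficient of `φ_k(x) φ_k(y)` in the kernel. -/
def kerCoef (c : ℕ → ℂ) (τ σ : ℝ) (k : ℕ) : ℂ :=
  (c k - if τ < σ then 1 else 0) * ((Real.exp ((k : ℝ) * (τ - σ)) : ℝ) : ℂ)

/-- The kernel `K(x, y; τ, σ)` with occupation numbers `c_k`. -/
def occKernel (c : ℕ → ℂ) (x y τ σ : ℝ) : ℂ :=
  ∑' k : ℕ, kerCoef c τ σ k * ((phi k x * phi k y : ℝ) : ℂ)

/-- The square root of the diagonal of the Mehler kernel. -/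
def diagRoot (r x : ℝ) : ℝ := Real.sqrt (mehler r x x)

lemma diagRoot_pos {r : ℝ} (hr : 0 < r) (hr1 : r < 1) (x : ℝ) : 0 < diagRoot r x :=
  Real.sqrt_pos.2 (mehler_pos hr hr1 x x)

lemma diagRoot_sq {r : ℝ} (hr : 0 < r) (hr1 : r < 1) (x : ℝ) : diagRoot r x ^ 2 = mehler r x x :=
  Real.sq_sqrt (mehler_pos hr hr1 x x).le

/-- Cauchy–Schwarz, obtained termwise from the inequality of the means with weights B/A and A/B. It
separates the variables in kernel bounds, as the weighted Hadamard inequality requires. -/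
lemma tsum_abs_phi_mul_phi_le {r : ℝ} (hr : 0 < r) (hr1 : r < 1) (x y : ℝ) :
    ∑' k, |phi k x| * |phi k y| * r ^ k ≤ diagRoot r x * diagRoot r y := by
  set A := diagRoot r x
  set B := diagRoot r y
  have hA : 0 < A := diagRoot_pos hr hr1 x
  have hB : 0 < B := diagRoot_pos hr hr1 y
  have hx := summable_phi_mul_phi x x hr hr1
  have hy := summable_phi_mul_phi y y hr hr1
  have h1 : ∑' k, |phi k x| * |phi k y| * r ^ k ≤
      ∑' k, ((B / A / 2) * (phi k x * phi k x * r ^ k) + (A / B / 2) * (phi k y * phi k y * r ^ k)) := by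
    refine (summable_abs_phi_mul_phi x y hr hr1).tsum_le_tsum (fun k => ?_)
      ((hx.mul_left _).add (hy.mul_left _))
    have h0 : 0 ≤ r ^ k := by positivity
    have h2 : |phi k x| * |phi k y| ≤
      (B / A / 2) * (phi k x * phi k x) + (A / B / 2) * (phi k y * phi k y) := by
      rw [← abs_mul_abs_self (phi k x), ← abs_mul_abs_self (phi k y)]
      have h3 : 0 ≤ (B * |phi k x| - A * |phi k y|) ^ 2 / (2 * (A * B)) := by positivity
      have h4 : (B * |phi k x| - A * |phi k y|) ^ 2 / (2 * (A * B)) =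
        (B / A / 2) * (|phi k x| * |phi k x|) + (A / B / 2) * (|phi k y| * |phi k y|) -
          |phi k x| * |phi k y| := by
        field_simp; ring
      linarith
    nlinarith
  refine h1.trans (le_of_eq ?_)
  rw [(hx.mul_left _).tsum_add (hy.mul_left _), tsum_mul_left, tsum_mul_left]
  change (B / A / 2) * mehler r x x + (A / B / 2) * mehler r y y = _
  rw [← diagRoot_sq hr hr1, ← diagRoot_sq hr hr1]
  change (B / A / 2) * A ^ 2 + (A / B / 2) * B ^ 2 = _
  field_simp
  ring

section Bounds

variable {ρ r : ℝ} {τ σ : ℝ} {c : ℕ → ℂ} {R : ℝ}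

/-- If τ < σ, the exponential e^{k(τ-σ)} decays by itself and c_k - 1 need only be bounded.
Otherwise it may grow, and the decay ρ^k of c_k compensates for it. -/
lemma norm_kerCoef_le (hρ : 0 < ρ) (hρ1 : ρ < 1) (hr : 0 < r)
    (h1 : ρ * Real.exp (τ - σ) ≤ r) (h2 : τ < σ → Real.exp (τ - σ) ≤ r) (hR : 0 ≤ R)
    (hc : ∀ k, ‖c k‖ ≤ R * ρ ^ k) (k : ℕ) : ‖kerCoef c τ σ k‖ ≤ (R + 1) * r ^ k := by
  unfold kerCoef
  rw [norm_mul, Complex.norm_real, Real.norm_of_nonneg (Real.exp_pos _).le]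
  have hexp : Real.exp ((k : ℝ) * (τ - σ)) = Real.exp (τ - σ) ^ k := Real.exp_nat_mul _ _
  have hrk : 0 < r ^ k := by positivity
  rw [hexp]
  split_ifs with h
  · have : ‖c k - 1‖ ≤ R + 1 := by
      refine (norm_sub_le _ _).trans ?_
      rw [norm_one]
      have h3 := hc k
      have h4 : ρ ^ k ≤ 1 := pow_le_one₀ hρ.le hρ1.le
      nlinarith
    gcongr
    exact h2 h
  · rw [sub_zero]
    calc ‖c k‖ * Real.exp (τ - σ) ^ k ≤ R * ρ ^ k * Real.exp (τ - σ) ^ k := by gcongr; exact hc k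
      _ = R * (ρ * Real.exp (τ - σ)) ^ k := by rw [mul_pow]; ring
      _ ≤ R * r ^ k := by gcongr
      _ ≤ (R + 1) * r ^ k := by gcongr; linarith

lemma norm_occKernel_term_le
    (hk : ∀ k, ‖kerCoef c τ σ k‖ ≤ (R + 1) * r ^ k) (x y : ℝ) (k : ℕ) :
    ‖kerCoef c τ σ k * ((phi k x * phi k y : ℝ) : ℂ)‖ ≤
      (R + 1) * (|phi k x| * |phi k y| * r ^ k) := by
  rw [norm_mul, Complex.norm_real, Real.norm_eq_abs, abs_mul]
  calc _ ≤ (R + 1) * r ^ k * (|phi k x| * |phi k y|) := by gcongr; exact hk k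
    _ = _ := by ring

lemma summable_occKernel_term (hr : 0 < r) (hr1 : r < 1)
    (hk : ∀ k, ‖kerCoef c τ σ k‖ ≤ (R + 1) * r ^ k) (x y : ℝ) :
    Summable fun k => kerCoef c τ σ k * ((phi k x * phi k y : ℝ) : ℂ) :=
  Summable.of_norm_bounded ((summable_abs_phi_mul_phi x y hr hr1).mul_left (R + 1))
    (norm_occKernel_term_le hk x y)

lemma norm_occKernel_le (hr : 0 < r) (hr1 : r < 1) (hR : 0 ≤ R)
    (hk : ∀ k, ‖kerCoef c τ σ k‖ ≤ (R + 1) * r ^ k) (x y : ℝ) :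
    ‖occKernel c x y τ σ‖ ≤ (R + 1) * diagRoot r x * diagRoot r y := by
  refine (tsum_of_norm_bounded ((summable_abs_phi_mul_phi x y hr hr1).mul_left (R + 1)).hasSum
    (norm_occKernel_term_le hk x y)).trans ?_
  rw [tsum_mul_left, mul_assoc]
  gcongr
  exact tsum_abs_phi_mul_phi_le hr hr1 x y

lemma tendsto_occKernel (hρ : 0 < ρ) (hρ1 : ρ < 1) (hr : 0 < r) (hr1 : r < 1)
    (h1 : ρ * Real.exp (τ - σ) ≤ r) (h2 : τ < σ → Real.exp (τ - σ) ≤ r) (hR : 0 ≤ R)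
    (hc : ∀ k, ‖c k‖ ≤ R * ρ ^ k) (x y : ℝ) :
    Filter.Tendsto (fun N => occKernel (fun k => if k < N then c k else 0) x y τ σ) Filter.atTop
      (nhds (occKernel c x y τ σ)) := by
  refine tendsto_tsum_of_dominated_convergence
    ((summable_abs_phi_mul_phi x y hr hr1).mul_left (R + 1)) (fun k => ?_)
    (Filter.Eventually.of_forall fun N => norm_occKernel_term_le
      (norm_kerCoef_le hρ hρ1 hr h1 h2 hR fun k => ?_) x y)
  · apply tendsto_const_nhds.congr'
    filter_upwards [Filter.eventually_gt_atTop k] with N hN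
    simp [kerCoef, hN]
  · split_ifs
    · exact hc k
    · rw [norm_zero]; positivity

end Bounds

/-- Only the k-th term changes, and e^{k(τ-σ)} factorizes, so the change is a function of (x, τ)
times a function of (y, σ): a rank-one perturbation of every kernel matrix. -/
lemma occKernel_update {c : ℕ → ℂ} {τ σ x y : ℝ}
    (hs : ∀ t k, Summable fun j => kerCoef (Function.update c k t) τ σ j *
      ((phi j x * phi j y : ℝ) : ℂ)) (k : ℕ) (t : ℂ) :
    occKernel (Function.update c k t) x y τ σ = occKernel (Function.update c k 0) x y τ σ +
      t * ((Real.exp (k * τ) * phi k x : ℝ) * (Real.exp (-(k * σ)) * phi k y : ℝ)) := by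
  unfold occKernel
  rw [← sub_eq_iff_eq_add', ← (hs t k).tsum_sub (hs 0 k), tsum_eq_single k]
  · simp only [kerCoef, Function.update_self]
    rw [show (k : ℝ) * (τ - σ) = k * τ + -(k * σ) by ring, Real.exp_add]
    push_cast
    ring
  · intro j hj
    simp [kerCoef, Function.update_of_ne hj]

lemma measurable_occKernel (c : ℕ → ℂ) {β : Type*} [MeasurableSpace β] {f g s u : β → ℝ}
    (hf : Measurable f) (hg : Measurable g) (hs : Measurable s) (hu : Measurable u)
    (hsum : ∀ b, Summable fun k => kerCoef c (s b) (u b) k * ((phi k (f b) * phi k (g b) : ℝ) : ℂ)) :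
    Measurable fun b => occKernel c (f b) (g b) (s b) (u b) := by
  refine measurable_of_tendsto_metrizable (f := fun N b => ∑ k ∈ Finset.range N,
    kerCoef c (s b) (u b) k * ((phi k (f b) * phi k (g b) : ℝ) : ℂ)) (fun N => ?_) ?_
  · refine Finset.measurable_sum _ fun k _ => ?_
    refine Measurable.mul (Measurable.mul ?_ ?_) ?_
    · exact measurable_const.sub
        (Measurable.ite (measurableSet_lt hs hu) measurable_const measurable_const)
    · refine Complex.measurable_ofReal.comp (Real.measurable_exp.comp ?_)
      exact (hs.sub hu).const_mul _
    · refine Complex.measurable_ofReal.comp ?_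
      exact ((continuous_phi k).measurable.comp hf).mul ((continuous_phi k).measurable.comp hg)
  · rw [tendsto_pi_nhds]
    intro b
    exact (hsum b).hasSum.tendsto_sum_nat

section Functionals

variable {ρ r : ℝ}

lemma Admissible.kerCoef_le {ι : Type*} {t : ι → ℝ} (hρ : 0 < ρ) (hρ1 : ρ < 1) (hr : 0 < r)
    (ht : TimeBound ρ r t) {c : ℕ → ℂ} {R : ℝ} (hR : 0 ≤ R) (hc : ∀ k, ‖c k‖ ≤ R * ρ ^ k)
    (i j : ι) (k : ℕ) : ‖kerCoef c (t i) (t j) k‖ ≤ (R + 1) * r ^ k :=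
  norm_kerCoef_le hρ hρ1 hr (ht i j).1 (ht i j).2 hR hc k

/-- By `occKernel_update` and `det_add_smul_vecMulVec`. The weight v multiplies columns and is
absorbed by one of the two rank-one vectors; it carries the indicators in the Fredholm determinant.
-/
lemma det_occKernel_affine {ι κ : Type*} [Fintype κ] [DecidableEq κ] {t : ι → ℝ} (hρ : 0 < ρ)
    (hρ1 : ρ < 1) (hr : 0 < r) (hr1 : r < 1) (ht : TimeBound ρ r t) (x : ι → ℝ) (v : ι → ℂ)
    (a : κ → ι) {c : ℕ → ℂ} (hc : Admissible ρ c) (k : ℕ) (s : ℂ) :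
    (Matrix.of fun i j => occKernel (Function.update c k s) (x (a i)) (x (a j)) (t (a i)) (t (a j)) *
      v (a j)).det = (1 - s) * (Matrix.of fun i j => occKernel (Function.update c k 0) (x (a i))
        (x (a j)) (t (a i)) (t (a j)) * v (a j)).det + s * (Matrix.of fun i j =>
        occKernel (Function.update c k 1) (x (a i)) (x (a j)) (t (a i)) (t (a j)) * v (a j)).det := by
  have hs : ∀ i j, ∀ s k, Summable fun l => kerCoef (Function.update c k s) (t (a i)) (t (a j)) l *
      ((phi l (x (a i)) * phi l (x (a j)) : ℝ) : ℂ) := by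
    intro i j s k
    obtain ⟨R, hR0, hR⟩ := hc.update hρ k s
    exact summable_occKernel_term hr hr1 (Admissible.kerCoef_le hρ hρ1 hr ht hR0 hR (a i) (a j)) _ _
  have key : ∀ s : ℂ, (Matrix.of fun i j => occKernel (Function.update c k s) (x (a i)) (x (a j))
      (t (a i)) (t (a j)) * v (a j)) = (Matrix.of fun i j => occKernel (Function.update c k 0)
        (x (a i)) (x (a j)) (t (a i)) (t (a j)) * v (a j)) + s • Matrix.vecMulVec
        (fun i => ((Real.exp (k * t (a i)) * phi k (x (a i)) : ℝ) : ℂ))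
        (fun j => ((Real.exp (-(k * t (a j))) * phi k (x (a j)) : ℝ) : ℂ) * v (a j)) := by
    intro s
    ext i j
    simp only [Matrix.of_apply, Matrix.add_apply, Matrix.smul_apply, Matrix.vecMulVec_apply]
    rw [occKernel_update (hs i j) k s, smul_eq_mul]
    ring
  rw [key s, key 1, one_smul, det_add_smul_vecMulVec]

lemma tendsto_det {κ : Type*} [Fintype κ] [DecidableEq κ] {A : ℕ → Matrix κ κ ℂ}
    {B : Matrix κ κ ℂ} (h : ∀ i j, Filter.Tendsto (fun N => A N i j) Filter.atTop (nhds (B i j))) :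
    Filter.Tendsto (fun N => (A N).det) Filter.atTop (nhds B.det) := by
  simp only [Matrix.det_apply]
  refine tendsto_finsetSum _ fun σ _ => Filter.Tendsto.const_smul ?_ _
  exact tendsto_finsetProd _ fun i _ => h _ _

/-- The determinant functional of the occupation numbers. -/
lemma multiAffine_det {ι : Type*} [Fintype ι] [DecidableEq ι] {t : ι → ℝ} (hρ : 0 < ρ)
    (hρ1 : ρ < 1) (hr : 0 < r) (hr1 : r < 1) (ht : TimeBound ρ r t) (x : ι → ℝ) :
    MultiAffine ρ fun c => (Matrix.of fun i j => occKernel c (x i) (x j) (t i) (t j)).det := by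
  refine ⟨fun c hc k s => ?_, fun R => ?_, fun R c hc => ?_⟩
  · simpa using det_occKernel_affine hρ hρ1 hr hr1 ht x 1 id hc k s
  -- The radius R may be negative, in which case no sequence qualifies; `max R 0` keeps the
  -- constants nonnegative.
  · refine ⟨hadamardConst (Fintype.card ι) * (max R 0 + 1) ^ Fintype.card ι *
      ∏ i, diagRoot r (x i) ^ 2, fun c hc => ?_⟩
    refine norm_det_le _ (by positivity) (fun i => diagRoot_pos hr hr1 (x i)) fun i j => ?_
    refine norm_occKernel_le hr hr1 (le_max_right _ _) (Admissible.kerCoef_le hρ hρ1 hr ht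
      (le_max_right _ _) (fun k => (hc k).trans ?_) i j) _ _
    gcongr
    exact le_max_left _ _
  · refine tendsto_det fun i j => ?_
    refine tendsto_occKernel hρ hρ1 hr hr1 (ht i j).1 (ht i j).2 (R := max R 0) (le_max_right _ _)
      (fun k => (hc k).trans ?_) _ _
    gcongr
    exact le_max_left _ _

/-- The Fredholm determinant functional of the occupation numbers. -/
lemma multiAffine_fredholmDet {α : Type*} [MeasurableSpace α] {μ : Measure α} [SigmaFinite μ]
    {x t : α → ℝ} {v : α → ℂ} (hx : Measurable x) (htm : Measurable t) (hv : Measurable v)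
    (hv1 : ∀ a, ‖v a‖ ≤ 1) (hρ : 0 < ρ) (hρ1 : ρ < 1) (hr : 0 < r) (hr1 : r < 1)
    (ht : TimeBound ρ r t) (hint : Integrable (fun a => diagRoot r (x a) ^ 2) μ) :
    MultiAffine ρ fun c => fredholmDet μ fun a b =>
      occKernel c (x a) (x b) (t a) (t b) * v b := by
  have hb : ∀ {R : ℝ}, 0 ≤ R → ∀ {c : ℕ → ℂ}, (∀ k, ‖c k‖ ≤ R * ρ ^ k) → ∀ a b,
      ‖occKernel c (x a) (x b) (t a) (t b) * v b‖ ≤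
        (R + 1) * diagRoot r (x a) * diagRoot r (x b) := by
    intro R hR c hc a b
    rw [norm_mul]
    refine (mul_le_of_le_one_right (norm_nonneg _) (hv1 b)).trans ?_
    exact norm_occKernel_le hr hr1 hR (Admissible.kerCoef_le hρ hρ1 hr ht hR hc a b) _ _
  have hm : ∀ {R : ℝ}, 0 ≤ R → ∀ {c : ℕ → ℂ}, (∀ k, ‖c k‖ ≤ R * ρ ^ k) →
      Measurable (Function.uncurry fun a b => occKernel c (x a) (x b) (t a) (t b) * v b) := by
    intro R hR c hc
    refine Measurable.mul ?_ (hv.comp measurable_snd)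
    refine measurable_occKernel c (hx.comp measurable_fst) (hx.comp measurable_snd)
      (htm.comp measurable_fst) (htm.comp measurable_snd) fun b => ?_
    exact summable_occKernel_term hr hr1 (Admissible.kerCoef_le hρ hρ1 hr ht hR hc b.1 b.2) _ _
  have hw : ∀ a, 0 < diagRoot r (x a) := fun a => diagRoot_pos hr hr1 _
  refine ⟨fun c hc k s => ?_, fun R => ?_, fun R c hc => ?_⟩
  · have hc' : ∀ s, ∃ R, 0 ≤ R ∧ ∀ j, ‖Function.update c k s j‖ ≤ R * ρ ^ j := fun s =>
      hc.update hρ k s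
    have hsum : ∀ s, Summable (fredholmTerm μ fun a b =>
        occKernel (Function.update c k s) (x a) (x b) (t a) (t b) * v b) := by
      intro s
      obtain ⟨R, hR0, hR⟩ := hc' s
      exact summable_fredholmTerm (by positivity) hw hint (hb hR0 hR)
    have hint' : ∀ s l, Integrable (fredholmIntegrand (fun a b =>
        occKernel (Function.update c k s) (x a) (x b) (t a) (t b) * v b) l)
        (Measure.pi fun _ : Fin l => μ) := by
      intro s l
      obtain ⟨R, hR0, hR⟩ := hc' s
      exact integrable_fredholmIntegrand (hm hR0 hR) (by positivity) hw hint (hb hR0 hR) l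
    unfold fredholmDet
    rw [← tsum_mul_left, ← tsum_mul_left, ← ((hsum 0).mul_left _).tsum_add ((hsum 1).mul_left _)]
    congr 1
    ext l
    unfold fredholmTerm
    have : ∀ a : Fin l → α, fredholmIntegrand (fun a b =>
        occKernel (Function.update c k s) (x a) (x b) (t a) (t b) * v b) l a =
        (1 - s) * fredholmIntegrand (fun a b =>
        occKernel (Function.update c k 0) (x a) (x b) (t a) (t b) * v b) l a +
        s * fredholmIntegrand (fun a b =>
        occKernel (Function.update c k 1) (x a) (x b) (t a) (t b) * v b) l a := fun a =>
      det_occKernel_affine hρ hρ1 hr hr1 ht x v a hc k s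
    simp only [this]
    rw [integral_add ((hint' 0 l).const_mul _) ((hint' 1 l).const_mul _), integral_const_mul,
      integral_const_mul]
    ring
  · refine ⟨_, fun c hc => norm_fredholmDet_le (C := max R 0 + 1) (by positivity) hw hint
      (hb (le_max_right R 0) fun k => (hc k).trans ?_)⟩
    gcongr
    exact le_max_left _ _
  · have hR : ∀ k, ‖c k‖ ≤ max R 0 * ρ ^ k := fun k => (hc k).trans (by
      gcongr
      exact le_max_left _ _)
    have hN : ∀ (N k : ℕ), ‖if k < N then c k else 0‖ ≤ max R 0 * ρ ^ k := by
      intro N k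
      split_ifs
      · exact hR k
      · rw [norm_zero]; positivity
    refine tendsto_fredholmDet (C := max R 0 + 1) (fun N => hm (le_max_right R 0) (hN N))
      (by positivity) hw hint (fun N => hb (le_max_right R 0) (hN N)) fun a b => ?_
    refine Filter.Tendsto.mul_const _ ?_
    exact tendsto_occKernel hρ hρ1 hr hr1 (ht a b).1 (ht a b).2 (le_max_right R 0) hR _ _

end Functionals

/-! ### The kernels of the statement -/

lemma propagator_eq (y t x : ℝ) : propagator y t x = mehler (Real.exp (-t)) x y := by
  unfold propagator mehler
  congr 1; ext k
  rw [← Real.exp_nat_mul]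
  congr 2; ring

lemma termE_eq (x y τ σ : ℝ) :
    termE x y τ σ = if τ < σ then mehler (Real.exp (τ - σ)) x y else 0 := by
  unfold termE mehler
  congr 1
  congr 1; ext k
  rw [← Real.exp_nat_mul]

lemma summable_phi_mul_phi_exp (x y : ℝ) {τ σ : ℝ} (h : τ < σ) :
    Summable fun k : ℕ => phi k x * phi k y * Real.exp ((k : ℝ) * (τ - σ)) := by
  have := summable_phi_mul_phi x y (Real.exp_pos (τ - σ)) (by rw [Real.exp_lt_one_iff]; linarith)
  refine this.congr fun k => ?_
  rw [← Real.exp_nat_mul]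

/-- The occupation series converges by itself, and so does the series for E when τ < σ; hence they
may be merged into one with coefficients c_k - 1_{τ<σ}. -/
lemma kernelK_eq {q ρ r x y τ σ R : ℝ} {z : ℂ} (hρ : 0 < ρ) (hr : 0 < r)
    (hr1 : r < 1) (h1 : ρ * Real.exp (τ - σ) ≤ r)
    (hc : ∀ k, ‖occProb q z k‖ ≤ R * ρ ^ k) (hR : 0 ≤ R) :
    Summable (fun k : ℕ => ((q : ℂ) ^ k * z / (1 + (q : ℂ) ^ k * z)) *
        ((phi k x * phi k y * Real.exp ((k : ℝ) * (τ - σ)) : ℝ) : ℂ)) ∧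
      kernelK q x y τ σ z = occKernel (occProb q z) x y τ σ := by
  have hs : Summable (fun k : ℕ => ((q : ℂ) ^ k * z / (1 + (q : ℂ) ^ k * z)) *
        ((phi k x * phi k y * Real.exp ((k : ℝ) * (τ - σ)) : ℝ) : ℂ)) := by
    refine Summable.of_norm_bounded ((summable_abs_phi_mul_phi x y hr hr1).mul_left R) fun k => ?_
    have h3 := hc k
    unfold occProb at h3
    rw [norm_mul, Complex.norm_real, Real.norm_eq_abs, abs_mul, abs_mul, abs_of_pos (Real.exp_pos _)]
    have hexp : Real.exp ((k : ℝ) * (τ - σ)) = Real.exp (τ - σ) ^ k := Real.exp_nat_mul _ _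
    rw [hexp]
    calc _ ≤ R * ρ ^ k * (|phi k x| * |phi k y| * Real.exp (τ - σ) ^ k) := by gcongr
      _ = R * (|phi k x| * |phi k y|) * (ρ * Real.exp (τ - σ)) ^ k := by rw [mul_pow]; ring
      _ ≤ R * (|phi k x| * |phi k y|) * r ^ k := by gcongr
      _ = _ := by ring
  refine ⟨hs, ?_⟩
  unfold kernelK occKernel termE
  split_ifs with h
  · have h2 := summable_phi_mul_phi_exp x y h
    rw [Complex.ofReal_tsum, ← hs.tsum_sub (Complex.summable_ofReal.2 h2)]
    congr 1; ext k
    simp only [kerCoef, if_pos h, occProb]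
    push_cast; ring
  · rw [Complex.ofReal_zero, sub_zero]
    congr 1; ext k
    simp only [kerCoef, if_neg h, occProb]
    push_cast; ring

/-- The coefficient of `φ_k(x) φ_k(y)` in the kernel of the eigenstate with occupied levels `S`. -/
def levelCoef (S : Finset ℕ) (τ σ : ℝ) (k : ℕ) : ℝ :=
  ((if k ∈ S then 1 else 0) - if τ < σ then 1 else 0) * Real.exp ((k : ℝ) * (τ - σ))

/-- The kernel of the eigenstate with occupied levels `S`. -/
def levelKernel (S : Finset ℕ) (x y τ σ : ℝ) : ℝ :=
  ∑' k : ℕ, levelCoef S τ σ k * (phi k x * phi k y)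

lemma kerCoef_occ (S : Finset ℕ) (τ σ : ℝ) (k : ℕ) :
    kerCoef (occ S) τ σ k = (levelCoef S τ σ k : ℂ) := by
  unfold kerCoef levelCoef occ
  push_cast
  split_ifs <;> simp

lemma occKernel_occ (S : Finset ℕ) (x y τ σ : ℝ) :
    occKernel (occ S) x y τ σ = (levelKernel S x y τ σ : ℂ) := by
  unfold occKernel levelKernel
  rw [Complex.ofReal_tsum]
  congr 1; ext k
  rw [kerCoef_occ]; push_cast; ring

lemma levelKernel_eq (S : Finset ℕ) (x y τ σ : ℝ) : levelKernel S x y τ σ =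
    (∑ k ∈ S, phi k x * phi k y * Real.exp ((k : ℝ) * (τ - σ))) - termE x y τ σ := by
  have h1 : HasSum (fun k => if k ∈ S then phi k x * phi k y * Real.exp ((k : ℝ) * (τ - σ)) else 0)
      (∑ k ∈ S, phi k x * phi k y * Real.exp ((k : ℝ) * (τ - σ))) := by
    have := hasSum_sum_of_ne_finset_zero (s := S) (L := .unconditional ℕ) (f := fun k => if k ∈ S then
      phi k x * phi k y * Real.exp ((k : ℝ) * (τ - σ)) else 0) (fun k hk => if_neg hk)
    convert this using 1
    exact Finset.sum_congr rfl fun k hk => (if_pos hk).symm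
  have h2 : HasSum (fun k : ℕ => if τ < σ then phi k x * phi k y * Real.exp ((k : ℝ) * (τ - σ)) else 0)
      (termE x y τ σ) := by
    unfold termE
    split_ifs with h
    · exact (summable_phi_mul_phi_exp x y h).hasSum
    · exact hasSum_zero
  rw [levelKernel, ← (h1.sub h2).tsum_eq]
  congr 1; ext k
  unfold levelCoef
  split_ifs <;> ring

lemma eigenKernel_eq {n : ℕ} (k : Eigenstate n) (x y τ σ : ℝ) :
    eigenKernel k.1 x y τ σ = levelKernel (levels k) x y τ σ := by
  rw [levelKernel_eq, eigenKernel]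
  simp [levels]

/-- The determinant `det K_S(x_i, x_j; t_i, t_j)` of the eigenstate with occupied levels `S`. -/
def levelDet {ι : Type*} [Fintype ι] [DecidableEq ι] (S : Finset ℕ) (t x : ι → ℝ) : ℝ :=
  (Matrix.of fun i j => levelKernel S (x i) (x j) (t i) (t j)).det

lemma ofReal_det {ι : Type*} [Fintype ι] [DecidableEq ι] (f : ι → ι → ℝ) :
    (((Matrix.of fun i j => f i j).det : ℝ) : ℂ) = (Matrix.of fun i j => (f i j : ℂ)).det := by
  have := RingHom.map_det Complex.ofRealHom (Matrix.of fun i j => f i j)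
  simp only [Complex.ofRealHom_eq_coe] at this
  rw [this]
  congr 1

lemma ofReal_levelDet {ι : Type*} [Fintype ι] [DecidableEq ι] (S : Finset ℕ) (t x : ι → ℝ) :
    (levelDet S t x : ℂ) =
      (Matrix.of fun i j => occKernel (occ S) (x i) (x j) (t i) (t j)).det := by
  rw [levelDet, ofReal_det]
  simp only [occKernel_occ]

lemma integrable_diagRoot_sq {r : ℝ} (hr : 0 < r) (hr1 : r < 1) :
    Integrable fun x => diagRoot r x ^ 2 := by
  simp only [diagRoot_sq hr hr1]
  exact integrable_mehler_diag hr hr1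

lemma integrable_diagRoot_sq_copies {r : ℝ} (hr : 0 < r) (hr1 : r < 1) (m : ℕ) :
    Integrable (fun a : ℝ × Fin m => diagRoot r a.1 ^ 2) (copies m) := by
  unfold copies
  have := (integrable_diagRoot_sq hr hr1).mul_prod (ν := (Measure.count : Measure (Fin m)))
    (g := fun _ => (1 : ℝ)) (integrable_const 1)
  simpa using this

instance sigmaFinite_copies (m : ℕ) : SigmaFinite (copies m) := by
  unfold copies; infer_instance

/-- The indicator weight of the gap kernel. -/
def gapWeight {m : ℕ} (A : Fin m → Set ℝ) (b : ℝ × Fin m) : ℂ :=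
  (A b.2)ᶜ.indicator (fun _ => (1 : ℂ)) b.1

lemma measurable_gapWeight {m : ℕ} {A : Fin m → Set ℝ} (hA : ∀ i, MeasurableSet (A i)) :
    Measurable (gapWeight A) := by
  apply measurable_from_prod_countable_left
  intro i
  exact measurable_const.indicator (hA i).compl

lemma norm_gapWeight_le {m : ℕ} (A : Fin m → Set ℝ) (b : ℝ × Fin m) : ‖gapWeight A b‖ ≤ 1 := by
  unfold gapWeight Set.indicator
  split_ifs <;> simp

section Contour

variable {q ρ r R : ℝ}

/-- Contour formula for the canonical correlation kernel determinants. -/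
theorem hasSum_contour_corrIntegrand {m n : ℕ} {τ : Fin m → ℝ} (hq : 0 < q) (hqρ : q < ρ)
    (hρ1 : ρ < 1) (hr : 0 < r) (hr1 : r < 1) (ht : TimeBound ρ r τ) (hR : 0 < R)
    (hpole : ∀ k : ℕ, q ^ k * R ≠ 1) (x : Fin m → ℝ) :
    CircleIntegrable (fun z => corrIntegrand q n τ x z / z) 0 R ∧
      HasSum (fun k : Eigenstate n => ((q ^ ((n : ℝ) / 2) / partitionFn q n *
        (q ^ (∑ i, k.1 i) * levelDet (levels k) τ x) : ℝ) : ℂ)) (contour R (corrIntegrand q n τ x)) := by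
  have hρ := hq.trans hqρ
  obtain ⟨B, hB0, hB⟩ := exists_norm_occProb_le hq (hqρ.trans hρ1) hR hpole
  have h := (multiAffine_det hρ hρ1 hr hr1 ht x).contour hq hqρ hρ1 hR hpole n
  have e : ∀ z ∈ Metric.sphere (0 : ℂ) R, corrIntegrand q n τ x z = fugF q n z *
      (Matrix.of fun i j => occKernel (occProb q z) (x i) (x j) (τ i) (τ j)).det := by
    intro z hz
    unfold corrIntegrand
    congr 3
    ext i j
    refine (kernelK_eq hρ hr hr1 (ht i j).1 (R := B) (fun k => ?_) hB0.le).2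
    refine (hB z hz k).trans ?_
    gcongr
  constructor
  · refine h.1.congr ?_
    intro θ _
    simp only [e _ (circleMap_mem_sphere 0 hR.le θ)]
  · rw [contour_congr hR e]
    refine h.2.congr_fun fun k => ?_
    rw [← ofReal_levelDet]
    push_cast
    ring

/-- Contour formula for the Fredholm determinants of the canonical kernels. -/
theorem hasSum_contour_gapIntegrand {m n : ℕ} {τ : Fin m → ℝ} (hq : 0 < q) (hqρ : q < ρ)
    (hρ1 : ρ < 1) (hr : 0 < r) (hr1 : r < 1) (ht : TimeBound ρ r τ) (hR : 0 < R)
    (hpole : ∀ k : ℕ, q ^ k * R ≠ 1) {A : Fin m → Set ℝ} (hA : ∀ i, MeasurableSet (A i)) :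
    (∀ z ∈ Metric.sphere (0 : ℂ) R,
        (∀ l, Integrable (fredholmIntegrand (gapKernel q τ A z) l)
          (Measure.pi fun _ : Fin l => copies m)) ∧
        Summable (fredholmTerm (copies m) (gapKernel q τ A z))) ∧
    CircleIntegrable (fun z => gapIntegrand q n τ A z / z) 0 R ∧
      HasSum (fun k : Eigenstate n => ((q ^ ((n : ℝ) / 2) / partitionFn q n : ℝ) : ℂ) *
        ((q : ℂ) ^ (∑ i, k.1 i) * fredholmDet (copies m) fun a b =>
          (levelKernel (levels k) a.1 b.1 (τ a.2) (τ b.2) : ℂ) * gapWeight A b))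
        (contour R (gapIntegrand q n τ A)) := by
  have hρ := hq.trans hqρ
  obtain ⟨B, hB0, hB⟩ := exists_norm_occProb_le hq (hqρ.trans hρ1) hR hpole
  have ht' : TimeBound ρ r fun a : ℝ × Fin m => τ a.2 := ht.comp Prod.snd
  have htm : Measurable fun a : ℝ × Fin m => τ a.2 := (measurable_of_countable τ).comp measurable_snd
  have hint := integrable_diagRoot_sq_copies hr hr1 m
  have h := (multiAffine_fredholmDet (μ := copies m) measurable_fst htm (measurable_gapWeight hA)
    (norm_gapWeight_le A) hρ hρ1 hr hr1 ht' hint).contour hq hqρ hρ1 hR hpole n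
  have hBρ : ∀ z ∈ Metric.sphere (0 : ℂ) R, ∀ k, ‖occProb q z k‖ ≤ B * ρ ^ k := by
    intro z hz k
    refine (hB z hz k).trans ?_
    gcongr
  have ek : ∀ z ∈ Metric.sphere (0 : ℂ) R, gapKernel q τ A z = fun a b =>
      occKernel (occProb q z) a.1 b.1 (τ a.2) (τ b.2) * gapWeight A b := by
    intro z hz
    ext a b
    unfold gapKernel
    rw [(kernelK_eq hρ hr hr1 (ht a.2 b.2).1 (hBρ z hz) hB0.le).2]
    rfl
  have e : ∀ z ∈ Metric.sphere (0 : ℂ) R, gapIntegrand q n τ A z = fugF q n z *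
      fredholmDet (copies m) fun a b =>
      occKernel (occProb q z) a.1 b.1 (τ a.2) (τ b.2) * gapWeight A b := by
    intro z hz
    unfold gapIntegrand
    rw [ek z hz]
  refine ⟨fun z hz => ?_, ?_, ?_⟩
  · rw [ek z hz]
    have hw : ∀ a : ℝ × Fin m, 0 < diagRoot r a.1 := fun a => diagRoot_pos hr hr1 _
    have hbd : ∀ a b : ℝ × Fin m, ‖occKernel (occProb q z) a.1 b.1 (τ a.2) (τ b.2) * gapWeight A b‖ ≤
        (B + 1) * diagRoot r a.1 * diagRoot r b.1 := by
      intro a b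
      rw [norm_mul]
      refine (mul_le_of_le_one_right (norm_nonneg _) (norm_gapWeight_le A b)).trans ?_
      exact norm_occKernel_le hr hr1 hB0.le
        (Admissible.kerCoef_le hρ hρ1 hr ht' hB0.le (hBρ z hz) a b) _ _
    refine ⟨fun l => integrable_fredholmIntegrand ?_ (by positivity) hw hint hbd l,
      summable_fredholmTerm (by positivity) hw hint hbd⟩
    refine Measurable.mul ?_ ((measurable_gapWeight hA).comp measurable_snd)
    refine measurable_occKernel _ (measurable_fst.comp measurable_fst)
      (measurable_fst.comp measurable_snd) (htm.comp measurable_fst) (htm.comp measurable_snd)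
      fun b => ?_
    exact summable_occKernel_term hr hr1
      (Admissible.kerCoef_le hρ hρ1 hr ht' hB0.le (hBρ z hz) b.1 b.2) _ _
  · refine h.1.congr ?_
    intro θ _
    simp only [e _ (circleMap_mem_sphere 0 hR.le θ)]
  · rw [contour_congr hR e]
    have h2 := h.2
    simp only [occKernel_occ] at h2
    exact h2

end Contour

/-! ### Integrating out one particle -/

/-- For invertible A this is the Schur complement, with the inverse written as adjugate over
determinant. The general case follows by continuity along s - A, which is singular only at the
finitely many roots of the characteristic polynomial. -/
lemma det_bordered {ι : Type*} [Fintype ι] [DecidableEq ι] (A : Matrix ι ι ℝ) (b c : ι → ℝ) (d : ℝ) :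
    (Matrix.fromBlocks A (Matrix.replicateCol Unit b) (Matrix.replicateRow Unit c)
      (Matrix.of fun _ _ => d)).det = d * A.det - c ⬝ᵥ (A.adjugate.mulVec b) := by
  suffices h : ∀ A : Matrix ι ι ℝ, ∀ s, (Matrix.fromBlocks (Matrix.scalar ι s - A)
      (Matrix.replicateCol Unit b) (Matrix.replicateRow Unit c) (Matrix.of fun _ _ => d)).det =
      d * (Matrix.scalar ι s - A).det - c ⬝ᵥ ((Matrix.scalar ι s - A).adjugate.mulVec b) by
    have := h (-A) 0
    simpa using this
  intro A
  have hcs : Continuous fun s : ℝ => Matrix.scalar ι s - A := by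
    refine Continuous.sub ?_ continuous_const
    change Continuous fun s : ℝ => Matrix.diagonal fun _ : ι => s
    exact Continuous.matrix_diagonal (continuous_pi fun _ => continuous_id)
  refine fun s => congrFun (Continuous.ext_on
    (f := fun s : ℝ => (Matrix.fromBlocks (Matrix.scalar ι s - A) (Matrix.replicateCol Unit b)
      (Matrix.replicateRow Unit c) (Matrix.of fun _ _ => d)).det)
    (g := fun s : ℝ => d * (Matrix.scalar ι s - A).det -
      c ⬝ᵥ ((Matrix.scalar ι s - A).adjugate.mulVec b))
    (s := {s | A.charpoly.eval s ≠ 0}) ?_ ?_ ?_ ?_) s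
  · have hfin : {s | A.charpoly.eval s = 0}.Finite := by
      refine A.charpoly.roots.toFinset.finite_toSet.subset fun s hs => ?_
      simp only [Finset.mem_coe, Multiset.mem_toFinset]
      rw [Polynomial.mem_roots (Matrix.charpoly_monic A).ne_zero]
      exact hs
    exact hfin.countable.dense_compl ℝ
  · apply Continuous.matrix_det
    exact Continuous.matrix_fromBlocks hcs continuous_const continuous_const continuous_const
  · refine (continuous_const.mul hcs.matrix_det).sub ?_
    exact Continuous.dotProduct continuous_const (hcs.matrix_adjugate.matrix_mulVec continuous_const)
  · intro s hs
    have hs' : (Matrix.scalar ι s - A).det ≠ 0 := by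
      rw [← Matrix.eval_charpoly]; exact hs
    have hu : IsUnit (Matrix.scalar ι s - A) :=
      (Matrix.isUnit_iff_isUnit_det _).2 (isUnit_iff_ne_zero.2 hs')
    let _ := hu.invertible
    dsimp only
    rw [Matrix.det_fromBlocks₁₁, Matrix.det_unique (n := Unit)]
    simp only [Matrix.sub_apply, Matrix.of_apply]
    rw [mul_sub, mul_comm]
    congr 1
    rw [Matrix.mul_assoc, Matrix.mul_apply]
    simp only [Matrix.replicateRow_apply]
    rw [dotProduct, Finset.mul_sum]
    refine Finset.sum_congr rfl fun i _ => ?_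
    rw [mul_left_comm]
    congr 1
    rw [Matrix.invOf_eq_nonsing_inv, Matrix.inv_def, Ring.inverse_eq_inv', Matrix.mul_apply, Matrix.mulVec, dotProduct, Finset.mul_sum]
    refine Finset.sum_congr rfl fun j _ => ?_
    simp only [Matrix.smul_apply, Matrix.replicateCol_apply, smul_eq_mul]
    field_simp

lemma continuous_mehler {r : ℝ} (hr : 0 < r) (hr1 : r < 1) :
    Continuous fun p : ℝ × ℝ => mehler r p.1 p.2 := by
  simp only [mehler_eq hr hr1]
  fun_prop

lemma continuous_levelKernel (S : Finset ℕ) (τ σ : ℝ) :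
    Continuous fun p : ℝ × ℝ => levelKernel S p.1 p.2 τ σ := by
  simp only [levelKernel_eq, termE_eq]
  refine Continuous.sub ?_ ?_
  · refine continuous_finsetSum _ fun k _ => ?_
    exact (((continuous_phi k).comp continuous_fst).mul
      ((continuous_phi k).comp continuous_snd)).mul continuous_const
  · by_cases h : τ < σ
    · simp only [if_pos h]
      exact continuous_mehler (Real.exp_pos _) (by rw [Real.exp_lt_one_iff]; linarith)
    · simp only [if_neg h]
      exact continuous_const

lemma continuous_levelDet {ι : Type*} [Fintype ι] [DecidableEq ι] (S : Finset ℕ) (t : ι → ℝ) :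
    Continuous fun x : ι → ℝ => levelDet S t x := by
  unfold levelDet
  apply Continuous.matrix_det
  refine continuous_matrix fun i j => ?_
  exact (continuous_levelKernel S (t i) (t j)).comp (f := fun x : ι → ℝ => (x i, x j))
    ((continuous_apply i).prodMk (continuous_apply j))

section Bounds

variable {ρ r : ℝ}

/-- Combines `MultiAffine.norm_le` with Hadamard's inequality on the polydisc of radius R = 1; the 2
is R + 1. A direct estimate with occupation numbers equal to 1 would control the dependence on S
less well. -/
lemma abs_levelDet_le {ι : Type*} [Fintype ι] [DecidableEq ι] (hρ : 0 < ρ) (hρ1 : ρ < 1)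
    (hr : 0 < r) (hr1 : r < 1) {t : ι → ℝ} (ht : TimeBound ρ r t) (S : Finset ℕ) (x : ι → ℝ) :
    |levelDet S t x| ≤ hadamardConst (Fintype.card ι) * 2 ^ Fintype.card ι *
      (∏ i, diagRoot r (x i) ^ 2) * (ρ ^ (∑ j ∈ S, j))⁻¹ := by
  have h := (multiAffine_det hρ hρ1 hr hr1 ht x).norm_le hρ hρ1 (B := hadamardConst (Fintype.card ι) *
    2 ^ Fintype.card ι * (∏ i, diagRoot r (x i) ^ 2)) (fun c hc => ?_) S (occ S)
    (fun k hk => by simp [occ, hk]) (fun k hk => by simp [occ, hk]; positivity)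
  · rw [← ofReal_levelDet, Complex.norm_real, Real.norm_eq_abs] at h
    exact h
  · refine norm_det_le _ (by positivity) (fun i => diagRoot_pos hr hr1 (x i)) fun i j => ?_
    have := norm_occKernel_le hr hr1 zero_le_one (Admissible.kerCoef_le hρ hρ1 hr ht
      zero_le_one (by simpa using hc) i j) (x i) (x j)
    rw [one_add_one_eq_two] at this
    exact this

lemma abs_levelCoef_le {τ σ : ℝ} (hρ : 0 < ρ) (hρ1 : ρ < 1) (hr : 0 < r)
    (h1 : ρ * Real.exp (τ - σ) ≤ r) (h2 : τ < σ → Real.exp (τ - σ) ≤ r) (S : Finset ℕ) :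
    ∃ C, 0 ≤ C ∧ ∀ k, |levelCoef S τ σ k| ≤ C * r ^ k := by
  obtain ⟨R, hR0, hR⟩ := admissible_occ hρ S
  refine ⟨R + 1, by positivity, fun k => ?_⟩
  have := norm_kerCoef_le hρ hρ1 hr h1 h2 hR0 hR k
  rwa [kerCoef_occ, Complex.norm_real, Real.norm_eq_abs] at this

lemma abs_levelKernel_le {τ σ : ℝ} (hρ : 0 < ρ) (hρ1 : ρ < 1) (hr : 0 < r) (hr1 : r < 1)
    (h1 : ρ * Real.exp (τ - σ) ≤ r) (h2 : τ < σ → Real.exp (τ - σ) ≤ r) (S : Finset ℕ) :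
    ∃ C, 0 ≤ C ∧ ∀ x y, |levelKernel S x y τ σ| ≤ C * diagRoot r x * diagRoot r y := by
  obtain ⟨R, hR0, hR⟩ := admissible_occ hρ S
  refine ⟨R + 1, by positivity, fun x y => ?_⟩
  have := norm_occKernel_le hr hr1 hR0 (norm_kerCoef_le hρ hρ1 hr h1 h2 hR0 hR) x y
  rwa [occKernel_occ, Complex.norm_real, Real.norm_eq_abs] at this

/-- By Parseval the coefficients multiply. With c = 1_{k∈S}, so that c² = c, one has (c - 1_{τ<s})(c
- 1_{s<σ}) = (1_{s≤τ} - 1_{s<σ})(c - 1_{τ<σ}), by inspection of the possible orders of τ, s and σ.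
-/
lemma integral_levelKernel_mul {τ s σ : ℝ} (hρ : 0 < ρ) (hρ1 : ρ < 1) (hr : 0 < r) (hr1 : r < 1)
    (h1 : ρ * Real.exp (τ - s) ≤ r) (h2 : τ < s → Real.exp (τ - s) ≤ r)
    (h3 : ρ * Real.exp (s - σ) ≤ r) (h4 : s < σ → Real.exp (s - σ) ≤ r) (S : Finset ℕ) (x y : ℝ) :
    ∫ ξ, levelKernel S x ξ τ s * levelKernel S ξ y s σ =
      ((if s ≤ τ then 1 else 0) - if s < σ then 1 else 0) * levelKernel S x y τ σ := by
  obtain ⟨C, hC0, hC⟩ := abs_levelCoef_le hρ hρ1 hr h1 h2 S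
  obtain ⟨C', hC0', hC'⟩ := abs_levelCoef_le hρ hρ1 hr h3 h4 S
  have hs1 : ∀ {C : ℝ} {τ σ : ℝ}, 0 ≤ C → (∀ k, |levelCoef S τ σ k| ≤ C * r ^ k) → ∀ x,
      Summable fun k => |levelCoef S τ σ k * phi k x| := by
    intro C τ σ hC0 hC x
    refine Summable.of_nonneg_of_le (fun k => abs_nonneg _) (fun k => ?_)
      ((summable_abs_phi_mul_pow x hr hr1).mul_left C)
    rw [abs_mul]
    calc _ ≤ C * r ^ k * |phi k x| := by gcongr; exact hC k
      _ = _ := by ring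
  have hs2 : ∀ {C : ℝ} {τ σ : ℝ}, 0 ≤ C → (∀ k, |levelCoef S τ σ k| ≤ C * r ^ k) → ∀ x ξ,
      Summable fun k => |levelCoef S τ σ k * phi k x * phi k ξ| := by
    intro C τ σ hC0 hC x ξ
    refine Summable.of_nonneg_of_le (fun k => abs_nonneg _) (fun k => ?_)
      ((summable_abs_phi_mul_phi x ξ hr hr1).mul_left C)
    rw [abs_mul, abs_mul]
    calc _ ≤ C * r ^ k * |phi k x| * |phi k ξ| := by gcongr; exact hC k
      _ = _ := by ring
  have key := integral_tsum_mul_tsum (hs1 hC0 hC x) (hs1 hC0' hC' y) (hs2 hC0 hC x) (hs2 hC0' hC' y)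
  have e1 : ∀ ξ, ∑' k, levelCoef S τ s k * phi k x * phi k ξ = levelKernel S x ξ τ s := by
    intro ξ; unfold levelKernel; congr 1; ext k; ring
  have e2 : ∀ ξ, ∑' k, levelCoef S s σ k * phi k y * phi k ξ = levelKernel S ξ y s σ := by
    intro ξ; unfold levelKernel; congr 1; ext k; ring
  simp only [e1, e2] at key
  rw [key, levelKernel, ← tsum_mul_left]
  congr 1; ext k
  have e3 : Real.exp ((k : ℝ) * (τ - σ)) = Real.exp ((k : ℝ) * (τ - s)) * Real.exp ((k : ℝ) * (s - σ)) := by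
    rw [← Real.exp_add]; congr 1; ring
  unfold levelCoef
  rw [e3]
  split_ifs <;> first | (exfalso; linarith) | ring

lemma integral_levelKernel_diag (S : Finset ℕ) (s : ℝ) :
    ∫ ξ, levelKernel S ξ ξ s s = S.card := by
  simp only [levelKernel_eq, termE_eq, lt_irrefl, if_false, sub_zero, sub_self, mul_zero,
    Real.exp_zero, mul_one]
  rw [integral_finsetSum _ fun k _ => integrable_phi_mul_phi k k]
  simp [integral_phi_mul_phi]

/-- The matrix whose determinant is `levelDet S t x`. -/
def levelMatrix {ι : Type*} (S : Finset ℕ) (t x : ι → ℝ) : Matrix ι ι ℝ :=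
  Matrix.of fun i j => levelKernel S (x i) (x j) (t i) (t j)

lemma levelDet_sum_unit {ι : Type*} [Fintype ι] [DecidableEq ι] (S : Finset ℕ) (t x : ι → ℝ)
    (s ξ : ℝ) : levelDet S (Sum.elim t fun _ : Unit => s) (Sum.elim x fun _ => ξ) =
      levelKernel S ξ ξ s s * levelDet S t x - ∑ i, ∑ j,
        (levelMatrix S t x).adjugate i j *
          (levelKernel S (x j) ξ (t j) s * levelKernel S ξ (x i) s (t i)) := by
  have h := det_bordered (Matrix.of fun i j => levelKernel S (x i) (x j) (t i) (t j))
    (fun j => levelKernel S (x j) ξ (t j) s) (fun i => levelKernel S ξ (x i) s (t i))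
    (levelKernel S ξ ξ s s)
  unfold levelDet
  rw [← sub_eq_zero, ← sub_eq_zero.2 h]
  congr 1
  · congr 1
    ext i j
    rcases i with i | i <;> rcases j with j | j <;> rfl
  · congr 1
    rw [dotProduct]
    refine Finset.sum_congr rfl fun i _ => ?_
    rw [Matrix.mulVec, dotProduct, Finset.mul_sum]
    refine Finset.sum_congr rfl fun j _ => ?_
    rw [levelMatrix]
    ring

/-- Integrating out one particle at time `s`. -/
lemma integral_levelDet_sum_unit {ι : Type*} [Fintype ι] [DecidableEq ι] (hρ : 0 < ρ) (hρ1 : ρ < 1)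
    (hr : 0 < r) (hr1 : r < 1) {t : ι → ℝ} {s : ℝ}
    (ht : TimeBound ρ r (Sum.elim t fun _ : Unit => s)) (S : Finset ℕ) (x : ι → ℝ) :
    ∫ ξ, levelDet S (Sum.elim t fun _ : Unit => s) (Sum.elim x fun _ => ξ) =
      ((S.card : ℝ) - (Finset.univ.filter fun i => t i = s).card) * levelDet S t x := by
  have h1 : ∀ i, ρ * Real.exp (t i - s) ≤ r ∧ (t i < s → Real.exp (t i - s) ≤ r) := fun i =>
    ht (Sum.inl i) (Sum.inr ())
  have h2 : ∀ i, ρ * Real.exp (s - t i) ≤ r ∧ (s < t i → Real.exp (s - t i) ≤ r) := fun i =>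
    ht (Sum.inr ()) (Sum.inl i)
  have h3 := (ht (Sum.inr ()) (Sum.inr ()))
  simp only [Sum.elim_inr] at h3
  set A := levelMatrix S t x with hA
  simp only [levelDet_sum_unit]
  have hdiag : Integrable fun ξ => levelKernel S ξ ξ s s := by
    simp only [levelKernel_eq, termE_eq, lt_irrefl, if_false, sub_zero, sub_self, mul_zero,
      Real.exp_zero, mul_one]
    exact integrable_finsetSum _ fun k _ => integrable_phi_mul_phi k k
  have hprod : ∀ i j, Integrable fun ξ =>
      levelKernel S (x j) ξ (t j) s * levelKernel S ξ (x i) s (t i) := by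
    intro i j
    obtain ⟨C, hC0, hC⟩ := abs_levelKernel_le hρ hρ1 hr hr1 (h1 j).1 (h1 j).2 S
    obtain ⟨C', hC0', hC'⟩ := abs_levelKernel_le hρ hρ1 hr hr1 (h2 i).1 (h2 i).2 S
    refine Integrable.mono' ((integrable_diagRoot_sq hr hr1).const_mul
      (C * diagRoot r (x j) * (C' * diagRoot r (x i)))) ?_ (Filter.Eventually.of_forall fun ξ => ?_)
    · apply Continuous.aestronglyMeasurable
      exact ((continuous_levelKernel S (t j) s).comp (continuous_const.prodMk continuous_id)).mul
        ((continuous_levelKernel S s (t i)).comp (continuous_id.prodMk continuous_const))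
    · have hw := diagRoot_pos hr hr1 ξ
      have hw1 := diagRoot_pos hr hr1 (x j)
      have hw2 := diagRoot_pos hr hr1 (x i)
      rw [norm_mul, Real.norm_eq_abs, Real.norm_eq_abs]
      calc _ ≤ (C * diagRoot r (x j) * diagRoot r ξ) * (C' * diagRoot r ξ * diagRoot r (x i)) := by
            gcongr
            · exact hC _ _
            · exact hC' _ _
        _ = _ := by ring
  rw [integral_sub (hdiag.mul_const _), integral_mul_const, integral_levelKernel_diag,
    integral_finsetSum]
  · have e : ∀ i, ∫ ξ, ∑ j, A.adjugate i j *
        (levelKernel S (x j) ξ (t j) s * levelKernel S ξ (x i) s (t i)) =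
        ∑ j, A.adjugate i j * (((if s ≤ t j then 1 else 0) - if s < t i then 1 else 0) * A j i) := by
      intro i
      rw [integral_finsetSum _ fun j _ => (hprod i j).const_mul _]
      refine Finset.sum_congr rfl fun j _ => ?_
      rw [integral_const_mul, integral_levelKernel_mul hρ hρ1 hr hr1 (h1 j).1 (h1 j).2 (h2 i).1 (h2 i).2]
      rfl
    rw [Finset.sum_congr rfl fun i _ => e i]
    -- One indicator depends on j alone and the other on i alone. Summing over the remaining index
    -- gives a diagonal entry of A adj(A) or adj(A) A, which is det A, so each index i contributes
    -- 1_{s≤t_i} - 1_{s<t_i} = 1_{t_i=s}.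
    have e1 : ∑ i, ∑ j, A.adjugate i j * (((if s ≤ t j then 1 else 0) - if s < t i then 1 else 0) *
        A j i) = (∑ j, (if s ≤ t j then 1 else 0) * ∑ i, A j i * A.adjugate i j) -
          ∑ i, (if s < t i then 1 else 0) * ∑ j, A.adjugate i j * A j i := by
      simp only [Finset.mul_sum]
      rw [Finset.sum_comm' (s := Finset.univ) (t := fun _ => Finset.univ) (t' := Finset.univ)
        (s' := fun _ => Finset.univ) (by simp)
        (f := fun j i => (if s ≤ t j then (1 : ℝ) else 0) * (A j i * A.adjugate i j)),
        ← Finset.sum_sub_distrib]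
      refine Finset.sum_congr rfl fun i _ => ?_
      rw [← Finset.sum_sub_distrib]
      refine Finset.sum_congr rfl fun j _ => ?_
      ring
    have e2 : ∀ j, ∑ i, A j i * A.adjugate i j = A.det := by
      intro j
      rw [← Matrix.mul_apply, Matrix.mul_adjugate]; simp
    have e3 : ∀ i, ∑ j, A.adjugate i j * A j i = A.det := by
      intro i
      rw [← Matrix.mul_apply, Matrix.adjugate_mul]; simp
    rw [e1]
    simp only [e2, e3]
    rw [← Finset.sum_mul, ← Finset.sum_mul, ← sub_mul, ← Finset.sum_sub_distrib]
    have e4 : ∑ i, ((if s ≤ t i then (1 : ℝ) else 0) - if s < t i then 1 else 0) =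
        (Finset.univ.filter fun i => t i = s).card := by
      rw [Finset.card_filter]
      push_cast
      refine Finset.sum_congr rfl fun i _ => ?_
      rcases lt_trichotomy s (t i) with h | h | h
      · simp [h, h.le, h.ne']
      · simp [h]
      · simp [h.not_ge, h.not_gt, h.ne]
    rw [e4]
    change _ - _ * levelDet S t x = _
    ring
  · exact fun i _ => integrable_finsetSum _ fun j _ => (hprod i j).const_mul _
  · exact integrable_finsetSum _ fun i _ => integrable_finsetSum _ fun j _ => (hprod i j).const_mul _

end Bounds

/-- At most `n` particles sit at one time. -/
lemma levelDet_eq_zero {ι : Type*} [Fintype ι] [DecidableEq ι] (S : Finset ℕ) (t x : ι → ℝ) (s : ℝ)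
    (h : S.card < (Finset.univ.filter fun i => t i = s).card) : levelDet S t x = 0 := by
  -- A vanishing combination of the rows with t_i ≥ s is sought. In columns with t_j ≤ s the term E
  -- is absent and the rows are combinations of |S| fixed vectors; the columns with t_j > s are
  -- imposed separately. By hypothesis these linear conditions are fewer than the rows.
  set f : ({i // s ≤ t i} → ℝ) →ₗ[ℝ] (S → ℝ) × ({i // s < t i} → ℝ) :=
    { toFun := fun a => (fun k => ∑ i, a i * (phi k (x i) * Real.exp ((k : ℕ) * t i)),
        fun j => ∑ i, a i * levelKernel S (x i) (x j) (t i) (t j))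
      map_add' := fun a b => by
        ext k <;> simp [add_mul, Finset.sum_add_distrib]
      map_smul' := fun c a => by
        ext k <;> simp [mul_assoc, Finset.mul_sum] }
  have hcard : Fintype.card {i // s ≤ t i} =
      (Finset.univ.filter fun i => t i = s).card + Fintype.card {i // s < t i} := by
    rw [Fintype.card_subtype, Fintype.card_subtype, ← Finset.card_union_of_disjoint]
    · congr 1
      ext i
      simp only [Finset.mem_filter, Finset.mem_univ, true_and, Finset.mem_union]
      rw [le_iff_eq_or_lt, eq_comm]
    · rw [Finset.disjoint_filter]
      intro i _ h1 h2
      exact absurd h1 h2.ne'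
  have hlt : Module.finrank ℝ ((S → ℝ) × ({i // s < t i} → ℝ)) <
      Module.finrank ℝ ({i // s ≤ t i} → ℝ) := by
    rw [Module.finrank_prod, Module.finrank_fintype_fun_eq_card, Module.finrank_fintype_fun_eq_card,
      Module.finrank_fintype_fun_eq_card, hcard, Fintype.card_coe]
    omega
  obtain ⟨a, ha, ha0⟩ := (Submodule.ne_bot_iff _).1 (LinearMap.ker_ne_bot_of_finrank_lt (f := f) hlt)
  rw [LinearMap.mem_ker] at ha
  have ha1 : ∀ k : S, ∑ i, a i * (phi k (x i) * Real.exp ((k : ℕ) * t i)) = 0 := fun k =>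
    congrFun (congrArg Prod.fst ha) k
  have ha2 : ∀ j : {i // s < t i}, ∑ i, a i * levelKernel S (x i) (x j) (t i) (t j) = 0 := fun j =>
    congrFun (congrArg Prod.snd ha) j
  unfold levelDet
  rw [← Matrix.exists_vecMul_eq_zero_iff]
  refine ⟨fun i => if hi : s ≤ t i then a ⟨i, hi⟩ else 0, ?_, ?_⟩
  · intro h0
    apply ha0
    ext i
    have := congrFun h0 i
    simpa [i.2] using this
  · ext j
    rw [Matrix.vecMul, dotProduct]
    simp only [Matrix.of_apply, Pi.zero_apply]
    have e : ∀ g : ι → ℝ, ∑ i, (if hi : s ≤ t i then a ⟨i, hi⟩ else 0) * g i =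
        ∑ i : {i // s ≤ t i}, a i * g i := by
      intro g
      have h1 := Finset.sum_subtype (F := inferInstance) (Finset.univ.filter fun i => s ≤ t i)
        (p := fun i => s ≤ t i) (by simp) fun i => (if hi : s ≤ t i then a ⟨i, hi⟩ else 0) * g i
      rw [Finset.sum_filter_of_ne] at h1
      · rw [h1]
        exact Finset.sum_congr rfl fun i _ => by rw [dif_pos i.2]
      · intro i _ hne
        by_contra hi
        exact hne (by rw [dif_neg hi, zero_mul])
    rw [e]
    by_cases hj : s < t j
    · exact ha2 ⟨j, hj⟩
    · have e2 : ∀ i : {i // s ≤ t i}, a i * levelKernel S (x i) (x j) (t i) (t j) =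
          ∑ k : S, (a i * (phi k (x i) * Real.exp ((k : ℕ) * t i))) *
            (phi k (x j) * Real.exp (-((k : ℕ) * t j))) := by
        intro i
        rw [levelKernel_eq, termE_eq, if_neg (by have := i.2; linarith), sub_zero, ← Finset.sum_coe_sort,
          Finset.mul_sum]
        refine Finset.sum_congr rfl fun k _ => ?_
        rw [show ((k : ℕ) : ℝ) * (t i - t j) = (k : ℕ) * t i + -((k : ℕ) * t j) by ring, Real.exp_add]
        ring
      simp only [e2]
      rw [Finset.sum_comm]
      simp only [← Finset.sum_mul, ha1, zero_mul, Finset.sum_const_zero]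

/-! ### Choices of particles at given times -/

/-- The number of choices of particles for the times `t i`, distinct at coinciding times. -/
def placements (n : ℕ) {ι : Type*} (t : ι → ℝ) : ℕ :=
  Nat.card {j : ι → Fin n // Function.Injective fun i => (t i, j i)}

lemma placements_comp_equiv (n : ℕ) {ι κ : Type*} (e : ι ≃ κ) (t : κ → ℝ) :
    placements n (t ∘ e) = placements n t := by
  refine Nat.card_congr ((Equiv.arrowCongr e (Equiv.refl (Fin n))).subtypeEquiv fun j => ?_)
  rw [← e.injective_comp]
  simp [Function.comp_def, Equiv.arrowCongr]

/-- A further particle at time s must avoid the labels already used at that time. The factor is the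
one produced by `integral_levelDet_sum_unit`, and this agreement is what makes marginals of the
joint density into correlation functions. In ℝ the identity also covers an overfull time, where no
choice exists. -/
lemma placements_sum_unit (n : ℕ) {ι : Type*} [Fintype ι] (t : ι → ℝ) (s : ℝ) :
    (placements n (Sum.elim t fun _ : Unit => s) : ℝ) =
      ((n : ℝ) - (Finset.univ.filter fun i => t i = s).card) * placements n t := by
  classical
  have e : {j : ι ⊕ Unit → Fin n // Function.Injective fun i =>
      (Sum.elim t (fun _ : Unit => s) i, j i)} ≃
      Σ j : {j : ι → Fin n // Function.Injective fun i => (t i, j i)},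
        {k : Fin n // ∀ i, t i = s → j.1 i ≠ k} :=
    { toFun := fun j => ⟨⟨fun i => j.1 (Sum.inl i), fun a b h => Sum.inl_injective (j.2 h)⟩,
        ⟨j.1 (Sum.inr ()), fun i hi h => by
          have := @j.2 (Sum.inl i) (Sum.inr ()) (by simpa [hi] using h)
          simp at this⟩⟩
      invFun := fun p => ⟨Sum.elim p.1.1 fun _ => p.2.1, by
        rintro (a | a) (b | b) h
        · exact congrArg _ (p.1.2 h)
        · simp only [Sum.elim_inl, Sum.elim_inr, Prod.mk.injEq] at h
          exact absurd h.2 (p.2.2 a h.1)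
        · simp only [Sum.elim_inl, Sum.elim_inr, Prod.mk.injEq] at h
          exact absurd h.2.symm (p.2.2 b h.1.symm)
        · rfl⟩
      left_inv := fun j => by
        ext i
        rcases i with i | i <;> rfl
      right_inv := fun p => rfl }
  have hc : ∀ j : {j : ι → Fin n // Function.Injective fun i => (t i, j i)},
      (Nat.card {k : Fin n // ∀ i, t i = s → j.1 i ≠ k} : ℝ) =
        (n : ℝ) - (Finset.univ.filter fun i => t i = s).card := by
    intro j
    have h1 : ((Finset.univ.filter fun i => t i = s).image j.1).card =
        (Finset.univ.filter fun i => t i = s).card := by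
      refine Finset.card_image_of_injOn fun a ha b hb hab => j.2 ?_
      simp only [Finset.coe_filter, Finset.mem_univ, true_and, Set.mem_ofPred_eq] at ha hb
      simp [ha, hb, hab]
    rw [Nat.card_eq_fintype_card, Fintype.card_subtype, ← h1, eq_sub_iff_add_eq]
    norm_cast
    rw [← Finset.card_union_of_disjoint]
    · refine (congrArg Finset.card (Finset.eq_univ_iff_forall.2 fun k => ?_)).trans (by simp)
      simp only [Finset.mem_union, Finset.mem_filter, Finset.mem_univ, true_and, Finset.mem_image]
      by_cases h : ∃ a, t a = s ∧ j.1 a = k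
      · exact Or.inr h
      · push Not at h
        exact Or.inl h
    · rw [Finset.disjoint_left]
      intro k hk
      simp only [Finset.mem_filter, Finset.mem_univ, true_and, Finset.mem_image] at hk ⊢
      push Not
      exact hk
  have := Fintype.ofFinite {j : ι → Fin n // Function.Injective fun i => (t i, j i)}
  rw [placements, Nat.card_congr e, Nat.card_sigma]
  push_cast
  rw [Finset.sum_congr rfl fun j _ => hc j, Finset.sum_const, nsmul_eq_mul, placements,
    Nat.card_eq_fintype_card, Finset.card_univ, mul_comm]

/-- If the indices at each time could be embedded into the n labels, the embeddings for the
different times would glue to an admissible choice. -/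
lemma exists_card_of_placements_eq_zero {n : ℕ} {ι : Type*} [Fintype ι] {t : ι → ℝ}
    (h : placements n t = 0) : ∃ s, n < (Finset.univ.filter fun i => t i = s).card := by
  by_contra hc
  push Not at hc
  have hf : ∀ s, Nonempty ({i // t i = s} ↪ Fin n) := fun s => by
    apply Function.Embedding.nonempty_of_card_le
    rw [Fintype.card_subtype, Fintype.card_fin]
    exact hc s
  let f := fun s => (hf s).some
  rw [placements, Nat.card_eq_zero] at h
  rcases h with h | h
  · refine h.false ⟨fun i => f (t i) ⟨i, rfl⟩, fun a b hab => ?_⟩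
    simp only [Prod.mk.injEq] at hab
    obtain ⟨h1, h2⟩ := hab
    have : f (t a) ⟨a, rfl⟩ = f (t a) ⟨b, h1.symm⟩ := by
      rw [h2]; congr! 2 <;> first | exact h1.symm | simp [h1]
    simpa using (f (t a)).injective this
  · exact h.not_finite inferInstance

/-- Slots `(l, k)` at pairwise distinct times `s l` can be filled by arbitrary permutations. -/
lemma placements_slots (n : ℕ) {p : ℕ} {s : Fin p → ℝ} (hs : Function.Injective s) :
    placements n (fun a : Fin p × Fin n => s a.1) = n.factorial ^ p := by
  have e : {j : Fin p × Fin n → Fin n // Function.Injective fun a => (s a.1, j a)} ≃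
      (Fin p → Equiv.Perm (Fin n)) :=
    { toFun := fun j l => Equiv.ofBijective (fun k => j.1 (l, k)) (Finite.injective_iff_bijective.1
        fun a b h => by simpa using @j.2 (l, a) (l, b) (by simpa using h))
      invFun := fun σ => ⟨fun a => σ a.1 a.2, fun a b h => by
        simp only [Prod.mk.injEq] at h
        have h1 := hs h.1
        obtain ⟨a1, a2⟩ := a
        obtain ⟨b1, b2⟩ := b
        simp only at h1
        subst h1
        simpa using h.2⟩
      left_inv := fun j => rfl
      right_inv := fun σ => by ext l k; rfl }
  rw [placements, Nat.card_congr e, Nat.card_eq_fintype_card, Fintype.card_pi]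
  simp [Fintype.card_perm]

lemma levelDet_comp_equiv {ι κ : Type*} [Fintype ι] [DecidableEq ι] [Fintype κ] [DecidableEq κ]
    (e : ι ≃ κ) (S : Finset ℕ) (t x : κ → ℝ) : levelDet S (t ∘ e) (x ∘ e) = levelDet S t x :=
  Matrix.det_submatrix_equiv_self e (levelMatrix S t x)

/-! ### Marginals of level determinants -/

section Marginal

variable {ρ r : ℝ} {ι κ : Type*} [Fintype ι] [DecidableEq ι] [Fintype κ] [DecidableEq κ]

lemma integrable_prod_diagRoot_sq (hr : 0 < r) (hr1 : r < 1) :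
    Integrable fun w : κ → ℝ => ∏ i, diagRoot r (w i) ^ 2 :=
  Integrable.fintype_prod fun _ => integrable_diagRoot_sq hr hr1

lemma continuous_sumElim_right (x : ι → ℝ) :
    Continuous fun w : κ → ℝ => (Sum.elim x w : ι ⊕ κ → ℝ) := by
  refine continuous_pi fun i => ?_
  rcases i with i | i
  · exact continuous_const
  · exact continuous_apply i

lemma abs_levelDet_sumElim_le (hρ : 0 < ρ) (hρ1 : ρ < 1) (hr : 0 < r) (hr1 : r < 1)
    {t : ι → ℝ} {u : κ → ℝ} (ht : TimeBound ρ r (Sum.elim t u)) (S : Finset ℕ) (x : ι → ℝ)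
    (w : κ → ℝ) : |levelDet S (Sum.elim t u) (Sum.elim x w)| ≤
      (hadamardConst (Fintype.card (ι ⊕ κ)) * 2 ^ Fintype.card (ι ⊕ κ) *
        (∏ i, diagRoot r (x i) ^ 2)) * (∏ i, diagRoot r (w i) ^ 2) * (ρ ^ (∑ j ∈ S, j))⁻¹ := by
  refine (abs_levelDet_le hρ hρ1 hr hr1 ht S _).trans_eq ?_
  rw [Fintype.prod_sum_type]
  simp only [Sum.elim_inl, Sum.elim_inr]
  ring

lemma integrable_levelDet_sumElim (hρ : 0 < ρ) (hρ1 : ρ < 1) (hr : 0 < r) (hr1 : r < 1)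
    {t : ι → ℝ} {u : κ → ℝ} (ht : TimeBound ρ r (Sum.elim t u)) (S : Finset ℕ) (x : ι → ℝ) :
    Integrable fun w : κ → ℝ => levelDet S (Sum.elim t u) (Sum.elim x w) :=
  (((integrable_prod_diagRoot_sq hr hr1).const_mul _).mul_const _).mono'
    ((continuous_levelDet S _).comp (continuous_sumElim_right x)).aestronglyMeasurable
    (Filter.Eventually.of_forall fun w => abs_levelDet_sumElim_le hρ hρ1 hr hr1 ht S x w)

/-- Induction on the number of integrated variables: integrating the first one produces the factor
by which `placements` grows when its time is adjoined. Written with products, the identity needs no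
division by a possibly vanishing count. -/
lemma placements_mul_integral_levelDet_fin (hρ : 0 < ρ) (hρ1 : ρ < 1) (hr : 0 < r) (hr1 : r < 1)
    (S : Finset ℕ) {t : ι → ℝ} (x : ι → ℝ) {p : ℕ} {u : Fin p → ℝ}
    (ht : TimeBound ρ r (Sum.elim t u)) :
    placements S.card t * ∫ w : Fin p → ℝ, levelDet S (Sum.elim t u) (Sum.elim x w) =
      placements S.card (Sum.elim t u) * levelDet S t x := by
  induction p with
  | zero =>
    have h1 : ∀ y : Fin 0 → ℝ, Sum.elim t y = t ∘ Equiv.sumEmpty ι (Fin 0) := fun y => by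
      ext i; rcases i with i | i
      · rfl
      · exact i.elim0
    have h2 : ∀ y : Fin 0 → ℝ, Sum.elim x y = x ∘ Equiv.sumEmpty ι (Fin 0) := fun y => by
      ext i; rcases i with i | i
      · rfl
      · exact i.elim0
    simp only [h1, h2, levelDet_comp_equiv, placements_comp_equiv]
    rw [integral_const, volume_pi, Measure.pi_of_empty]
    simp
  | succ p ih =>
    set e : ι ⊕ Fin (p + 1) ≃ (ι ⊕ Fin p) ⊕ Unit :=
      (Equiv.sumCongr (Equiv.refl ι) ((finSuccEquiv p).trans (Equiv.optionEquivSumPUnit _))).trans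
        (Equiv.sumAssoc ι (Fin p) Unit).symm with he
    have hcomp : ∀ (y : ι → ℝ) (a : ℝ) (v : Fin p → ℝ), (Sum.elim y (Fin.cons a v : Fin (p + 1) → ℝ)) =
        (Sum.elim (Sum.elim y v) fun _ => a) ∘ e := by
      intro y a v
      ext i
      rcases i with i | i
      · rfl
      · refine Fin.cases ?_ (fun i => ?_) i
        · simp [he]
        · simp [he]
    obtain ⟨s, v, rfl⟩ : ∃ s v, u = Fin.cons s v := ⟨u 0, Fin.tail u, (Fin.cons_self_tail u).symm⟩
    rw [hcomp] at ht
    have ht2 : TimeBound ρ r (Sum.elim (Sum.elim t v) fun _ : Unit => s) := by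
      have := ht.comp e.symm
      rwa [Function.comp_assoc, Equiv.self_comp_symm, Function.comp_id] at this
    have ht1 : TimeBound ρ r (Sum.elim t v) := ht2.comp Sum.inl
    have hint := integrable_levelDet_sumElim hρ hρ1 hr hr1 (u := (Fin.cons s v : Fin (p + 1) → ℝ))
      (by rw [hcomp]; exact ht) S x
    have hmp := (volume_preserving_piFinSuccAbove (fun _ : Fin (p + 1) => ℝ) 0).symm
    rw [← hmp.integral_comp (MeasurableEquiv.measurableEmbedding _), Measure.volume_eq_prod,
      integral_prod_symm]
    · have h3 : ∀ w : Fin p → ℝ, ∫ ξ : ℝ, levelDet S (Sum.elim t (Fin.cons s v : Fin (p + 1) → ℝ))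
          (Sum.elim x ((MeasurableEquiv.piFinSuccAbove (fun _ : Fin (p + 1) => ℝ) 0).symm (ξ, w))) =
          ((S.card : ℝ) - (Finset.univ.filter fun i => Sum.elim t v i = s).card) *
            levelDet S (Sum.elim t v) (Sum.elim x w) := by
        intro w
        rw [← integral_levelDet_sum_unit hρ hρ1 hr hr1 ht2]
        congr 1
        ext ξ
        rw [← levelDet_comp_equiv e, ← hcomp, ← hcomp]
        congr 2
        ext i
        refine Fin.cases ?_ (fun i => ?_) i
        · simp [MeasurableEquiv.piFinSuccAbove, Fin.insertNthEquiv]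
        · simp [MeasurableEquiv.piFinSuccAbove, Fin.insertNthEquiv]
      simp only [h3]
      rw [integral_const_mul, mul_left_comm, ih ht1, hcomp, placements_comp_equiv,
        placements_sum_unit, mul_assoc]
    · rw [← Measure.volume_eq_prod]
      exact (hmp.integrable_comp_emb (MeasurableEquiv.measurableEmbedding _)).2 hint

lemma placements_mul_integral_levelDet (hρ : 0 < ρ) (hρ1 : ρ < 1) (hr : 0 < r) (hr1 : r < 1)
    (S : Finset ℕ) {t : ι → ℝ} (x : ι → ℝ) {u : κ → ℝ} (ht : TimeBound ρ r (Sum.elim t u)) :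
    placements S.card t * ∫ w : κ → ℝ, levelDet S (Sum.elim t u) (Sum.elim x w) =
      placements S.card (Sum.elim t u) * levelDet S t x := by
  set e := Fintype.equivFin κ
  set e' : ι ⊕ Fin (Fintype.card κ) ≃ ι ⊕ κ := Equiv.sumCongr (Equiv.refl ι) e.symm
  have hcomp : ∀ (y : ι → ℝ) (v : κ → ℝ), Sum.elim y v ∘ e' = Sum.elim y (v ∘ e.symm) := by
    intro y v
    ext i
    rcases i with i | i <;> rfl
  have h := placements_mul_integral_levelDet_fin hρ hρ1 hr hr1 S x (t := t) (u := u ∘ e.symm) (by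
    rw [← hcomp]; exact ht.comp e')
  rw [← hcomp, placements_comp_equiv] at h
  rw [← h]
  congr 1
  have hmp := volume_measurePreserving_piCongrLeft (fun _ : κ => ℝ) e.symm
  rw [← hmp.integral_comp (MeasurableEquiv.measurableEmbedding _)]
  congr 1
  ext w
  rw [← levelDet_comp_equiv e', hcomp, hcomp]
  congr 2
  ext i
  simp [MeasurableEquiv.coe_piCongrLeft, Equiv.piCongrLeft_apply]

end Marginal

/-! ### The correlation series -/

/-- The thermal average of `levelDet` over the eigenstates. -/
def corrSum (q : ℝ) (n : ℕ) {ι : Type*} [Fintype ι] [DecidableEq ι] (t x : ι → ℝ) : ℝ :=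
  ∑' k : Eigenstate n, q ^ ((n : ℝ) / 2) / partitionFn q n *
    (q ^ (∑ i, k.1 i) * levelDet (levels k) t x)

section CorrSum

variable {q ρ r : ℝ} {n : ℕ} {ι κ : Type*} [Fintype ι] [DecidableEq ι] [Fintype κ] [DecidableEq κ]

lemma norm_corrSum_term_le (hq : 0 < q) (hq1 : q < 1) {D B : ℝ}
    (k : Eigenstate n) (hD : |D| ≤ B * (ρ ^ (∑ j ∈ levels k, j))⁻¹) :
    ‖q ^ ((n : ℝ) / 2) / partitionFn q n * (q ^ (∑ i, k.1 i) * D)‖ ≤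
      (esum q n)⁻¹ * B * (q / ρ) ^ (∑ i, k.1 i) := by
  rw [rpow_div_partitionFn hq, Real.norm_eq_abs, abs_mul, abs_mul,
    abs_of_pos (inv_pos.2 (esum_pos hq hq1 n)), abs_of_pos (pow_pos hq _), div_pow,
    mul_assoc, div_eq_mul_inv]
  rw [sum_levels] at hD
  have := esum_pos hq hq1 n
  calc _ ≤ (esum q n)⁻¹ * (q ^ (∑ i, k.1 i) * (B * (ρ ^ (∑ i, k.1 i))⁻¹)) := by gcongr
    _ = _ := by ring

lemma summable_bound (hq : 0 < q) (hqρ : q < ρ) (B : ℝ) :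
    Summable fun k : Eigenstate n => (esum q n)⁻¹ * B * (q / ρ) ^ (∑ i, k.1 i) :=
  (summable_pow_sum (div_nonneg hq.le (hq.trans hqρ).le)
    ((div_lt_one (hq.trans hqρ)).2 hqρ)).mul_left _

lemma hasSum_corrSum (hq : 0 < q) (hqρ : q < ρ) (hρ1 : ρ < 1) (hr : 0 < r) (hr1 : r < 1)
    {t : ι → ℝ} (ht : TimeBound ρ r t) (x : ι → ℝ) :
    HasSum (fun k : Eigenstate n => q ^ ((n : ℝ) / 2) / partitionFn q n *
      (q ^ (∑ i, k.1 i) * levelDet (levels k) t x)) (corrSum q n t x) :=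
  (Summable.of_norm_bounded (summable_bound hq hqρ _) fun k =>
    norm_corrSum_term_le hq (hqρ.trans hρ1) k
      (abs_levelDet_le (hq.trans hqρ) hρ1 hr hr1 ht (levels k) x)).hasSum

lemma measurable_corrSum (hq : 0 < q) (hqρ : q < ρ) (hρ1 : ρ < 1) (hr : 0 < r) (hr1 : r < 1)
    {t : ι → ℝ} (ht : TimeBound ρ r t) : Measurable fun x : ι → ℝ => corrSum q n t x := by
  refine measurable_of_tendsto_metrizable' Filter.atTop
    (f := fun (s : Finset (Eigenstate n)) (x : ι → ℝ) => ∑ k ∈ s,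
      q ^ ((n : ℝ) / 2) / partitionFn q n * (q ^ (∑ i, k.1 i) * levelDet (levels k) t x))
    (fun s => ?_) ?_
  · exact Finset.measurable_fun_sum _ fun k _ =>
      ((continuous_levelDet (levels k) t).measurable.const_mul _).const_mul _
  · rw [tendsto_pi_nhds]
    exact fun x => hasSum_corrSum hq hqρ hρ1 hr hr1 ht x

lemma corrSum_comp_equiv (e : ι ≃ κ) (t x : κ → ℝ) :
    corrSum q n (t ∘ e) (x ∘ e) = corrSum q n t x := by
  simp only [corrSum, levelDet_comp_equiv]

lemma corrSum_eq_zero (t x : ι → ℝ) (h : placements n t = 0) : corrSum q n t x = 0 := by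
  obtain ⟨s, hs⟩ := exists_card_of_placements_eq_zero h
  simp only [corrSum]
  rw [tsum_congr (g := fun _ => 0), tsum_zero]
  intro k
  rw [levelDet_eq_zero (levels k) t x s (by rwa [card_levels])]
  simp

lemma abs_corrSum_sumElim_le (hq : 0 < q) (hqρ : q < ρ) (hρ1 : ρ < 1) (hr : 0 < r) (hr1 : r < 1)
    {t : ι → ℝ} {u : κ → ℝ} (ht : TimeBound ρ r (Sum.elim t u)) (x : ι → ℝ) :
    ∃ B, 0 ≤ B ∧ ∀ w : κ → ℝ, |corrSum q n (Sum.elim t u) (Sum.elim x w)| ≤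
      B * ∏ i, diagRoot r (w i) ^ 2 := by
  have hρ := hq.trans hqρ
  have hq1 := hqρ.trans hρ1
  have := esum_pos hq hq1 n
  have hnn : 0 ≤ hadamardConst (Fintype.card (ι ⊕ κ)) := by unfold hadamardConst; positivity
  have hqn : 0 ≤ q / ρ := by positivity
  refine ⟨∑' k : Eigenstate n, (esum q n)⁻¹ * (hadamardConst (Fintype.card (ι ⊕ κ)) *
    2 ^ Fintype.card (ι ⊕ κ) * (∏ i, diagRoot r (x i) ^ 2)) * (q / ρ) ^ (∑ i, k.1 i),
    tsum_nonneg fun k => by positivity, fun w => ?_⟩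
  rw [← tsum_mul_right]
  rw [← Real.norm_eq_abs]
  refine tsum_of_norm_bounded ((summable_bound hq hqρ _).mul_right _).hasSum fun k => ?_
  refine (norm_corrSum_term_le hq hq1 k
    (abs_levelDet_sumElim_le hρ hρ1 hr hr1 ht (levels k) x w)).trans_eq ?_
  ring

lemma integrable_corrSum_sumElim (hq : 0 < q) (hqρ : q < ρ) (hρ1 : ρ < 1) (hr : 0 < r) (hr1 : r < 1)
    {t : ι → ℝ} {u : κ → ℝ} (ht : TimeBound ρ r (Sum.elim t u)) (x : ι → ℝ) :
    Integrable fun w : κ → ℝ => corrSum q n (Sum.elim t u) (Sum.elim x w) := by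
  obtain ⟨B, -, hB⟩ := abs_corrSum_sumElim_le (n := n) hq hqρ hρ1 hr hr1 ht x
  exact ((integrable_prod_diagRoot_sq hr hr1).const_mul _).mono'
    ((measurable_corrSum hq hqρ hρ1 hr hr1 ht).comp
      (continuous_sumElim_right x).measurable).aestronglyMeasurable
    (Filter.Eventually.of_forall hB)

/-- Thermal averages commute with integration against bounded functions. -/
lemma hasSum_integral_corrSum (hq : 0 < q) (hqρ : q < ρ) (hρ1 : ρ < 1) (hr : 0 < r) (hr1 : r < 1)
    {t : ι → ℝ} {u : κ → ℝ} (ht : TimeBound ρ r (Sum.elim t u)) (x : ι → ℝ) {g : (κ → ℝ) → ℝ}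
    (hg : Measurable g) (hg1 : ∀ w, |g w| ≤ 1) :
    HasSum (fun k : Eigenstate n => q ^ ((n : ℝ) / 2) / partitionFn q n *
      (q ^ (∑ i, k.1 i) * ∫ w : κ → ℝ, g w * levelDet (levels k) (Sum.elim t u) (Sum.elim x w)))
      (∫ w : κ → ℝ, g w * corrSum q n (Sum.elim t u) (Sum.elim x w)) := by
  have hρ := hq.trans hqρ
  have hq1 := hqρ.trans hρ1
  set C := (hadamardConst (Fintype.card (ι ⊕ κ)) * 2 ^ Fintype.card (ι ⊕ κ) *
        (∏ i, diagRoot r (x i) ^ 2))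
  have hbd : ∀ (k : Eigenstate n) (w : κ → ℝ),
      |g w * levelDet (levels k) (Sum.elim t u) (Sum.elim x w)| ≤
      C * (∏ i, diagRoot r (w i) ^ 2) * (ρ ^ (∑ j ∈ levels k, j))⁻¹ := by
    intro k w
    rw [abs_mul]
    exact (mul_le_of_le_one_left (abs_nonneg _) (hg1 w)).trans
      (abs_levelDet_sumElim_le hρ hρ1 hr hr1 ht (levels k) x w)
  have hI := integrable_prod_diagRoot_sq (κ := κ) hr hr1
  have hmeas : ∀ k : Eigenstate n, Measurable fun w : κ → ℝ =>
      g w * levelDet (levels k) (Sum.elim t u) (Sum.elim x w) := fun k =>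
    hg.mul ((continuous_levelDet (levels k) _).comp (continuous_sumElim_right x)).measurable
  have hint : ∀ k : Eigenstate n, Integrable fun w : κ → ℝ =>
      q ^ ((n : ℝ) / 2) / partitionFn q n * (q ^ (∑ i, k.1 i) *
        (g w * levelDet (levels k) (Sum.elim t u) (Sum.elim x w))) := fun k =>
    (((((hI.const_mul C).mul_const _).mono' (hmeas k).aestronglyMeasurable
      (Filter.Eventually.of_forall (hbd k)))).const_mul _).const_mul _
  have h := hasSum_integral_of_summable_integral_norm hint (by
    refine Summable.of_nonneg_of_le (fun k => integral_nonneg fun w => norm_nonneg _) (fun k => ?_)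
      (summable_bound (n := n) hq hqρ (C * ∫ w : κ → ℝ, ∏ i, diagRoot r (w i) ^ 2))
    calc ∫ w : κ → ℝ, ‖q ^ ((n : ℝ) / 2) / partitionFn q n * (q ^ (∑ i, k.1 i) *
          (g w * levelDet (levels k) (Sum.elim t u) (Sum.elim x w)))‖
        ≤ ∫ w : κ → ℝ, (esum q n)⁻¹ * C * (q / ρ) ^ (∑ i, k.1 i) * ∏ i, diagRoot r (w i) ^ 2 := by
          refine integral_mono (hint k).norm (hI.const_mul _) fun w => ?_
          refine (norm_corrSum_term_le hq hq1 k (hbd k w)).trans_eq ?_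
          ring
      _ = _ := by rw [integral_const_mul]; ring)
  simp only [integral_const_mul] at h
  have e : ∀ w : κ → ℝ, g w * corrSum q n (Sum.elim t u) (Sum.elim x w) =
      ∑' k : Eigenstate n, q ^ ((n : ℝ) / 2) / partitionFn q n * (q ^ (∑ i, k.1 i) *
        (g w * levelDet (levels k) (Sum.elim t u) (Sum.elim x w))) := by
    intro w
    rw [corrSum, ← tsum_mul_left]
    exact tsum_congr fun k => by ring
  simp only [e]
  exact h

/-- The combinatorial factors depend on the eigenstate only through its number n of levels, so they
pass through the thermal average. -/
lemma placements_mul_integral_corrSum (hq : 0 < q) (hqρ : q < ρ) (hρ1 : ρ < 1) (hr : 0 < r)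
    (hr1 : r < 1) {t : ι → ℝ} {u : κ → ℝ} (ht : TimeBound ρ r (Sum.elim t u)) (x : ι → ℝ) :
    placements n t * ∫ w : κ → ℝ, corrSum q n (Sum.elim t u) (Sum.elim x w) =
      placements n (Sum.elim t u) * corrSum q n t x := by
  have h1 := (hasSum_integral_corrSum (n := n) hq hqρ hρ1 hr hr1 ht x (g := fun _ => 1)
    measurable_const (by simp)).mul_left (placements n t : ℝ)
  have h2 := (hasSum_corrSum (n := n) hq hqρ hρ1 hr hr1 (t := t) (ht.comp Sum.inl) x).mul_left
    (placements n (Sum.elim t u) : ℝ)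
  simp only [one_mul] at h1
  refine h1.unique (h2.congr_fun fun k => ?_)
  have := placements_mul_integral_levelDet (hq.trans hqρ) hρ1 hr hr1 (levels k) x ht
  rw [card_levels] at this
  rw [mul_left_comm, mul_left_comm _ (q ^ _), this]
  ring

end CorrSum

/-! ### The Cauchy–Binet expansion -/

/-- The Cauchy–Binet expansion. -/
lemma det_sum_mul_eq {n : ℕ} (a b : Fin n → ℕ → ℝ) (R : Finset ℕ) :
    (Matrix.of fun i j => ∑ k ∈ R, a i k * b j k).det =
      ∑ S ∈ Finset.powersetCard n R, (Matrix.of fun i j => ∑ k ∈ S, a i k * b j k).det := by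
  classical
  -- The contribution of choosing the summand f(i) in row i. It vanishes unless f is injective,
  -- since otherwise two rows are proportional; the injective choices are then grouped by their
  -- image.
  set w : (Fin n → ℕ) → ℝ := fun f =>
    (Matrix.detRowAlternating (R := ℝ) (n := Fin n)) fun i => a i (f i) • fun j => b j (f i) with hw
  have h1 : ∀ R : Finset ℕ, (Matrix.of fun i j => ∑ k ∈ R, a i k * b j k).det =
      ∑ f ∈ Fintype.piFinset fun _ : Fin n => R, w f := by
    intro R
    refine Eq.trans ?_ (MultilinearMap.map_sum_finset _ (fun i k => a i k • fun j => b j k)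
      fun _ : Fin n => R)
    change Matrix.det _ = Matrix.det _
    congr 1
    ext i j
    simp
  have h2 : ∀ f, ¬ Function.Injective f → w f = 0 := by
    intro f hf
    rw [Function.not_injective_iff] at hf
    obtain ⟨i, j, hij, hne⟩ := hf
    have h := (Matrix.detRowAlternating (R := ℝ) (n := Fin n)).toMultilinearMap.map_smul_univ
      (fun i => a i (f i)) (fun i j => b j (f i))
    refine h.trans ?_
    have h0 : (Matrix.detRowAlternating (R := ℝ) (n := Fin n)) (fun i j => b j (f i)) = 0 :=
      AlternatingMap.map_eq_zero_of_eq _ _ (by simp [hij]) hne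
    exact (congrArg _ h0).trans (smul_zero _)
  have h3 : ∀ R : Finset ℕ, ∑ f ∈ Fintype.piFinset fun _ : Fin n => R, w f =
      ∑ f ∈ (Fintype.piFinset fun _ : Fin n => R).filter Function.Injective, w f := fun R =>
    (Finset.sum_filter_of_ne fun f _ hf => by_contra fun h => hf (h2 f h)).symm
  rw [h1, h3, ← Finset.sum_fiberwise_of_maps_to (t := Finset.powersetCard n R)
    (g := fun f => Finset.univ.image f)]
  · refine Finset.sum_congr rfl fun S hS => ?_
    rw [h1, h3]
    rw [Finset.mem_powersetCard] at hS
    refine Finset.sum_congr ?_ fun _ _ => rfl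
    ext f
    simp only [Finset.mem_filter, Fintype.mem_piFinset]
    constructor
    · rintro ⟨⟨_, h5⟩, h6⟩
      exact ⟨fun i => h6 ▸ Finset.mem_image_of_mem f (Finset.mem_univ i), h5⟩
    · rintro ⟨h4, h5⟩
      refine ⟨⟨fun i => hS.1 (h4 i), h5⟩, Finset.eq_of_subset_of_card_le ?_ ?_⟩
      · intro x hx
        obtain ⟨i, -, rfl⟩ := Finset.mem_image.1 hx
        exact h4 i
      · rw [Finset.card_image_of_injective _ h5, hS.2]
        simp
  · intro f hf
    simp only [Finset.mem_filter, Fintype.mem_piFinset] at hf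
    rw [Finset.mem_powersetCard, Finset.card_image_of_injective _ hf.2]
    refine ⟨fun x hx => ?_, by simp⟩
    obtain ⟨i, -, rfl⟩ := Finset.mem_image.1 hx
    exact hf.1 i

/-- Finite Cauchy–Binet on the levels below N, and N → ∞. Summability over eigenstates has to be
assumed, as convergence along this one exhaustion would not provide it. -/
lemma tsum_det_levels {n : ℕ} {a b : Fin n → ℕ → ℝ} (hs : ∀ i j, Summable fun k => a i k * b j k)
    (hd : Summable fun k : Eigenstate n => (Matrix.of fun i j => ∑ l ∈ levels k, a i l * b j l).det) :
    ∑' k : Eigenstate n, (Matrix.of fun i j => ∑ l ∈ levels k, a i l * b j l).det =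
      (Matrix.of fun i j => ∑' k, a i k * b j k).det := by
  have h1 := tendsto_sum_powersetCard
    (g := fun S => (Matrix.of fun i j => ∑ l ∈ S, a i l * b j l).det) hd.hasSum
  simp only [← det_sum_mul_eq] at h1
  refine tendsto_nhds_unique h1 ?_
  have hc : Continuous fun M : Matrix (Fin n) (Fin n) ℝ => M.det := continuous_id.matrix_det
  refine (hc.tendsto _).comp ?_
  refine tendsto_pi_nhds.2 fun i => tendsto_pi_nhds.2 fun j => ?_
  exact (hs i j).hasSum.tendsto_sum_nat

/-! ### Determinants over all slots -/

lemma det_prod_of_upper {p n : ℕ} {M : Matrix (Fin p × Fin n) (Fin p × Fin n) ℝ}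
    (h : ∀ a b, b.1 < a.1 → M a b = 0) :
    M.det = ∏ l, (Matrix.of fun i j => M (l, i) (l, j)).det := by
  have hb : M.BlockTriangular Prod.fst := fun a b => h a b
  rw [hb.det_fintype]
  refine Finset.prod_congr rfl fun l _ => ?_
  let e : Fin n ≃ {a : Fin p × Fin n // a.1 = l} :=
    { toFun := fun i => ⟨(l, i), rfl⟩
      invFun := fun a => a.1.2
      left_inv := fun _ => rfl
      right_inv := fun a => Subtype.ext (Prod.ext a.2.symm rfl) }
  rw [← Matrix.det_submatrix_equiv_self e]
  rfl

/-- In blocks indexed by times, the kernel matrix is ΦΨ - E with E strictly upper triangular. After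
moving the last block of rows to the top it factors as AB. Here A has the blocks Φ in its first
column and identities on the rest of the diagonal; B has the blocks Ψ in its first row, and below
them the rows of -E shifted down by one. So A is block lower and B block upper triangular, and only
Φ at the last time, Ψ at the first time and the steps E(s_l, s_{l+1}) enter the determinants. The
sign of the cyclic shift cancels the signs of the blocks -E. -/
lemma levelDet_slots {n P : ℕ} (k : Eigenstate n) {s : Fin (P + 1) → ℝ} (hs : StrictMono s)
    (x : Fin (P + 1) → Fin n → ℝ) :
    levelDet (levels k) (fun a : Fin (P + 1) × Fin n => s a.1) (fun a => x a.1 a.2) =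
      (Matrix.of fun i j => ∑ a ∈ levels k, phi a (x (Fin.last P) i) * phi a (x 0 j) *
        Real.exp ((a : ℝ) * (s (Fin.last P) - s 0))).det *
      ∏ l : Fin P, (Matrix.of fun i j =>
        termE (x l.castSucc i) (x l.succ j) (s l.castSucc) (s l.succ)).det := by
  set Φ : Fin (P + 1) → Fin n → Fin n → ℝ := fun l i a =>
    phi (k.1 a) (x l i) * Real.exp (k.1 a * s l) with hΦ
  set Ψ : Fin n → Fin (P + 1) → Fin n → ℝ := fun a l j =>
    phi (k.1 a) (x l j) * Real.exp (-(k.1 a * s l)) with hΨ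
  have hexp : ∀ l l' i j, ∑ a, Φ l i a * Ψ a l' j =
      ∑ a ∈ levels k, phi a (x l i) * phi a (x l' j) * Real.exp ((a : ℝ) * (s l - s l')) := by
    intro l l' i j
    rw [levels, Finset.sum_map]
    refine Finset.sum_congr rfl fun a _ => ?_
    simp only [hΦ, hΨ, Function.Embedding.coeFn_mk]
    rw [mul_sub, sub_eq_add_neg, Real.exp_add]
    ring
  set M := levelMatrix (levels k) (fun a : Fin (P + 1) × Fin n => s a.1) (fun a => x a.1 a.2) with hM
  have hMe : ∀ l i l' j, M (l, i) (l', j) = ∑ a, Φ l i a * Ψ a l' j -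
      termE (x l i) (x l' j) (s l) (s l') := by
    intro l i l' j
    rw [hexp, hM, levelMatrix, Matrix.of_apply, levelKernel_eq]
  set A : Matrix (Fin (P + 1) × Fin n) (Fin (P + 1) × Fin n) ℝ := Matrix.of fun a b =>
    Fin.cases (motive := fun _ => ℝ) (if b.1 = 0 then Φ (Fin.last P) a.2 b.2 else 0)
      (fun l => if b.1 = 0 then Φ l.castSucc a.2 b.2 else if b.1 = l.succ ∧ b.2 = a.2 then 1 else 0)
      a.1 with hA
  set B : Matrix (Fin (P + 1) × Fin n) (Fin (P + 1) × Fin n) ℝ := Matrix.of fun a b =>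
    Fin.cases (motive := fun _ => ℝ) (Ψ a.2 b.1 b.2)
      (fun l => -termE (x l.castSucc a.2) (x b.1 b.2) (s l.castSucc) (s b.1)) a.1 with hB
  set π : Equiv.Perm (Fin (P + 1) × Fin n) :=
    Equiv.prodCongrLeft fun _ : Fin n => (finRotate (P + 1)).symm with hπ
  have hrot : ∀ l : Fin P, (finRotate (P + 1)).symm l.succ = l.castSucc := by
    intro l
    rw [Equiv.symm_apply_eq, Fin.ext_iff, coe_finRotate_of_ne_last (Fin.castSucc_lt_last l).ne]
    simp
  have hrot0 : (finRotate (P + 1)).symm 0 = Fin.last P := by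
    rw [Equiv.symm_apply_eq, finRotate_last]
  have hA0 : ∀ i l' j, A (0, i) (l', j) = if l' = 0 then Φ (Fin.last P) i j else 0 :=
    fun _ _ _ => rfl
  have hAs : ∀ l i l' j, A (Fin.succ l, i) (l', j) =
      if l' = 0 then Φ l.castSucc i j else if l' = l.succ ∧ j = i then 1 else 0 := fun _ _ _ _ => rfl
  have hB0 : ∀ i l' j, B (0, i) (l', j) = Ψ i l' j := fun _ _ _ => rfl
  have hBs : ∀ l i l' j, B (Fin.succ l, i) (l', j) =
      -termE (x l.castSucc i) (x l' j) (s l.castSucc) (s l') := fun _ _ _ _ => rfl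
  clear_value A B
  have hMAB : M.submatrix π id = A * B := by
    ext ⟨l, i⟩ ⟨l', j⟩
    rw [Matrix.mul_apply, Fintype.sum_prod_type, Fin.sum_univ_succ, Matrix.submatrix_apply]
    refine Fin.cases ?_ (fun l => ?_) l
    · have : π (0, i) = (Fin.last P, i) := Prod.ext hrot0 rfl
      rw [this, id, hMe]
      have hE : termE (x (Fin.last P) i) (x l' j) (s (Fin.last P)) (s l') = 0 := by
        rw [termE, if_neg (not_lt.2 (hs.monotone (Fin.le_last l')))]
      simp [hA0, hB0, hE, Fin.succ_ne_zero]
    · have : π (l.succ, i) = (l.castSucc, i) := Prod.ext (hrot l) rfl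
      rw [this, id, hMe]
      simp [hAs, hB0, hBs, Fin.succ_ne_zero, ite_and, Finset.sum_ite_eq, sub_eq_add_neg]
  have hdA : A.det = (Matrix.of fun i a => Φ (Fin.last P) i a).det := by
    rw [← Matrix.det_transpose, det_prod_of_upper, Fin.prod_univ_succ, Finset.prod_eq_one, mul_one]
    · rw [← Matrix.det_transpose]
      congr 1
      ext i j
      simp [hA0]
    · intro l _
      rw [← Matrix.det_one (n := Fin n) (R := ℝ)]
      congr 1
      ext i j
      simp [hAs, Fin.succ_ne_zero, Matrix.one_apply]
    · rintro ⟨l, i⟩ ⟨l', j⟩ hll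
      dsimp only at hll
      rw [Matrix.transpose_apply]
      have hl0 : l ≠ 0 := (Fin.zero_le l' |>.trans_lt hll).ne'
      obtain rfl | ⟨l', rfl⟩ := Fin.eq_zero_or_eq_succ l'
      · simp [hA0, hl0]
      · simp [hAs, hl0, hll.ne']
  have hdB : B.det = (Matrix.of fun a j => Ψ a 0 j).det * ∏ l : Fin P, ((-1) ^ n *
      (Matrix.of fun i j => termE (x l.castSucc i) (x l.succ j) (s l.castSucc) (s l.succ)).det) := by
    rw [det_prod_of_upper, Fin.prod_univ_succ]
    · simp only [hB0]
      congr 1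
      refine Finset.prod_congr rfl fun l _ => ?_
      have := Matrix.det_neg (Matrix.of fun i j : Fin n =>
        termE (x l.castSucc i) (x l.succ j) (s l.castSucc) (s l.succ))
      rw [Fintype.card_fin] at this
      rw [← this]
      congr 1
      ext i j
      simp [hBs]
    · rintro ⟨l, i⟩ ⟨l', j⟩ hll
      dsimp only at hll
      obtain rfl | ⟨l, rfl⟩ := Fin.eq_zero_or_eq_succ l
      · exact absurd hll (Fin.not_lt_zero _)
      · have : l' ≤ l.castSucc := by
          rw [Fin.le_castSucc_iff]; exact hll
        simp [hBs, termE, not_lt.2 (hs.monotone this)]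
  have hsign : (Equiv.Perm.sign π : ℤ) = ((-1) ^ P) ^ n := by
    rw [hπ, Equiv.Perm.sign_prodCongrLeft]
    simp [Equiv.Perm.sign_symm, sign_finRotate]
  have hdet : ((-1 : ℝ) ^ P) ^ n * M.det = A.det * B.det := by
    rw [← Matrix.det_mul, ← hMAB, Matrix.det_permute, hsign]
    push_cast
    rfl
  have hsq' : ((-1 : ℝ) ^ P) ^ n ≠ 0 := by positivity
  have hprod : (Matrix.of fun i j => ∑ a ∈ levels k, phi a (x (Fin.last P) i) * phi a (x 0 j) *
        Real.exp ((a : ℝ) * (s (Fin.last P) - s 0))).det =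
      (Matrix.of fun i a => Φ (Fin.last P) i a).det * (Matrix.of fun a j => Ψ a 0 j).det := by
    rw [← Matrix.det_mul]
    congr 1
    ext i j
    rw [Matrix.of_apply, ← hexp, Matrix.mul_apply]
    rfl
  change M.det = _
  rw [hdA, hdB, Finset.prod_mul_distrib, Finset.prod_const, Finset.card_univ, Fintype.card_fin]
    at hdet
  rw [hprod]
  apply mul_left_cancel₀ hsq'
  rw [hdet]
  have hsq2 : ((-1 : ℝ) ^ n) ^ P = ((-1 : ℝ) ^ P) ^ n := by rw [← pow_mul, ← pow_mul, mul_comm]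
  rw [hsq2]
  ring

/-- The joint density of all particles is the thermal average of the level determinants. -/
lemma multiDensity_eq {T : ℝ} (hT : 0 < T) {n p : ℕ} (hp : p ≠ 0) {s : Fin p → ℝ} (hs : StrictMono s)
    (hs0 : ∀ l, s l ∈ Set.Ico 0 (1 / T)) (x : Fin p → Fin n → ℝ) :
    multiDensity T s x = 1 / (n.factorial : ℝ) ^ p *
      corrSum (boltz T) n (fun a : Fin p × Fin n => s a.1) (fun a => x a.1 a.2) := by
  obtain ⟨P, rfl⟩ := Nat.exists_eq_succ_of_ne_zero hp
  simp only [Nat.succ_eq_add_one] at *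
  set q := boltz T with hq
  have hq0 : 0 < q := boltz_pos T
  obtain ⟨ρ, r, hqρ, hρ1, hr, hr1, ht⟩ := exists_timeBound hT (t := fun a : Fin (P + 1) × Fin n => s a.1)
    fun a => hs0 a.1
  have hsum := hasSum_corrSum (n := n) hq0 hqρ hρ1 hr hr1 ht fun a => x a.1 a.2
  -- The time that closes the period: q^k e^{k(s_last - s_0)} = e^{-kt}, so the Boltzmann factor
  -- becomes the propagation from the last time back to the first.
  set t := 1 / T - (s (Fin.last P) - s 0) with htdef
  have ht0 : 0 < t := by
    have := (hs0 (Fin.last P)).2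
    have := (hs0 0).1
    linarith
  set E := ∏ l : Fin P, (Matrix.of fun i j =>
    termE (x l.castSucc i) (x l.succ j) (s l.castSucc) (s l.succ)).det with hE
  set a : Fin n → ℕ → ℝ := fun i k => phi k (x (Fin.last P) i) * Real.exp (-(k * t)) with ha
  set b : Fin n → ℕ → ℝ := fun j k => phi k (x 0 j) with hb
  have hterm : ∀ k : Eigenstate n, q ^ (∑ i, k.1 i) *
      levelDet (levels k) (fun a : Fin (P + 1) × Fin n => s a.1) (fun a => x a.1 a.2) =
      (Matrix.of fun i j => ∑ l ∈ levels k, a i l * b j l).det * E := by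
    intro k
    rw [levelDet_slots k hs x, ← mul_assoc]
    congr 1
    have h1 : ∀ u : Fin n → ℕ → ℝ, (Matrix.of fun i j => ∑ l ∈ levels k, u i l * b j l).det =
        (Matrix.of fun i c => u i (k.1 c)).det * (Matrix.of fun c j => b j (k.1 c)).det := by
      intro u
      rw [← Matrix.det_mul]
      congr 1
      ext i j
      rw [Matrix.of_apply, levels, Finset.sum_map, Matrix.mul_apply]
      rfl
    have h2 : ∀ i j, ∑ l ∈ levels k, phi l (x (Fin.last P) i) * phi l (x 0 j) *
        Real.exp ((l : ℝ) * (s (Fin.last P) - s 0)) = ∑ l ∈ levels k, (phi l (x (Fin.last P) i) *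
          Real.exp ((l : ℝ) * (s (Fin.last P) - s 0))) * b j l := fun i j =>
      Finset.sum_congr rfl fun l _ => by simp only [hb]; ring
    simp only [h2]
    rw [h1 a, h1 fun i l => phi l (x (Fin.last P) i) * Real.exp ((l : ℝ) * (s (Fin.last P) - s 0)),
      ← mul_assoc, ← Finset.prod_pow_eq_pow_sum, ← Matrix.det_mul_row]
    congr 2
    ext i c
    simp only [Matrix.of_apply, ha, hq, boltz]
    rw [← Real.exp_nat_mul, mul_left_comm, ← Real.exp_add]
    congr 2
    rw [htdef]
    ring
  have hsab : ∀ i j, Summable fun k => a i k * b j k := by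
    intro i j
    refine (summable_phi_mul_phi (x (Fin.last P) i) (x 0 j) (r := Real.exp (-t)) (Real.exp_pos _)
      (by rw [Real.exp_lt_one_iff]; linarith)).congr fun k => ?_
    simp only [ha, hb]
    rw [← Real.exp_nat_mul]
    ring_nf
  have hmeh : ∀ i j, ∑' k, a i k * b j k = propagator (x 0 j) t (x (Fin.last P) i) := by
    intro i j
    unfold propagator
    congr 1
    ext k
    simp only [ha, hb]
    ring
  simp only [hterm] at hsum
  have hE0 : corrSum q n (fun a : Fin (P + 1) × Fin n => s a.1) (fun a => x a.1 a.2) =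
      q ^ ((n : ℝ) / 2) / partitionFn q n *
        ((Matrix.of fun i j => propagator (x 0 j) t (x (Fin.last P) i)).det * E) := by
    -- Summability of the first determinants is deduced from that of the full terms by dividing by
    -- E.
    by_cases hEz : E = 0
    · simp only [hEz, mul_zero] at hsum
      rw [hsum.unique hasSum_zero, hEz]; simp
    · have hc : q ^ ((n : ℝ) / 2) / partitionFn q n ≠ 0 := by
        rw [rpow_div_partitionFn hq0]
        exact (inv_pos.2 (esum_pos hq0 (hqρ.trans hρ1) n)).ne'
      have hd := (summable_mul_right_iff hEz).1 ((summable_mul_left_iff hc).1 hsum.summable)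
      rw [← hsum.tsum_eq, tsum_mul_left, tsum_mul_right, tsum_det_levels hsab hd]
      simp only [hmeh]
  rw [multiDensity, hE0, Fin.prod_univ_castSucc, hE]
  have hinc : ∀ l : Fin P, finRotate (P + 1) l.castSucc = l.succ := by
    intro l
    rw [Fin.ext_iff, coe_finRotate_of_ne_last (Fin.castSucc_lt_last l).ne]
    simp
  have h1 : ∀ l : Fin P, (Matrix.of fun j k : Fin n => propagator (x (finRotate (P + 1) l.castSucc) j)
      (increment (1 / T) s l.castSucc) (x l.castSucc k)).det =
      (Matrix.of fun i j => termE (x l.castSucc i) (x l.succ j) (s l.castSucc) (s l.succ)).det := by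
    intro l
    have hlt : s l.castSucc < s l.succ := hs Fin.castSucc_lt_succ
    rw [← Matrix.det_transpose, hinc, increment, hinc, if_pos hlt]
    congr 1
    ext i j
    simp only [Matrix.transpose_apply, Matrix.of_apply]
    rw [propagator_eq, termE_eq, if_pos hlt, neg_sub]
  have h2 : (Matrix.of fun j k : Fin n => propagator (x (finRotate (P + 1) (Fin.last P)) j)
      (increment (1 / T) s (Fin.last P)) (x (Fin.last P) k)).det =
      (Matrix.of fun i j => propagator (x 0 j) t (x (Fin.last P) i)).det := by
    rw [← Matrix.det_transpose, increment, finRotate_last,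
      if_neg (not_lt.2 (hs.monotone (Fin.zero_le _)))]
    rfl
  simp only [h1, h2]
  ring

/-! ### Marginals over a subfamily of slots -/

/-- An injection `f` and the complement of its range exhaust `ι`. -/
def sumComplEquiv {ι κ : Type*} {f : κ → ι} (hf : Function.Injective f) {p : ι → Prop}
    (hp : ∀ a, p a ↔ ∃ i, f i = a) : κ ⊕ {a // ¬ p a} ≃ ι :=
  Equiv.ofBijective (Sum.elim f Subtype.val) (by
    constructor
    · rintro (a | a) (b | b) h
      · exact congrArg _ (hf h)
      · exact absurd ((hp _).2 ⟨a, h⟩) b.2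
      · exact absurd ((hp _).2 ⟨b, h.symm⟩) a.2
      · exact congrArg _ (Subtype.ext h)
    · intro a
      by_cases h : p a
      · exact ⟨Sum.inl ((hp a).1 h).choose, ((hp a).1 h).choose_spec⟩
      · exact ⟨Sum.inr ⟨a, h⟩, rfl⟩)

lemma coe_sumComplEquiv {ι κ : Type*} {f : κ → ι} (hf : Function.Injective f) {p : ι → Prop}
    (hp : ∀ a, p a ↔ ∃ i, f i = a) : ⇑(sumComplEquiv hf hp) = Sum.elim f Subtype.val := rfl

section

variable {ι κ C : Type*} [Fintype ι] [Fintype κ] [Fintype C]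

lemma sumElim_comp_symm_eq (e : κ ⊕ C ≃ ι) :
    (fun p : (κ → ℝ) × (C → ℝ) => (Sum.elim p.1 p.2 ∘ e.symm : ι → ℝ)) =
      MeasurableEquiv.piCongrLeft (fun _ : ι => ℝ) e ∘
        (MeasurableEquiv.sumPiEquivProdPi fun _ : κ ⊕ C => ℝ).symm := by
  funext p i
  obtain ⟨j, rfl⟩ := e.surjective i
  rcases j with i | i <;>
  simp [MeasurableEquiv.coe_piCongrLeft, Equiv.piCongrLeft_apply_apply,
    MeasurableEquiv.coe_sumPiEquivProdPi_symm]

lemma measurePreserving_sumElim (e : κ ⊕ C ≃ ι) : MeasurePreserving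
    (fun p : (κ → ℝ) × (C → ℝ) => (Sum.elim p.1 p.2 ∘ e.symm : ι → ℝ)) := by
  rw [sumElim_comp_symm_eq]
  exact (volume_measurePreserving_piCongrLeft (fun _ : ι => ℝ) e).comp
    (volume_measurePreserving_sumPiEquivProdPi_symm (fun _ : κ ⊕ C => ℝ))

lemma measurableEmbedding_sumElim (e : κ ⊕ C ≃ ι) : MeasurableEmbedding
    (fun p : (κ → ℝ) × (C → ℝ) => (Sum.elim p.1 p.2 ∘ e.symm : ι → ℝ)) := by
  rw [sumElim_comp_symm_eq]
  exact (MeasurableEquiv.piCongrLeft (fun _ : ι => ℝ) e).measurableEmbedding.comp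
    (MeasurableEquiv.sumPiEquivProdPi (fun _ : κ ⊕ C => ℝ)).symm.measurableEmbedding

lemma integral_eq_integral_sumElim (e : κ ⊕ C ≃ ι) {G : (ι → ℝ) → ℝ} (hG : Integrable G) :
    ∫ y, G y = ∫ x : κ → ℝ, ∫ w : C → ℝ, G (Sum.elim x w ∘ e.symm) := by
  rw [← (measurePreserving_sumElim e).integral_comp (measurableEmbedding_sumElim e),
    Measure.volume_eq_prod, integral_prod]
  rw [← Measure.volume_eq_prod]
  exact ((measurePreserving_sumElim e).integrable_comp_emb (measurableEmbedding_sumElim e)).2 hG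

/-- The marginal over the complement of an injection, tested against a bounded function. -/
lemma integral_comp_injective_mul {f : κ → ι} (hf : Function.Injective f)
    {p : ι → Prop} (hp : ∀ a, p a ↔ ∃ i, f i = a) [Fintype {a // ¬ p a}]
    {D : (ι → ℝ) → ℝ} (hD : Integrable D) {g : (κ → ℝ) → ℝ} (hg : Measurable g)
    (hg1 : ∀ x, |g x| ≤ 1) :
    ∫ y, g (y ∘ f) * D y = ∫ x, g x * ∫ w, D (Sum.elim x w ∘ (sumComplEquiv hf hp).symm) := by
  have hmeas : Measurable fun y : ι → ℝ => g (y ∘ f) :=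
    hg.comp (measurable_pi_lambda _ fun i => measurable_pi_apply _)
  rw [integral_eq_integral_sumElim (sumComplEquiv hf hp)]
  · congr 1
    ext x
    rw [← integral_const_mul]
    congr 1
    ext w
    congr 2
    ext i
    have : (sumComplEquiv hf hp).symm (f i) = Sum.inl i := by
      rw [Equiv.symm_apply_eq]; rfl
    simp [this]
  · refine hD.norm.mono' (hmeas.aestronglyMeasurable.mul hD.1)
      (Filter.Eventually.of_forall fun y => ?_)
    rw [norm_mul]
    exact mul_le_of_le_one_left (norm_nonneg _) (hg1 _)

end

section Marginal

variable {q ρ r : ℝ} {n : ℕ} {ι κ : Type*} [Fintype ι] [DecidableEq ι] [Fintype κ] [DecidableEq κ]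

lemma sumElim_elim0 (t : κ → ℝ) : (Sum.elim (fun i : Fin 0 => i.elim0) t : Fin 0 ⊕ κ → ℝ) =
    t ∘ Equiv.emptySum (Fin 0) κ := by
  ext i
  rcases i with i | i
  · exact i.elim0
  · rfl

lemma integrable_levelDet (hρ : 0 < ρ) (hρ1 : ρ < 1) (hr : 0 < r) (hr1 : r < 1)
    {t : κ → ℝ} (ht : TimeBound ρ r t) (S : Finset ℕ) : Integrable (levelDet S t) := by
  have h := integrable_levelDet_sumElim hρ hρ1 hr hr1 (t := fun i : Fin 0 => i.elim0) (u := t)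
    (by rw [sumElim_elim0]; exact ht.comp _) S (fun i : Fin 0 => i.elim0)
  simpa only [sumElim_elim0, levelDet_comp_equiv] using h

lemma integrable_corrSum (hq : 0 < q) (hqρ : q < ρ) (hρ1 : ρ < 1) (hr : 0 < r) (hr1 : r < 1)
    {t : κ → ℝ} (ht : TimeBound ρ r t) : Integrable (corrSum q n t) := by
  have h := integrable_corrSum_sumElim (n := n) hq hqρ hρ1 hr hr1 (t := fun i : Fin 0 => i.elim0) (u := t)
    (by rw [sumElim_elim0]; exact ht.comp _) (fun i : Fin 0 => i.elim0)
  simpa only [sumElim_elim0, corrSum_comp_equiv] using h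

lemma hasSum_integral_mul_corrSum (hq : 0 < q) (hqρ : q < ρ) (hρ1 : ρ < 1) (hr : 0 < r) (hr1 : r < 1)
    {t : κ → ℝ} (ht : TimeBound ρ r t) {g : (κ → ℝ) → ℝ}
    (hg : Measurable g) (hg1 : ∀ w, |g w| ≤ 1) :
    HasSum (fun k : Eigenstate n => q ^ ((n : ℝ) / 2) / partitionFn q n *
      (q ^ (∑ i, k.1 i) * ∫ w : κ → ℝ, g w * levelDet (levels k) t w))
      (∫ w : κ → ℝ, g w * corrSum q n t w) := by
  have h := hasSum_integral_corrSum (n := n) hq hqρ hρ1 hr hr1 (t := fun i : Fin 0 => i.elim0) (u := t)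
    (by rw [sumElim_elim0]; exact ht.comp _) (fun i : Fin 0 => i.elim0) hg hg1
  simpa only [sumElim_elim0, levelDet_comp_equiv, corrSum_comp_equiv] using h

lemma comp_sumComplEquiv {f : κ → ι} (hf : Function.Injective f) {p : ι → Prop}
    (hp : ∀ a, p a ↔ ∃ i, f i = a) (t : ι → ℝ) :
    t ∘ sumComplEquiv hf hp = Sum.elim (t ∘ f) fun a => t a.1 := by
  rw [coe_sumComplEquiv]
  ext i
  rcases i with i | i <;> rfl

lemma placements_mul_integral_comp_levelDet (hρ : 0 < ρ) (hρ1 : ρ < 1) (hr : 0 < r) (hr1 : r < 1)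
    {t : ι → ℝ} (ht : TimeBound ρ r t) (S : Finset ℕ) {f : κ → ι} (hf : Function.Injective f)
    {g : (κ → ℝ) → ℝ} (hg : Measurable g) (hg1 : ∀ x, |g x| ≤ 1) :
    placements S.card (t ∘ f) * ∫ y, g (y ∘ f) * levelDet S t y =
      placements S.card t * ∫ x, g x * levelDet S (t ∘ f) x := by
  classical
  have hp : ∀ a, (fun a => ∃ i, f i = a) a ↔ ∃ i, f i = a := fun _ => Iff.rfl
  rw [integral_comp_injective_mul hf hp (integrable_levelDet hρ hρ1 hr hr1 ht S) hg hg1,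
    ← integral_const_mul, ← integral_const_mul]
  congr 1
  ext x
  have ht' := ht.comp (sumComplEquiv hf hp)
  rw [comp_sumComplEquiv] at ht'
  have h := placements_mul_integral_levelDet hρ hρ1 hr hr1 S x ht'
  rw [← comp_sumComplEquiv hf hp, placements_comp_equiv] at h
  rw [mul_left_comm, mul_left_comm (placements _ t : ℝ), ← h]
  congr 3
  ext w
  rw [← levelDet_comp_equiv (sumComplEquiv hf hp), Function.comp_assoc, Equiv.symm_comp_self,
    Function.comp_id]

lemma placements_mul_integral_compl_corrSum (hq : 0 < q) (hqρ : q < ρ) (hρ1 : ρ < 1) (hr : 0 < r)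
    (hr1 : r < 1) {t : ι → ℝ} (ht : TimeBound ρ r t) {f : κ → ι} (hf : Function.Injective f)
    {p : ι → Prop} (hp : ∀ a, p a ↔ ∃ i, f i = a) [Fintype {a // ¬ p a}] (x : κ → ℝ) :
    placements n (t ∘ f) * ∫ w, corrSum q n t (Sum.elim x w ∘ (sumComplEquiv hf hp).symm) =
      placements n t * corrSum q n (t ∘ f) x := by
  classical
  have ht' := ht.comp (sumComplEquiv hf hp)
  rw [comp_sumComplEquiv] at ht'
  have h := placements_mul_integral_corrSum (n := n) hq hqρ hρ1 hr hr1 ht' x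
  rw [← comp_sumComplEquiv hf hp, placements_comp_equiv] at h
  rw [← h]
  congr 2
  ext w
  rw [← corrSum_comp_equiv (sumComplEquiv hf hp), Function.comp_assoc, Equiv.symm_comp_self,
    Function.comp_id]

lemma placements_mul_integral_comp_corrSum (hq : 0 < q) (hqρ : q < ρ) (hρ1 : ρ < 1) (hr : 0 < r)
    (hr1 : r < 1) {t : ι → ℝ} (ht : TimeBound ρ r t) {f : κ → ι} (hf : Function.Injective f)
    {g : (κ → ℝ) → ℝ} (hg : Measurable g) (hg1 : ∀ x, |g x| ≤ 1) :
    placements n (t ∘ f) * ∫ y, g (y ∘ f) * corrSum q n t y =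
      placements n t * ∫ x, g x * corrSum q n (t ∘ f) x := by
  classical
  rw [integral_comp_injective_mul hf (fun _ => Iff.rfl) (integrable_corrSum hq hqρ hρ1 hr hr1 ht) hg hg1,
    ← integral_const_mul, ← integral_const_mul]
  congr 1
  ext x
  rw [mul_left_comm, mul_left_comm (placements _ t : ℝ),
    placements_mul_integral_compl_corrSum hq hqρ hρ1 hr hr1 ht hf fun _ => Iff.rfl]

end Marginal

/-! ### Correlation functions of free fermions -/

lemma times_timeIndex {m : ℕ} (τ : Fin m → ℝ) (i : Fin m) : times τ (timeIndex τ i) = τ i := by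
  have := ((timeSet τ).orderIsoOfFin rfl).apply_symm_apply
    ⟨τ i, Finset.mem_image_of_mem τ (Finset.mem_univ i)⟩
  exact congrArg Subtype.val this

lemma times_strictMono {m : ℕ} (τ : Fin m → ℝ) : StrictMono (times τ) :=
  ((timeSet τ).orderEmbOfFin rfl).strictMono

lemma times_mem {m : ℕ} (τ : Fin m → ℝ) (l : Fin (timeSet τ).card) : ∃ i, τ i = times τ l := by
  have := Finset.orderEmbOfFin_mem (timeSet τ) rfl l
  obtain ⟨i, -, hi⟩ := Finset.mem_image.1 this
  exact ⟨i, hi⟩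

lemma card_timeSet_ne_zero {m : ℕ} (hm : 1 ≤ m) (τ : Fin m → ℝ) : (timeSet τ).card ≠ 0 := by
  rw [Finset.card_ne_zero]
  exact ⟨τ ⟨0, hm⟩, Finset.mem_image_of_mem τ (Finset.mem_univ _)⟩

lemma slot_injective {m n : ℕ} {τ : Fin m → ℝ} {j : Fin m → Fin n}
    (hj : Function.Injective fun i => (τ i, j i)) :
    Function.Injective fun i => (timeIndex τ i, j i) := by
  intro a b h
  simp only [Prod.mk.injEq] at h
  apply hj
  simp only [Prod.mk.injEq]
  exact ⟨by rw [← times_timeIndex τ a, h.1, times_timeIndex], h.2⟩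

lemma isSlot_iff {m n : ℕ} (τ : Fin m → ℝ) (j : Fin m → Fin n) (a : Fin (timeSet τ).card × Fin n) :
    IsSlot τ j a ↔ ∃ i, (timeIndex τ i, j i) = a := Iff.rfl

lemma fill_eq {m n : ℕ} {τ : Fin m → ℝ} {j : Fin m → Fin n}
    (hj : Function.Injective fun i => (τ i, j i)) (x : Fin m → ℝ) (w : {a // ¬ IsSlot τ j a} → ℝ)
    (a : Fin (timeSet τ).card × Fin n) : fill τ j x w a.1 a.2 =
      (Sum.elim x w ∘ (sumComplEquiv (slot_injective hj) (isSlot_iff τ j)).symm) a := by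
  obtain ⟨b, rfl⟩ := (sumComplEquiv (slot_injective hj) (isSlot_iff τ j)).surjective a
  rw [Function.comp_apply, Equiv.symm_apply_apply]
  rcases b with i | a
  · have h : IsSlot τ j (timeIndex τ i, j i) := ⟨i, rfl⟩
    change fill τ j x w (timeIndex τ i) (j i) = x i
    rw [fill, dif_pos h]
    congr 1
    exact slot_injective hj h.choose_spec
  · change fill τ j x w a.1.1 a.1.2 = w a
    rw [fill, dif_neg a.2]

/-- Each admissible choice of labels contributes the same marginal, `corrSum` divided by the number
of choices. If no choice is admissible, some time is overfull, and `corrSum` vanishes as well. -/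
lemma fermionCorr_eq {T : ℝ} (hT : 0 < T) {n m : ℕ} (hm : 1 ≤ m) {τ : Fin m → ℝ}
    (hτ : ∀ i, τ i ∈ Set.Ico 0 (1 / T)) (x : Fin m → ℝ) :
    fermionCorr T n τ x = corrSum (boltz T) n τ x := by
  classical
  have hs0 : ∀ l, times τ l ∈ Set.Ico 0 (1 / T) := fun l => by
    obtain ⟨i, hi⟩ := times_mem τ l
    rw [← hi]; exact hτ i
  obtain ⟨ρ, r, hqρ, hρ1, hr, hr1, ht⟩ := exists_timeBound hT
    (t := fun a : Fin (timeSet τ).card × Fin n => times τ a.1) fun a => hs0 a.1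
  have hfac : ((n.factorial : ℝ) ^ (timeSet τ).card) ≠ 0 := by positivity
  have h : ∀ j : Fin m → Fin n, Function.Injective (fun i => (τ i, j i)) →
      (placements n τ : ℝ) * ∫ w : {a // ¬ IsSlot τ j a} → ℝ, multiDensity T (times τ) (fill τ j x w) =
        corrSum (boltz T) n τ x := by
    intro j hj
    have e : (fun a : Fin (timeSet τ).card × Fin n => times τ a.1) ∘
        (fun i => (timeIndex τ i, j i)) = τ := by
      ext i; exact times_timeIndex τ i
    have h1 := placements_mul_integral_compl_corrSum (n := n) (boltz_pos T) hqρ hρ1 hr hr1 ht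
      (slot_injective hj) (isSlot_iff τ j) x
    rw [e, placements_slots n (times_strictMono τ).injective] at h1
    simp only [multiDensity_eq hT (card_timeSet_ne_zero hm τ) (times_strictMono τ) hs0, fill_eq hj]
    rw [integral_const_mul, mul_left_comm]
    push_cast at h1
    refine (congrArg (fun y => 1 / (n.factorial : ℝ) ^ (timeSet τ).card * y) h1).trans ?_
    field_simp
  rw [fermionCorr]
  by_cases hW : placements n τ = 0
  · rw [corrSum_eq_zero _ _ hW, Finset.sum_eq_zero]
    intro j hj
    rw [placements, Nat.card_eq_zero] at hW
    rcases hW with hW | hW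
    · exact (hW.false ⟨j, by simpa using hj⟩).elim
    · exact (hW.not_finite inferInstance).elim
  · have hW' : (placements n τ : ℝ) ≠ 0 := Nat.cast_ne_zero.2 hW
    have hcard : (Finset.univ.filter fun j : Fin m → Fin n =>
        Function.Injective fun i => (τ i, j i)).card = placements n τ := by
      rw [placements, Nat.card_eq_fintype_card, Fintype.card_subtype]
    rw [Finset.sum_congr rfl (g := fun _ => (placements n τ : ℝ)⁻¹ * corrSum (boltz T) n τ x),
      Finset.sum_const, nsmul_eq_mul]
    · rw [← mul_assoc]
      have : ((Finset.univ.filter fun j : Fin m → Fin n =>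
        Function.Injective fun i => (τ i, j i)).card : ℝ) = placements n τ := by rw [hcard]
      convert one_mul _
      rw [← mul_inv_cancel₀ hW', ← this]
    · intro j hj
      rw [eq_inv_mul_iff_mul_eq₀ hW']
      convert h j (by simpa using hj)

/-- At coinciding times E is absent, and the kernel matrix of an eigenstate is the product of the
transposed Slater matrix with the Slater matrix. -/
lemma density_eq {q : ℝ} (hq : 0 < q) {n : ℕ} (x : Fin n → ℝ) :
    density q x = 1 / (n.factorial : ℝ) * corrSum q n (fun _ : Fin n => 0) x := by
  rw [density, corrSum, ← tsum_mul_left, ← tsum_mul_left]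
  congr 1
  ext k
  have h1 : levelDet (levels k) (fun _ : Fin n => (0 : ℝ)) x =
      (Matrix.of fun i j => phi (k.1 i) (x j)).det ^ 2 := by
    rw [sq]
    nth_rewrite 1 [← Matrix.det_transpose]
    rw [← Matrix.det_mul, levelDet]
    congr 1
    ext i j
    rw [Matrix.of_apply, levelKernel_eq, Matrix.mul_apply, termE, if_neg (lt_irrefl _), sub_zero,
      levels, Finset.sum_map]
    simp
  rw [h1, slater, mul_pow, div_pow, Real.sq_sqrt (by positivity), Real.rpow_add hq]
  have h2 : q ^ (∑ i, (k.1 i : ℝ)) = q ^ (∑ i, k.1 i) := by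
    rw [← Real.rpow_natCast]; push_cast; rfl
  rw [h2]
  ring

/-! ### Inclusion–exclusion over injections -/

lemma sum_embedding_prod {ι R : Type*} [Fintype ι] [DecidableEq ι] [CommRing R] (χ : ι → R) (l : ℕ) :
    ∑ e : Fin l ↪ ι, ∏ i, χ (e i) =
      (l.factorial : R) * ∑ t ∈ Finset.powersetCard l Finset.univ, ∏ a ∈ t, χ a := by
  rw [← Finset.sum_fiberwise_of_maps_to (t := Finset.powersetCard l Finset.univ)
    (g := fun e : Fin l ↪ ι => Finset.univ.map e), Finset.mul_sum]
  · refine Finset.sum_congr rfl fun t ht => ?_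
    rw [Finset.mem_powersetCard] at ht
    have h1 : ∀ e ∈ Finset.univ.filter fun e : Fin l ↪ ι => Finset.univ.map e = t,
        ∏ i, χ (e i) = ∏ a ∈ t, χ a := by
      intro e he
      rw [Finset.mem_filter] at he
      rw [← he.2, Finset.prod_map]
    rw [Finset.sum_congr rfl h1, Finset.sum_const, nsmul_eq_mul]
    congr 2
    rw [← Fintype.card_subtype]
    have e : {e : Fin l ↪ ι // Finset.univ.map e = t} ≃ (Fin l ↪ t) :=
      { toFun := fun e => ⟨fun i => ⟨e.1 i, by
            have h := Finset.mem_map_of_mem e.1 (Finset.mem_univ i)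
            rwa [e.2] at h⟩, fun a b h => by
            simpa using h⟩
        invFun := fun e => ⟨e.trans (Function.Embedding.subtype _), by
          refine Finset.eq_of_subset_of_card_le (fun a ha => ?_) (by simp [ht.2])
          obtain ⟨i, -, rfl⟩ := Finset.mem_map.1 ha
          exact (e i).2⟩
        left_inv := fun e => rfl
        right_inv := fun e => rfl }
    rw [Fintype.card_congr e, Fintype.card_embedding_eq, Fintype.card_coe, ht.2, Fintype.card_fin,
      Nat.descFactorial_self]
  · intro e _
    rw [Finset.mem_powersetCard]
    exact ⟨Finset.subset_univ _, by simp⟩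

/-- Inclusion–exclusion, with each l-element subset counted through its l! enumerations, so that the
coefficients are already those of a Fredholm series. -/
lemma prod_one_sub_eq {ι : Type*} [Fintype ι] [DecidableEq ι] (χ : ι → ℝ) :
    ∏ a, (1 - χ a) = ∑ l ∈ Finset.range (Fintype.card ι + 1),
      (-1) ^ l / (l.factorial : ℝ) * ∑ e : Fin l ↪ ι, ∏ i, χ (e i) := by
  simp only [sub_eq_add_neg]
  rw [Finset.prod_one_add, Finset.sum_powerset]
  refine Finset.sum_congr rfl fun l _ => ?_
  rw [sum_embedding_prod, Finset.mul_sum, Finset.mul_sum]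
  refine Finset.sum_congr rfl fun t ht => ?_
  rw [Finset.mem_powersetCard] at ht
  rw [Finset.prod_neg, ht.2]
  field_simp

lemma placements_eq_zero_of_lt {n l m : ℕ} {τ : Fin m → ℝ} (f : Fin l → Fin m) (h : m * n < l) :
    placements n (τ ∘ f) = 0 := by
  rw [placements, Nat.card_eq_zero]
  left
  constructor
  rintro ⟨j, hj⟩
  have : Function.Injective fun i => (f i, j i) := by
    intro a b hab
    simp only [Prod.mk.injEq] at hab
    apply hj
    simp [hab.1, hab.2]
  have := Fintype.card_le_of_injective _ this
  simp only [Fintype.card_fin, Fintype.card_prod] at this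
  omega

/-- Summation over injections into `Fin m × Fin n` with prescribed first components. -/
lemma sum_embedding_fst {n l m : ℕ} {τ : Fin m → ℝ} (hτ : Function.Injective τ)
    (F : (Fin l → Fin m) → ℝ) :
    ∑ e : Fin l ↪ Fin m × Fin n, F (fun i => (e i).1) =
      ∑ f : Fin l → Fin m, (placements n (τ ∘ f) : ℝ) * F f := by
  classical
  rw [← Finset.sum_fiberwise (g := fun (e : Fin l ↪ Fin m × Fin n) (i : Fin l) => (e i).1)]
  refine Finset.sum_congr rfl fun f _ => ?_
  rw [Finset.sum_congr rfl (g := fun _ => F f), Finset.sum_const, nsmul_eq_mul]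
  · congr 2
    rw [← Fintype.card_subtype, placements, ← Nat.card_eq_fintype_card]
    refine Nat.card_congr
      { toFun := fun e => ⟨fun i => (e.1 i).2, fun a b h => ?_⟩
        invFun := fun j => ⟨⟨fun i => (f i, j.1 i), fun a b h => j.2 ?_⟩, rfl⟩
        left_inv := fun e => ?_
        right_inv := fun j => rfl }
    · apply e.1.injective
      simp only [Function.comp_apply, Prod.mk.injEq] at h
      have h2 := hτ h.1
      rw [← e.2] at h2
      exact Prod.ext h2 h.2
    · simp only [Prod.mk.injEq] at h
      simp [h.1, h.2]
    · apply Subtype.ext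
      apply Function.Embedding.ext
      intro i
      exact Prod.ext (congrFun e.2 i).symm rfl
  · intro e he
    rw [Finset.mem_filter] at he
    rw [← he.2]

/-! ### Gap probabilities of one eigenstate -/

/-- The real version of `gapWeight`. -/
def gapInd {m : ℕ} (A : Fin m → Set ℝ) (k : Fin m) (y : ℝ) : ℝ :=
  (A k)ᶜ.indicator (fun _ => (1 : ℝ)) y

lemma gapWeight_eq {m : ℕ} (A : Fin m → Set ℝ) (b : ℝ × Fin m) :
    gapWeight A b = (gapInd A b.2 b.1 : ℂ) := by
  unfold gapWeight gapInd Set.indicator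
  split_ifs <;> simp

lemma measurable_gapInd {m : ℕ} {A : Fin m → Set ℝ} (hA : ∀ i, MeasurableSet (A i)) (k : Fin m) :
    Measurable (gapInd A k) := measurable_const.indicator (hA k).compl

lemma abs_gapInd_le {m : ℕ} (A : Fin m → Set ℝ) (k : Fin m) (y : ℝ) : |gapInd A k y| ≤ 1 := by
  unfold gapInd Set.indicator
  split_ifs <;> simp

lemma abs_prod_gapInd_le {m : ℕ} {κ : Type*} [Fintype κ] (A : Fin m → Set ℝ) (f : κ → Fin m)
    (x : κ → ℝ) : |∏ i, gapInd A (f i) (x i)| ≤ 1 := by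
  rw [Finset.abs_prod]
  exact Finset.prod_le_one (fun _ _ => abs_nonneg _) fun i _ => abs_gapInd_le A _ _

section Gap

variable {ρ r : ℝ} {m : ℕ} {τ : Fin m → ℝ} {A : Fin m → Set ℝ}

lemma measurable_prod_gapInd {κ : Type*} [Fintype κ] (hA : ∀ i, MeasurableSet (A i)) (f : κ → Fin m) :
    Measurable fun x : κ → ℝ => ∏ i, gapInd A (f i) (x i) :=
  Finset.measurable_fun_prod _ fun i _ => (measurable_gapInd hA _).comp (measurable_pi_apply i)

/-- Inclusion–exclusion over the particles found outside their sets. Each term involves only l slots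
and sees the corresponding marginal, which is (n!)^m divided by `placements` times a smaller
determinant. The sum over the labels for given times restores the factor `placements`. -/
lemma integral_prod_one_sub_gapInd (hρ : 0 < ρ) (hρ1 : ρ < 1) (hr : 0 < r) (hr1 : r < 1)
    (ht : TimeBound ρ r τ) (hτ : Function.Injective τ) (hA : ∀ i, MeasurableSet (A i))
    (S : Finset ℕ) :
    ∫ y : Fin m × Fin S.card → ℝ, (∏ a, (1 - gapInd A a.1 (y a))) * levelDet S (fun a => τ a.1) y =
      (S.card.factorial : ℝ) ^ m * ∑ l ∈ Finset.range (m * S.card + 1), (-1) ^ l / (l.factorial : ℝ) *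
        ∑ f : Fin l → Fin m, ∫ x : Fin l → ℝ, (∏ i, gapInd A (f i) (x i)) * levelDet S (τ ∘ f) x := by
  have ht' : TimeBound ρ r fun a : Fin m × Fin S.card => τ a.1 := ht.comp Prod.fst
  have hint : ∀ (l : ℕ) (e : Fin l ↪ Fin m × Fin S.card), Integrable
      fun y : Fin m × Fin S.card → ℝ =>
        (∏ i, gapInd A (e i).1 (y (e i))) * levelDet S (fun a => τ a.1) y := by
    intro l e
    refine (integrable_levelDet hρ hρ1 hr hr1 ht' S).norm.mono'
      (((measurable_prod_gapInd hA fun i => (e i).1).comp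
        (measurable_pi_lambda _ fun i => measurable_pi_apply (e i))).aestronglyMeasurable.mul
        (continuous_levelDet S _).aestronglyMeasurable) (Filter.Eventually.of_forall fun y => ?_)
    rw [norm_mul]
    exact mul_le_of_le_one_left (norm_nonneg _)
      (abs_prod_gapInd_le A (fun i => (e i).1) fun i => y (e i))
  have hexp : ∀ y : Fin m × Fin S.card → ℝ,
      (∏ a, (1 - gapInd A a.1 (y a))) * levelDet S (fun a => τ a.1) y =
      ∑ l ∈ Finset.range (m * S.card + 1), (-1) ^ l / (l.factorial : ℝ) *
        ∑ e : Fin l ↪ Fin m × Fin S.card,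
          (∏ i, gapInd A (e i).1 (y (e i))) * levelDet S (fun a => τ a.1) y := by
    intro y
    have := prod_one_sub_eq fun a : Fin m × Fin S.card => gapInd A a.1 (y a)
    rw [this, Finset.sum_mul]
    simp only [Fintype.card_prod, Fintype.card_fin]
    refine Finset.sum_congr rfl fun l _ => ?_
    rw [mul_assoc, Finset.sum_mul]
  simp only [hexp]
  rw [integral_finsetSum _ fun l _ =>
    (integrable_finsetSum _ fun e _ => hint l e).const_mul _, Finset.mul_sum]
  refine Finset.sum_congr rfl fun l _ => ?_
  rw [integral_const_mul, integral_finsetSum _ fun e _ => hint l e, mul_left_comm]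
  congr 1
  set J : (Fin l → Fin m) → ℝ := fun f =>
    ∫ x : Fin l → ℝ, (∏ i, gapInd A (f i) (x i)) * levelDet S (τ ∘ f) x with hJ
  have hI : ∀ e : Fin l ↪ Fin m × Fin S.card,
      ∫ y : Fin m × Fin S.card → ℝ,
        (∏ i, gapInd A (e i).1 (y (e i))) * levelDet S (fun a => τ a.1) y =
      (S.card.factorial : ℝ) ^ m *
        ((placements S.card (τ ∘ fun i => (e i).1) : ℝ)⁻¹ * J fun i => (e i).1) := by
    intro e
    have h := placements_mul_integral_comp_levelDet hρ hρ1 hr hr1 ht' S e.injective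
      (measurable_prod_gapInd hA fun i => (e i).1) (abs_prod_gapInd_le A fun i => (e i).1)
    rw [placements_slots _ hτ] at h
    push_cast at h
    have hne : (placements S.card (τ ∘ fun i => (e i).1) : ℝ) ≠ 0 := by
      rw [Nat.cast_ne_zero, placements, Nat.card_ne_zero]
      refine ⟨⟨⟨fun i => (e i).2, fun a b hab => ?_⟩⟩, inferInstance⟩
      simp only [Function.comp_apply, Prod.mk.injEq] at hab
      exact e.injective (Prod.ext (hτ hab.1) hab.2)
    rw [mul_left_comm, eq_inv_mul_iff_mul_eq₀ hne]
    exact h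
  simp only [hI]
  rw [← Finset.mul_sum, sum_embedding_fst hτ
    (fun f => (placements S.card (τ ∘ f) : ℝ)⁻¹ * J f)]
  congr 1
  refine Finset.sum_congr rfl fun f _ => ?_
  -- When the l times cannot be filled there are no embeddings on one side, and the determinant
  -- vanishes on the other.
  by_cases hW : placements S.card (τ ∘ f) = 0
  · have : J f = 0 := by
      obtain ⟨s, hs⟩ := exists_card_of_placements_eq_zero hW
      simp only [hJ, levelDet_eq_zero S (τ ∘ f) _ s hs, mul_zero, integral_zero]
    rw [this]; simp
  · rw [mul_inv_cancel_left₀ (Nat.cast_ne_zero.2 hW)]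

/-- A point of l copies of ℝ × {1, …, m} consists of l positions and an assignment f of times;
integration against counting measure is the sum over f. The indicators multiply the columns and come
out of the determinant. -/
lemma fredholmTerm_levelKernel (hρ : 0 < ρ) (hρ1 : ρ < 1) (hr : 0 < r) (hr1 : r < 1)
    (ht : TimeBound ρ r τ) (hA : ∀ i, MeasurableSet (A i)) (S : Finset ℕ) (l : ℕ) :
    fredholmTerm (copies m) (fun a b =>
      (levelKernel S a.1 b.1 (τ a.2) (τ b.2) : ℂ) * gapWeight A b) l =
    (((-1) ^ l / (l.factorial : ℝ) * ∑ f : Fin l → Fin m, ∫ x : Fin l → ℝ,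
      (∏ i, gapInd A (f i) (x i)) * levelDet S (τ ∘ f) x : ℝ) : ℂ) := by
  set G : (Fin l → ℝ) × (Fin l → Fin m) → ℝ := fun p =>
    (∏ i, gapInd A (p.2 i) (p.1 i)) * levelDet S (τ ∘ p.2) p.1 with hG
  have hmp := measurePreserving_arrowProdEquivProdArrow ℝ (Fin m) (Fin l)
    (fun _ => (volume : Measure ℝ)) (fun _ => (Measure.count : Measure (Fin m)))
  have he : ∀ a : Fin l → ℝ × Fin m, fredholmIntegrand (fun a b =>
      (levelKernel S a.1 b.1 (τ a.2) (τ b.2) : ℂ) * gapWeight A b) l a =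
      (G (MeasurableEquiv.arrowProdEquivProdArrow ℝ (Fin m) (Fin l) a) : ℂ) := by
    intro a
    have h1 := Matrix.det_mul_row (fun i => gapInd A (a i).2 (a i).1)
      (Matrix.of fun i j => levelKernel S (a i).1 (a j).1 (τ (a i).2) (τ (a j).2))
    change _ = ((_ * Matrix.det _ : ℝ) : ℂ)
    refine Eq.trans ?_ (congrArg (fun y : ℝ => (y : ℂ)) h1)
    rw [ofReal_det, fredholmIntegrand]
    congr 1
    ext i j
    simp only [Matrix.of_apply, gapWeight_eq]
    push_cast
    ring
  have hGe : ∀ x f, G (x, f) = (∏ i, gapInd A (f i) (x i)) * levelDet S (τ ∘ f) x := fun _ _ => rfl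
  clear_value G
  have hGm : ∀ f : Fin l → Fin m, Integrable fun x : Fin l → ℝ => G (x, f) := by
    intro f
    simp only [hGe]
    refine (integrable_levelDet hρ hρ1 hr hr1 (ht.comp f) S).norm.mono'
      ((measurable_prod_gapInd hA f).aestronglyMeasurable.mul
        (continuous_levelDet S _).aestronglyMeasurable) (Filter.Eventually.of_forall fun x => ?_)
    rw [norm_mul]
    exact mul_le_of_le_one_left (norm_nonneg _) (abs_prod_gapInd_le A f x)
  have hGmeas : Measurable G := by
    refine measurable_from_prod_countable_left fun f => ?_
    simp only [hGe]
    exact (measurable_prod_gapInd hA f).mul (continuous_levelDet S _).measurable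
  have hGint : Integrable G ((Measure.pi fun _ : Fin l => (volume : Measure ℝ)).prod
      (Measure.pi fun _ : Fin l => (Measure.count : Measure (Fin m)))) := by
    refine (integrable_prod_iff' hGmeas.aestronglyMeasurable).2
      ⟨Filter.Eventually.of_forall fun f => hGm f, Integrable.of_finite⟩
  rw [fredholmTerm]
  simp only [he]
  rw [integral_complex_ofReal, Complex.ofReal_mul]
  congr 1
  · push_cast; rfl
  · congr 1
    have h2 := hmp.integral_comp (MeasurableEquiv.measurableEmbedding _) G
    refine h2.trans ?_
    rw [integral_prod_symm _ hGint, integral_fintype Integrable.of_finite]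
    refine Finset.sum_congr rfl fun f _ => ?_
    rw [measureReal_def, Measure.pi_singleton]
    simp only [hGe, Measure.count_singleton, Finset.prod_const_one, ENNReal.toReal_one, one_smul]
    rfl

/-- The Fredholm series of an eigenstate terminates: more than mn points put more than n of them at
a single time, where the determinants vanish. -/
lemma integral_prod_one_sub_gapInd_eq_fredholmDet (hρ : 0 < ρ) (hρ1 : ρ < 1) (hr : 0 < r)
    (hr1 : r < 1) (ht : TimeBound ρ r τ) (hτ : Function.Injective τ)
    (hA : ∀ i, MeasurableSet (A i)) (S : Finset ℕ) :
    ((1 / (S.card.factorial : ℝ) ^ m * ∫ y : Fin m × Fin S.card → ℝ,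
      (∏ a, (1 - gapInd A a.1 (y a))) * levelDet S (fun a => τ a.1) y : ℝ) : ℂ) =
    fredholmDet (copies m) fun a b =>
      (levelKernel S a.1 b.1 (τ a.2) (τ b.2) : ℂ) * gapWeight A b := by
  rw [integral_prod_one_sub_gapInd hρ hρ1 hr hr1 ht hτ hA, fredholmDet,
    tsum_congr (fredholmTerm_levelKernel hρ hρ1 hr hr1 ht hA S),
    tsum_eq_sum (s := Finset.range (m * S.card + 1)), ← mul_assoc, one_div, inv_mul_cancel₀ (by positivity),
    one_mul, Complex.ofReal_sum]
  intro l hl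
  rw [Finset.mem_range, not_lt] at hl
  rw [Finset.sum_eq_zero]
  · simp
  · intro f _
    obtain ⟨s, hs⟩ := exists_card_of_placements_eq_zero
      (placements_eq_zero_of_lt (n := S.card) (τ := τ) f (by omega))
    simp only [levelDet_eq_zero S (τ ∘ f) _ s hs, mul_zero, integral_zero]

/-- The thermal average of the gap probabilities. -/
lemma hasSum_fredholmDet_levelKernel {q : ℝ} {n : ℕ} (hq : 0 < q) (hqρ : q < ρ) (hρ1 : ρ < 1)
    (hr : 0 < r) (hr1 : r < 1) (ht : TimeBound ρ r τ) (hτ : Function.Injective τ)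
    (hA : ∀ i, MeasurableSet (A i)) :
    HasSum (fun k : Eigenstate n => ((q ^ ((n : ℝ) / 2) / partitionFn q n : ℝ) : ℂ) *
        ((q : ℂ) ^ (∑ i, k.1 i) * fredholmDet (copies m) fun a b =>
          (levelKernel (levels k) a.1 b.1 (τ a.2) (τ b.2) : ℂ) * gapWeight A b))
      ((1 / (n.factorial : ℝ) ^ m * ∫ y : Fin m × Fin n → ℝ,
        (∏ a, (1 - gapInd A a.1 (y a))) * corrSum q n (fun a => τ a.1) y : ℝ) : ℂ) := by
  have h := (hasSum_integral_mul_corrSum (n := n) hq hqρ hρ1 hr hr1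
    (t := fun a : Fin m × Fin n => τ a.1) (ht.comp Prod.fst)
    (g := fun y => ∏ a, (1 - gapInd A a.1 (y a)))
    (Finset.measurable_fun_prod _ fun a _ =>
      ((measurable_gapInd hA _).comp (measurable_pi_apply a)).const_sub 1) (fun y => by
      rw [Finset.abs_prod]
      refine Finset.prod_le_one (fun _ _ => abs_nonneg _) fun a _ => ?_
      unfold gapInd Set.indicator
      split_ifs <;> simp)).mul_left (1 / (n.factorial : ℝ) ^ m)
  refine ((Complex.hasSum_ofReal).2 h).congr_fun fun k => ?_
  have h1 := integral_prod_one_sub_gapInd_eq_fredholmDet (hq.trans hqρ) hρ1 hr hr1 ht hτ hA (levels k)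
  rw [← h1, card_levels]
  push_cast
  ring

end Gap

/-! ### Gap probabilities of free fermions -/

lemma measurePreserving_uncurry (ι κ : Type*) [Fintype ι] [Fintype κ] :
    MeasurePreserving (MeasurableEquiv.curry ι κ ℝ).symm where
  measurable := (MeasurableEquiv.curry ι κ ℝ).symm.measurable
  map_eq := by
    refine (Measure.pi_eq fun s hs => ?_).symm
    rw [MeasurableEquiv.map_apply]
    have : (MeasurableEquiv.curry ι κ ℝ).symm ⁻¹' Set.univ.pi s =
        Set.univ.pi fun i => Set.univ.pi fun j => s (i, j) := by
      ext x
      simp [MeasurableEquiv.coe_curry_symm, Function.uncurry]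
    rw [this, volume_pi_pi]
    simp only [volume_pi_pi]
    rw [Fintype.prod_prod_type]

lemma timeIndex_bijective {m : ℕ} {τ : Fin m → ℝ} (hτ : Function.Injective τ) :
    Function.Bijective (timeIndex τ) := by
  constructor
  · intro a b h
    apply hτ
    rw [← times_timeIndex τ a, h, times_timeIndex]
  · intro l
    obtain ⟨i, hi⟩ := times_mem τ l
    refine ⟨i, (times_strictMono τ).injective ?_⟩
    rw [times_timeIndex, hi]

lemma integral_times_eq {T : ℝ} (hT : 0 < T) {n m : ℕ} (hm : 1 ≤ m) {τ : Fin m → ℝ}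
    (hτ : ∀ i, τ i ∈ Set.Ico 0 (1 / T)) (hτi : Function.Injective τ)
    (g : (Fin m → Fin n → ℝ) → ℝ) :
    ∫ x, g (fun i => x (timeIndex τ i)) * multiDensity T (times τ) x =
      1 / (n.factorial : ℝ) ^ m * ∫ y : Fin m × Fin n → ℝ, g (fun i j => y (i, j)) *
        corrSum (boltz T) n (fun a => τ a.1) y := by
  have hs0 : ∀ l, times τ l ∈ Set.Ico 0 (1 / T) := fun l => by
    obtain ⟨i, hi⟩ := times_mem τ l
    rw [← hi]; exact hτ i
  have hcard : (timeSet τ).card = m := by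
    rw [timeSet, Finset.card_image_of_injective _ hτi]; simp
  simp only [multiDensity_eq hT (card_timeSet_ne_zero hm τ) (times_strictMono τ) hs0]
  have hpow : (n.factorial : ℝ) ^ (timeSet τ).card = (n.factorial : ℝ) ^ m := by rw [hcard]
  rw [hpow, ← integral_const_mul]
  set e : Fin (timeSet τ).card ≃ Fin m := (Equiv.ofBijective _ (timeIndex_bijective hτi)).symm
  set e2 : Fin (timeSet τ).card × Fin n ≃ Fin m × Fin n := Equiv.prodCongr e (Equiv.refl _)
  have hmp := (volume_measurePreserving_piCongrLeft (fun _ : Fin m × Fin n => ℝ) e2).comp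
    (measurePreserving_uncurry (Fin (timeSet τ).card) (Fin n))
  rw [← hmp.integral_comp ((MeasurableEquiv.measurableEmbedding _).comp
    (MeasurableEquiv.measurableEmbedding _))]
  congr 1
  ext x
  have h1 : ∀ a, MeasurableEquiv.piCongrLeft (fun _ : Fin m × Fin n => ℝ) e2
      ((MeasurableEquiv.curry (Fin (timeSet τ).card) (Fin n) ℝ).symm x) a =
      x (timeIndex τ a.1) a.2 := by
    intro a
    obtain ⟨b, rfl⟩ := e2.surjective a
    rw [MeasurableEquiv.coe_piCongrLeft, Equiv.piCongrLeft_apply_apply]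
    simp [e2, e, Function.uncurry]
    rw [← Equiv.ofBijective_apply (timeIndex τ) (timeIndex_bijective hτi), Equiv.apply_symm_apply]
  have h2 : (fun a : Fin m × Fin n => x (timeIndex τ a.1) a.2) =
      (fun a : Fin (timeSet τ).card × Fin n => x a.1 a.2) ∘ e2.symm := by
    ext a; rfl
  have h3 : (fun a : Fin m × Fin n => τ a.1) =
      (fun a : Fin (timeSet τ).card × Fin n => times τ a.1) ∘ e2.symm := by
    ext a; exact (times_timeIndex τ a.1).symm
  rw [Function.comp_apply]
  simp only [h1]
  rw [show (MeasurableEquiv.piCongrLeft (fun _ : Fin m × Fin n => ℝ) e2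
      ((MeasurableEquiv.curry (Fin (timeSet τ).card) (Fin n) ℝ).symm x)) =
      fun a => x (timeIndex τ a.1) a.2 from funext h1, h2, h3, corrSum_comp_equiv]
  ring

lemma prod_one_sub_gapInd {m n : ℕ} (A : Fin m → Set ℝ) (y : Fin m → Fin n → ℝ) :
    ∏ a : Fin m × Fin n, (1 - gapInd A a.1 (y a.1 a.2)) =
      {y : Fin m → Fin n → ℝ | ∀ i j, y i j ∈ A i}.indicator (fun _ => 1) y := by
  classical
  have h : ∀ a : Fin m × Fin n, 1 - gapInd A a.1 (y a.1 a.2) = if y a.1 a.2 ∈ A a.1 then 1 else 0 := by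
    intro a
    by_cases h : y a.1 a.2 ∈ A a.1 <;> simp [gapInd, h]
  simp only [h]
  by_cases hy : ∀ i j, y i j ∈ A i
  · rw [Set.indicator_of_mem (by exact hy), Finset.prod_eq_one]
    intro a _
    rw [if_pos (hy a.1 a.2)]
  · rw [Set.indicator_of_notMem (by exact hy)]
    push Not at hy
    obtain ⟨i, j, hij⟩ := hy
    exact Finset.prod_eq_zero (Finset.mem_univ (i, j)) (by simp [hij])

lemma fermionGap_eq {T : ℝ} (hT : 0 < T) {n m : ℕ} (hm : 1 ≤ m) {τ : Fin m → ℝ}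
    (hτ : ∀ i, τ i ∈ Set.Ico 0 (1 / T)) (hτi : Function.Injective τ) {A : Fin m → Set ℝ}
    (hA : ∀ i, MeasurableSet (A i)) :
    fermionGap T n τ A = 1 / (n.factorial : ℝ) ^ m * ∫ y : Fin m × Fin n → ℝ,
        (∏ a, (1 - gapInd A a.1 (y a))) * corrSum (boltz T) n (fun a => τ a.1) y := by
  have h := integral_times_eq hT hm hτ hτi (n := n) fun y : Fin m → Fin n → ℝ =>
    ∏ a : Fin m × Fin n, (1 - gapInd A a.1 (y a.1 a.2))
  rw [← h, fermionGap, ← integral_indicator]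
  · congr 1
    ext x
    have e := prod_one_sub_gapInd A fun i => x (timeIndex τ i)
    beta_reduce
    rw [e]
    by_cases hx : ∀ i j, x (timeIndex τ i) j ∈ A i
    · rw [Set.indicator_of_mem (by exact hx), Set.indicator_of_mem (by exact hx), one_mul]
    · rw [Set.indicator_of_notMem (by exact hx), Set.indicator_of_notMem (by exact hx), zero_mul]
  · simp only [Set.ofPred_forall]
    refine MeasurableSet.iInter fun i => MeasurableSet.iInter fun j => ?_
    exact ((measurable_pi_apply j).comp (measurable_pi_apply (timeIndex τ i))) (hA i)

/-! ### Total positivity of the exponential kernel -/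

lemma det_integral_eq {n : ℕ} (g : Fin n → ℝ → ℝ) (μ : Fin n → Measure ℝ) [∀ j, SigmaFinite (μ j)]
    (hg : ∀ i j, Integrable (g i) (μ j)) :
    (Matrix.of fun i j => ∫ t, g i t ∂μ j).det =
      ∫ x, (Matrix.of fun i j => g i (x j)).det ∂(Measure.pi μ) := by
  simp only [Matrix.det_apply', Matrix.of_apply]
  rw [integral_finsetSum]
  · refine Finset.sum_congr rfl fun σ _ => ?_
    rw [integral_const_mul, integral_fintype_prod_eq_prod fun i => g (σ i)]
  · exact fun σ _ => (Integrable.fintype_prod fun i => hg (σ i) i).const_mul _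

lemma integral_mul_exp_mul {w a b : ℝ} (hab : a ≤ b) :
    ∫ t in Set.Ioc a b, w * Real.exp (w * t) = Real.exp (w * b) - Real.exp (w * a) := by
  rw [← intervalIntegral.integral_of_le hab]
  have hc : Continuous fun t => w * Real.exp (w * t) := by fun_prop
  refine intervalIntegral.integral_eq_sub_of_hasDerivAt (f := fun t => Real.exp (w * t))
    (fun t _ => ?_) (hc.intervalIntegrable _ _)
  have := ((hasDerivAt_id t).const_mul w).exp
  simpa [mul_comm] using this

lemma integrableOn_mul_exp_mul (w a b : ℝ) :
    Integrable (fun t => w * Real.exp (w * t)) (volume.restrict (Set.Ioc a b)) :=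
  (Continuous.integrableOn_Icc (f := fun t => w * Real.exp (w * t)) (by fun_prop)).mono_set
    Set.Ioc_subset_Icc_self

/-- The exponential kernel is totally positive, with determinants bounded by the diagonal. -/
lemma det_exp_mul_bounds (n : ℕ) : ∀ (u v : Fin n → ℝ), Monotone u → Monotone v →
    0 ≤ (Matrix.of fun i j => Real.exp (u i * v j)).det ∧
      (Matrix.of fun i j => Real.exp (u i * v j)).det ≤ ∏ i, Real.exp (u i * v i) := by
  induction n with
  | zero => intro u v _ _; simp
  | succ n ih =>
    intro u v hu hv
    set w : Fin n → ℝ := fun i => u i.succ - u 0 with hw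
    have hw0 : ∀ i, 0 ≤ w i := fun i => sub_nonneg.2 (hu (Fin.zero_le _))
    have hwm : Monotone w := fun i j hij => sub_le_sub_right (hu (Fin.succ_le_succ_iff.2 hij)) _
    have hvs : ∀ j : Fin n, v j.castSucc ≤ v j.succ := fun j => hv Fin.castSucc_lt_succ.le
    set μ : Fin n → Measure ℝ := fun j => volume.restrict (Set.Ioc (v j.castSucc) (v j.succ)) with hμ
    have h1 : (Matrix.of fun i j => Real.exp (u i * v j)).det = (∏ j, Real.exp (u 0 * v j)) *
        (Matrix.of fun i j => Real.exp ((u i - u 0) * v j)).det := by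
      rw [← Matrix.det_mul_row]
      congr 1
      ext i j
      simp only [Matrix.of_apply]
      rw [← Real.exp_add]
      ring_nf
    -- After factoring out the exponentials with u_0 the first row consists of ones. Differences of
    -- neighbouring columns turn it into (1, 0, …, 0) and lower the size by one.
    have h2 : (Matrix.of fun i j : Fin (n + 1) => Real.exp ((u i - u 0) * v j)).det =
        (Matrix.of fun i j : Fin n => Real.exp (w i * v j.succ) - Real.exp (w i * v j.castSucc)).det := by
      rw [Matrix.det_eq_of_forall_col_eq_smul_add_pred (fun _ => 1)
        (B := Matrix.of fun i j => Fin.cases (motive := fun _ => ℝ) (Real.exp ((u i - u 0) * v 0))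
          (fun j => Real.exp ((u i - u 0) * v j.succ) - Real.exp ((u i - u 0) * v j.castSucc)) j)]
      · rw [Matrix.det_succ_row_zero, Fin.sum_univ_succ, Finset.sum_eq_zero]
        · simp only [Matrix.of_apply, Fin.cases_zero, sub_self, zero_mul, Real.exp_zero]
          simp only [Fin.coe_ofNat_eq_mod, Nat.zero_mod, pow_zero, one_mul, add_zero]
          congr 1
        · intro j _
          simp
      · intro i; rfl
      · intro i j
        simp
    have h3 : (Matrix.of fun i j : Fin n => Real.exp (w i * v j.succ) - Real.exp (w i * v j.castSucc)).det
        = ∫ x, (∏ i, w i) * (Matrix.of fun i j => Real.exp (w i * x j)).det ∂(Measure.pi μ) := by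
      have e : ∀ x : Fin n → ℝ, (∏ i, w i) * (Matrix.of fun i j => Real.exp (w i * x j)).det =
          (Matrix.of fun i j => w i * Real.exp (w i * x j)).det := fun x =>
        (Matrix.det_mul_column w _).symm
      simp only [e]
      rw [← det_integral_eq (fun i t => w i * Real.exp (w i * t)) μ
        fun i j => integrableOn_mul_exp_mul _ _ _]
      congr 1
      ext i j
      simp only [Matrix.of_apply, hμ]
      rw [integral_mul_exp_mul (hvs j)]
    -- The integration variables interlace with v: x_j lies in (v_j, v_{j+1}]. They are therefore
    -- ordered, and the induction hypothesis applies under the integral.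
    have hae : ∀ᵐ x ∂(Measure.pi μ), Monotone x := by
      have hres : Measure.pi μ = (volume : Measure (Fin n → ℝ)).restrict
          (Set.univ.pi fun j => Set.Ioc (v j.castSucc) (v j.succ)) := by
        rw [volume_pi, Measure.restrict_pi_pi]
      rw [hres]
      filter_upwards [ae_restrict_mem (MeasurableSet.univ_pi fun j => measurableSet_Ioc)] with x hx
      intro i j hij
      rcases hij.eq_or_lt with rfl | hij
      · exact le_rfl
      · have hi := (hx i (Set.mem_univ _)).2
        have hj := (hx j (Set.mem_univ _)).1
        have : v i.succ ≤ v j.castSucc := hv (by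
          rw [Fin.le_iff_val_le_val]; simpa using hij)
        linarith
    have hprod0 : 0 ≤ ∏ i, w i := Finset.prod_nonneg fun i _ => hw0 i
    have hP : 0 ≤ ∏ j, Real.exp (u 0 * v j) := Finset.prod_nonneg fun _ _ => (Real.exp_pos _).le
    rw [h1, h2, h3]
    refine ⟨mul_nonneg hP (integral_nonneg_of_ae ?_), ?_⟩
    · filter_upwards [hae] with x hx
      exact mul_nonneg hprod0 (ih w x hwm hx).1
    · have e4 : ∏ i, Real.exp (u i * v i) = (∏ j, Real.exp (u 0 * v j)) *
          ∏ i : Fin n, Real.exp (w i * v i.succ) := by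
        rw [← Finset.prod_congr rfl fun i _ => show Real.exp (u 0 * v i) *
          Real.exp ((u i - u 0) * v i) = Real.exp (u i * v i) by rw [← Real.exp_add]; ring_nf,
          Finset.prod_mul_distrib, Fin.prod_univ_succ (fun i => Real.exp ((u i - u 0) * v i))]
        simp [hw]
      rw [e4]
      refine mul_le_mul_of_nonneg_left ?_ hP
      calc ∫ x, (∏ i, w i) * (Matrix.of fun i j => Real.exp (w i * x j)).det ∂(Measure.pi μ)
          ≤ ∫ x, ∏ i, (w i * Real.exp (w i * x i)) ∂(Measure.pi μ) := by
            refine integral_mono_of_nonneg ?_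
              (Integrable.fintype_prod fun i => integrableOn_mul_exp_mul (w i) _ _) ?_
            · filter_upwards [hae] with x hx
              exact mul_nonneg hprod0 (ih w x hwm hx).1
            · filter_upwards [hae] with x hx
              rw [Finset.prod_mul_distrib]
              exact mul_le_mul_of_nonneg_left (ih w x hwm hx).2 hprod0
        _ = ∏ i : Fin n, (Real.exp (w i * v i.succ) - Real.exp (w i * v i.castSucc)) := by
            rw [integral_fintype_prod_eq_prod fun i t => w i * Real.exp (w i * t)]
            refine Finset.prod_congr rfl fun i _ => ?_
            rw [hμ, integral_mul_exp_mul (hvs i)]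
        _ ≤ _ := by
            refine Finset.prod_le_prod (fun i _ => ?_) fun i _ => ?_
            · exact sub_nonneg.2 (Real.exp_le_exp.2 (mul_le_mul_of_nonneg_left (hvs i) (hw0 i)))
            · linarith [Real.exp_pos (w i * v i.castSucc)]

/-- Rearrangement with gaps. -/
lemma sum_mul_sub_comp_perm_ge {n : ℕ} {u v : Fin n → ℝ} {δ : ℝ} (hδ : 0 ≤ δ)
    (hu : ∀ i j, i < j → δ ≤ u j - u i) (hv : ∀ i j, i < j → δ ≤ v j - v i)
    {σ : Equiv.Perm (Fin n)} (hσ : σ ≠ 1) :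
    δ ^ 2 / 2 ≤ ∑ i, u i * v i - ∑ i, u i * v (σ i) := by
  have key : ∀ f g : Fin n → ℝ, Monotone f → Monotone g → 0 ≤ ∑ i, f i * (g i - g (σ i)) := by
    intro f g hf hg
    have := (hf.monovary hg).sum_mul_comp_perm_le_sum_mul (σ := σ)
    simp only [mul_sub, Finset.sum_sub_distrib]
    linarith
  have hmono : ∀ f : Fin n → ℝ, (∀ i j, i < j → δ ≤ f j - f i) →
      Monotone fun i : Fin n => f i - δ * (i : ℕ) := by
    intro f hf
    cases n with
    | zero => exact fun i => i.elim0
    | succ n =>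
      refine Fin.monotone_iff_le_succ.2 fun i => ?_
      have := hf i.castSucc i.succ Fin.castSucc_lt_succ
      simp only [Fin.val_castSucc, Fin.val_succ]
      push_cast
      linarith
  have hrank : Monotone fun i : Fin n => ((i : ℕ) : ℝ) := fun i j hij => by
    exact Nat.cast_le.2 hij
  have h1 := key _ _ (hmono u hu) (hmono v hv)
  have h2 := key _ _ (hmono u hu) hrank
  have h3 := key _ _ hrank (hmono v hv)
  -- Writing u_i = (u_i - δi) + δi, and v likewise, splits the deficit into four rearrangement
  -- deficits of monotone sequences. Three are merely nonnegative. The one with the ranks in both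
  -- places is half of ∑(i - σ(i))², at least 1/2 as σ moves some index.
  have h4 : (1 : ℝ) / 2 ≤ ∑ i : Fin n, ((i : ℕ) : ℝ) * (((i : ℕ) : ℝ) - ((σ i : ℕ) : ℝ)) := by
    have e : ∑ i : Fin n, ((σ i : ℕ) : ℝ) ^ 2 = ∑ i : Fin n, ((i : ℕ) : ℝ) ^ 2 :=
      Equiv.sum_comp σ fun i : Fin n => ((i : ℕ) : ℝ) ^ 2
    have e2 : ∑ i : Fin n, ((i : ℕ) : ℝ) * (((i : ℕ) : ℝ) - ((σ i : ℕ) : ℝ)) =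
        (∑ i : Fin n, (((i : ℕ) : ℝ) - ((σ i : ℕ) : ℝ)) ^ 2) / 2 := by
      have : ∑ i : Fin n, (((i : ℕ) : ℝ) - ((σ i : ℕ) : ℝ)) ^ 2 =
          2 * ∑ i : Fin n, ((i : ℕ) : ℝ) * (((i : ℕ) : ℝ) - ((σ i : ℕ) : ℝ)) +
          (∑ i : Fin n, ((σ i : ℕ) : ℝ) ^ 2 - ∑ i : Fin n, ((i : ℕ) : ℝ) ^ 2) := by
        rw [Finset.mul_sum, ← Finset.sum_sub_distrib, ← Finset.sum_add_distrib]
        refine Finset.sum_congr rfl fun i _ => ?_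
        ring
      rw [this, e]
      ring
    obtain ⟨i, hi⟩ : ∃ i, σ i ≠ i := by
      by_contra h
      push Not at h
      exact hσ (Equiv.ext h)
    have h5 : (1 : ℝ) ≤ (((i : ℕ) : ℝ) - ((σ i : ℕ) : ℝ)) ^ 2 := by
      have : ((i : ℕ) : ℤ) - ((σ i : ℕ) : ℤ) ≠ 0 := by
        intro h
        apply hi
        ext
        omega
      have h6 := Int.one_le_abs this
      rw [one_le_sq_iff_one_le_abs]
      exact_mod_cast h6
    have h7 := Finset.single_le_sum (f := fun i : Fin n => (((i : ℕ) : ℝ) - ((σ i : ℕ) : ℝ)) ^ 2)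
      (fun i _ => sq_nonneg _) (Finset.mem_univ i)
    rw [e2]
    linarith
  have h8 : ∑ i, u i * v i - ∑ i, u i * v (σ i) =
      ∑ i : Fin n, (u i - δ * (i : ℕ)) * ((v i - δ * (i : ℕ)) - (v (σ i) - δ * (σ i : ℕ))) +
      δ * ∑ i : Fin n, (u i - δ * (i : ℕ)) * (((i : ℕ) : ℝ) - ((σ i : ℕ) : ℝ)) +
      δ * ∑ i : Fin n, ((i : ℕ) : ℝ) * ((v i - δ * (i : ℕ)) - (v (σ i) - δ * (σ i : ℕ))) +
      δ ^ 2 * ∑ i : Fin n, ((i : ℕ) : ℝ) * (((i : ℕ) : ℝ) - ((σ i : ℕ) : ℝ)) := by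
    simp only [Finset.mul_sum]
    rw [← Finset.sum_sub_distrib, ← Finset.sum_add_distrib, ← Finset.sum_add_distrib,
      ← Finset.sum_add_distrib]
    refine Finset.sum_congr rfl fun i _ => ?_
    ring
  rw [h8]
  nlinarith [mul_nonneg hδ h2, mul_nonneg hδ h3, mul_le_mul_of_nonneg_left h4 (sq_nonneg δ)]

/-- In the Leibniz formula the identity dominates: every other permutation is smaller by a factor
e^{-cδ²/2}, by `sum_mul_sub_comp_perm_ge`, and there are fewer than n! of them. -/
lemma det_exp_mul_ge {n : ℕ} {u v : Fin n → ℝ} {δ c : ℝ} (hδ : 0 ≤ δ) (hc : 0 ≤ c)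
    (hu : ∀ i j, i < j → δ ≤ u j - u i) (hv : ∀ i j, i < j → δ ≤ v j - v i) :
    (1 - (n.factorial : ℝ) * Real.exp (-(c * δ ^ 2 / 2))) * ∏ i, Real.exp (c * (u i * v i)) ≤
      (Matrix.of fun i j => Real.exp (c * (u i * v j))).det := by
  rw [← Matrix.det_transpose, Matrix.det_apply, ← Finset.add_sum_erase _ _ (Finset.mem_univ (1 : Equiv.Perm (Fin n)))]
  simp only [Equiv.Perm.sign_one, one_smul, Equiv.Perm.coe_one, id, Matrix.transpose_apply,
    Matrix.of_apply]
  rw [sub_mul, one_mul, sub_eq_add_neg]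
  refine add_le_add le_rfl ?_
  have hb : ∀ σ ∈ Finset.univ.erase (1 : Equiv.Perm (Fin n)),
      -(Real.exp (-(c * δ ^ 2 / 2)) * ∏ i, Real.exp (c * (u i * v i))) ≤
        Equiv.Perm.sign σ • ∏ i, Real.exp (c * (u i * v (σ i))) := by
    intro σ hσ
    have h1 := sum_mul_sub_comp_perm_ge hδ hu hv (Finset.ne_of_mem_erase hσ)
    have h2 : ∏ i, Real.exp (c * (u i * v (σ i))) ≤
        Real.exp (-(c * δ ^ 2 / 2)) * ∏ i, Real.exp (c * (u i * v i)) := by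
      rw [← Real.exp_sum, ← Real.exp_sum, ← Real.exp_add, Real.exp_le_exp, ← Finset.mul_sum,
        ← Finset.mul_sum]
      nlinarith
    have h3 : 0 ≤ ∏ i, Real.exp (c * (u i * v (σ i))) :=
      Finset.prod_nonneg fun _ _ => (Real.exp_pos _).le
    rcases Int.units_eq_one_or (Equiv.Perm.sign σ) with h | h <;> rw [h]
    · rw [one_smul]; linarith
    · rw [Units.neg_smul, one_smul]; linarith
  have h4 := Finset.sum_le_sum hb
  rw [Finset.sum_const, nsmul_eq_mul] at h4
  refine le_trans ?_ h4
  have h5 : ((Finset.univ.erase (1 : Equiv.Perm (Fin n))).card : ℝ) ≤ n.factorial := by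
    have := Finset.card_erase_le (s := (Finset.univ : Finset (Equiv.Perm (Fin n)))) (a := 1)
    rw [Finset.card_univ, Fintype.card_perm, Fintype.card_fin] at this
    exact_mod_cast this
  have h6 : 0 ≤ Real.exp (-(c * δ ^ 2 / 2)) * ∏ i, Real.exp (c * (u i * v i)) :=
    mul_nonneg (Real.exp_pos _).le (Finset.prod_nonneg fun _ _ => (Real.exp_pos _).le)
  nlinarith

/-! ### Configurations in the same order -/

/-- `u` and `v` are ordered in the same way. -/
def SameOrder {n : ℕ} (u v : Fin n → ℝ) : Prop := ∀ i j, u i < u j ↔ v i < v j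

lemma SameOrder.exists_monotone {n : ℕ} {u v : Fin n → ℝ} (h : SameOrder u v) :
    ∃ σ : Equiv.Perm (Fin n), Monotone (u ∘ σ) ∧ Monotone (v ∘ σ) := by
  refine ⟨Tuple.sort u, Tuple.monotone_sort u, fun i j hij => ?_⟩
  have := Tuple.monotone_sort u hij
  rw [← not_lt] at this ⊢
  exact fun h' => this ((h _ _).2 h')

lemma det_submatrix_perm {n : ℕ} (σ : Equiv.Perm (Fin n)) (f : ℝ → ℝ → ℝ) (u v : Fin n → ℝ) :
    (Matrix.of fun i j => f (u (σ i)) (v (σ j))).det = (Matrix.of fun i j => f (u i) (v j)).det :=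
  Matrix.det_submatrix_equiv_self σ (Matrix.of fun i j => f (u i) (v j))

lemma SameOrder.det_exp_bounds {n : ℕ} {u v : Fin n → ℝ} (h : SameOrder u v) {c : ℝ} (hc : 0 ≤ c) :
    0 ≤ (Matrix.of fun i j => Real.exp (c * (u i * v j))).det ∧
      (Matrix.of fun i j => Real.exp (c * (u i * v j))).det ≤ ∏ i, Real.exp (c * (u i * v i)) := by
  obtain ⟨σ, h1, h2⟩ := h.exists_monotone
  have h3 := det_exp_mul_bounds n (fun i => c * u (σ i)) (v ∘ σ)
    (fun i j hij => mul_le_mul_of_nonneg_left (h1 hij) hc) h2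
  simp only [mul_assoc, Function.comp_apply] at h3
  rw [det_submatrix_perm σ (fun a b => Real.exp (c * (a * b)))] at h3
  rwa [Equiv.prod_comp σ fun i => Real.exp (c * (u i * v i))] at h3

lemma SameOrder.det_exp_ge {n : ℕ} {u v : Fin n → ℝ} (h : SameOrder u v) {c δ : ℝ} (hc : 0 ≤ c)
    (hδ : 0 < δ) (hu : ∀ i j, i ≠ j → δ ≤ |u i - u j|) (hv : ∀ i j, i ≠ j → δ ≤ |v i - v j|) :
    (1 - (n.factorial : ℝ) * Real.exp (-(c * δ ^ 2 / 2))) * ∏ i, Real.exp (c * (u i * v i)) ≤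
      (Matrix.of fun i j => Real.exp (c * (u i * v j))).det := by
  obtain ⟨σ, h1, h2⟩ := h.exists_monotone
  have key : ∀ w : Fin n → ℝ, Monotone (w ∘ σ) → (∀ i j, i ≠ j → δ ≤ |w i - w j|) →
      ∀ i j, i < j → δ ≤ (w ∘ σ) j - (w ∘ σ) i := by
    intro w hw hd i j hij
    have h3 := hd (σ j) (σ i) (fun h => hij.ne' (σ.injective h))
    have h4 := hw hij.le
    simp only [Function.comp_apply] at h4 ⊢
    rwa [abs_of_nonneg (sub_nonneg.2 h4)] at h3
  have h3 := det_exp_mul_ge hδ.le hc (key u h1 hu) (key v h2 hv)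
  simp only [Function.comp_apply] at h3
  rw [det_submatrix_perm σ (fun a b => Real.exp (c * (a * b)))] at h3
  rwa [Equiv.prod_comp σ fun i => Real.exp (c * (u i * v i))] at h3

/-- Exactly one relabelling puts a configuration of distinct points into a given order. -/
lemma existsUnique_sameOrder {n : ℕ} {u v : Fin n → ℝ} (hu : Function.Injective u)
    (hv : Function.Injective v) : ∃! σ : Equiv.Perm (Fin n), SameOrder u (v ∘ σ) := by
  have hus : StrictMono (u ∘ Tuple.sort u) :=
    (Tuple.monotone_sort u).strictMono_of_injective (hu.comp (Equiv.injective _))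
  have hvs : StrictMono (v ∘ Tuple.sort v) :=
    (Tuple.monotone_sort v).strictMono_of_injective (hv.comp (Equiv.injective _))
  refine ⟨(Tuple.sort u).symm.trans (Tuple.sort v), fun i j => ?_, fun σ hσ => ?_⟩
  · have h1 := hus.lt_iff_lt (a := (Tuple.sort u).symm i) (b := (Tuple.sort u).symm j)
    have h2 := hvs.lt_iff_lt (a := (Tuple.sort u).symm i) (b := (Tuple.sort u).symm j)
    simp only [Function.comp_apply, Equiv.apply_symm_apply] at h1 h2
    simp only [Function.comp_apply, Equiv.trans_apply]
    rw [h1, h2]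
  · have h1 : StrictMono (v ∘ σ ∘ Tuple.sort u) := fun i j hij => (hσ _ _).1 (hus hij)
    have h2 : v ∘ σ ∘ Tuple.sort u = v ∘ Tuple.sort v := by
      rw [← h1.range_inj hvs]
      have e1 : Set.range (v ∘ σ ∘ Tuple.sort u) = Set.range v := by
        rw [← Equiv.coe_trans, EquivLike.range_comp]
      rw [e1, EquivLike.range_comp]
    ext i
    have h3 := hv (congrFun h2 ((Tuple.sort u).symm i))
    simp only [Function.comp_apply, Equiv.apply_symm_apply] at h3
    rw [Equiv.trans_apply, h3]

/-! ### Determinants of Mehler kernels -/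

/-- The ratio of `det (mehler r (u i) (v j))` to its diagonal product. -/
def stepRatio (r : ℝ) {n : ℕ} (u v : Fin n → ℝ) : ℝ :=
  (Matrix.of fun i j => Real.exp (r / (1 - r ^ 2) * (u i * v j))).det /
    ∏ i, Real.exp (r / (1 - r ^ 2) * (u i * v i))

lemma det_mehler {r : ℝ} (hr : 0 < r) (hr1 : r < 1) {n : ℕ} (u v : Fin n → ℝ) :
    (Matrix.of fun i j => mehler r (u i) (v j)).det =
      (∏ i, mehler r (u i) (v i)) * stepRatio r u v := by
  set K := 1 / (Real.sqrt (2 * Real.pi) * Real.sqrt (1 - r ^ 2)) with hK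
  set a := -((1 + r ^ 2) / (4 * (1 - r ^ 2))) with ha
  set c := r / (1 - r ^ 2) with hc
  have h : ∀ x y, mehler r x y = (K * Real.exp (a * x ^ 2)) * (Real.exp (a * y ^ 2) *
      Real.exp (c * (x * y))) := by
    intro x y
    rw [mehler_eq hr hr1, mul_add, Real.exp_add]
    ring
  have hne : ∏ i, Real.exp (c * (u i * v i)) ≠ 0 :=
    Finset.prod_ne_zero_iff.2 fun i _ => (Real.exp_pos _).ne'
  have h1 := Matrix.det_mul_column (fun i => K * Real.exp (a * u i ^ 2))
    (Matrix.of fun i j => Real.exp (a * v j ^ 2) * Real.exp (c * (u i * v j)))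
  have h2 := Matrix.det_mul_row (fun j => Real.exp (a * v j ^ 2))
    (Matrix.of fun i j => Real.exp (c * (u i * v j)))
  simp only [Matrix.of_apply] at h1 h2
  simp only [h]
  have e : ∏ i, (K * Real.exp (a * u i ^ 2)) * (Real.exp (a * v i ^ 2) *
      Real.exp (c * (u i * v i))) = (∏ i, (K * Real.exp (a * u i ^ 2))) *
        ((∏ i, Real.exp (a * v i ^ 2)) * ∏ i, Real.exp (c * (u i * v i))) := by
    rw [← Finset.prod_mul_distrib, ← Finset.prod_mul_distrib]
  have e2 : ∀ A B C D : ℝ, C ≠ 0 → A * (B * D) = A * (B * C) * (D / C) := by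
    intro A B C D hC; field_simp
  rw [h1, h2, e, stepRatio, ← hc]
  exact e2 _ _ _ _ hne

lemma ratio_nonneg {r : ℝ} (hr : 0 < r) (hr1 : r < 1) : 0 ≤ r / (1 - r ^ 2) :=
  div_nonneg hr.le (by nlinarith)

lemma SameOrder.stepRatio_bounds {r : ℝ} (hr : 0 < r) (hr1 : r < 1) {n : ℕ} {u v : Fin n → ℝ}
    (h : SameOrder u v) : 0 ≤ stepRatio r u v ∧ stepRatio r u v ≤ 1 := by
  have hpos : 0 < ∏ i, Real.exp (r / (1 - r ^ 2) * (u i * v i)) :=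
    Finset.prod_pos fun i _ => Real.exp_pos _
  have := h.det_exp_bounds (ratio_nonneg hr hr1)
  exact ⟨div_nonneg this.1 hpos.le, (div_le_one hpos).2 this.2⟩

/-- With r = e^{-t} the coefficient r/(1-r²) is of order 1/t, so for separated configurations the
loss over a short step is exponentially small in 1/t. It stays negligible when multiplied by the
number of steps. -/
lemma SameOrder.stepRatio_ge {r : ℝ} (hr : 0 < r) (hr1 : r < 1) {n : ℕ} {u v : Fin n → ℝ}
    (h : SameOrder u v) {δ : ℝ} (hδ : 0 < δ) (hu : ∀ i j, i ≠ j → δ ≤ |u i - u j|)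
    (hv : ∀ i j, i ≠ j → δ ≤ |v i - v j|) :
    1 - (n.factorial : ℝ) * Real.exp (-(r / (1 - r ^ 2) * δ ^ 2 / 2)) ≤ stepRatio r u v := by
  have hpos : 0 < ∏ i, Real.exp (r / (1 - r ^ 2) * (u i * v i)) :=
    Finset.prod_pos fun i _ => Real.exp_pos _
  exact (le_div_iff₀ hpos).2 (h.det_exp_ge (ratio_nonneg hr hr1) hδ hu hv)

lemma continuous_stepRatio (r : ℝ) (n : ℕ) :
    Continuous fun p : (Fin n → ℝ) × (Fin n → ℝ) => stepRatio r p.1 p.2 := by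
  unfold stepRatio
  refine Continuous.div ?_ ?_ fun p => Finset.prod_ne_zero_iff.2 fun i _ => (Real.exp_pos _).ne'
  · apply Continuous.matrix_det
    refine continuous_matrix fun i j => ?_
    simp only [Matrix.of_apply]
    fun_prop
  · fun_prop

/-- Short steps have ratio close to `1`. -/
lemma ratio_exp_ge {t β : ℝ} (ht : 0 < t) (htβ : t ≤ β) :
    Real.exp (-β) / (2 * t) ≤ Real.exp (-t) / (1 - Real.exp (-t) ^ 2) := by
  have h1 : 1 - Real.exp (-t) ^ 2 ≤ 2 * t := by
    rw [← Real.exp_nat_mul]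
    have := Real.add_one_le_exp ((2 : ℕ) * -t)
    push_cast at this ⊢
    linarith
  have h2 : 0 < 1 - Real.exp (-t) ^ 2 := by
    have : Real.exp (-t) < 1 := by rw [Real.exp_lt_one_iff]; linarith
    nlinarith [Real.exp_pos (-t)]
  exact div_le_div₀ (Real.exp_pos _).le (Real.exp_le_exp.2 (by linarith)) h2 h1

/-! ### The joint density as a product over steps -/

lemma increment_pos {β : ℝ} {p : ℕ} {s : Fin p → ℝ} (hs : ∀ l, s l ∈ Set.Ico 0 β) (l : Fin p) :
    0 < increment β s l := by
  unfold increment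
  split_ifs with h
  · linarith
  · linarith [(hs l).2, (hs (finRotate p l)).1]

lemma multiDensity_eq_prod {T : ℝ} {n p : ℕ} {s : Fin p → ℝ} (hs : ∀ l, s l ∈ Set.Ico 0 (1 / T))
    (x : Fin p → Fin n → ℝ) :
    multiDensity T s x = 1 / (n.factorial : ℝ) ^ p *
      ((boltz T) ^ ((n : ℝ) / 2) / partitionFn (boltz T) n) *
      ((∏ l, ∏ k, mehler (Real.exp (-increment (1 / T) s l)) (x l k) (x (finRotate p l) k)) *
        ∏ l, stepRatio (Real.exp (-increment (1 / T) s l)) (x l) (x (finRotate p l))) := by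
  rw [multiDensity, ← Finset.prod_mul_distrib]
  congr 1
  refine Finset.prod_congr rfl fun l _ => ?_
  have h := increment_pos hs l
  rw [← det_mehler (Real.exp_pos _) (by rw [Real.exp_lt_one_iff]; linarith), ← Matrix.det_transpose]
  congr 1
  ext i j
  simp only [Matrix.transpose_apply, Matrix.of_apply]
  rw [propagator_eq]

/-! ### Bridge densities -/

lemma ouDensity_eq {t : ℝ} (ht : 0 < t) (x y : ℝ) : ouDensity t x y =
    (Real.sqrt (2 * Real.pi * (1 - Real.exp (-t) ^ 2)))⁻¹ *
      Real.exp (-(y - Real.exp (-t) * x) ^ 2 / (2 * (1 - Real.exp (-t) ^ 2))) := by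
  have h1 : Real.exp (-(2 * t)) = Real.exp (-t) ^ 2 := by
    rw [← Real.exp_nat_mul]; congr 1; push_cast; ring
  have h2 : 0 ≤ 1 - Real.exp (-t) ^ 2 := by
    have : Real.exp (-t) < 1 := by rw [Real.exp_lt_one_iff]; linarith
    nlinarith [Real.exp_pos (-t)]
  rw [ouDensity, gaussianPDFReal, h1, Real.coe_toNNReal _ h2]

/-- The ground state transformation: conjugation by e^{-x²/4} turns the oscillator propagator into
the Ornstein–Uhlenbeck transition density. The extra factors telescope along a path and cancel on a
loop. -/
lemma ouDensity_eq_mehler {t : ℝ} (ht : 0 < t) (x y : ℝ) :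
    ouDensity t x y = mehler (Real.exp (-t)) x y * Real.exp ((x ^ 2 - y ^ 2) / 4) := by
  have hr : Real.exp (-t) < 1 := by rw [Real.exp_lt_one_iff]; linarith
  rw [ouDensity_eq ht, mehler_eq (Real.exp_pos _) hr]
  set r := Real.exp (-t) with hrdef
  have h2 : 0 < 1 - r ^ 2 := by nlinarith [Real.exp_pos (-t)]
  rw [Real.sqrt_mul (by positivity), one_div, mul_assoc, mul_assoc, ← Real.exp_add, ← Real.exp_add]
  congr 2
  field_simp
  ring

lemma ouDensity_pos {t : ℝ} (ht : 0 < t) (x y : ℝ) : 0 < ouDensity t x y := by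
  have hr : Real.exp (-t) < 1 := by rw [Real.exp_lt_one_iff]; linarith
  rw [ouDensity_eq_mehler ht]
  exact mul_pos (mehler_pos (Real.exp_pos _) hr x y) (Real.exp_pos _)

/-- A Cameron–Martin shift. The part b e^{-s} follows the deterministic flow and costs nothing; the
part a e^s produces a ratio of exponentials at the two ends of the step, which telescopes along a
path. -/
lemma ouDensity_add {t : ℝ} (ht : 0 < t) (a b s x y : ℝ) :
    ouDensity t (x + (a * Real.exp s + b * Real.exp (-s)))
      (y + (a * Real.exp (s + t) + b * Real.exp (-(s + t)))) =
    ouDensity t x y * Real.exp ((a * Real.exp s * x + a ^ 2 * Real.exp s ^ 2 / 2) -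
      (a * Real.exp (s + t) * y + a ^ 2 * Real.exp (s + t) ^ 2 / 2)) := by
  have hr : Real.exp (-t) < 1 := by rw [Real.exp_lt_one_iff]; linarith
  have h2 : 0 < 1 - Real.exp (-t) ^ 2 := by nlinarith [Real.exp_pos (-t)]
  rw [ouDensity_eq ht, ouDensity_eq ht, mul_assoc (Real.sqrt _)⁻¹, ← Real.exp_add]
  congr 2
  have e1 : Real.exp s = Real.exp (s + t) * Real.exp (-t) := by rw [← Real.exp_add]; congr 1; ring
  have e2 : Real.exp (-(s + t)) = Real.exp (-s) * Real.exp (-t) := by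
    rw [← Real.exp_add]; congr 1; ring
  rw [e1, e2]
  field_simp
  ring

/-- The times `0 < t_1 < ⋯ < t_P < β` preceded by `0`. -/
lemma cons_zero_mem {β : ℝ} (hβ : 0 < β) {P : ℕ} {t : Fin P → ℝ} (ht : ∀ i, t i ∈ Set.Ioo 0 β)
    (l : Fin (P + 1)) : (Fin.cons 0 t : Fin (P + 1) → ℝ) l ∈ Set.Ico 0 β := by
  refine Fin.cases ?_ (fun i => ?_) l
  · simpa using hβ
  · simpa using ⟨(ht i).1.le, (ht i).2⟩

lemma cons_zero_strictMono {β : ℝ} {P : ℕ} {t : Fin P → ℝ} (ht : ∀ i, t i ∈ Set.Ioo 0 β)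
    (hts : StrictMono t) : StrictMono (Fin.cons 0 t : Fin (P + 1) → ℝ) := by
  intro i j hij
  obtain rfl | ⟨j, rfl⟩ := Fin.eq_zero_or_eq_succ j
  · exact absurd hij (Fin.not_lt_zero _)
  · obtain rfl | ⟨i, rfl⟩ := Fin.eq_zero_or_eq_succ i
    · simpa using (ht j).1
    · simpa using hts (Fin.succ_lt_succ_iff.1 hij)

lemma snoc_sub_eq_increment {β : ℝ} {P : ℕ} {t : Fin P → ℝ} (ht : ∀ i, t i ∈ Set.Ioo 0 β)
    (hts : StrictMono t) (i : Fin (P + 1)) :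
    (Fin.snoc t β : Fin (P + 1) → ℝ) i - (Fin.cons 0 t : Fin (P + 1) → ℝ) i =
      increment β (Fin.cons 0 t : Fin (P + 1) → ℝ) i := by
  have hs := cons_zero_strictMono ht hts
  refine Fin.lastCases ?_ (fun j => ?_) i
  · rw [increment, finRotate_last, if_neg (not_lt.2 (hs.monotone (Fin.zero_le _))), Fin.snoc_last]
    simp
  · have hrot : finRotate (P + 1) j.castSucc = j.succ := by
      rw [Fin.ext_iff, coe_finRotate_of_ne_last (Fin.castSucc_lt_last j).ne]
      simp
    rw [increment, hrot, if_pos (hs Fin.castSucc_lt_succ)]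
    simp

lemma cons_snoc_castSucc {P : ℕ} (a b : ℝ) (t : Fin P → ℝ) (i : Fin (P + 1)) :
    (Fin.cons a (Fin.snoc t b : Fin (P + 1) → ℝ) : Fin (P + 2) → ℝ) i.castSucc =
      (Fin.cons a t : Fin (P + 1) → ℝ) i := by
  refine Fin.cases rfl (fun j => ?_) i
  rw [Fin.castSucc_succ, Fin.cons_succ, Fin.cons_succ, Fin.snoc_castSucc]

/-- The bridge is a closed loop, so the ground state factors cancel and the last step returns
cyclically to y. This is the contribution of one particle to the diagonal part of the fermion
density. -/
lemma mehler_mul_bridgeDensity {β : ℝ} (hβ : 0 < β) {P : ℕ} {t : Fin P → ℝ}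
    (ht : ∀ i, t i ∈ Set.Ioo 0 β) (hts : StrictMono t) (y : ℝ) (x : Fin P → ℝ) :
    mehler (Real.exp (-β)) y y * bridgeDensity β y t x =
      ∏ l, mehler (Real.exp (-increment β (Fin.cons 0 t : Fin (P + 1) → ℝ) l))
        ((Fin.cons y x : Fin (P + 1) → ℝ) l)
        ((Fin.cons y x : Fin (P + 1) → ℝ) (finRotate (P + 1) l)) := by
  have hm := mehler_pos (Real.exp_pos (-β)) (by rw [Real.exp_lt_one_iff]; linarith) y y
  have hpos := increment_pos (cons_zero_mem hβ ht)
  have h1 : ∀ i : Fin (P + 1), ouDensity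
      ((Fin.cons 0 (Fin.snoc t β : Fin (P + 1) → ℝ) : Fin (P + 2) → ℝ) i.succ -
        (Fin.cons 0 (Fin.snoc t β : Fin (P + 1) → ℝ) : Fin (P + 2) → ℝ) i.castSucc)
      ((Fin.cons y (Fin.snoc x y : Fin (P + 1) → ℝ) : Fin (P + 2) → ℝ) i.castSucc)
      ((Fin.cons y (Fin.snoc x y : Fin (P + 1) → ℝ) : Fin (P + 2) → ℝ) i.succ) =
      mehler (Real.exp (-increment β (Fin.cons 0 t : Fin (P + 1) → ℝ) i))
        ((Fin.cons y x : Fin (P + 1) → ℝ) i)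
        ((Fin.cons y x : Fin (P + 1) → ℝ) (finRotate (P + 1) i)) *
      Real.exp (((Fin.cons y x : Fin (P + 1) → ℝ) i ^ 2 -
        (Fin.cons y x : Fin (P + 1) → ℝ) (finRotate (P + 1) i) ^ 2) / 4) := by
    intro i
    rw [cons_snoc_castSucc, cons_snoc_castSucc, Fin.cons_succ, Fin.cons_succ,
      snoc_sub_eq_increment ht hts, ouDensity_eq_mehler (hpos i), Fin.snoc_eq_cons_rotate]
  rw [bridgeDensity]
  simp only [h1]
  rw [Finset.prod_mul_distrib, ← Real.exp_sum, ← Finset.sum_div, Finset.sum_sub_distrib,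
    Equiv.sum_comp (finRotate (P + 1)) fun i => (Fin.cons y x : Fin (P + 1) → ℝ) i ^ 2, sub_self,
    zero_div, Real.exp_zero, mul_one, ouDensity_eq_mehler hβ, sub_self, zero_div, Real.exp_zero,
    mul_one, mul_div_cancel₀ _ hm.ne']

/-- The mean at time `s` of the bridge from `1` to `1`. -/
def bridgeMean (β s : ℝ) : ℝ :=
  1 / (Real.exp β + 1) * Real.exp s + Real.exp β / (Real.exp β + 1) * Real.exp (-s)

lemma bridgeMean_zero (β : ℝ) : bridgeMean β 0 = 1 := by
  unfold bridgeMean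
  have : Real.exp β + 1 ≠ 0 := by positivity
  rw [neg_zero, Real.exp_zero]
  field_simp
  ring

lemma bridgeMean_self (β : ℝ) : bridgeMean β β = 1 := by
  unfold bridgeMean
  have : Real.exp β + 1 ≠ 0 := by positivity
  rw [Real.exp_neg]
  field_simp

lemma bridgeMean_pos (β s : ℝ) : 0 < bridgeMean β s := by
  unfold bridgeMean; positivity

lemma continuous_bridgeMean (β : ℝ) : Continuous (bridgeMean β) := by
  unfold bridgeMean; fun_prop

/-- The bridge from `y` to `y` is the bridge from `0` to `0`, shifted by its mean. -/
lemma bridgeDensity_add {β : ℝ} (hβ : 0 < β) {P : ℕ} {t : Fin P → ℝ}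
    (ht : ∀ i, t i ∈ Set.Ioo 0 β) (hts : StrictMono t) (y : ℝ) (x : Fin P → ℝ) :
    bridgeDensity β y t (fun i => x i + y * bridgeMean β (t i)) = bridgeDensity β 0 t x := by
  set a := y * (1 / (Real.exp β + 1)) with ha
  set b := y * (Real.exp β / (Real.exp β + 1)) with hb
  have hmean : ∀ s, y * bridgeMean β s = a * Real.exp s + b * Real.exp (-s) := by
    intro s; rw [bridgeMean, ha, hb]; ring
  set S : Fin (P + 2) → ℝ := Fin.cons 0 (Fin.snoc t β : Fin (P + 1) → ℝ) with hS
  set U : Fin (P + 2) → ℝ := Fin.cons 0 (Fin.snoc x 0 : Fin (P + 1) → ℝ) with hU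
  set V : Fin (P + 2) → ℝ := Fin.cons y
    (Fin.snoc (fun i => x i + y * bridgeMean β (t i)) y : Fin (P + 1) → ℝ) with hV
  have hVU : ∀ i, V i = U i + y * bridgeMean β (S i) := by
    intro i
    refine Fin.cases ?_ (fun i => Fin.lastCases ?_ (fun i => ?_) i) i
    · simp [hV, hU, hS, bridgeMean_zero]
    · simp [hV, hU, hS, bridgeMean_self]
    · simp [hV, hU, hS]
  have hinc : ∀ i : Fin (P + 1), 0 < S i.succ - S i.castSucc := by
    intro i
    rw [hS, cons_snoc_castSucc, Fin.cons_succ, snoc_sub_eq_increment ht hts]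
    exact increment_pos (cons_zero_mem hβ ht) i
  set h : Fin (P + 2) → ℝ := fun i => a * Real.exp (S i) * U i + a ^ 2 * Real.exp (S i) ^ 2 / 2 with hh
  have h1 : ∀ i : Fin (P + 1), ouDensity (S i.succ - S i.castSucc) (V i.castSucc) (V i.succ) =
      ouDensity (S i.succ - S i.castSucc) (U i.castSucc) (U i.succ) *
        Real.exp (h i.castSucc - h i.succ) := by
    intro i
    have := ouDensity_add (hinc i) a b (S i.castSucc) (U i.castSucc) (U i.succ)
    rw [add_sub_cancel] at this
    rw [hVU, hVU, hmean, hmean, this]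
  -- The costs of the shift telescope, and the two ends are the ones that appear in the
  -- normalization of the bridge.
  have htel : ∑ i : Fin (P + 1), (h i.castSucc - h i.succ) = h 0 - h (Fin.last (P + 1)) := by
    have e1 := Fin.sum_univ_succ h
    have e2 := Fin.sum_univ_castSucc h
    rw [Finset.sum_sub_distrib]
    linarith
  have h0 : h 0 - h (Fin.last (P + 1)) = a ^ 2 / 2 - a ^ 2 * Real.exp β ^ 2 / 2 := by
    have e1 : S (Fin.last (P + 1)) = β := by
      rw [hS, ← Fin.succ_last, Fin.cons_succ, Fin.snoc_last]
    have e2 : U (Fin.last (P + 1)) = 0 := by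
      rw [hU, ← Fin.succ_last, Fin.cons_succ, Fin.snoc_last]
    simp only [hh, e1, e2]
    simp [hS, hU]
  have hend : ouDensity β y y = ouDensity β 0 0 * Real.exp (a ^ 2 / 2 - a ^ 2 * Real.exp β ^ 2 / 2) := by
    have := ouDensity_add hβ a b 0 0 0
    rw [← hmean, ← hmean] at this
    simp only [zero_add, bridgeMean_zero, bridgeMean_self, mul_one] at this
    rw [this]
    simp
  have hne := (ouDensity_pos hβ 0 0).ne'
  have e : bridgeDensity β y t (fun i => x i + y * bridgeMean β (t i)) =
      (∏ i : Fin (P + 1), ouDensity (S i.succ - S i.castSucc) (V i.castSucc) (V i.succ)) /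
        ouDensity β y y := rfl
  have e' : bridgeDensity β 0 t x =
      (∏ i : Fin (P + 1), ouDensity (S i.succ - S i.castSucc) (U i.castSucc) (U i.succ)) /
        ouDensity β 0 0 := rfl
  rw [e, e']
  simp only [h1]
  rw [Finset.prod_mul_distrib, ← Real.exp_sum, htel, h0, hend, mul_div_mul_right _ _ (Real.exp_pos _).ne']

lemma bridgeDensity_nonneg {β : ℝ} (hβ : 0 < β) {P : ℕ} {t : Fin P → ℝ}
    (ht : ∀ i, t i ∈ Set.Ioo 0 β) (hts : StrictMono t) (y : ℝ) (x : Fin P → ℝ) :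
    0 ≤ bridgeDensity β y t x := by
  have hm := mehler_pos (Real.exp_pos (-β)) (by rw [Real.exp_lt_one_iff]; linarith) y y
  have hpos := increment_pos (cons_zero_mem hβ ht)
  refine nonneg_of_mul_nonneg_right ?_ hm
  rw [mehler_mul_bridgeDensity hβ ht hts]
  exact Finset.prod_nonneg fun l _ => (mehler_pos (Real.exp_pos _)
    (by rw [Real.exp_lt_one_iff]; linarith [hpos l]) _ _).le

lemma continuous_bridgeDensity {β : ℝ} (hβ : 0 < β) {P : ℕ} {t : Fin P → ℝ}
    (ht : ∀ i, t i ∈ Set.Ioo 0 β) (hts : StrictMono t) :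
    Continuous fun p : ℝ × (Fin P → ℝ) => bridgeDensity β p.1 t p.2 := by
  have hβ1 : Real.exp (-β) < 1 := by rw [Real.exp_lt_one_iff]; linarith
  have hm : ∀ y, mehler (Real.exp (-β)) y y ≠ 0 := fun y => (mehler_pos (Real.exp_pos (-β)) hβ1 y y).ne'
  have hpos := increment_pos (cons_zero_mem hβ ht)
  have e : ∀ p : ℝ × (Fin P → ℝ), bridgeDensity β p.1 t p.2 =
      (∏ l, mehler (Real.exp (-increment β (Fin.cons 0 t : Fin (P + 1) → ℝ) l))
        ((Fin.cons p.1 p.2 : Fin (P + 1) → ℝ) l)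
        ((Fin.cons p.1 p.2 : Fin (P + 1) → ℝ) (finRotate (P + 1) l))) /
        mehler (Real.exp (-β)) p.1 p.1 := by
    intro p
    rw [← mehler_mul_bridgeDensity hβ ht hts, mul_div_cancel_left₀ _ (hm _)]
  have hc : Continuous fun p : ℝ × (Fin P → ℝ) => (Fin.cons p.1 p.2 : Fin (P + 1) → ℝ) := by
    refine continuous_pi fun l => ?_
    refine Fin.cases ?_ (fun i => ?_) l
    · exact continuous_fst
    · exact (continuous_apply i).comp continuous_snd
  simp only [e]
  refine Continuous.div (continuous_finsetProd _ fun l _ => ?_) ?_ fun p => hm _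
  · exact (continuous_mehler (Real.exp_pos _) (by rw [Real.exp_lt_one_iff]; linarith [hpos l])).comp
      (((continuous_apply l).comp hc).prodMk ((continuous_apply _).comp hc))
  · exact (continuous_mehler (Real.exp_pos _) hβ1).comp (continuous_fst.prodMk continuous_fst)

/-! ### Relabelling the particles at each time -/

/-- Relabelling the particles at time `l` by the permutation `σ l`. -/
def relabel {p n : ℕ} (σ : Fin p → Equiv.Perm (Fin n)) (x : Fin p → Fin n → ℝ) :
    Fin p → Fin n → ℝ := fun l k => x l (σ l k)

/-- At all times the particles are ordered in the same way as at the first time. -/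
def IsAligned {P n : ℕ} (x : Fin (P + 1) → Fin n → ℝ) : Prop := ∀ l, SameOrder (x 0) (x l)

lemma SameOrder.symm_trans {n : ℕ} {u v w : Fin n → ℝ} (h : SameOrder u v) (h' : SameOrder u w) :
    SameOrder v w := fun i j => (h i j).symm.trans (h' i j)

lemma measurableSet_sameOrder {n : ℕ} :
    MeasurableSet {p : (Fin n → ℝ) × (Fin n → ℝ) | SameOrder p.1 p.2} := by
  have h : {p : (Fin n → ℝ) × (Fin n → ℝ) | SameOrder p.1 p.2} =
      ⋂ i, ⋂ j, {p | p.1 i < p.1 j ↔ p.2 i < p.2 j} := by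
    ext p; simp [SameOrder]
  rw [h]
  refine MeasurableSet.iInter fun i => MeasurableSet.iInter fun j => ?_
  have h1 : Measurable fun p : (Fin n → ℝ) × (Fin n → ℝ) => p.1 i < p.1 j :=
    measurableSet_setOfPred.1 (measurableSet_lt (by fun_prop) (by fun_prop))
  have h2 : Measurable fun p : (Fin n → ℝ) × (Fin n → ℝ) => p.2 i < p.2 j :=
    measurableSet_setOfPred.1 (measurableSet_lt (by fun_prop) (by fun_prop))
  exact measurableSet_setOfPred.2 (h1.iff h2)

lemma measurableSet_isAligned (P n : ℕ) :
    MeasurableSet {x : Fin (P + 1) → Fin n → ℝ | IsAligned x} := by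
  have h : {x : Fin (P + 1) → Fin n → ℝ | IsAligned x} =
      ⋂ l, (fun x : Fin (P + 1) → Fin n → ℝ => (x 0, x l)) ⁻¹'
        {p : (Fin n → ℝ) × (Fin n → ℝ) | SameOrder p.1 p.2} := by
    ext x; simp [IsAligned]
  rw [h]
  exact MeasurableSet.iInter fun l => measurableSet_sameOrder.preimage (by fun_prop)

lemma measurePreserving_relabel {p n : ℕ} (σ : Fin p → Equiv.Perm (Fin n)) :
    MeasurePreserving (relabel σ : (Fin p → Fin n → ℝ) → Fin p → Fin n → ℝ) volume volume := by
  refine volume_preserving_pi (f := fun l (u : Fin n → ℝ) k => u (σ l k)) fun l => ?_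
  have h := volume_measurePreserving_piCongrLeft (fun _ : Fin n => ℝ) (σ l).symm
  convert h using 1
  ext u k
  rw [MeasurableEquiv.coe_piCongrLeft]
  have h := Equiv.piCongrLeft_apply_apply (fun _ : Fin n => ℝ) (σ l).symm u (σ l k)
  rw [Equiv.symm_apply_apply] at h
  exact h.symm

lemma multiDensity_relabel {T : ℝ} (hT : 0 < T) {n p : ℕ} (hp : p ≠ 0) {s : Fin p → ℝ}
    (hs : StrictMono s) (hs0 : ∀ l, s l ∈ Set.Ico 0 (1 / T)) (σ : Fin p → Equiv.Perm (Fin n))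
    (x : Fin p → Fin n → ℝ) : multiDensity T s (relabel σ x) = multiDensity T s x := by
  rw [multiDensity_eq hT hp hs hs0, multiDensity_eq hT hp hs hs0]
  congr 1
  exact corrSum_comp_equiv (Equiv.prodShear (Equiv.refl (Fin p)) σ)
    (fun a : Fin p × Fin n => s a.1) fun a => x a.1 a.2

lemma ae_injective (n : ℕ) : ∀ᵐ u : Fin n → ℝ, Function.Injective u := by
  have h : ∀ i j : Fin n, i ≠ j → ∀ᵐ u : Fin n → ℝ, u i ≠ u j := by
    intro i j hij
    set L : (Fin n → ℝ) →ₗ[ℝ] ℝ := LinearMap.proj (R := ℝ) (φ := fun _ : Fin n => ℝ) i -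
      LinearMap.proj (R := ℝ) (φ := fun _ : Fin n => ℝ) j with hL
    have h1 : (volume : Measure (Fin n → ℝ)) (LinearMap.ker L : Set (Fin n → ℝ)) = 0 := by
      refine Measure.addHaar_submodule _ _ fun h => ?_
      have : (Pi.single i 1 : Fin n → ℝ) ∈ LinearMap.ker L := h ▸ Submodule.mem_top
      rw [LinearMap.mem_ker] at this
      simp [hL, hij.symm] at this
    rw [ae_iff]
    convert h1 using 2
    ext u
    simp [hL, sub_eq_zero]
  have h2 : ∀ᵐ u : Fin n → ℝ, ∀ i j : Fin n, i ≠ j → u i ≠ u j := by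
    rw [ae_all_iff]; intro i; rw [ae_all_iff]; intro j
    by_cases hij : i = j
    · exact Filter.Eventually.of_forall fun u h => absurd hij h
    · filter_upwards [h i j hij] with u hu _ using hu
  filter_upwards [h2] with u hu i j hij
  by_contra hne
  exact hu i j hne hij

lemma ae_forall_injective (p n : ℕ) :
    ∀ᵐ x : Fin p → Fin n → ℝ, ∀ l, Function.Injective (x l) := by
  rw [ae_all_iff]
  intro l
  exact (Measure.tendsto_eval_ae_ae (μ := fun _ : Fin p => (volume : Measure (Fin n → ℝ)))
    (i := l)).eventually (ae_injective n)

lemma isAligned_relabel_cons {P n : ℕ} (σ : Fin P → Equiv.Perm (Fin n))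
    (x : Fin (P + 1) → Fin n → ℝ) :
    IsAligned (relabel (Fin.cons 1 σ : Fin (P + 1) → Equiv.Perm (Fin n)) x) ↔
      ∀ l, SameOrder (x 0) (x l.succ ∘ σ l) := by
  constructor
  · intro h l
    exact h l.succ
  · intro h l
    obtain rfl | ⟨l, rfl⟩ := Fin.eq_zero_or_eq_succ l
    · exact fun i j => Iff.rfl
    · exact h l

-- At each later time exactly one permutation reproduces the initial order, and the times are
-- relabelled independently. Inserting this 1 restricts integrals of symmetric functions to aligned
-- configurations.
open Classical in
lemma sum_isAligned {P n : ℕ} {x : Fin (P + 1) → Fin n → ℝ}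
    (hx : ∀ l, Function.Injective (x l)) :
    ∑ σ : Fin P → Equiv.Perm (Fin n),
      (if IsAligned (relabel (Fin.cons 1 σ : Fin (P + 1) → Equiv.Perm (Fin n)) x)
        then (1 : ℝ≥0∞) else 0) = 1 := by
  have h : ∀ l : Fin P, ∑ σ : Equiv.Perm (Fin n),
      (if SameOrder (x 0) (x l.succ ∘ σ) then (1 : ℝ≥0∞) else 0) = 1 := by
    intro l
    obtain ⟨σ, hσ, hu⟩ := existsUnique_sameOrder (hx 0) (hx l.succ)
    rw [Finset.sum_eq_single σ, if_pos hσ]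
    · intro τ _ hτ
      exact if_neg fun h => hτ (hu τ h)
    · simp
  calc _ = ∑ σ : Fin P → Equiv.Perm (Fin n), ∏ l,
        (if SameOrder (x 0) (x l.succ ∘ σ l) then (1 : ℝ≥0∞) else 0) := by
        refine Finset.sum_congr rfl fun σ _ => ?_
        rw [isAligned_relabel_cons, Finset.prod_ite_zero]
        simp
    _ = ∏ l : Fin P, ∑ σ : Equiv.Perm (Fin n),
        (if SameOrder (x 0) (x l.succ ∘ σ) then (1 : ℝ≥0∞) else 0) := by
        rw [Finset.prod_univ_sum, Fintype.piFinset_univ]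
    _ = 1 := by simp [h]

lemma multiDensity_nonneg_of_isAligned {T : ℝ} (hT : 0 < T) {n P : ℕ} {s : Fin (P + 1) → ℝ}
    (hs0 : ∀ l, s l ∈ Set.Ico 0 (1 / T)) {x : Fin (P + 1) → Fin n → ℝ} (hx : IsAligned x) :
    0 ≤ multiDensity T s x := by
  have hq := boltz_pos T
  have hq1 : boltz T < 1 := by
    rw [boltz, Real.exp_lt_one_iff]; have := one_div_pos.2 hT; linarith
  rw [multiDensity_eq_prod hs0, rpow_div_partitionFn hq]
  have h0 : ∀ l, 0 < Real.exp (-increment (1 / T) s l) := fun l => Real.exp_pos _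
  have h1 : ∀ l, Real.exp (-increment (1 / T) s l) < 1 := fun l => by
    rw [Real.exp_lt_one_iff]; linarith [increment_pos hs0 l]
  refine mul_nonneg (mul_nonneg (by positivity) (inv_nonneg.2 (esum_pos hq hq1 n).le))
    (mul_nonneg ?_ ?_)
  · exact Finset.prod_nonneg fun l _ => Finset.prod_nonneg fun k _ =>
      (mehler_pos (h0 l) (h1 l) _ _).le
  · exact Finset.prod_nonneg fun l _ =>
      (((hx l).symm_trans (hx _)).stepRatio_bounds (h0 l) (h1 l)).1

/-- The density is invariant under relabelling at each time, and almost every configuration can be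
relabelled into an aligned one, where total positivity applies. -/
lemma ae_multiDensity_nonneg {T : ℝ} (hT : 0 < T) {n P : ℕ} {s : Fin (P + 1) → ℝ}
    (hs : StrictMono s) (hs0 : ∀ l, s l ∈ Set.Ico 0 (1 / T)) :
    ∀ᵐ x : Fin (P + 1) → Fin n → ℝ, 0 ≤ multiDensity T s x := by
  classical
  filter_upwards [ae_forall_injective (P + 1) n] with x hx
  have h := sum_isAligned hx
  obtain ⟨σ, _, hσ⟩ := Finset.exists_ne_zero_of_sum_ne_zero (h ▸ one_ne_zero)
  have ha : IsAligned (relabel (Fin.cons 1 σ : Fin (P + 1) → Equiv.Perm (Fin n)) x) := by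
    by_contra hne
    exact hσ (if_neg hne)
  rw [← multiDensity_relabel hT (Nat.succ_ne_zero P) hs hs0 (Fin.cons 1 σ) x]
  exact multiDensity_nonneg_of_isAligned hT hs0 ha

lemma measurable_multiDensity {T : ℝ} (hT : 0 < T) {n p : ℕ} (hp : p ≠ 0) {s : Fin p → ℝ}
    (hs : StrictMono s) (hs0 : ∀ l, s l ∈ Set.Ico 0 (1 / T)) :
    Measurable fun x : Fin p → Fin n → ℝ => multiDensity T s x := by
  obtain ⟨ρ, r, hqρ, hρ1, hr, hr1, ht⟩ := exists_timeBound hT hs0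
  simp only [multiDensity_eq hT hp hs hs0]
  have h := measurable_corrSum (n := n) (boltz_pos T) hqρ hρ1 hr hr1
    (ht.comp (Prod.fst : Fin p × Fin n → Fin p))
  exact (h.comp (measurable_pi_lambda _ fun a => by fun_prop)).const_mul _

open Classical in
/-- A function which is symmetric in the particles at each later time can be integrated over the
aligned configurations only. -/
lemma lintegral_eq_isAligned {T : ℝ} (hT : 0 < T) {n P : ℕ} {s : Fin (P + 1) → ℝ}
    (hs : StrictMono s) (hs0 : ∀ l, s l ∈ Set.Ico 0 (1 / T))
    {F : (Fin (P + 1) → Fin n → ℝ) → ℝ≥0∞} (hF : Measurable F)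
    (hFs : ∀ σ, σ 0 = 1 → ∀ x, F (relabel σ x) = F x) :
    ∫⁻ x, F x * ENNReal.ofReal (multiDensity T s x) =
      (n.factorial : ℝ≥0∞) ^ P * ∫⁻ x, F x * (if IsAligned x then 1 else 0) *
        ENNReal.ofReal (multiDensity T s x) := by
  have hm := measurable_multiDensity hT (n := n) (Nat.succ_ne_zero P) hs hs0
  set H : (Fin (P + 1) → Fin n → ℝ) → ℝ≥0∞ := fun x => F x * (if IsAligned x then 1 else 0) *
    ENNReal.ofReal (multiDensity T s x) with hH
  have hHm : Measurable H := (hF.mul (Measurable.ite (measurableSet_isAligned P n)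
    measurable_const measurable_const)).mul hm.ennreal_ofReal
  have h1 : ∫⁻ x, F x * ENNReal.ofReal (multiDensity T s x) =
      ∫⁻ x, ∑ σ : Fin P → Equiv.Perm (Fin n),
        H (relabel (Fin.cons 1 σ : Fin (P + 1) → Equiv.Perm (Fin n)) x) := by
    refine lintegral_congr_ae ?_
    filter_upwards [ae_forall_injective (P + 1) n] with x hx
    have hF1 : ∀ σ : Fin P → Equiv.Perm (Fin n),
        F (relabel (Fin.cons 1 σ : Fin (P + 1) → Equiv.Perm (Fin n)) x) = F x := fun σ =>
      hFs _ (Fin.cons_zero _ _) x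
    simp only [hH, hF1, multiDensity_relabel hT (Nat.succ_ne_zero P) hs hs0]
    rw [← Finset.sum_mul, ← Finset.mul_sum, sum_isAligned hx, mul_one]
  rw [h1, lintegral_finsetSum (f := fun σ x =>
      H (relabel (Fin.cons 1 σ : Fin (P + 1) → Equiv.Perm (Fin n)) x)) _ fun σ _ =>
    hHm.comp (measurePreserving_relabel (p := P + 1) (Fin.cons 1 σ)).measurable]
  simp only [(measurePreserving_relabel _).lintegral_comp hHm]
  simp [Fintype.card_perm, Nat.cast_pow]

lemma integrable_multiDensity {T : ℝ} (hT : 0 < T) {n p : ℕ} (hp : p ≠ 0) {s : Fin p → ℝ}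
    (hs : StrictMono s) (hs0 : ∀ l, s l ∈ Set.Ico 0 (1 / T)) :
    Integrable fun x : Fin p → Fin n → ℝ => multiDensity T s x := by
  obtain ⟨ρ, r, hqρ, hρ1, hr, hr1, ht⟩ := exists_timeBound hT hs0
  simp only [multiDensity_eq hT hp hs hs0]
  refine Integrable.const_mul ?_ _
  have h := integrable_corrSum (n := n) (boltz_pos T) hqρ hρ1 hr hr1
    (ht.comp (Prod.fst : Fin p × Fin n → Fin p))
  exact ((measurePreserving_uncurry (Fin p) (Fin n)).integrable_comp_emb
    (MeasurableEquiv.measurableEmbedding _)).2 h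

lemma integral_mul_multiDensity {T : ℝ} (hT : 0 < T) {n p : ℕ} (hp : p ≠ 0) {s : Fin p → ℝ}
    (hs : StrictMono s) (hs0 : ∀ l, s l ∈ Set.Ico 0 (1 / T)) (g : (Fin p → Fin n → ℝ) → ℝ) :
    ∫ x, g x * multiDensity T s x = 1 / (n.factorial : ℝ) ^ p * ∫ y : Fin p × Fin n → ℝ,
      g (Function.curry y) * corrSum (boltz T) n (fun b => s b.1) y := by
  rw [← (measurePreserving_uncurry (Fin p) (Fin n)).integral_comp
    (MeasurableEquiv.measurableEmbedding _), ← integral_const_mul]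
  refine integral_congr_ae (Filter.Eventually.of_forall fun x => ?_)
  simp only [multiDensity_eq hT hp hs hs0]
  rw [show Function.curry ((MeasurableEquiv.curry (Fin p) (Fin n) ℝ).symm x) = x from rfl,
    mul_left_comm]
  rfl

/-- The densities at different sets of times are consistent. -/
lemma map_withDensity_multiDensity {T : ℝ} (hT : 0 < T) {n P p : ℕ} {s : Fin (P + 1) → ℝ}
    (hs : StrictMono s) (hs0 : ∀ l, s l ∈ Set.Ico 0 (1 / T)) {f : Fin (p + 1) → Fin (P + 1)}
    (hf : StrictMono f) :
    ((volume : Measure (Fin (P + 1) → Fin n → ℝ)).withDensity fun x =>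
      ENNReal.ofReal (multiDensity T s x)).map (fun x => x ∘ f) =
    (volume : Measure (Fin (p + 1) → Fin n → ℝ)).withDensity fun x =>
      ENNReal.ofReal (multiDensity T (s ∘ f) x) := by
  obtain ⟨ρ, r, hqρ, hρ1, hr, hr1, ht⟩ := exists_timeBound hT hs0
  have hq := boltz_pos T
  have hsf := hs.comp hf
  have hsf0 : ∀ l, (s ∘ f) l ∈ Set.Ico 0 (1 / T) := fun l => hs0 _
  have hfm : Measurable fun x : Fin (P + 1) → Fin n → ℝ => x ∘ f :=
    measurable_pi_lambda _ fun l => measurable_pi_apply _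
  ext B hB
  rw [Measure.map_apply hfm hB, withDensity_apply _ (hfm hB), withDensity_apply _ hB,
    ← ofReal_integral_eq_lintegral_ofReal (integrable_multiDensity hT (Nat.succ_ne_zero _) hs hs0).integrableOn
      (ae_restrict_of_ae (ae_multiDensity_nonneg hT hs hs0)),
    ← ofReal_integral_eq_lintegral_ofReal (integrable_multiDensity hT (Nat.succ_ne_zero _) hsf hsf0).integrableOn
      (ae_restrict_of_ae (ae_multiDensity_nonneg hT hsf hsf0))]
  congr 1
  set g : (Fin (p + 1) → Fin n → ℝ) → ℝ := B.indicator fun _ => 1 with hg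
  have hgm : Measurable g := measurable_const.indicator hB
  have e1 : ∫ x in (fun x : Fin (P + 1) → Fin n → ℝ => x ∘ f) ⁻¹' B, multiDensity T s x =
      ∫ x, g (x ∘ f) * multiDensity T s x := by
    rw [← integral_indicator (hfm hB)]
    refine integral_congr_ae (Filter.Eventually.of_forall fun x => ?_)
    by_cases hx : x ∘ f ∈ B
    · simp [hg, hx]
    · simp [hg, hx]
  have e2 : ∫ x in B, multiDensity T (s ∘ f) x = ∫ x, g x * multiDensity T (s ∘ f) x := by
    rw [← integral_indicator hB]
    refine integral_congr_ae (Filter.Eventually.of_forall fun x => ?_)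
    by_cases hx : x ∈ B
    · simp [hg, hx]
    · simp [hg, hx]
  rw [e1, e2, integral_mul_multiDensity (p := P + 1) hT (Nat.succ_ne_zero _) hs hs0
    fun x => g (x ∘ f), integral_mul_multiDensity (p := p + 1) hT (Nat.succ_ne_zero _) hsf hsf0]
  have h := placements_mul_integral_comp_corrSum (n := n) hq hqρ hρ1 hr hr1
    (ht.comp (Prod.fst : Fin (P + 1) × Fin n → Fin (P + 1)))
    (f := Prod.map f (id : Fin n → Fin n)) (hf.injective.prodMap Function.injective_id)
    (g := fun y => g (Function.curry y))
    (hgm.comp (measurable_pi_lambda _ fun l => measurable_pi_lambda _ fun k =>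
      measurable_pi_apply (l, k))) (fun y => by
        rw [hg]; unfold Set.indicator; split_ifs <;> simp)
  have h1 := placements_slots n hsf.injective
  have h2 := placements_slots n hs.injective
  have ec1 : (fun a : Fin (P + 1) × Fin n => s a.1) ∘ Prod.map f (id : Fin n → Fin n) =
    fun b : Fin (p + 1) × Fin n => (s ∘ f) b.1 := rfl
  change (placements n ((fun a : Fin (P + 1) × Fin n => s a.1) ∘ Prod.map f id) : ℝ) *
    (∫ y : Fin (P + 1) × Fin n → ℝ, g (Function.curry y ∘ f) *
      corrSum (boltz T) n (fun b => s b.1) y) =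
    (placements n (fun a : Fin (P + 1) × Fin n => s a.1) : ℝ) *
    (∫ y : Fin (p + 1) × Fin n → ℝ, g (Function.curry y) *
      corrSum (boltz T) n ((fun a : Fin (P + 1) × Fin n => s a.1) ∘ Prod.map f id) y) at h
  rw [ec1, h1, h2] at h
  have hn : (n.factorial : ℝ) ≠ 0 := by positivity
  push_cast at h
  field_simp
  linear_combination h

/-! ### Product measures with densities -/

lemma lintegral_prod_eq_prod_lintegral {α : Type*} [MeasurableSpace α] : ∀ {n : ℕ}
    (μ : Fin n → Measure α) [∀ i, SigmaFinite (μ i)] {f : Fin n → α → ℝ≥0∞},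
    (∀ i, Measurable (f i)) → ∫⁻ x, ∏ i, f i (x i) ∂Measure.pi μ = ∏ i, ∫⁻ a, f i a ∂μ i := by
  intro n
  induction n with
  | zero => intro μ _ f _; simp
  | succ n ih =>
    intro μ _ f hf
    have h := (measurePreserving_piFinSuccAbove μ 0).symm
    rw [← h.lintegral_comp_emb (MeasurableEquiv.measurableEmbedding _)]
    simp only [MeasurableEquiv.piFinSuccAbove_symm_apply, Fin.insertNthEquiv_zero,
      Fin.prod_univ_succ, Fin.consEquiv_apply, Fin.cons_zero, Fin.cons_succ]
    rw [lintegral_prod_mul (g := fun x : Fin n → α => ∏ i, f i.succ (x i))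
      (hf 0).aemeasurable (Finset.measurable_fun_prod _ fun i _ =>
        (hf i.succ).comp (measurable_pi_apply i)).aemeasurable]
    congr 1
    exact ih (fun i => μ i.succ) fun i => hf i.succ

lemma pi_withDensity {α : Type*} [MeasurableSpace α] {n : ℕ} (μ : Measure α) [SigmaFinite μ]
    {f : Fin n → α → ℝ≥0∞} (hf : ∀ i, Measurable (f i)) (hf' : ∀ i x, f i x ≠ ∞) :
    (Measure.pi fun i => μ.withDensity (f i)) =
      (Measure.pi fun _ : Fin n => μ).withDensity fun x => ∏ i, f i (x i) := by
  have : ∀ i, SigmaFinite (μ.withDensity (f i)) := fun i =>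
    SigmaFinite.withDensity_of_ne_top (Filter.Eventually.of_forall (hf' i))
  refine (Measure.pi_eq fun s hs => ?_)
  rw [withDensity_apply _ (MeasurableSet.univ_pi hs), Measure.restrict_pi_pi,
    lintegral_prod_eq_prod_lintegral _ hf]
  exact Finset.prod_congr rfl fun i _ => (withDensity_apply _ (hs i)).symm

lemma measurePreserving_flip (p n : ℕ) :
    MeasurePreserving (fun (x : Fin n → Fin p → ℝ) l k => x k l) volume volume := by
  have h1 := (measurePreserving_uncurry (Fin p) (Fin n)).symm
  have h2 := volume_measurePreserving_piCongrLeft (fun _ : Fin p × Fin n => ℝ)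
    (Equiv.prodComm (Fin n) (Fin p))
  have h3 := measurePreserving_uncurry (Fin n) (Fin p)
  refine (h1.comp (h2.comp h3)).congr ?_ (Filter.Eventually.of_forall fun x => ?_)
  · exact measurable_pi_lambda _ fun l => measurable_pi_lambda _ fun k => by fun_prop
  · ext l k
    simp only [Function.comp_apply]
    change (MeasurableEquiv.piCongrLeft (fun _ => ℝ) (Equiv.prodComm (Fin n) (Fin p))
      ((MeasurableEquiv.curry (Fin n) (Fin p) ℝ).symm x)) (l, k) = _
    rw [MeasurableEquiv.coe_piCongrLeft]
    exact Equiv.piCongrLeft_apply_apply (fun _ : Fin p × Fin n => ℝ)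
      (Equiv.prodComm (Fin n) (Fin p)) _ (k, l)

/-! ### Mixtures of bridges -/

/-- The mixture of the bridges from `y` to `y`, with weights `∏ G(y_k, β | y_k, 0)`. -/
def bridgeMixture (β : ℝ) {n : ℕ} {Ω : Type*} [MeasurableSpace Ω]
    (Q : Kernel (Fin n → ℝ) Ω) : Measure Ω :=
  ((volume : Measure (Fin n → ℝ)).withDensity fun y =>
    ENNReal.ofReal (∏ k, mehler (Real.exp (-β)) (y k) (y k))).bind Q

section Bridges

variable {β : ℝ} {n : ℕ} {Ω : Type*} [MeasurableSpace Ω] {X : Fin n → ℝ → Ω → ℝ}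
  {Q : Kernel (Fin n → ℝ) Ω}

lemma IsOUBridgeFamily.lintegral_eval (hX : IsOUBridgeFamily β X Q) (hβ : 0 < β) {P : ℕ}
    {t : Fin P → ℝ} (ht : ∀ i, t i ∈ Set.Ioo 0 β) (hts : StrictMono t) (y : Fin n → ℝ)
    {H : (Fin n → Fin P → ℝ) → ℝ≥0∞} (hH : Measurable H) :
    ∫⁻ ω, H (fun k i => X k (t i) ω) ∂Q y =
      ∫⁻ x, H x * ∏ k, ENNReal.ofReal (bridgeDensity β (y k) t (x k)) := by
  have hev : Measurable fun ω (k : Fin n) (i : Fin P) => X k (t i) ω :=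
    measurable_pi_lambda _ fun k => measurable_pi_lambda _ fun i => hX.measurable_eval k (t i)
  have hm : ∀ k, Measurable fun x : Fin P → ℝ => ENNReal.ofReal (bridgeDensity β (y k) t x) :=
    fun k => ENNReal.measurable_ofReal.comp
      ((continuous_bridgeDensity hβ ht hts).comp (Continuous.prodMk_right (y k))).measurable
  have hmp : Measurable fun x : Fin n → Fin P → ℝ =>
      ∏ k, ENNReal.ofReal (bridgeDensity β (y k) t (x k)) :=
    Finset.measurable_fun_prod _ fun k _ => (hm k).comp (measurable_pi_apply k)
  rw [← lintegral_map hH hev, hX.law y P t hts ht, pi_withDensity _ hm fun _ _ =>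
    ENNReal.ofReal_ne_top, lintegral_withDensity_eq_lintegral_mul _ hmp hH]
  refine lintegral_congr fun x => ?_
  rw [Pi.mul_apply, mul_comm]

/-- Normalization is contained in the law at an empty set of times, where the space of positions is
a single point and the bridge density equals 1. -/
lemma IsOUBridgeFamily.isProbabilityMeasure (hX : IsOUBridgeFamily β X Q) (hβ : 0 < β)
    (y : Fin n → ℝ) : IsProbabilityMeasure (Q y) := by
  have h := hX.lintegral_eval hβ (t := (Fin.elim0 : Fin 0 → ℝ)) (fun i => i.elim0)
    (fun i => i.elim0) y (H := fun _ => 1) measurable_const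
  have h1 : ∀ (a : ℝ) (x : Fin 0 → ℝ), bridgeDensity β a (Fin.elim0 : Fin 0 → ℝ) x = 1 := by
    intro a x
    have hm : mehler (Real.exp (-β)) a a ≠ 0 := (mehler_pos (Real.exp_pos _)
      (by rw [Real.exp_lt_one_iff]; linarith) _ _).ne'
    have h := mehler_mul_bridgeDensity hβ (t := (Fin.elim0 : Fin 0 → ℝ)) (fun i => i.elim0)
      (fun i => i.elim0) a x
    refine mul_left_cancel₀ hm (h.trans ?_)
    simp [increment]
  simp only [h1] at h
  refine ⟨?_⟩
  simpa [volume_pi, Measure.pi_univ] using h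

lemma measurable_loopWeight (hβ : 0 < β) : Measurable fun y : Fin n → ℝ =>
    ENNReal.ofReal (∏ k, mehler (Real.exp (-β)) (y k) (y k)) := by
  have h := (continuous_mehler (Real.exp_pos (-β)) (by rw [Real.exp_lt_one_iff]; linarith)).measurable
  have hk : ∀ k : Fin n, Measurable fun y : Fin n → ℝ => mehler (Real.exp (-β)) (y k) (y k) :=
    fun k => h.comp (by fun_prop : Measurable fun y : Fin n → ℝ => (y k, y k))
  have hp : Measurable fun y : Fin n → ℝ => ∏ k, mehler (Real.exp (-β)) (y k) (y k) :=
    Finset.measurable_fun_prod _ fun k _ => hk k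
  exact hp.ennreal_ofReal

lemma lintegral_bridgeMixture (hβ : 0 < β) {H : Ω → ℝ≥0∞} (hH : Measurable H) :
    ∫⁻ ω, H ω ∂bridgeMixture β Q =
      ∫⁻ y : Fin n → ℝ, ENNReal.ofReal (∏ k, mehler (Real.exp (-β)) (y k) (y k)) *
        ∫⁻ ω, H ω ∂Q y := by
  rw [bridgeMixture, Measure.lintegral_bind Q.measurable.aemeasurable hH.aemeasurable,
    lintegral_withDensity_eq_lintegral_mul _ (measurable_loopWeight hβ) hH.lintegral_kernel]
  rfl

lemma IsOUBridgeFamily.isFiniteMeasure_bridgeMixture (hX : IsOUBridgeFamily β X Q) (hβ : 0 < β) :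
    IsFiniteMeasure (bridgeMixture β Q) := by
  have hr1 : Real.exp (-β) < 1 := by rw [Real.exp_lt_one_iff]; linarith
  refine ⟨?_⟩
  rw [← lintegral_one, lintegral_bridgeMixture hβ measurable_const]
  have h1 : ∀ y, ∫⁻ _, 1 ∂Q y = 1 := fun y => by
    have := hX.isProbabilityMeasure hβ y
    simp
  simp only [h1, mul_one]
  have hi : Integrable fun y : Fin n → ℝ => ∏ k, mehler (Real.exp (-β)) (y k) (y k) :=
    Integrable.fintype_prod fun _ => integrable_mehler_diag (Real.exp_pos _) hr1
  exact hi.lintegral_lt_top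

/-- The diagonal propagators, collected particle by particle instead of step by step, are loops,
each a return weight times a bridge density. The determinants leave only the step ratios. The factor
(n!)^P is the one that restricting to aligned configurations produces. -/
lemma multiDensity_cons {T : ℝ} (hT : 0 < T) {P : ℕ} {t : Fin P → ℝ}
    (ht : ∀ i, t i ∈ Set.Ioo 0 (1 / T)) (hts : StrictMono t) {s : Fin (P + 1) → ℝ}
    (hs : s = Fin.cons 0 t) (y : Fin n → ℝ) (x : Fin P → Fin n → ℝ) :
    (n.factorial : ℝ) ^ P * multiDensity T s (Fin.cons y x : Fin (P + 1) → Fin n → ℝ) =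
      1 / n.factorial * (esum (boltz T) n)⁻¹ *
      ((∏ l, stepRatio (Real.exp (-increment (1 / T) s l)) ((Fin.cons y x : Fin (P + 1) → Fin n → ℝ) l)
          ((Fin.cons y x : Fin (P + 1) → Fin n → ℝ) (finRotate (P + 1) l))) *
        ((∏ k, mehler (Real.exp (-(1 / T))) (y k) (y k)) *
          ∏ k, bridgeDensity (1 / T) (y k) t fun l => x l k)) := by
  have hβ : 0 < 1 / T := one_div_pos.2 hT
  have hs0 : ∀ l, s l ∈ Set.Ico 0 (1 / T) := hs ▸ cons_zero_mem hβ ht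
  have hzk : ∀ k l, (Fin.cons y x : Fin (P + 1) → Fin n → ℝ) l k =
      (Fin.cons (y k) (fun l => x l k) : Fin (P + 1) → ℝ) l := by
    intro k l
    obtain rfl | ⟨l, rfl⟩ := Fin.eq_zero_or_eq_succ l <;> simp
  have hpr : (∏ l, ∏ k, mehler (Real.exp (-increment (1 / T) s l))
      ((Fin.cons y x : Fin (P + 1) → Fin n → ℝ) l k)
      ((Fin.cons y x : Fin (P + 1) → Fin n → ℝ) (finRotate (P + 1) l) k)) =
      (∏ k, mehler (Real.exp (-(1 / T))) (y k) (y k)) *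
        ∏ k, bridgeDensity (1 / T) (y k) t fun l => x l k := by
    rw [Finset.prod_comm, ← Finset.prod_mul_distrib]
    refine Finset.prod_congr rfl fun k _ => ?_
    rw [mehler_mul_bridgeDensity hβ ht hts, hs]
    simp only [hzk]
  rw [multiDensity_eq_prod hs0, hpr, rpow_div_partitionFn (boltz_pos T), pow_succ]
  have hn : (n.factorial : ℝ) ≠ 0 := by positivity
  field_simp

lemma measurable_bridgeDensity_prod (hβ : 0 < β) {P : ℕ} {t : Fin P → ℝ}
    (ht : ∀ i, t i ∈ Set.Ioo 0 β) (hts : StrictMono t) :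
    Measurable fun p : (Fin n → ℝ) × (Fin P → Fin n → ℝ) =>
      ∏ k, ENNReal.ofReal (bridgeDensity β (p.1 k) t fun l => p.2 l k) := by
  have hb := (continuous_bridgeDensity hβ ht hts).measurable
  have hm : ∀ k : Fin n, Measurable fun p : (Fin n → ℝ) × (Fin P → Fin n → ℝ) =>
      ((p.1 k, fun l => p.2 l k) : ℝ × (Fin P → ℝ)) := fun k =>
    ((measurable_pi_apply k).comp measurable_fst).prodMk (measurable_pi_lambda _ fun l =>
      (measurable_pi_apply k).comp ((measurable_pi_apply l).comp measurable_snd))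
  generalize hg : (fun p : ℝ × (Fin P → ℝ) => bridgeDensity β p.1 t p.2) = g at hb
  have hgp : ∀ a x, bridgeDensity β a t x = g (a, x) := fun a x => hg ▸ rfl
  simp only [hgp]
  exact Finset.measurable_fun_prod _ fun k _ => (hb.comp (hm k)).ennreal_ofReal

/-- Sampling a mixture of bridges at the times `0 < t_1 < ⋯ < t_P`. -/
lemma IsOUBridgeFamily.lintegral_bridgeMixture_eval (hX : IsOUBridgeFamily β X Q) (hβ : 0 < β)
    {P : ℕ} {t : Fin P → ℝ} (ht : ∀ i, t i ∈ Set.Ioo 0 β) (hts : StrictMono t)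
    {s : Fin (P + 1) → ℝ} (hs : s = Fin.cons 0 t)
    {H : (Fin (P + 1) → Fin n → ℝ) → ℝ≥0∞} (hH : Measurable H) :
    ∫⁻ ω, H (fun l k => X k (s l) ω) ∂bridgeMixture β Q =
      ∫⁻ p : (Fin n → ℝ) × (Fin P → Fin n → ℝ), H (Fin.cons p.1 p.2) *
        (ENNReal.ofReal (∏ k, mehler (Real.exp (-β)) (p.1 k) (p.1 k)) *
          ∏ k, ENNReal.ofReal (bridgeDensity β (p.1 k) t fun l => p.2 l k)) := by
  have hcons : Measurable fun p : (Fin n → ℝ) × (Fin P → Fin n → ℝ) =>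
      (Fin.cons p.1 p.2 : Fin (P + 1) → Fin n → ℝ) := by
    refine measurable_pi_lambda _ fun l => ?_
    obtain rfl | ⟨l, rfl⟩ := Fin.eq_zero_or_eq_succ l
    · simpa using measurable_fst
    · simp only [Fin.cons_succ]; fun_prop
  have hev : Measurable fun ω (l : Fin (P + 1)) (k : Fin n) => X k (s l) ω :=
    measurable_pi_lambda _ fun l => measurable_pi_lambda _ fun k => hX.measurable_eval k (s l)
  have hm1 : Measurable fun p : (Fin n → ℝ) × (Fin P → Fin n → ℝ) => H (Fin.cons p.1 p.2) :=
    hH.comp hcons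
  have hm2 : Measurable fun p : (Fin n → ℝ) × (Fin P → Fin n → ℝ) =>
      ENNReal.ofReal (∏ k, mehler (Real.exp (-β)) (p.1 k) (p.1 k)) :=
    (measurable_loopWeight hβ).comp measurable_fst
  have hm3 := hm1.mul (hm2.mul (measurable_bridgeDensity_prod (n := n) hβ ht hts))
  rw [lintegral_bridgeMixture hβ (H := fun ω => H fun l k => X k (s l) ω) (hH.comp hev)]
  rw [show (volume : Measure ((Fin n → ℝ) × (Fin P → Fin n → ℝ))) =
    (volume : Measure (Fin n → ℝ)).prod volume from rfl]
  refine Eq.trans ?_ (lintegral_prod _ hm3.aemeasurable).symm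
  refine lintegral_congr fun y => ?_
  have hHy : Measurable fun x : Fin P → Fin n → ℝ => H (Fin.cons y x) :=
    hm1.comp measurable_prodMk_left
  have hfl := measurePreserving_flip P n
  have hev' : ∫⁻ ω, H (fun l k => X k (s l) ω) ∂Q y =
      ∫⁻ ω, H (Fin.cons y fun l k => X k (t l) ω) ∂Q y := by
    refine lintegral_congr_ae ?_
    filter_upwards [hX.endpoints y] with ω hω
    congr 1
    ext l k
    rw [hs]
    obtain rfl | ⟨l, rfl⟩ := Fin.eq_zero_or_eq_succ l
    · simpa using (hω k).1
    · simp
  rw [hev']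
  have e2 := hX.lintegral_eval hβ ht hts y
    (H := fun x => H (Fin.cons y fun l k => x k l)) (hHy.comp hfl.measurable)
  rw [e2, ← lintegral_const_mul' _ _ ENNReal.ofReal_ne_top]
  have e3 := hfl.lintegral_comp (hm3.comp (measurable_prodMk_left (x := y)))
  refine Eq.trans ?_ e3
  refine lintegral_congr fun x => ?_
  simp only [Function.comp_apply, Pi.mul_apply]
  rw [mul_left_comm]

open Classical in
/-- The multi-time density of the fermions as an expectation over bridges. -/
lemma IsOUBridgeFamily.lintegral_multiDensity {T : ℝ} (hX : IsOUBridgeFamily (1 / T) X Q)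
    (hT : 0 < T) {P : ℕ} {t : Fin P → ℝ} (ht : ∀ i, t i ∈ Set.Ioo 0 (1 / T)) (hts : StrictMono t)
    {s : Fin (P + 1) → ℝ} (hs : s = Fin.cons 0 t)
    {F : (Fin (P + 1) → Fin n → ℝ) → ℝ≥0∞} (hF : Measurable F)
    (hFs : ∀ σ, σ 0 = 1 → ∀ x, F (relabel σ x) = F x) :
    ∫⁻ x, F x * ENNReal.ofReal (multiDensity T s x) =
      ENNReal.ofReal (1 / n.factorial * (esum (boltz T) n)⁻¹) *
      ∫⁻ ω, F (fun l k => X k (s l) ω) * (if IsAligned fun l k => X k (s l) ω then 1 else 0) *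
        ENNReal.ofReal (∏ l, stepRatio (Real.exp (-increment (1 / T) s l))
          (fun k => X k (s l) ω) (fun k => X k (s (finRotate (P + 1) l)) ω))
        ∂bridgeMixture (1 / T) Q := by
  have hβ : 0 < 1 / T := one_div_pos.2 hT
  have hq := boltz_pos T
  have hr1 : Real.exp (-(1 / T)) < 1 := by rw [Real.exp_lt_one_iff]; linarith
  have hC : 0 ≤ (esum (boltz T) n)⁻¹ := inv_nonneg.2 (esum_pos hq hr1 n).le
  have hs0 : ∀ l, s l ∈ Set.Ico 0 (1 / T) := hs ▸ cons_zero_mem hβ ht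
  have hss : StrictMono s := hs ▸ cons_zero_strictMono ht hts
  set W : (Fin (P + 1) → Fin n → ℝ) → ℝ := fun x =>
    ∏ l, stepRatio (Real.exp (-increment (1 / T) s l)) (x l) (x (finRotate (P + 1) l)) with hW
  have hWm : Measurable W := by
    have hl : ∀ l : Fin (P + 1), Continuous fun x : Fin (P + 1) → Fin n → ℝ =>
        stepRatio (Real.exp (-increment (1 / T) s l)) (x l) (x (finRotate (P + 1) l)) := fun l =>
      (continuous_stepRatio (Real.exp (-increment (1 / T) s l)) n).comp
        (by fun_prop : Continuous fun x : Fin (P + 1) → Fin n → ℝ =>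
          (x l, x (finRotate (P + 1) l)))
    exact (continuous_finsetProd _ fun l _ => hl l).measurable
  set H : (Fin (P + 1) → Fin n → ℝ) → ℝ≥0∞ := fun x =>
    F x * (if IsAligned x then 1 else 0) * ENNReal.ofReal (W x) with hH
  have hHm : Measurable H := (hF.mul (Measurable.ite (measurableSet_isAligned P n)
    measurable_const measurable_const)).mul hWm.ennreal_ofReal
  set c := ENNReal.ofReal (1 / n.factorial * (esum (boltz T) n)⁻¹) with hc
  have hdens : ∀ (y : Fin n → ℝ) (x : Fin P → Fin n → ℝ),
      (n.factorial : ℝ≥0∞) ^ P * (F (Fin.cons y x) *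
        (if IsAligned (Fin.cons y x : Fin (P + 1) → Fin n → ℝ) then 1 else 0) *
        ENNReal.ofReal (multiDensity T s (Fin.cons y x : Fin (P + 1) → Fin n → ℝ))) =
      c * (H (Fin.cons y x) * (ENNReal.ofReal (∏ k, mehler (Real.exp (-(1 / T))) (y k) (y k)) *
          ∏ k, ENNReal.ofReal (bridgeDensity (1 / T) (y k) t fun l => x l k))) := by
    intro y x
    have hmc := multiDensity_cons hT ht hts hs y x
    have hHz : H (Fin.cons y x) = F (Fin.cons y x) *
      (if IsAligned (Fin.cons y x : Fin (P + 1) → Fin n → ℝ) then 1 else 0) *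
      ENNReal.ofReal (W (Fin.cons y x)) := rfl
    rw [hHz]
    have hm0 : 0 ≤ ∏ k, mehler (Real.exp (-(1 / T))) (y k) (y k) :=
      Finset.prod_nonneg fun k _ => (mehler_pos (Real.exp_pos _) hr1 _ _).le
    rw [← ENNReal.ofReal_prod_of_nonneg fun k _ => bridgeDensity_nonneg hβ ht hts _ _,
      ← ENNReal.ofReal_mul hm0]
    have hWz : (∏ l, stepRatio (Real.exp (-increment (1 / T) s l))
        ((Fin.cons y x : Fin (P + 1) → Fin n → ℝ) l)
          ((Fin.cons y x : Fin (P + 1) → Fin n → ℝ) (finRotate (P + 1) l))) =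
      W (Fin.cons y x) := rfl
    rw [hWz] at hmc
    by_cases ha : IsAligned (Fin.cons y x : Fin (P + 1) → Fin n → ℝ)
    swap
    · simp [ha]
    have h1 : ∀ l, Real.exp (-increment (1 / T) s l) < 1 := fun l => by
      rw [Real.exp_lt_one_iff]; linarith [increment_pos hs0 l]
    have hW0 : 0 ≤ W (Fin.cons y x) := Finset.prod_nonneg fun l _ =>
      (((ha l).symm_trans (ha _)).stepRatio_bounds (Real.exp_pos _) (h1 l)).1
    have hkey := congrArg ENNReal.ofReal hmc
    rw [ENNReal.ofReal_mul (by positivity), ENNReal.ofReal_pow (by positivity),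
      ENNReal.ofReal_natCast, ENNReal.ofReal_mul (mul_nonneg (by positivity) hC),
      ENNReal.ofReal_mul hW0] at hkey
    rw [if_pos ha, mul_one, mul_left_comm, hkey]
    rw [← hc]
    simp only [mul_assoc, mul_left_comm]
  have hsplit := (volume_preserving_piFinSuccAbove (fun _ : Fin (P + 1) => Fin n → ℝ) 0).symm
  rw [lintegral_eq_isAligned hT hss hs0 hF hFs, ← lintegral_const_mul' _ _
    (ENNReal.pow_ne_top (ENNReal.natCast_ne_top _)),
    ← hsplit.lintegral_comp_emb (MeasurableEquiv.measurableEmbedding _)]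
  have e1 : ∀ p : (Fin n → ℝ) × (Fin P → Fin n → ℝ),
      (MeasurableEquiv.piFinSuccAbove (fun _ : Fin (P + 1) => Fin n → ℝ) 0).symm p =
        (Fin.cons p.1 p.2 : Fin (P + 1) → Fin n → ℝ) := fun p => by
    rw [MeasurableEquiv.piFinSuccAbove_symm_apply, Fin.insertNthEquiv_zero]
    rfl
  simp only [e1, hdens]
  rw [lintegral_const_mul' _ _ ENNReal.ofReal_ne_top]
  congr 1
  exact (hX.lintegral_bridgeMixture_eval hβ ht hts hs hHm).symm

end Bridges

/-! ### Refining grids of times -/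

/-- The times `0 < t_1 < ⋯ < t_P < β` contain `S` and have mesh at most `β / (N + 1)`. -/
structure IsGrid (β : ℝ) (S : Finset ℝ) (N : ℕ) {P : ℕ} (t : Fin P → ℝ) : Prop where
  mem : ∀ i, t i ∈ Set.Ioo 0 β
  strictMono : StrictMono t
  card_le : P ≤ S.card + N
  exists_eq : ∀ u ∈ S, ∃ i, t i = u
  increment_le : ∀ l, increment β (Fin.cons 0 t : Fin (P + 1) → ℝ) l ≤ β / (N + 1)
  exists_near : ∀ u ∈ Set.Icc 0 β, ∃ l, |u - (Fin.cons 0 t : Fin (P + 1) → ℝ) l| ≤ β / (N + 1)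

lemma exists_isGrid {β : ℝ} (hβ : 0 < β) {S : Finset ℝ} (hS : ∀ u ∈ S, u ∈ Set.Ioo 0 β) (N : ℕ) :
    ∃ (P : ℕ) (t : Fin P → ℝ), IsGrid β S N t := by
  classical
  set h : ℝ := β / (N + 1) with hh
  have hN : (0 : ℝ) < N + 1 := by positivity
  have hh0 : 0 < h := by positivity
  have hNh : (N + 1 : ℝ) * h = β := by rw [hh]; field_simp
  -- The N interior points of the division of [0, β] into N + 1 equal parts; with time 0 in front,
  -- they give the mesh bound also across the end of the period.
  set A : Finset ℝ := S ∪ (Finset.range N).image fun j : ℕ => ((j : ℝ) + 1) * h with hA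
  have hAmem : ∀ u ∈ A, u ∈ Set.Ioo 0 β := by
    intro u hu
    rcases Finset.mem_union.1 hu with hu | hu
    · exact hS u hu
    · obtain ⟨j, hj, rfl⟩ := Finset.mem_image.1 hu
      have : (j : ℝ) + 1 ≤ N := by exact_mod_cast Finset.mem_range.1 hj
      refine ⟨by positivity, ?_⟩
      rw [← hNh]
      exact mul_lt_mul_of_pos_right (by linarith) hh0
  set t : Fin A.card → ℝ := ⇑(A.orderEmbOfFin rfl) with ht
  have htA : ∀ u ∈ A, ∃ i, t i = u := fun u hu => by
    have : u ∈ Set.range (A.orderEmbOfFin rfl) := by rw [Finset.range_orderEmbOfFin]; exact hu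
    exact this
  have htm : ∀ i, t i ∈ Set.Ioo 0 β := fun i => hAmem _ (Finset.orderEmbOfFin_mem A rfl i)
  have hts : StrictMono t := (A.orderEmbOfFin rfl).strictMono
  set s : Fin (A.card + 1) → ℝ := Fin.cons 0 t with hs
  have hss : StrictMono s := cons_zero_strictMono htm hts
  have hs0 : ∀ l, s l ∈ Set.Ico 0 β := cons_zero_mem hβ htm
  have hgrid : ∀ j : ℕ, j ≤ N → ∃ l, s l = j * h := by
    intro j hj
    rcases j with _ | j
    · exact ⟨0, by simp [hs]⟩
    · obtain ⟨i, hi⟩ := htA (((j : ℝ) + 1) * h) (Finset.mem_union_right _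
        (Finset.mem_image_of_mem _ (Finset.mem_range.2 hj)))
      exact ⟨i.succ, by simp [hs, hi]⟩
  have hfl : ∀ u : ℝ, 0 ≤ u → ((⌊u / h⌋₊ : ℕ) : ℝ) * h ≤ u ∧ u < ((⌊u / h⌋₊ : ℕ) + 1 : ℝ) * h := by
    intro u hu
    have h1 := Nat.floor_le (div_nonneg hu hh0.le)
    have h2 := Nat.lt_floor_add_one (u / h)
    exact ⟨(le_div_iff₀ hh0).1 h1, (div_lt_iff₀ hh0).1 h2⟩
  refine ⟨A.card, t, htm, hts, ?_, fun u hu => htA u (Finset.mem_union_left _ hu), fun l => ?_,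
    fun u hu => ?_⟩
  · refine (Finset.card_union_le _ _).trans (Nat.add_le_add_left ?_ _)
    exact Finset.card_image_le.trans (Finset.card_range N).le
  · change increment β s l ≤ h
    induction l using Fin.lastCases with
    | last =>
      have h0 : s 0 = 0 := by simp [hs]
      rw [increment, finRotate_last, h0, if_neg (not_lt.2 (hs0 _).1)]
      obtain ⟨l, hl⟩ := hgrid N le_rfl
      have : s l ≤ s (Fin.last _) := hss.monotone (Fin.le_last l)
      rw [hl] at this
      linarith
    | cast i =>
      have hrot : finRotate (A.card + 1) i.castSucc = i.succ := by
        rw [finRotate_apply]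
        simp
      rw [increment, hrot, if_pos (hss Fin.castSucc_lt_succ)]
      obtain ⟨h1, h2⟩ := hfl (s i.castSucc) (hs0 _).1
      set j := ⌊s i.castSucc / h⌋₊ with hj
      by_cases hjN : j + 1 ≤ N
      · obtain ⟨l, hl⟩ := hgrid (j + 1) hjN
        have hlt : i.castSucc < l := by
          rw [← hss.lt_iff_lt, hl]; push_cast; exact h2
        have : s i.succ ≤ s l := hss.monotone (Fin.castSucc_lt_iff_succ_le.1 hlt)
        rw [hl] at this
        push_cast at this
        linarith
      · have hj' : (N : ℝ) ≤ j := by exact_mod_cast (by omega : N ≤ j)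
        have : (N : ℝ) * h ≤ j * h := by gcongr
        have := (hs0 i.succ).2
        linarith
  · obtain ⟨h1, h2⟩ := hfl u hu.1
    by_cases hj : ⌊u / h⌋₊ ≤ N
    · obtain ⟨l, hl⟩ := hgrid _ hj
      refine ⟨l, ?_⟩
      change |u - s l| ≤ h
      rw [hl, abs_le]
      constructor <;> linarith
    · obtain ⟨l, hl⟩ := hgrid N le_rfl
      refine ⟨l, ?_⟩
      change |u - s l| ≤ h
      have hj' : (N : ℝ) + 1 ≤ (⌊u / h⌋₊ : ℕ) := by exact_mod_cast (by omega)
      have : ((N : ℝ) + 1) * h ≤ (⌊u / h⌋₊ : ℕ) * h := by gcongr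
      have := hu.2
      rw [hl, abs_le]
      constructor <;> linarith

/-! ### The weight of a path sampled on a grid -/

open Classical in
/-- The weight of a path sampled at the times `s`. -/
def pathWeight (β : ℝ) {n P : ℕ} (s : Fin (P + 1) → ℝ) (Y : ℝ → Fin n → ℝ) : ℝ≥0∞ :=
  (if IsAligned fun l => Y (s l) then 1 else 0) *
    ENNReal.ofReal (∏ l, stepRatio (Real.exp (-increment β s l)) (Y (s l))
      (Y (s (finRotate (P + 1) l))))

lemma pathWeight_le_one {β : ℝ} {n P : ℕ} {s : Fin (P + 1) → ℝ} (hs : ∀ l, s l ∈ Set.Ico 0 β)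
    (Y : ℝ → Fin n → ℝ) : pathWeight β s Y ≤ 1 := by
  unfold pathWeight
  split_ifs with ha
  · rw [one_mul, ENNReal.ofReal_le_one]
    have hb : ∀ l, 0 ≤ stepRatio (Real.exp (-increment β s l)) (Y (s l))
        (Y (s (finRotate (P + 1) l))) ∧ stepRatio (Real.exp (-increment β s l)) (Y (s l))
        (Y (s (finRotate (P + 1) l))) ≤ 1 := fun l =>
      ((ha l).symm_trans (ha _)).stepRatio_bounds (Real.exp_pos _)
        (by rw [Real.exp_lt_one_iff]; linarith [increment_pos hs l])
    exact Finset.prod_le_one (fun l _ => (hb l).1) fun l _ => (hb l).2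
  · simp

lemma one_sub_le_prod {ι : Type*} (s : Finset ι) {a : ι → ℝ} {ε : ℝ} (hε : ∀ i ∈ s, 1 - ε ≤ a i)
    (h1 : ∀ i ∈ s, a i ≤ 1) (h0 : ∀ i ∈ s, 0 ≤ a i) : 1 - s.card * ε ≤ ∏ i ∈ s, a i := by
  classical
  induction s using Finset.induction_on with
  | empty => simp
  | insert i s hi ih =>
    rw [Finset.prod_insert hi, Finset.card_insert_of_notMem hi]
    have h := ih (fun j hj => hε j (Finset.mem_insert_of_mem hj))
      (fun j hj => h1 j (Finset.mem_insert_of_mem hj))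
      (fun j hj => h0 j (Finset.mem_insert_of_mem hj))
    have hp1 : ∏ j ∈ s, a j ≤ 1 := Finset.prod_le_one
      (fun j hj => h0 j (Finset.mem_insert_of_mem hj))
      fun j hj => h1 j (Finset.mem_insert_of_mem hj)
    have hp0 : 0 ≤ ∏ j ∈ s, a j :=
      Finset.prod_nonneg fun j hj => h0 j (Finset.mem_insert_of_mem hj)
    have hi1 := hε i (Finset.mem_insert_self _ _)
    have hi2 := h1 i (Finset.mem_insert_self _ _)
    push_cast
    nlinarith

lemma exists_forall_le_abs_sub {β : ℝ} {n : ℕ} {Y : ℝ → Fin n → ℝ}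
    (hY : ∀ k, ContinuousOn (fun u => Y u k) (Set.Icc 0 β))
    (hne : ∀ k l, k ≠ l → ∀ u ∈ Set.Icc 0 β, Y u k ≠ Y u l) :
    ∃ δ > 0, ∀ k l, k ≠ l → ∀ u ∈ Set.Icc 0 β, δ ≤ |Y u k - Y u l| := by
  have h : ∀ p : Fin n × Fin n, ∃ δ > 0, p.1 ≠ p.2 → ∀ u ∈ Set.Icc 0 β, δ ≤ |Y u p.1 - Y u p.2| := by
    rintro ⟨k, l⟩
    by_cases hkl : k = l
    · exact ⟨1, one_pos, fun h => absurd hkl h⟩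
    rcases (Set.Icc 0 β).eq_empty_or_nonempty with he | hne'
    · exact ⟨1, one_pos, fun _ u hu => by simp [he] at hu⟩
    obtain ⟨u, hu, hmin⟩ := isCompact_Icc.exists_isMinOn hne' ((hY k).sub (hY l)).abs
    exact ⟨|Y u k - Y u l|, abs_pos.2 (sub_ne_zero.2 (hne k l hkl u hu)), fun _ v hv => hmin hv⟩
  choose δ hδ h using h
  rcases isEmpty_or_nonempty (Fin n × Fin n) with he | hne'
  · exact ⟨1, one_pos, fun k l => (he.false (k, l)).elim⟩
  · obtain ⟨p, hp⟩ := Finite.exists_min δ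
    exact ⟨δ p, hδ p, fun k l hkl u hu => (hp (k, l)).trans (h (k, l) hkl u hu)⟩

lemma sameOrder_of_forall_ne {β : ℝ} {n : ℕ} {Y : ℝ → Fin n → ℝ}
    (hY : ∀ k, ContinuousOn (fun u => Y u k) (Set.Icc 0 β))
    (hne : ∀ k l, k ≠ l → ∀ u ∈ Set.Icc 0 β, Y u k ≠ Y u l) {u v : ℝ} (hu : u ∈ Set.Icc 0 β)
    (hv : v ∈ Set.Icc 0 β) : SameOrder (Y u) (Y v) := by
  have key : ∀ u ∈ Set.Icc 0 β, ∀ v ∈ Set.Icc 0 β, ∀ k l, Y u k < Y u l → Y v k < Y v l := by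
    intro u hu v hv k l h
    have hkl : k ≠ l := by rintro rfl; exact lt_irrefl _ h
    by_contra hcon
    have hcon' : Y v l < Y v k := lt_of_le_of_ne (not_lt.1 hcon) fun e => hne k l hkl v hv e.symm
    obtain ⟨w, hw, hw0⟩ := (isPreconnected_Icc (a := (0 : ℝ)) (b := β)).intermediate_value hu hv
      ((hY k).sub (hY l)) ⟨(sub_neg.2 h).le, (sub_pos.2 hcon').le⟩
    exact hne k l hkl w hw (sub_eq_zero.1 hw0)
  exact fun k l => ⟨key u hu v hv k l, key v hv u hu k l⟩

section Limit

variable {β : ℝ} {S : Finset ℝ} {n : ℕ} {P : ℕ → ℕ} {t : (N : ℕ) → Fin (P N) → ℝ}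
  {Y : ℝ → Fin n → ℝ}

/-- Paths that never meet keep their order, and by compactness a uniform distance δ. Each step ratio
is then at least 1 - n! e^{-c(N+1)}, while the number of steps grows only linearly in N. -/
lemma tendsto_pathWeight_one (hβ : 0 < β) (ht : ∀ N, IsGrid β S N (t N))
    (hY : ∀ k, ContinuousOn (fun u => Y u k) (Set.Icc 0 β))
    (hne : ∀ k l, k ≠ l → ∀ u ∈ Set.Icc 0 β, Y u k ≠ Y u l) :
    Filter.Tendsto (fun N => pathWeight β (Fin.cons 0 (t N) : Fin (P N + 1) → ℝ) Y) Filter.atTop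
      (nhds 1) := by
  obtain ⟨δ, hδ, hsep⟩ := exists_forall_le_abs_sub hY hne
  -- The exponent in `SameOrder.stepRatio_ge`, by `ratio_exp_ge` for a step of length at most
  -- β/(N+1), with the factor N + 1 taken out.
  set c : ℝ := Real.exp (-β) / (2 * β) * δ ^ 2 / 2 with hc
  have hc0 : 0 < c := by positivity
  have hlow : ∀ N : ℕ, ENNReal.ofReal (1 - ((S.card : ℝ) + 1) * n.factorial *
      (((N : ℝ) + 1) * Real.exp (-(c * (N + 1))))) ≤
      pathWeight β (Fin.cons 0 (t N) : Fin (P N + 1) → ℝ) Y := by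
    intro N
    set s : Fin (P N + 1) → ℝ := Fin.cons 0 (t N) with hs
    have hs0 : ∀ l, s l ∈ Set.Ico 0 β := cons_zero_mem hβ (ht N).mem
    have hs1 : ∀ l, s l ∈ Set.Icc 0 β := fun l => ⟨(hs0 l).1, (hs0 l).2.le⟩
    have hso : ∀ l l', SameOrder (Y (s l)) (Y (s l')) := fun l l' =>
      sameOrder_of_forall_ne hY hne (hs1 l) (hs1 l')
    have hal : IsAligned fun l => Y (s l) := fun l => hso 0 l
    unfold pathWeight
    rw [if_pos hal, one_mul]
    refine ENNReal.ofReal_le_ofReal ?_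
    have hN : (0 : ℝ) < N + 1 := by positivity
    have hstep : ∀ l, 1 - n.factorial * Real.exp (-(c * (N + 1))) ≤
        stepRatio (Real.exp (-increment β s l)) (Y (s l)) (Y (s (finRotate (P N + 1) l))) := by
      intro l
      have hi0 := increment_pos hs0 l
      have hi1 : increment β s l ≤ β / (N + 1) := (ht N).increment_le l
      have hi2 : increment β s l ≤ β := hi1.trans (div_le_self hβ.le (by linarith))
      have hr1 : Real.exp (-increment β s l) < 1 := by rw [Real.exp_lt_one_iff]; linarith
      refine le_trans ?_ ((hso l (finRotate _ l)).stepRatio_ge (Real.exp_pos _) hr1 hδ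
        (fun i j hij => hsep i j hij _ (hs1 _)) fun i j hij => hsep i j hij _ (hs1 _))
      have h3 : c * (N + 1) ≤ Real.exp (-increment β s l) /
          (1 - Real.exp (-increment β s l) ^ 2) * δ ^ 2 / 2 := by
        have h4 : Real.exp (-β) / (2 * β) * (N + 1) ≤ Real.exp (-β) / (2 * increment β s l) := by
          rw [div_mul_eq_mul_div, div_le_div_iff₀ (by positivity) (by positivity)]
          have := (le_div_iff₀ hN).1 hi1
          have he := Real.exp_pos (-β)
          nlinarith [mul_le_mul_of_nonneg_left this he.le]
        have h5 := h4.trans (ratio_exp_ge hi0 hi2)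
        have h6 : c * (N + 1) = Real.exp (-β) / (2 * β) * (N + 1) * δ ^ 2 / 2 := by rw [hc]; ring
        rw [h6]
        gcongr
      gcongr
    have hprod := one_sub_le_prod Finset.univ (fun l _ => hstep l)
      (fun l _ => ((hso l (finRotate _ l)).stepRatio_bounds (Real.exp_pos _)
        (by rw [Real.exp_lt_one_iff]; linarith [increment_pos hs0 l])).2)
      (fun l _ => ((hso l (finRotate _ l)).stepRatio_bounds (Real.exp_pos _)
        (by rw [Real.exp_lt_one_iff]; linarith [increment_pos hs0 l])).1)
    refine le_trans ?_ hprod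
    rw [Finset.card_univ, Fintype.card_fin]
    have hP : (P N : ℝ) ≤ S.card + N := by exact_mod_cast (ht N).card_le
    have hP1 : ((P N + 1 : ℕ) : ℝ) ≤ ((S.card : ℝ) + 1) * (N + 1) := by
      push_cast
      have : (0 : ℝ) ≤ (S.card : ℝ) * N := by positivity
      linarith
    have he : 0 ≤ (n.factorial : ℝ) * Real.exp (-(c * (N + 1))) := by positivity
    nlinarith [mul_le_mul_of_nonneg_right hP1 he]
  have hup : ∀ N, pathWeight β (Fin.cons 0 (t N) : Fin (P N + 1) → ℝ) Y ≤ 1 := fun N =>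
    pathWeight_le_one (cons_zero_mem hβ (ht N).mem) Y
  have hx : Filter.Tendsto (fun N : ℕ => c * ((N : ℝ) + 1)) Filter.atTop Filter.atTop :=
    (Filter.tendsto_atTop_add_const_right _ 1 tendsto_natCast_atTop_atTop).const_mul_atTop hc0
  have hlim : Filter.Tendsto (fun N : ℕ => ((N : ℝ) + 1) * Real.exp (-(c * (N + 1))))
      Filter.atTop (nhds 0) := by
    have h := ((Real.tendsto_pow_mul_exp_neg_atTop_nhds_zero 1).comp hx).const_mul c⁻¹
    rw [mul_zero] at h
    refine h.congr fun N => ?_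
    simp only [Function.comp_apply, pow_one]
    field_simp
  have hlim2 := (ENNReal.continuous_ofReal.tendsto _).comp
    ((hlim.const_mul (((S.card : ℝ) + 1) * n.factorial)).const_sub 1)
  rw [mul_zero, sub_zero, ENNReal.ofReal_one] at hlim2
  exact tendsto_of_tendsto_of_tendsto_of_le_of_le hlim2 tendsto_const_nhds hlow hup

/-- By continuity the reversed order persists on a neighbourhood of u in [0, β]. A sufficiently fine
grid has a point there, alignment fails, and the weight is exactly 0 from then on. -/
lemma tendsto_pathWeight_zero (ht : ∀ N, IsGrid β S N (t N))
    (hY : ∀ k, ContinuousOn (fun u => Y u k) (Set.Icc 0 β)) {k l : Fin n} (h0 : Y 0 l < Y 0 k)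
    {u : ℝ} (hu : u ∈ Set.Icc 0 β) (hlt : Y u k < Y u l) :
    Filter.Tendsto (fun N => pathWeight β (Fin.cons 0 (t N) : Fin (P N + 1) → ℝ) Y) Filter.atTop
      (nhds 0) := by
  have hev : ∀ᶠ v in nhdsWithin u (Set.Icc 0 β), Y v k < Y v l :=
    (hY k u hu).eventually_lt (hY l u hu) hlt
  obtain ⟨ε, hε, hball⟩ := Metric.mem_nhdsWithin_iff.1 hev
  have hmesh : ∀ᶠ N : ℕ in Filter.atTop, β / ((N : ℝ) + 1) < ε := by
    have : Filter.Tendsto (fun N : ℕ => β / ((N : ℝ) + 1)) Filter.atTop (nhds 0) :=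
      tendsto_const_nhds.div_atTop
        (Filter.tendsto_atTop_add_const_right _ 1 tendsto_natCast_atTop_atTop)
    exact this.eventually_lt_const hε
  refine tendsto_const_nhds.congr' ?_
  filter_upwards [hmesh] with N hN
  symm
  unfold pathWeight
  rw [if_neg, zero_mul]
  intro ha
  obtain ⟨i, hi⟩ := (ht N).exists_near u hu
  have hβ : 0 < β := by
    by_contra hβ
    have := hu.1.trans hu.2
    have h00 : u = 0 := le_antisymm (hu.2.trans (not_lt.1 hβ)) hu.1
    rw [h00] at hlt
    exact lt_asymm h0 hlt
  have hmem := cons_zero_mem hβ (ht N).mem i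
  have := hball ⟨by rw [Metric.mem_ball, dist_comm, Real.dist_eq]; exact hi.trans_lt hN,
    hmem.1, hmem.2.le⟩
  have h2 := (ha i l k).1 (by simpa using h0)
  exact lt_asymm h2 this

end Limit

/-! ### Bridges almost surely do not touch without crossing -/

/-- A countable dense set of times. -/
def rationalTimes (β : ℝ) : Set ℝ := Set.Ioo 0 β ∩ Set.range ((↑) : ℚ → ℝ)

lemma countable_rationalTimes (β : ℝ) : (rationalTimes β).Countable :=
  (Set.countable_range _).mono Set.inter_subset_right

lemma Icc_subset_closure_rationalTimes {β : ℝ} (hβ : 0 < β) :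
    Set.Icc 0 β ⊆ closure (rationalTimes β) := by
  rw [← closure_Ioo hβ.ne]
  exact closure_minimal (Rat.denseRange_cast.open_subset_closure_inter isOpen_Ioo) isClosed_closure

lemma le_of_rationalTimes {β : ℝ} (hβ : 0 < β) {f g : ℝ → ℝ} (hf : ContinuousOn f (Set.Icc 0 β))
    (hg : ContinuousOn g (Set.Icc 0 β)) (h : ∀ u ∈ rationalTimes β, f u ≤ g u) {u : ℝ}
    (hu : u ∈ Set.Icc 0 β) : f u ≤ g u := by
  have hsub : rationalTimes β ⊆ Set.Icc 0 β := fun v hv => Set.Ioo_subset_Icc_self hv.1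
  exact ContinuousWithinAt.closure_le (Icc_subset_closure_rationalTimes hβ hu)
    ((hf u hu).mono hsub) ((hg u hu).mono hsub) h

lemma lintegral_comp_multiDensity {T : ℝ} (hT : 0 < T) {n P p : ℕ} {s : Fin (P + 1) → ℝ}
    (hs : StrictMono s) (hs0 : ∀ l, s l ∈ Set.Ico 0 (1 / T)) {f : Fin (p + 1) → Fin (P + 1)}
    (hf : StrictMono f) {F : (Fin (p + 1) → Fin n → ℝ) → ℝ≥0∞} (hF : Measurable F) :
    ∫⁻ x : Fin (P + 1) → Fin n → ℝ, F (x ∘ f) * ENNReal.ofReal (multiDensity T s x) =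
      ∫⁻ x, F x * ENNReal.ofReal (multiDensity T (s ∘ f) x) := by
  have hfm : Measurable fun x : Fin (P + 1) → Fin n → ℝ => x ∘ f :=
    measurable_pi_lambda _ fun l => measurable_pi_apply _
  have hFf : Measurable fun x : Fin (P + 1) → Fin n → ℝ => F (x ∘ f) := hF.comp hfm
  have hm1 : Measurable fun x : Fin (P + 1) → Fin n → ℝ => ENNReal.ofReal (multiDensity T s x) :=
    (measurable_multiDensity hT (Nat.succ_ne_zero _) hs hs0).ennreal_ofReal
  have hm2 : Measurable fun x : Fin (p + 1) → Fin n → ℝ =>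
      ENNReal.ofReal (multiDensity T (s ∘ f) x) :=
    (measurable_multiDensity hT (Nat.succ_ne_zero _) (hs.comp hf) fun l => hs0 (f l)).ennreal_ofReal
  have h := congrArg (fun μ => ∫⁻ x, F x ∂μ) (map_withDensity_multiDensity hT (n := n) hs hs0 hf)
  rw [lintegral_map hF hfm, lintegral_withDensity_eq_lintegral_mul _ hm1 hFf,
    lintegral_withDensity_eq_lintegral_mul _ hm2 hF] at h
  simpa only [Pi.mul_apply, mul_comm] using h

section Bridges

variable {β : ℝ} {n : ℕ} {Ω : Type*} [MeasurableSpace Ω] {X : Fin n → ℝ → Ω → ℝ}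
  {Q : Kernel (Fin n → ℝ) Ω}

/-- The event that, at the times in `S`, the gap between particles `k` and `l` is at least
`c` times the mean of the bridge from `1` to `1`. -/
def gapEvent (X : Fin n → ℝ → Ω → ℝ) (β : ℝ) (k l : Fin n) (S : Set ℝ) (c : ℝ) : Set Ω :=
  {ω | ∀ u ∈ S, c * bridgeMean β u ≤ X k u ω - X l u ω}

lemma IsOUBridgeFamily.measurableSet_gapEvent (hX : IsOUBridgeFamily β X Q) (k l : Fin n)
    {S : Set ℝ} (hS : S.Countable) (c : ℝ) : MeasurableSet (gapEvent X β k l S c) := by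
  have h : gapEvent X β k l S c = ⋂ u ∈ S, {ω | c * bridgeMean β u ≤ X k u ω - X l u ω} := by
    ext; simp [gapEvent]
  rw [h]
  exact MeasurableSet.biInter hS fun u _ => measurableSet_le measurable_const
    ((hX.measurable_eval k u).sub (hX.measurable_eval l u))

/-- Bridges from y are bridges from 0 shifted by y times the mean, so measuring gaps in units of the
mean makes a change of starting points a translation of the threshold c. -/
lemma IsOUBridgeFamily.measure_gapEvent_finset (hX : IsOUBridgeFamily β X Q) (hβ : 0 < β)
    (k l : Fin n) {S : Finset ℝ} (hS : ∀ u ∈ S, u ∈ Set.Ioo 0 β) (c : ℝ) (y : Fin n → ℝ) :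
    Q y (gapEvent X β k l S c) = Q 0 (gapEvent X β k l S (c - (y k - y l))) := by
  set t : Fin S.card → ℝ := ⇑(S.orderEmbOfFin rfl) with ht
  have htm : ∀ i, t i ∈ Set.Ioo 0 β := fun i => hS _ (Finset.orderEmbOfFin_mem S rfl i)
  have hts : StrictMono t := (S.orderEmbOfFin rfl).strictMono
  have hrange : Set.range t = (S : Set ℝ) := Finset.range_orderEmbOfFin S rfl
  set B : ℝ → Set (Fin n → Fin S.card → ℝ) := fun c =>
    {x | ∀ i, c * bridgeMean β (t i) ≤ x k i - x l i} with hB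
  have hBm : ∀ c, MeasurableSet (B c) := by
    intro c
    have h : B c = ⋂ i, {x | c * bridgeMean β (t i) ≤ x k i - x l i} := by ext; simp [hB]
    rw [h]
    exact MeasurableSet.iInter fun i => measurableSet_le measurable_const (by fun_prop)
  have hQ : ∀ (y : Fin n → ℝ) (c : ℝ), Q y (gapEvent X β k l S c) =
      ∫⁻ x, (B c).indicator 1 x * ∏ j, ENNReal.ofReal (bridgeDensity β (y j) t (x j)) := by
    intro y c
    rw [← hX.lintegral_eval hβ htm hts y (measurable_one.indicator (hBm c)),
      ← lintegral_indicator_one (hX.measurableSet_gapEvent k l S.countable_toSet c)]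
    refine lintegral_congr fun ω => ?_
    have hiff : ω ∈ gapEvent X β k l S c ↔ (fun k i => X k (t i) ω) ∈ B c := by
      simp only [gapEvent, hB, ← hrange, Set.forall_mem_range]
      exact Iff.rfl
    by_cases hω : ω ∈ gapEvent X β k l S c
    · rw [Set.indicator_of_mem hω, Set.indicator_of_mem (hiff.1 hω)]
      rfl
    · rw [Set.indicator_of_notMem hω, Set.indicator_of_notMem fun h => hω (hiff.2 h)]
  rw [hQ, hQ, ← lintegral_add_right_eq_self (μ := (volume : Measure (Fin n → Fin S.card → ℝ))) _
    fun k i => y k * bridgeMean β (t i)]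
  refine lintegral_congr fun x => ?_
  congr 1
  · have hiff : (x + fun k i => y k * bridgeMean β (t i)) ∈ B c ↔ x ∈ B (c - (y k - y l)) := by
      refine forall_congr' fun i => ?_
      simp only [Pi.add_apply]
      constructor <;> intro h <;> linarith
    by_cases hx : x ∈ B (c - (y k - y l))
    · rw [Set.indicator_of_mem hx, Set.indicator_of_mem (hiff.2 hx)]
      rfl
    · rw [Set.indicator_of_notMem hx, Set.indicator_of_notMem fun h => hx (hiff.1 h)]
  · refine Finset.prod_congr rfl fun j _ => ?_
    congr 1
    exact bridgeDensity_add hβ htm hts (y j) (x j)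

lemma IsOUBridgeFamily.measure_gapEvent (hX : IsOUBridgeFamily β X Q) (hβ : 0 < β)
    (k l : Fin n) (c : ℝ) (y : Fin n → ℝ) :
    Q y (gapEvent X β k l (rationalTimes β) c) =
      Q 0 (gapEvent X β k l (rationalTimes β) (c - (y k - y l))) := by
  classical
  have : Countable (rationalTimes β) := (countable_rationalTimes β).to_subtype
  have hprob := hX.isProbabilityMeasure hβ
  have hlim : ∀ (y : Fin n → ℝ) (c : ℝ), Filter.Tendsto
      (fun I : Finset (rationalTimes β) => Q y (gapEvent X β k l (I.image (↑) : Finset ℝ) c))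
      Filter.atTop (nhds (Q y (gapEvent X β k l (rationalTimes β) c))) := by
    intro y c
    have := hprob y
    have h := tendsto_measure_iInter_atTop (μ := Q y)
      (s := fun I : Finset (rationalTimes β) => gapEvent X β k l (I.image (↑) : Finset ℝ) c)
      (fun I => (hX.measurableSet_gapEvent k l (Finset.countable_toSet _) c).nullMeasurableSet)
      (fun I J hIJ ω hω u hu => hω u (by
        rw [Finset.mem_coe] at hu ⊢
        exact Finset.image_subset_image hIJ hu)) ⟨∅, measure_ne_top _ _⟩
    suffices hset : gapEvent X β k l (rationalTimes β) c =
        ⋂ I : Finset (rationalTimes β), gapEvent X β k l (I.image (↑) : Finset ℝ) c by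
      rw [hset]; exact h
    ext ω
    rw [Set.mem_iInter]
    constructor
    · intro hω I u hu
      obtain ⟨v, _, rfl⟩ := Finset.mem_image.1 (Finset.mem_coe.1 hu)
      exact hω v v.2
    · intro hω u hu
      exact hω {⟨u, hu⟩} u (by simp)
  refine tendsto_nhds_unique (hlim y c) ((hlim 0 (c - (y k - y l))).congr fun I => ?_)
  refine (hX.measure_gapEvent_finset hβ k l (fun u hu => ?_) c y).symm
  obtain ⟨v, _, rfl⟩ := Finset.mem_image.1 hu
  exact v.2.1

lemma gapEvent_anti (k l : Fin n) {S : Set ℝ} {c c' : ℝ} (h : c ≤ c') :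
    gapEvent X β k l S c' ⊆ gapEvent X β k l S c := fun _ hω u hu =>
  (mul_le_mul_of_nonneg_right h (bridgeMean_pos β u).le).trans (hω u hu)

/-- The probability that the gap of the bridges from `0` to `0` stays above `-a` times the mean. -/
def gapProb (Q : Kernel (Fin n → ℝ) Ω) (X : Fin n → ℝ → Ω → ℝ) (β : ℝ) (k l : Fin n) (a : ℝ) : ℝ :=
  (Q 0).real (gapEvent X β k l (rationalTimes β) (-a))

lemma IsOUBridgeFamily.monotone_gapProb (hX : IsOUBridgeFamily β X Q) (hβ : 0 < β) (k l : Fin n) :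
    Monotone (gapProb Q X β k l) := by
  have := hX.isProbabilityMeasure hβ 0
  exact fun a b hab => measureReal_mono (gapEvent_anti k l (neg_le_neg hab))

/-- Gaps that are nonnegative but come arbitrarily close to 0 have probability at most the left jump
of the monotone function `gapProb` at y_k - y_l, which is 0 at a point of continuity. No fine path
property of the bridges is needed. -/
lemma IsOUBridgeFamily.measure_touch (hX : IsOUBridgeFamily β X Q) (hβ : 0 < β) {k l : Fin n}
    {y : Fin n → ℝ} (hy : ContinuousAt (gapProb Q X β k l) (y k - y l)) :
    Q y (gapEvent X β k l (rationalTimes β) 0 \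
      ⋃ j : ℕ, gapEvent X β k l (rationalTimes β) (1 / ((j : ℝ) + 1))) = 0 := by
  have hp := hX.isProbabilityMeasure hβ
  have hc := countable_rationalTimes β
  have hreal : ∀ c, (Q y).real (gapEvent X β k l (rationalTimes β) c) =
      gapProb Q X β k l (y k - y l - c) := by
    intro c
    rw [gapProb, Measure.real, Measure.real, hX.measure_gapEvent hβ k l c y]
    congr 3
    ring
  have h0 : Filter.Tendsto (fun j : ℕ => gapProb Q X β k l (y k - y l) -
      gapProb Q X β k l (y k - y l - 1 / ((j : ℝ) + 1))) Filter.atTop (nhds 0) := by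
    have h1 : Filter.Tendsto (fun j : ℕ => y k - y l - 1 / ((j : ℝ) + 1)) Filter.atTop
        (nhds (y k - y l)) := by
      simpa using tendsto_one_div_add_atTop_nhds_zero_nat.const_sub (y k - y l)
    simpa using (hy.tendsto.comp h1).const_sub (gapProb Q X β k l (y k - y l))
  set E := gapEvent X β k l (rationalTimes β) 0 \
      ⋃ j : ℕ, gapEvent X β k l (rationalTimes β) (1 / ((j : ℝ) + 1)) with hE
  have hle : ∀ j : ℕ, (Q y).real E ≤ gapProb Q X β k l (y k - y l) -
      gapProb Q X β k l (y k - y l - 1 / ((j : ℝ) + 1)) := by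
    intro j
    have h1 : (0 : ℝ) ≤ 1 / ((j : ℝ) + 1) := by positivity
    have h2 := measureReal_sdiff (μ := Q y) (gapEvent_anti (X := X) (β := β) k l (S := rationalTimes β) h1)
      (hX.measurableSet_gapEvent k l hc (1 / ((j : ℝ) + 1)))
    rw [hreal, hreal, sub_zero] at h2
    rw [← h2]
    exact measureReal_mono (Set.sdiff_subset_sdiff_right (Set.subset_iUnion
      (fun j : ℕ => gapEvent X β k l (rationalTimes β) (1 / ((j : ℝ) + 1))) j))
  have h3 : (Q y).real E ≤ 0 := ge_of_tendsto' h0 hle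
  have h4 : (Q y).real E = 0 := le_antisymm h3 measureReal_nonneg
  exact (measureReal_eq_zero_iff).1 h4

lemma ae_sub_notMem {n : ℕ} {S : Set ℝ} (hS : S.Countable) {k l : Fin n} (hkl : k ≠ l) :
    ∀ᵐ y : Fin n → ℝ, y k - y l ∉ S := by
  set L : (Fin n → ℝ) →ₗ[ℝ] ℝ := LinearMap.proj (R := ℝ) (φ := fun _ : Fin n => ℝ) k -
      LinearMap.proj (R := ℝ) (φ := fun _ : Fin n => ℝ) l with hL
  have hsurj : Function.Surjective L := fun a => ⟨Pi.single k a, by simp [hL, hkl.symm]⟩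
  obtain ⟨c, _, hc⟩ := L.exists_map_addHaar_eq_smul_addHaar
    (volume : Measure (Fin n → ℝ)) (volume : Measure ℝ) hsurj
  have hm : Measurable L := L.continuous_of_finiteDimensional.measurable
  have h : (volume : Measure (Fin n → ℝ)).map L S = 0 := by
    rw [hc, Measure.smul_apply, hS.measure_zero, smul_zero]
  rw [Measure.map_apply hm hS.measurableSet] at h
  rw [ae_iff]
  convert h using 2
  ext y
  simp [hL]

/-- By compactness, disjoint continuous paths stay some 1/(j+1) apart, a condition that may be
tested on countably many times. -/
lemma IsOUBridgeFamily.measurableSet_nonintersecting (hX : IsOUBridgeFamily β X Q) (hβ : 0 < β) :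
    MeasurableSet (nonintersecting β X) := by
  have hc := countable_rationalTimes β
  have h : nonintersecting β X = ⋂ k, ⋂ l, ⋂ _ : k ≠ l, ⋃ j : ℕ, ⋂ u ∈ rationalTimes β,
      {ω | 1 / ((j : ℝ) + 1) ≤ |X k u ω - X l u ω|} := by
    ext ω
    simp only [Set.mem_iInter, Set.mem_iUnion]
    constructor
    · intro hω k l hkl
      obtain ⟨δ, hδ, hsep⟩ := exists_forall_le_abs_sub (β := β) (Y := fun u k => X k u ω)
        (fun k => hX.continuous_path k ω) hω
      obtain ⟨j, hj⟩ := exists_nat_one_div_lt hδ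
      exact ⟨j, fun u hu => hj.le.trans (hsep k l hkl u (Set.Ioo_subset_Icc_self hu.1))⟩
    · intro hω k l hkl u hu
      obtain ⟨j, hj⟩ := hω k l hkl
      have h1 := le_of_rationalTimes hβ (f := fun _ => 1 / ((j : ℝ) + 1)) continuousOn_const
        ((hX.continuous_path k ω).sub (hX.continuous_path l ω)).abs hj hu
      have h2 : (0 : ℝ) < 1 / ((j : ℝ) + 1) := by positivity
      exact sub_ne_zero.1 (abs_pos.1 (h2.trans_le h1))
  rw [h]
  exact MeasurableSet.iInter fun k => MeasurableSet.iInter fun l => MeasurableSet.iInter fun _ =>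
    MeasurableSet.iUnion fun j => MeasurableSet.biInter hc fun u _ =>
      measurableSet_le measurable_const
        ((hX.measurable_eval k u).sub (hX.measurable_eval l u)).abs

/-- Up to null events, bridges which intersect cross each other. -/
lemma IsOUBridgeFamily.ae_crossing (hX : IsOUBridgeFamily β X Q) (hβ : 0 < β) :
    ∀ᵐ ω ∂bridgeMixture β Q, ω ∉ nonintersecting β X →
      ∃ k l, X l 0 ω < X k 0 ω ∧ ∃ u ∈ Set.Icc 0 β, X k u ω < X l u ω := by
  set touch : Fin n → Fin n → Set Ω := fun k l => gapEvent X β k l (rationalTimes β) 0 \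
      ⋃ j : ℕ, gapEvent X β k l (rationalTimes β) (1 / ((j : ℝ) + 1)) with htouch
  have hc := countable_rationalTimes β
  have htm : ∀ k l, MeasurableSet (touch k l) := fun k l =>
    (hX.measurableSet_gapEvent k l hc 0).diff
      (MeasurableSet.iUnion fun j => hX.measurableSet_gapEvent k l hc _)
  set bad : Set Ω := ⋃ k, ⋃ l, ⋃ _ : k ≠ l, (touch k l ∪ {ω | X k 0 ω = X l 0 ω}) with hbad
  have hbm : MeasurableSet bad := MeasurableSet.iUnion fun k => MeasurableSet.iUnion fun l =>
    MeasurableSet.iUnion fun _ => (htm k l).union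
      (measurableSet_eq_fun (hX.measurable_eval k 0) (hX.measurable_eval l 0))
  have hnull : bridgeMixture β Q bad = 0 := by
    rw [← lintegral_indicator_one hbm, lintegral_bridgeMixture hβ (measurable_one.indicator hbm)]
    refine (lintegral_congr_ae ?_).trans lintegral_zero
    -- A monotone function has countably many discontinuities, and almost every y has all its
    -- differences outside these countable sets.
    have hdisc : ∀ᵐ y : Fin n → ℝ, ∀ k l, k ≠ l → ContinuousAt (gapProb Q X β k l) (y k - y l) := by
      rw [ae_all_iff]; intro k; rw [ae_all_iff]; intro l
      by_cases hkl : k = l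
      · exact Filter.Eventually.of_forall fun y h => absurd hkl h
      · filter_upwards [ae_sub_notMem (hX.monotone_gapProb hβ k l).countable_not_continuousAt hkl]
          with y hy _
        by_contra hcon
        exact hy hcon
    filter_upwards [hdisc, ae_injective n] with y hy hinj
    rw [lintegral_indicator_one hbm]
    have h0 : Q y bad = 0 := by
      rw [hbad]
      simp only [measure_iUnion_null_iff, measure_union_null_iff]
      refine fun k l hkl => ⟨hX.measure_touch hβ (hy k l hkl), ?_⟩
      have : ∀ᵐ ω ∂Q y, ¬ X k 0 ω = X l 0 ω := by
        filter_upwards [hX.endpoints y] with ω hω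
        rw [(hω k).1, (hω l).1]
        exact fun h => hkl (hinj h)
      rw [ae_iff] at this
      simpa using this
    rw [h0, mul_zero]
  have hae : ∀ᵐ ω ∂bridgeMixture β Q, ω ∉ bad := by
    rw [ae_iff]; simpa using hnull
  filter_upwards [hae] with ω hω hint
  by_contra hcon
  push Not at hcon
  have hgood : ∀ k l, k ≠ l → ω ∉ touch k l ∧ X k 0 ω ≠ X l 0 ω := by
    intro k l hkl
    constructor
    · intro h; exact hω (Set.mem_iUnion.2 ⟨k, Set.mem_iUnion.2 ⟨l, Set.mem_iUnion.2 ⟨hkl, Or.inl h⟩⟩⟩)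
    · intro h; exact hω (Set.mem_iUnion.2 ⟨k, Set.mem_iUnion.2 ⟨l, Set.mem_iUnion.2 ⟨hkl, Or.inr h⟩⟩⟩)
  have key : ∀ k l, X l 0 ω < X k 0 ω → ∀ u ∈ Set.Icc 0 β, X k u ω ≠ X l u ω := by
    intro k l h0 u hu heq
    have hkl : k ≠ l := by rintro rfl; exact lt_irrefl _ h0
    have hpos := hcon k l h0
    have hE : ω ∈ gapEvent X β k l (rationalTimes β) 0 := by
      intro v hv
      rw [zero_mul]
      exact sub_nonneg.2 (hpos v (Set.Ioo_subset_Icc_self hv.1))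
    have hU : ω ∈ ⋃ j : ℕ, gapEvent X β k l (rationalTimes β) (1 / ((j : ℝ) + 1)) := by
      by_contra h
      exact (hgood k l hkl).1 ⟨hE, h⟩
    obtain ⟨j, hj⟩ := Set.mem_iUnion.1 hU
    have h1 := le_of_rationalTimes hβ (f := fun v => 1 / ((j : ℝ) + 1) * bridgeMean β v)
      (g := fun v => X k v ω - X l v ω)
      ((continuous_bridgeMean β).const_mul _).continuousOn
      ((hX.continuous_path k ω).sub (hX.continuous_path l ω)) hj hu
    have h2 : 0 < 1 / ((j : ℝ) + 1) * bridgeMean β u := mul_pos (by positivity) (bridgeMean_pos β u)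
    linarith [sub_eq_zero.2 heq]
  refine hint fun k l hkl u hu => ?_
  rcases lt_or_gt_of_ne (hgood k l hkl).2 with h | h
  · exact fun e => key l k h u hu e.symm
  · exact key k l h u hu

open Classical in
/-- Integrating against the multi-time density a function which is symmetric in the particles at each
later time amounts to averaging it over the bridges which do not intersect. -/
lemma IsOUBridgeFamily.lintegral_multiDensity_eq {T : ℝ} (hX : IsOUBridgeFamily (1 / T) X Q)
    (hT : 0 < T) {P : ℕ} {t : Fin P → ℝ} (ht : ∀ i, t i ∈ Set.Ioo 0 (1 / T)) (hts : StrictMono t)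
    {s : Fin (P + 1) → ℝ} (hs : s = Fin.cons 0 t)
    {F : (Fin (P + 1) → Fin n → ℝ) → ℝ≥0∞} (hF : Measurable F)
    (hFs : ∀ σ, σ 0 = 1 → ∀ x, F (relabel σ x) = F x) {B : ℝ≥0∞} (hB : B ≠ ∞) (hFB : ∀ x, F x ≤ B) :
    ∫⁻ x, F x * ENNReal.ofReal (multiDensity T s x) =
      ENNReal.ofReal (1 / n.factorial * (esum (boltz T) n)⁻¹) *
      ∫⁻ ω in nonintersecting (1 / T) X, F (fun l k => X k (s l) ω) ∂bridgeMixture (1 / T) Q := by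
  have hβ : 0 < 1 / T := one_div_pos.2 hT
  have hfin := hX.isFiniteMeasure_bridgeMixture hβ
  have hNm := hX.measurableSet_nonintersecting hβ
  set S : Finset ℝ := Finset.univ.image t with hS
  have hSm : ∀ u ∈ S, u ∈ Set.Ioo 0 (1 / T) := by
    intro u hu
    obtain ⟨i, _, rfl⟩ := Finset.mem_image.1 hu
    exact ht i
  -- All grids contain the given times. By consistency of the densities the left side below is the
  -- same for every N, so it equals the limit of the expectations over bridges.
  choose R τ hτ using fun N => exists_isGrid hβ hSm N
  set c := ENNReal.ofReal (1 / n.factorial * (esum (boltz T) n)⁻¹) with hcdef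
  have hss : StrictMono s := hs ▸ cons_zero_strictMono ht hts
  have hev : Measurable fun ω (l : Fin (P + 1)) (k : Fin n) => X k (s l) ω :=
    measurable_pi_lambda _ fun l => measurable_pi_lambda _ fun k => hX.measurable_eval k (s l)
  have hFev : Measurable fun ω => F fun l k => X k (s l) ω := hF.comp hev
  have hwm : ∀ N, Measurable fun ω => pathWeight (1 / T) (Fin.cons 0 (τ N) : Fin (R N + 1) → ℝ)
      fun u k => X k u ω := by
    intro N
    set σ : Fin (R N + 1) → ℝ := Fin.cons 0 (τ N) with hσ
    have he : Measurable fun ω (l : Fin (R N + 1)) (k : Fin n) => X k (σ l) ω :=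
      measurable_pi_lambda _ fun l => measurable_pi_lambda _ fun k => hX.measurable_eval k (σ l)
    have hst : ∀ l, Measurable fun x : Fin (R N + 1) → Fin n → ℝ =>
        stepRatio (Real.exp (-increment (1 / T) σ l)) (x l) (x (finRotate (R N + 1) l)) := fun l =>
      (continuous_stepRatio (Real.exp (-increment (1 / T) σ l)) n).measurable.comp
        (by fun_prop : Measurable fun x : Fin (R N + 1) → Fin n → ℝ =>
          (x l, x (finRotate (R N + 1) l)))
    have hw : Measurable fun x : Fin (R N + 1) → Fin n → ℝ =>
        (if IsAligned x then (1 : ℝ≥0∞) else 0) * ENNReal.ofReal (∏ l,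
          stepRatio (Real.exp (-increment (1 / T) σ l)) (x l) (x (finRotate (R N + 1) l))) :=
      (Measurable.ite (measurableSet_isAligned (R N) n) measurable_const measurable_const).mul
        (Finset.measurable_fun_prod _ fun l _ => hst l).ennreal_ofReal
    exact hw.comp he
  have hstep : ∀ N, ∫⁻ x, F x * ENNReal.ofReal (multiDensity T s x) = c *
      ∫⁻ ω, F (fun l k => X k (s l) ω) *
        pathWeight (1 / T) (Fin.cons 0 (τ N) : Fin (R N + 1) → ℝ) (fun u k => X k u ω)
        ∂bridgeMixture (1 / T) Q := by
    intro N
    set σ : Fin (R N + 1) → ℝ := Fin.cons 0 (τ N) with hσ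
    have hσs : StrictMono σ := cons_zero_strictMono (hτ N).mem (hτ N).strictMono
    have hσ0 : ∀ l, σ l ∈ Set.Ico 0 (1 / T) := cons_zero_mem hβ (hτ N).mem
    have hf : ∀ l, ∃ j, σ j = s l := by
      intro l
      obtain rfl | ⟨i, rfl⟩ := Fin.eq_zero_or_eq_succ l
      · exact ⟨0, by simp [hs, hσ]⟩
      · obtain ⟨j, hj⟩ := (hτ N).exists_eq (t i) (Finset.mem_image_of_mem t (Finset.mem_univ i))
        exact ⟨j.succ, by simp [hs, hσ, hj]⟩
    choose f hf using hf
    have hfm : StrictMono f := fun i j hij => by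
      rw [← hσs.lt_iff_lt, hf, hf]; exact hss hij
    have hcomp : σ ∘ f = s := funext hf
    -- The initial time is kept, so a relabelling of the grid that fixes time 0 restricts to one of
    -- the original times that does so.
    have hf0 : f 0 = 0 := hσs.injective (by rw [hf]; simp [hs, hσ])
    have hfmeas : Measurable fun x : Fin (R N + 1) → Fin n → ℝ => x ∘ f :=
      measurable_pi_lambda _ fun l => measurable_pi_apply _
    have h1 := lintegral_comp_multiDensity hT hσs hσ0 hfm hF
    rw [hcomp] at h1
    rw [← h1, hX.lintegral_multiDensity hT (hτ N).mem (hτ N).strictMono hσ (F := fun x => F (x ∘ f))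
      (hF.comp hfmeas) (fun σ' hσ' x => hFs (σ' ∘ f) (by rw [Function.comp_apply, hf0, hσ']) (x ∘ f))]
    congr 1
    refine lintegral_congr fun ω => ?_
    have hFe : F ((fun l k => X k (σ l) ω) ∘ f) = F fun l k => X k (s l) ω := by
      congr 1
      ext l k
      simp only [Function.comp_apply, hf]
    rw [hFe, mul_assoc]
    rfl
  have hlim : Filter.Tendsto (fun N => ∫⁻ ω, F (fun l k => X k (s l) ω) *
        pathWeight (1 / T) (Fin.cons 0 (τ N) : Fin (R N + 1) → ℝ) (fun u k => X k u ω)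
        ∂bridgeMixture (1 / T) Q) Filter.atTop
      (nhds (∫⁻ ω, (nonintersecting (1 / T) X).indicator (fun ω => F fun l k => X k (s l) ω) ω
        ∂bridgeMixture (1 / T) Q)) := by
    refine tendsto_lintegral_of_dominated_convergence (fun _ => B) (fun N => hFev.mul (hwm N))
      (fun N => Filter.Eventually.of_forall fun ω => ?_) ?_ ?_
    · calc _ ≤ B * 1 := mul_le_mul' (hFB _) (pathWeight_le_one (cons_zero_mem hβ (hτ N).mem) _)
        _ = B := mul_one B
    · rw [lintegral_const]
      exact ENNReal.mul_ne_top hB (measure_ne_top _ _)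
    · filter_upwards [hX.ae_crossing hβ] with ω hω
      have hFt : F (fun l k => X k (s l) ω) ≠ ∞ := ((hFB _).trans_lt hB.lt_top).ne
      by_cases hN : ω ∈ nonintersecting (1 / T) X
      · rw [Set.indicator_of_mem hN]
        have h := tendsto_pathWeight_one hβ hτ (Y := fun u k => X k u ω)
          (fun k => hX.continuous_path k ω) hN
        simpa using ENNReal.Tendsto.const_mul h (Or.inr hFt)
      · rw [Set.indicator_of_notMem hN]
        obtain ⟨k, l, h0, u, hu, hlt⟩ := hω hN
        have h := tendsto_pathWeight_zero hτ (Y := fun u k => X k u ω)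
          (fun k => hX.continuous_path k ω) h0 hu hlt
        simpa using ENNReal.Tendsto.const_mul h (Or.inr hFt)
  rw [lintegral_indicator hNm] at hlim
  have hlim2 := ENNReal.Tendsto.const_mul hlim (Or.inr (ENNReal.ofReal_ne_top : c ≠ ∞))
  exact tendsto_nhds_unique (tendsto_const_nhds.congr hstep) hlim2

end Bridges

/-! ### The law of the nonintersecting processes -/

lemma corrSum_fin_zero {q : ℝ} (hq : 0 < q) (hq1 : q < 1) (n : ℕ) (t x : Fin 0 → ℝ) :
    corrSum q n t x = 1 := by
  simp only [corrSum, levelDet, Matrix.det_isEmpty, mul_one, rpow_div_partitionFn hq]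
  rw [tsum_mul_left]
  exact inv_mul_cancel₀ (esum_pos hq hq1 n).ne'

/-- The marginal identity with all particles integrated out: the empty correlation function is 1,
and the (n!)^p fillings of the slots cancel the factor from random labelling. -/
lemma integral_multiDensity {T : ℝ} (hT : 0 < T) {n p : ℕ} (hp : p ≠ 0) {s : Fin p → ℝ}
    (hs : StrictMono s) (hs0 : ∀ l, s l ∈ Set.Ico 0 (1 / T)) :
    ∫ x : Fin p → Fin n → ℝ, multiDensity T s x = 1 := by
  obtain ⟨ρ, r, hqρ, hρ1, hr, hr1, ht⟩ := exists_timeBound hT hs0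
  have h1 := integral_mul_multiDensity hT (n := n) hp hs hs0 fun _ => 1
  have h2 := placements_mul_integral_comp_corrSum (n := n) (boltz_pos T) hqρ hρ1 hr hr1
    (ht.comp (Prod.fst : Fin p × Fin n → Fin p)) (f := (Fin.elim0 : Fin 0 → Fin p × Fin n))
    (fun i => i.elim0) (g := fun _ => 1) measurable_const (fun _ => by simp)
  have hpl : placements n ((s ∘ Prod.fst) ∘ (Fin.elim0 : Fin 0 → Fin p × Fin n)) = 1 := by
    unfold placements
    rw [Nat.card_eq_one_iff_unique]
    exact ⟨⟨fun a b => Subtype.ext (funext fun i => i.elim0)⟩,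
      ⟨⟨fun i => i.elim0, fun i => i.elim0⟩⟩⟩
  rw [hpl] at h2
  have hpl2 : placements n (s ∘ (Prod.fst : Fin p × Fin n → Fin p)) = n.factorial ^ p :=
    placements_slots n hs.injective
  rw [hpl2] at h2
  simp only [one_mul, corrSum_fin_zero (boltz_pos T) (hqρ.trans hρ1), Nat.cast_one] at h1 h2
  rw [h1]
  change 1 / (n.factorial : ℝ) ^ p * (∫ y : Fin p × Fin n → ℝ,
    corrSum (boltz T) n (s ∘ Prod.fst) y) = 1
  rw [h2]
  have hn : (n.factorial : ℝ) ≠ 0 := by positivity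
  simp [volume_pi, hn, Measure.real]

lemma measurable_density {T : ℝ} (hT : 0 < T) {n : ℕ} :
    Measurable fun y : Fin n → ℝ => density (boltz T) y := by
  have h0 : ∀ _ : Fin n, (0 : ℝ) ∈ Set.Ico 0 (1 / T) := fun _ => ⟨le_rfl, one_div_pos.2 hT⟩
  obtain ⟨ρ, r, hqρ, hρ1, hr, hr1, ht⟩ := exists_timeBound hT h0
  simp only [density_eq (boltz_pos T)]
  exact (measurable_corrSum (boltz_pos T) hqρ hρ1 hr hr1 ht).const_mul _

lemma multiDensity_one {T : ℝ} (hT : 0 < T) {n : ℕ} {s : Fin 1 → ℝ} (hs : s 0 = 0)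
    (x : Fin 1 → Fin n → ℝ) : multiDensity T s x = density (boltz T) (x 0) := by
  rw [multiDensity_eq hT one_ne_zero (Subsingleton.strictMono s) (fun l => by
    rw [Subsingleton.elim l 0, hs]; exact ⟨le_rfl, one_div_pos.2 hT⟩), density_eq (boltz_pos T),
    pow_one, ← corrSum_comp_equiv (Equiv.uniqueProd (Fin n) (Fin 1)).symm]
  congr 2
  ext i
  exact hs

section Bridges

variable {n : ℕ} {Ω : Type*} [MeasurableSpace Ω] {X : Fin n → ℝ → Ω → ℝ}
  {Q : Kernel (Fin n → ℝ) Ω} {T : ℝ}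

/-- The density of the initial points in terms of the probability not to intersect. -/
lemma IsOUBridgeFamily.density_ae_eq (hX : IsOUBridgeFamily (1 / T) X Q) (hT : 0 < T) :
    (fun y : Fin n → ℝ => ENNReal.ofReal (density (boltz T) y)) =ᵐ[volume] fun y =>
      ENNReal.ofReal (1 / n.factorial * (esum (boltz T) n)⁻¹) *
        (ENNReal.ofReal (∏ k, mehler (Real.exp (-(1 / T))) (y k) (y k)) *
          Q y (nonintersecting (1 / T) X)) := by
  have hβ : 0 < 1 / T := one_div_pos.2 hT
  have hNm := hX.measurableSet_nonintersecting hβ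
  have hw := measurable_loopWeight (n := n) hβ
  have hd : Measurable fun y : Fin n → ℝ => ENNReal.ofReal (density (boltz T) y) :=
    (measurable_density hT).ennreal_ofReal
  refine ae_eq_of_forall_setLIntegral_eq_of_sigmaFinite hd
    ((hw.mul (Q.measurable_coe hNm)).const_mul _) fun A hA _ => ?_
  -- This test function need not be symmetric in the particles at time 0; symmetry is required only
  -- at later times, of which there are none here.
  have hF : Measurable fun x : Fin (0 + 1) → Fin n → ℝ => A.indicator (1 : (Fin n → ℝ) → ℝ≥0∞) (x 0) :=
    (measurable_one.indicator hA).comp (measurable_pi_apply 0)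
  have hind : ∀ y : Fin n → ℝ, A.indicator (1 : (Fin n → ℝ) → ℝ≥0∞) y ≤ 1 := fun y =>
    Set.indicator_le_self' (fun _ _ => zero_le) y
  have h := hX.lintegral_multiDensity_eq hT (t := (Fin.elim0 : Fin 0 → ℝ)) (fun i => i.elim0)
    (fun i => i.elim0) rfl hF (fun σ hσ x => by
      have h0 : relabel σ x 0 = x 0 := by ext k; simp only [relabel, hσ, Equiv.Perm.one_apply]
      rw [h0])
    ENNReal.one_ne_top fun x => hind (x 0)
  have e1 : ∫⁻ x : Fin (0 + 1) → Fin n → ℝ, A.indicator (1 : (Fin n → ℝ) → ℝ≥0∞) (x 0) *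
      ENNReal.ofReal (multiDensity T (Fin.cons 0 (Fin.elim0 : Fin 0 → ℝ)) x) =
      ∫⁻ y in A, ENNReal.ofReal (density (boltz T) y) := by
    have hm := (measurable_one.indicator hA : Measurable (A.indicator (1 : (Fin n → ℝ) → ℝ≥0∞))).mul hd
    rw [← lintegral_indicator hA]
    refine Eq.trans ?_ (((volume_preserving_funUnique (Fin 1) (Fin n → ℝ)).lintegral_comp hm).trans ?_)
    · refine lintegral_congr fun x => ?_
      rw [multiDensity_one hT (by simp)]
      rfl
    · refine lintegral_congr fun y => ?_
      by_cases hy : y ∈ A <;> simp [hy]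
  rw [← e1, h, lintegral_const_mul' _ _ ENNReal.ofReal_ne_top]
  congr 1
  have hm2 : Measurable fun ω => (nonintersecting (1 / T) X).indicator
      (fun ω => A.indicator (1 : (Fin n → ℝ) → ℝ≥0∞) fun k => X k 0 ω) ω :=
    Measurable.indicator ((measurable_one.indicator hA).comp
      (measurable_pi_lambda _ fun k => hX.measurable_eval k 0)) hNm
  have e2 : ∫⁻ ω in nonintersecting (1 / T) X, A.indicator (1 : (Fin n → ℝ) → ℝ≥0∞)
      (fun k => X k ((Fin.cons 0 (Fin.elim0 : Fin 0 → ℝ) : Fin (0 + 1) → ℝ) 0) ω)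
      ∂bridgeMixture (1 / T) Q = ∫⁻ ω, (nonintersecting (1 / T) X).indicator
      (fun ω => A.indicator (1 : (Fin n → ℝ) → ℝ≥0∞) fun k => X k 0 ω) ω ∂bridgeMixture (1 / T) Q := by
    rw [lintegral_indicator hNm]
    rfl
  rw [e2, lintegral_bridgeMixture hβ hm2, ← lintegral_indicator hA]
  refine lintegral_congr fun y => ?_
  have e3 : ∫⁻ ω, (nonintersecting (1 / T) X).indicator
      (fun ω => A.indicator (1 : (Fin n → ℝ) → ℝ≥0∞) fun k => X k 0 ω) ω ∂Q y =
      A.indicator (1 : (Fin n → ℝ) → ℝ≥0∞) y * Q y (nonintersecting (1 / T) X) := by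
    rw [← lintegral_indicator_one hNm, ← lintegral_const_mul' _ _
      ((hind y).trans_lt ENNReal.one_lt_top).ne]
    refine lintegral_congr_ae ?_
    filter_upwards [hX.endpoints y] with ω hω
    have hy : (fun k => X k 0 ω) = y := funext fun k => (hω k).1
    by_cases hωN : ω ∈ nonintersecting (1 / T) X
    · rw [Set.indicator_of_mem hωN, Set.indicator_of_mem hωN, hy, Pi.one_apply, mul_one]
    · rw [Set.indicator_of_notMem hωN, Set.indicator_of_notMem hωN, mul_zero]
  rw [e3]
  by_cases hy : y ∈ A <;> simp [hy]

/-- The density P_n is, up to a constant, the return weight times the probability that the bridges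
do not intersect. The latter cancels the normalization of the conditional law, and the bridge
mixture restricted to the event remains. -/
lemma IsOUBridgeFamily.periodicOU_eq (hX : IsOUBridgeFamily (1 / T) X Q) (hT : 0 < T) :
    periodicOU T X Q = ENNReal.ofReal (1 / n.factorial * (esum (boltz T) n)⁻¹) •
      (bridgeMixture (1 / T) Q).restrict (nonintersecting (1 / T) X) := by
  have hβ : 0 < 1 / T := one_div_pos.2 hT
  have hNm := hX.measurableSet_nonintersecting hβ
  have hprob := hX.isProbabilityMeasure hβ
  have hw := measurable_loopWeight (n := n) hβ
  have hd : Measurable fun y : Fin n → ℝ => ENNReal.ofReal (density (boltz T) y) :=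
    (measurable_density hT).ennreal_ofReal
  have hcond : ∀ {E : Set Ω}, MeasurableSet E → Measurable fun y : Fin n → ℝ =>
      ProbabilityTheory.cond (Q y) (nonintersecting (1 / T) X) E := by
    intro E hE
    simp only [ProbabilityTheory.cond_apply hNm]
    exact (Q.measurable_coe hNm).inv.mul (Q.measurable_coe (hNm.inter hE))
  ext E hE
  rw [periodicOU, Measure.bind_apply hE
      (Measure.measurable_of_measurable_coe _ fun E hE => hcond hE).aemeasurable,
    lintegral_withDensity_eq_lintegral_mul _ hd (hcond hE), Measure.smul_apply,
    Measure.restrict_apply hE, smul_eq_mul, ← lintegral_indicator_one (hE.inter hNm),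
    lintegral_bridgeMixture hβ (measurable_one.indicator (hE.inter hNm))]
  simp only [lintegral_indicator_one (hE.inter hNm)]
  rw [← lintegral_const_mul' _ _ ENNReal.ofReal_ne_top]
  refine lintegral_congr_ae ?_
  filter_upwards [hX.density_ae_eq hT] with y hy
  rw [Pi.mul_apply, hy, ProbabilityTheory.cond_apply hNm, Set.inter_comm E]
  have := hprob y
  -- Where the event is null, so is its intersection with E, and both sides vanish; no cancellation
  -- is needed.
  by_cases h0 : Q y (nonintersecting (1 / T) X) = 0
  · have h1 : Q y (nonintersecting (1 / T) X ∩ E) = 0 := measure_mono_null Set.inter_subset_left h0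
    rw [h0, h1]
    simp only [mul_zero]
  · rw [mul_assoc, mul_assoc, ← mul_assoc (Q y (nonintersecting (1 / T) X)),
      ENNReal.mul_inv_cancel h0 (measure_ne_top _ _), one_mul]

/-- The positions of the nonintersecting processes at times `s_1 < ⋯ < s_p` have the same symmetric
statistics as the free fermions. -/
lemma IsOUBridgeFamily.lintegral_periodicOU (hX : IsOUBridgeFamily (1 / T) X Q) (hT : 0 < T)
    {p : ℕ} (hp : p ≠ 0) {s : Fin p → ℝ} (hs : StrictMono s) (hs0 : ∀ l, s l ∈ Set.Ico 0 (1 / T))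
    {F : (Fin p → Fin n → ℝ) → ℝ≥0∞} (hF : Measurable F) (hFs : ∀ σ x, F (relabel σ x) = F x)
    {B : ℝ≥0∞} (hB : B ≠ ∞) (hFB : ∀ x, F x ≤ B) :
    ∫⁻ ω, F (fun l k => X k (s l) ω) ∂periodicOU T X Q =
      ∫⁻ x, F x * ENNReal.ofReal (multiDensity T s x) := by
  obtain ⟨m, rfl⟩ := Nat.exists_eq_succ_of_ne_zero hp
  have hβ : 0 < 1 / T := one_div_pos.2 hT
  -- The bridges are described from time 0 onwards, so 0 is adjoined to the times if it is missing
  -- and removed again by consistency.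
  set S : Finset ℝ := (Finset.univ.image s).erase 0 with hS
  have hSm : ∀ u ∈ S, u ∈ Set.Ioo 0 (1 / T) := by
    intro u hu
    obtain ⟨hu0, hu⟩ := Finset.mem_erase.1 hu
    obtain ⟨i, _, rfl⟩ := Finset.mem_image.1 hu
    exact ⟨lt_of_le_of_ne (hs0 i).1 hu0.symm, (hs0 i).2⟩
  set t : Fin S.card → ℝ := ⇑(S.orderEmbOfFin rfl) with ht
  have htm : ∀ i, t i ∈ Set.Ioo 0 (1 / T) := fun i => hSm _ (Finset.orderEmbOfFin_mem S rfl i)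
  have hts : StrictMono t := (S.orderEmbOfFin rfl).strictMono
  set σ : Fin (S.card + 1) → ℝ := Fin.cons 0 t with hσ
  have hσs : StrictMono σ := cons_zero_strictMono htm hts
  have hσ0 : ∀ l, σ l ∈ Set.Ico 0 (1 / T) := cons_zero_mem hβ htm
  have hf : ∀ l, ∃ j, σ j = s l := by
    intro l
    by_cases hl : s l = 0
    · exact ⟨0, by simp [hσ, hl]⟩
    · have hmem : s l ∈ Set.range t := by
        rw [ht, Finset.range_orderEmbOfFin]
        exact Finset.mem_erase.2 ⟨hl, Finset.mem_image_of_mem s (Finset.mem_univ l)⟩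
      obtain ⟨j, hj⟩ := hmem
      exact ⟨j.succ, by simp [hσ, hj]⟩
  choose f hf using hf
  have hfm : StrictMono f := fun i j hij => by
    rw [← hσs.lt_iff_lt, hf, hf]; exact hs hij
  have hcomp : σ ∘ f = s := funext hf
  have hfmeas : Measurable fun x : Fin (S.card + 1) → Fin n → ℝ => x ∘ f :=
    measurable_pi_lambda _ fun l => measurable_pi_apply _
  have h1 := lintegral_comp_multiDensity hT hσs hσ0 hfm hF
  rw [hcomp] at h1
  rw [← h1, hX.lintegral_multiDensity_eq hT htm hts hσ (F := fun x => F (x ∘ f))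
    (hF.comp hfmeas) (fun σ' _ x => hFs (σ' ∘ f) (x ∘ f)) hB fun x => hFB _, hX.periodicOU_eq hT,
    lintegral_smul_measure, smul_eq_mul]
  congr 1
  refine lintegral_congr fun ω => ?_
  congr 1
  ext l k
  simp only [Function.comp_apply, hf]

/-! ### Correlation functions and gap probabilities -/

lemma lintegral_indicator_mul_multiDensity (hT : 0 < T) {p : ℕ} (hp : p ≠ 0) {s : Fin p → ℝ}
    (hs : StrictMono s) (hs0 : ∀ l, s l ∈ Set.Ico 0 (1 / T)) {E : Set (Fin p → Fin n → ℝ)}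
    (hE : MeasurableSet E) :
    ∫⁻ x, E.indicator 1 x * ENNReal.ofReal (multiDensity T s x) =
      ENNReal.ofReal (∫ x in E, multiDensity T s x) := by
  have hnn : ∀ᵐ x : Fin p → Fin n → ℝ, 0 ≤ multiDensity T s x := by
    obtain ⟨m, rfl⟩ := Nat.exists_eq_succ_of_ne_zero hp
    exact ae_multiDensity_nonneg hT hs hs0
  rw [ofReal_integral_eq_lintegral_ofReal (integrable_multiDensity hT hp hs hs0).integrableOn
    (ae_restrict_of_ae hnn), ← lintegral_indicator hE]
  refine lintegral_congr fun x => ?_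
  by_cases hx : x ∈ E <;> simp [hx]

section Correlation

variable {m : ℕ} {τ : Fin m → ℝ}

/-- The configurations in which the particles `j i` at times `τ i` form a point of `B`. -/
def slotSet (τ : Fin m → ℝ) (j : Fin m → Fin n) (B : Set (Fin m → ℝ)) :
    Set (Fin (timeSet τ).card → Fin n → ℝ) :=
  {x | (fun i => x (timeIndex τ i) (j i)) ∈ B}

lemma measurableSet_slotSet (j : Fin m → Fin n) {B : Set (Fin m → ℝ)} (hB : MeasurableSet B) :
    MeasurableSet (slotSet τ j B) :=
  hB.preimage (measurable_pi_lambda _ fun i => by fun_prop)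

lemma placements_mul_integral_slotSet (hT : 0 < T) (hm : 1 ≤ m)
    (hτ : ∀ i, τ i ∈ Set.Ico 0 (1 / T)) {j : Fin m → Fin n}
    (hj : Function.Injective fun i => (τ i, j i)) {B : Set (Fin m → ℝ)} (hB : MeasurableSet B) :
    (placements n τ : ℝ) * ∫ x in slotSet τ j B, multiDensity T (times τ) x =
      ∫ x in B, corrSum (boltz T) n τ x := by
  have hp := card_timeSet_ne_zero hm τ
  have hs0 : ∀ l, times τ l ∈ Set.Ico 0 (1 / T) := fun l => by
    obtain ⟨i, hi⟩ := times_mem τ l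
    rw [← hi]; exact hτ i
  obtain ⟨ρ, r, hqρ, hρ1, hr, hr1, ht⟩ := exists_timeBound hT hs0
  set g : (Fin m → ℝ) → ℝ := B.indicator 1 with hg
  have hgm : Measurable g := measurable_one.indicator hB
  have hg1 : ∀ x, |g x| ≤ 1 := fun x => by
    rw [hg]; unfold Set.indicator; split_ifs <;> simp
  have e1 : ∫ x in slotSet τ j B, multiDensity T (times τ) x =
      ∫ x, g (fun i => x (timeIndex τ i) (j i)) * multiDensity T (times τ) x := by
    rw [← integral_indicator (measurableSet_slotSet j hB)]
    refine integral_congr_ae (Filter.Eventually.of_forall fun x => ?_)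
    by_cases hx : (fun i => x (timeIndex τ i) (j i)) ∈ B
    · have hx' : x ∈ slotSet τ j B := hx
      simp [hg, hx, hx']
    · have hx' : x ∉ slotSet τ j B := hx
      simp [hg, hx, hx']
  have e2 : ∫ x in B, corrSum (boltz T) n τ x = ∫ x, g x * corrSum (boltz T) n τ x := by
    rw [← integral_indicator hB]
    refine integral_congr_ae (Filter.Eventually.of_forall fun x => ?_)
    by_cases hx : x ∈ B <;> simp [hg, hx]
  rw [e1, e2, integral_mul_multiDensity hT hp (times_strictMono τ) hs0]
  have h := placements_mul_integral_comp_corrSum (n := n) (boltz_pos T) hqρ hρ1 hr hr1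
    (ht.comp (Prod.fst : Fin (timeSet τ).card × Fin n → Fin (timeSet τ).card))
    (f := fun i => (timeIndex τ i, j i)) (slot_injective hj) hgm hg1
  have hcomp : (times τ ∘ (Prod.fst : Fin (timeSet τ).card × Fin n → Fin (timeSet τ).card)) ∘
      (fun i => (timeIndex τ i, j i)) = τ := funext fun i => times_timeIndex τ i
  have hpl : placements n (times τ ∘ (Prod.fst : Fin (timeSet τ).card × Fin n → _)) =
      n.factorial ^ (timeSet τ).card := placements_slots n (times_strictMono τ).injective
  rw [hcomp, hpl] at h
  have hn : (n.factorial : ℝ) ≠ 0 := by positivity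
  push_cast at h
  change (placements n τ : ℝ) * (1 / (n.factorial : ℝ) ^ (timeSet τ).card *
    ∫ y : Fin (timeSet τ).card × Fin n → ℝ, g (y ∘ fun i => (timeIndex τ i, j i)) *
      corrSum (boltz T) n (times τ ∘ Prod.fst) y) = _
  rw [mul_left_comm, h]
  field_simp

/-- The number of admissible choices with positions in B is a bounded symmetric function of the
configuration at each time, so its expectation is the same as for the fermions, where every choice
contributes an equal share. -/
lemma isCorrelationFn_periodicOU (hX : IsOUBridgeFamily (1 / T) X Q) (hT : 0 < T) (hm : 1 ≤ m)
    (hτ : ∀ i, τ i ∈ Set.Ico 0 (1 / T)) :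
    IsCorrelationFn (periodicOU T X Q) X τ (corrSum (boltz T) n τ) := by
  classical
  intro B hB
  have hp := card_timeSet_ne_zero hm τ
  have hs0 : ∀ l, times τ l ∈ Set.Ico 0 (1 / T) := fun l => by
    obtain ⟨i, hi⟩ := times_mem τ l
    rw [← hi]; exact hτ i
  obtain ⟨ρ, r, hqρ, hρ1, hr, hr1, ht⟩ := exists_timeBound hT hτ
  set J : Finset (Fin m → Fin n) :=
    Finset.univ.filter fun j => Function.Injective fun i => (τ i, j i) with hJ
  have hJcard : J.card = placements n τ := by
    rw [placements, Nat.card_eq_fintype_card, Fintype.card_subtype]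
  set F : (Fin (timeSet τ).card → Fin n → ℝ) → ℝ≥0∞ := fun x =>
    ∑ j ∈ J, (slotSet τ j B).indicator 1 x with hF
  have hFm : Measurable F := Finset.measurable_fun_sum _ fun j _ =>
    measurable_one.indicator (measurableSet_slotSet j hB)
  have hFs : ∀ σ x, F (relabel σ x) = F x := by
    intro σ x
    -- Relabelling the particles permutes the admissible choices among themselves.
    refine Finset.sum_equiv (Equiv.piCongrRight fun i => σ (timeIndex τ i)) (fun j => ?_)
      fun j _ => ?_
    · simp only [hJ, Finset.mem_filter, Finset.mem_univ, true_and]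
      have hinj : ∀ i i', (τ i, (Equiv.piCongrRight fun i => σ (timeIndex τ i)) j i) =
          (τ i', (Equiv.piCongrRight fun i => σ (timeIndex τ i)) j i') ↔
          (τ i, j i) = (τ i', j i') := by
        intro i i'
        simp only [Prod.mk.injEq, Equiv.piCongrRight_apply, Pi.map_apply]
        refine and_congr_right fun h => ?_
        have hti : timeIndex τ i = timeIndex τ i' :=
          (times_strictMono τ).injective (by rw [times_timeIndex, times_timeIndex, h])
        rw [hti]
        exact (σ _).injective.eq_iff
      exact ⟨fun h i i' hi => h ((hinj i i').1 hi), fun h i i' hi => h ((hinj i i').2 hi)⟩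
    · rfl
  have hFB : ∀ x, F x ≤ J.card := by
    intro x
    calc F x ≤ ∑ _j ∈ J, (1 : ℝ≥0∞) := Finset.sum_le_sum fun j _ =>
          Set.indicator_le_self' (fun _ _ => zero_le) x
      _ = J.card := by simp
  have hkey := hX.lintegral_periodicOU hT hp (times_strictMono τ) hs0 hFm hFs
    (ENNReal.natCast_ne_top _) hFB
  have hev : Measurable fun ω (l : Fin (timeSet τ).card) (k : Fin n) => X k (times τ l) ω :=
    measurable_pi_lambda _ fun l => measurable_pi_lambda _ fun k => hX.measurable_eval k _
  have hleft : ∫⁻ ω, F (fun l k => X k (times τ l) ω) ∂periodicOU T X Q =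
      ∑ j ∈ J, periodicOU T X Q {ω | (fun i => X (j i) (τ i) ω) ∈ B} := by
    rw [lintegral_finsetSum (f := fun j ω => (slotSet τ j B).indicator 1
      fun l k => X k (times τ l) ω) _ fun j _ =>
        (measurable_one.indicator (measurableSet_slotSet j hB)).comp hev]
    refine Finset.sum_congr rfl fun j _ => ?_
    have hset : {ω | (fun i => X (j i) (τ i) ω) ∈ B} =
        (fun ω l k => X k (times τ l) ω) ⁻¹' slotSet τ j B := by
      ext ω
      simp only [slotSet, Set.mem_preimage, Set.mem_ofPred_eq, times_timeIndex]
    rw [hset, ← lintegral_indicator_one (hev (measurableSet_slotSet j hB))]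
    rfl
  have hright : ∫⁻ x, F x * ENNReal.ofReal (multiDensity T (times τ) x) =
      ∑ j ∈ J, ENNReal.ofReal (∫ x in slotSet τ j B, multiDensity T (times τ) x) := by
    simp only [hF, Finset.sum_mul]
    rw [lintegral_finsetSum (f := fun j x => (slotSet τ j B).indicator 1 x *
      ENNReal.ofReal (multiDensity T (times τ) x)) _ fun j _ => (measurable_one.indicator
      (measurableSet_slotSet j hB)).mul (measurable_multiDensity hT hp (times_strictMono τ)
        hs0).ennreal_ofReal]
    exact Finset.sum_congr rfl fun j _ => lintegral_indicator_mul_multiDensity hT hp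
      (times_strictMono τ) hs0 (measurableSet_slotSet j hB)
  have hgoal : ∑ j ∈ J, periodicOU T X Q {ω | (fun i => X (j i) (τ i) ω) ∈ B} =
      ∫⁻ x in B, ENNReal.ofReal (corrSum (boltz T) n τ x) := by
    rw [← hleft, hkey, hright]
    by_cases hpl : placements n τ = 0
    · have hJ0 : J = ∅ := Finset.card_eq_zero.1 (hJcard.trans hpl)
      simp [hJ0, corrSum_eq_zero τ _ hpl]
    have hpl0 : (0 : ℝ) < placements n τ := by exact_mod_cast Nat.pos_of_ne_zero hpl
    have hint := integrable_corrSum (n := n) (boltz_pos T) hqρ hρ1 hr hr1 ht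
    obtain ⟨j₀, hj₀⟩ : J.Nonempty := Finset.card_pos.1 (hJcard ▸ Nat.pos_of_ne_zero hpl)
    have hnn : ∀ᵐ x : Fin (timeSet τ).card → Fin n → ℝ, 0 ≤ multiDensity T (times τ) x := by
      have := times_strictMono τ
      generalize times τ = s at this hs0
      generalize (timeSet τ).card = p at s hp
      obtain ⟨a, rfl⟩ := Nat.exists_eq_succ_of_ne_zero hp
      exact ae_multiDensity_nonneg hT this hs0
    -- `ENNReal.ofReal` would truncate negative values. The sign is read off from integrals over
    -- sets, which are multiples of integrals of the nonnegative joint density.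
    have hcnn : 0 ≤ᵐ[volume] fun x : Fin m → ℝ => corrSum (boltz T) n τ x := by
      refine ae_nonneg_of_forall_setIntegral_nonneg hint fun E hE _ => ?_
      rw [← placements_mul_integral_slotSet hT hm hτ (Finset.mem_filter.1 hj₀).2 hE]
      exact mul_nonneg hpl0.le (integral_nonneg_of_ae (ae_restrict_of_ae hnn))
    rw [← ofReal_integral_eq_lintegral_ofReal hint.integrableOn (ae_restrict_of_ae hcnn)]
    have hterm : ∀ j ∈ J, ∫ x in slotSet τ j B, multiDensity T (times τ) x =
        (placements n τ : ℝ)⁻¹ * ∫ x in B, corrSum (boltz T) n τ x := by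
      intro j hj
      rw [← placements_mul_integral_slotSet hT hm hτ (Finset.mem_filter.1 hj).2 hB,
        inv_mul_cancel_left₀ hpl0.ne']
    rw [Finset.sum_congr rfl fun j hj => by rw [hterm j hj], Finset.sum_const, hJcard,
      nsmul_eq_mul, ← ENNReal.ofReal_natCast, ← ENNReal.ofReal_mul hpl0.le,
      mul_inv_cancel_left₀ hpl0.ne']
  convert hgoal

/-- The event does not depend on labels, so symmetric statistics suffice to compare the two models.
-/
lemma periodicOU_real_gap (hX : IsOUBridgeFamily (1 / T) X Q) (hT : 0 < T) (hm : 1 ≤ m)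
    (hτ : ∀ i, τ i ∈ Set.Ico 0 (1 / T)) {A : Fin m → Set ℝ} (hA : ∀ i, MeasurableSet (A i)) :
    (periodicOU T X Q).real {ω | ∀ i j, X j (τ i) ω ∈ A i} = fermionGap T n τ A := by
  have hp := card_timeSet_ne_zero hm τ
  have hs0 : ∀ l, times τ l ∈ Set.Ico 0 (1 / T) := fun l => by
    obtain ⟨i, hi⟩ := times_mem τ l
    rw [← hi]; exact hτ i
  set E : Set (Fin (timeSet τ).card → Fin n → ℝ) := {x | ∀ i j, x (timeIndex τ i) j ∈ A i} with hE
  have hEm : MeasurableSet E := by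
    have h : E = ⋂ i, ⋂ j, {x | x (timeIndex τ i) j ∈ A i} := by ext; simp [hE]
    rw [h]
    exact MeasurableSet.iInter fun i => MeasurableSet.iInter fun j =>
      (hA i).preimage (by fun_prop)
  have hFs : ∀ σ x, E.indicator (1 : (Fin (timeSet τ).card → Fin n → ℝ) → ℝ≥0∞) (relabel σ x) = E.indicator 1 x := by
    intro σ x
    have hiff : relabel σ x ∈ E ↔ x ∈ E := forall_congr' fun i =>
      ⟨fun h j => by simpa [relabel] using h ((σ (timeIndex τ i)).symm j), fun h j => h _⟩
    by_cases hx : x ∈ E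
    · rw [Set.indicator_of_mem hx, Set.indicator_of_mem (hiff.2 hx)]; rfl
    · rw [Set.indicator_of_notMem hx, Set.indicator_of_notMem fun h => hx (hiff.1 h)]
  have hkey := hX.lintegral_periodicOU hT hp (times_strictMono τ) hs0
    (measurable_one.indicator hEm) hFs ENNReal.one_ne_top
    fun x => Set.indicator_le_self' (fun _ _ => zero_le) x
  have hev : Measurable fun ω (l : Fin (timeSet τ).card) (k : Fin n) => X k (times τ l) ω :=
    measurable_pi_lambda _ fun l => measurable_pi_lambda _ fun k => hX.measurable_eval k _
  have hset : {ω | ∀ i j, X j (τ i) ω ∈ A i} = (fun ω l k => X k (times τ l) ω) ⁻¹' E := by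
    ext ω
    simp only [hE, Set.mem_preimage, Set.mem_ofPred_eq, times_timeIndex]
  have hleft : ∫⁻ ω, E.indicator (1 : (Fin (timeSet τ).card → Fin n → ℝ) → ℝ≥0∞) (fun l k => X k (times τ l) ω)
      ∂periodicOU T X Q = periodicOU T X Q {ω | ∀ i j, X j (τ i) ω ∈ A i} := by
    rw [hset, ← lintegral_indicator_one (hev hEm)]
    rfl
  have hnn : ∀ᵐ x : Fin (timeSet τ).card → Fin n → ℝ, 0 ≤ multiDensity T (times τ) x := by
    have := times_strictMono τ
    generalize times τ = s at this hs0
    generalize (timeSet τ).card = p at s hp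
    obtain ⟨a, rfl⟩ := Nat.exists_eq_succ_of_ne_zero hp
    exact ae_multiDensity_nonneg hT this hs0
  rw [Measure.real, ← hleft, hkey, lintegral_indicator_mul_multiDensity hT hp
    (times_strictMono τ) hs0 hEm, ENNReal.toReal_ofReal
      (integral_nonneg_of_ae (ae_restrict_of_ae hnn))]
  rfl

lemma isProbabilityMeasure_periodicOU (hX : IsOUBridgeFamily (1 / T) X Q) (hT : 0 < T) :
    IsProbabilityMeasure (periodicOU T X Q) := by
  have hs0 : ∀ l : Fin 1, (fun _ => 0 : Fin 1 → ℝ) l ∈ Set.Ico 0 (1 / T) := fun _ =>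
    ⟨le_rfl, one_div_pos.2 hT⟩
  have hs : StrictMono (fun _ => 0 : Fin 1 → ℝ) := Subsingleton.strictMono _
  have h := hX.lintegral_periodicOU hT one_ne_zero hs hs0 (F := fun _ => 1) measurable_const
    (fun _ _ => rfl) ENNReal.one_ne_top fun _ => le_rfl
  have h2 := lintegral_indicator_mul_multiDensity (n := n) hT one_ne_zero hs hs0 MeasurableSet.univ
  simp only [Set.indicator_univ, Pi.one_apply, Measure.restrict_univ,
    integral_multiDensity hT one_ne_zero hs hs0, ENNReal.ofReal_one] at h2
  rw [h2, lintegral_one] at h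
  exact ⟨h⟩

end Correlation

end Bridges

end MNS

end

/-! ### Assembling the theorem -/

theorem theorem4 (n m : ℕ) (hn : 1 ≤ n) (hm : 1 ≤ m) (T : ℝ) (hT : 0 < T)
    (τ : Fin m → ℝ) (hτ : ∀ i, τ i ∈ Set.Ico 0 (1 / T))
    (r : ℝ) (hr : 0 < r) (hpole : ∀ k : ℕ, MNS.boltz T ^ k * r ≠ 1) :
    -- the series defining the kernels converge on the contour
    (∀ x y : ℝ, ∀ i j, ∀ z ∈ Metric.sphere (0 : ℂ) r,
      Summable (fun k : ℕ => ((MNS.boltz T : ℂ) ^ k * z / (1 + (MNS.boltz T : ℂ) ^ k * z)) *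
        ((MNS.phi k x * MNS.phi k y * Real.exp ((k : ℝ) * (τ i - τ j)) : ℝ) : ℂ)) ∧
      (τ i < τ j →
        Summable fun k : ℕ => MNS.phi k x * MNS.phi k y * Real.exp ((k : ℝ) * (τ i - τ j)))) ∧
    -- (a) multi-time correlation functions of the free fermions
    (∀ x : Fin m → ℝ,
      HasSum (fun k : MNS.Eigenstate n =>
          MNS.boltz T ^ ((n : ℝ) / 2) / MNS.partitionFn (MNS.boltz T) n *
            (MNS.boltz T ^ (∑ i, k.1 i) *
              Matrix.det (Matrix.of fun i j =>
                MNS.eigenKernel k.1 (x i) (x j) (τ i) (τ j))))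
        (MNS.fermionCorr T n τ x) ∧
      CircleIntegrable (fun z => MNS.corrIntegrand (MNS.boltz T) n τ x z / z) 0 r ∧
      (MNS.fermionCorr T n τ x : ℂ) =
        MNS.contour r (MNS.corrIntegrand (MNS.boltz T) n τ x)) ∧
    -- (b) multi-time gap probabilities of the free fermions
    (Function.Injective τ → ∀ A : Fin m → Set ℝ, (∀ i, MeasurableSet (A i)) →
      (∀ z ∈ Metric.sphere (0 : ℂ) r,
        (∀ l, Integrable
          (MNS.fredholmIntegrand (MNS.gapKernel (MNS.boltz T) τ A z) l)
          (MeasureTheory.Measure.pi fun _ : Fin l => MNS.copies m)) ∧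
        Summable (MNS.fredholmTerm (MNS.copies m) (MNS.gapKernel (MNS.boltz T) τ A z))) ∧
      CircleIntegrable (fun z => MNS.gapIntegrand (MNS.boltz T) n τ A z / z) 0 r ∧
      (MNS.fermionGap T n τ A : ℂ) =
        MNS.contour r (MNS.gapIntegrand (MNS.boltz T) n τ A)) ∧
    -- (a) and (b) for the nonintersecting Ornstein–Uhlenbeck processes with period `1 / T`
    (∀ (Ω : Type*) [MeasurableSpace Ω] (X : Fin n → ℝ → Ω → ℝ)
      (Q : ProbabilityTheory.Kernel (Fin n → ℝ) Ω),
      MNS.IsOUBridgeFamily (1 / T) X Q →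
      MeasureTheory.IsProbabilityMeasure (MNS.periodicOU T X Q) ∧
      MNS.IsCorrelationFn (MNS.periodicOU T X Q) X τ
        (fun x => (MNS.contour r (MNS.corrIntegrand (MNS.boltz T) n τ x)).re) ∧
      (Function.Injective τ → ∀ A : Fin m → Set ℝ, (∀ i, MeasurableSet (A i)) →
        (((MNS.periodicOU T X Q).real {ω | ∀ i j, X j (τ i) ω ∈ A i} : ℝ) : ℂ) =
          MNS.contour r (MNS.gapIntegrand (MNS.boltz T) n τ A))) := by
  have hq : 0 < MNS.boltz T := MNS.boltz_pos T
  obtain ⟨ρ, r', hqρ, hρ1, hr', hr1, ht⟩ := MNS.exists_timeBound hT hτ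
  -- The same series over eigenstates sums to the canonical average and to the contour integral;
  -- uniqueness of sums equates them.
  have hcorr : ∀ x : Fin m → ℝ, ((MNS.corrSum (MNS.boltz T) n τ x : ℝ) : ℂ) =
      MNS.contour r (MNS.corrIntegrand (MNS.boltz T) n τ x) := fun x =>
    (Complex.hasSum_ofReal.2 (MNS.hasSum_corrSum hq hqρ hρ1 hr' hr1 ht x)).unique
      (MNS.hasSum_contour_corrIntegrand hq hqρ hρ1 hr' hr1 ht hr hpole x).2
  have hgap : Function.Injective τ → ∀ A : Fin m → Set ℝ, (∀ i, MeasurableSet (A i)) →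
      (MNS.fermionGap T n τ A : ℂ) = MNS.contour r (MNS.gapIntegrand (MNS.boltz T) n τ A) := by
    intro hτi A hA
    rw [MNS.fermionGap_eq hT hm hτ hτi hA]
    exact (MNS.hasSum_fredholmDet_levelKernel hq hqρ hρ1 hr' hr1 ht hτi hA).unique
      (MNS.hasSum_contour_gapIntegrand hq hqρ hρ1 hr' hr1 ht hr hpole hA).2.2
  refine ⟨fun x y i j z hz => ⟨?_, MNS.summable_phi_mul_phi_exp x y⟩, fun x => ⟨?_, ?_, ?_⟩,
    fun hτi A hA => ⟨?_, ?_, hgap hτi A hA⟩, ?_⟩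
  · obtain ⟨B, hB0, hB⟩ := MNS.exists_norm_occProb_le hq (hqρ.trans hρ1) hr hpole
    refine (MNS.kernelK_eq (hq.trans hqρ) hr' hr1 (ht i j).1 (R := B) (fun k => ?_) hB0.le).1
    refine (hB z hz k).trans ?_
    gcongr
  · rw [MNS.fermionCorr_eq hT hm hτ]
    refine (MNS.hasSum_corrSum hq hqρ hρ1 hr' hr1 ht x).congr_fun fun k => ?_
    simp only [MNS.eigenKernel_eq, MNS.levelDet]
  · exact (MNS.hasSum_contour_corrIntegrand hq hqρ hρ1 hr' hr1 ht hr hpole x).1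
  · rw [MNS.fermionCorr_eq hT hm hτ]
    exact hcorr x
  · exact (MNS.hasSum_contour_gapIntegrand (n := n) hq hqρ hρ1 hr' hr1 ht hr hpole hA).1
  · exact (MNS.hasSum_contour_gapIntegrand hq hqρ hρ1 hr' hr1 ht hr hpole hA).2.1
  · intro Ω _ X Q hX
    refine ⟨MNS.isProbabilityMeasure_periodicOU hX hT, ?_, fun hτi A hA => ?_⟩
    -- Taking the real part loses nothing, as the contour integral equals the real number `corrSum`.
    · convert MNS.isCorrelationFn_periodicOU hX hT hm hτ using 2 with x
      rw [← hcorr x, Complex.ofReal_re]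
    · rw [MNS.periodicOU_real_gap hX hT hm hτ hA]
      exact hgap hτi A hA
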